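/- Let $m>3$ and $A\in\mathbb{R}$. Let $\varphi_0(\xi)=\frac1{4\pi}e^{-|\xi|^2/4}$, $\bar{\mathfrak u}^0_h(\xi)=\frac{1-e^{-|\xi|^2/4}}{2\pi|\xi|^2}(-\xi_2,\xi_1)^T$ (the Oseen vortex, with value $0$ at $\xi=0$), $\nabla^\perp=(\partial_2,-\partial_1)^T$ and $\mathcal L=\Delta+\frac12\,\xi\cdot\nabla+1$ on $\mathbb{R}^2$. Let $X_m$ be the Hilbert space of vector fields $\Phi:\mathbb{R}^2\to\mathbb{C}^2$ with $\int_{\mathbb{R}^2}(1+|\xi|^2)^m|\Phi(\xi)|^2\,d\xi<\infty$ and $\nabla\cdot\Phi=0$ in the sense of distributions. Consider on $X_m$ the unbounded operator $$L_A\Phi=\mathcal L\Phi-A\,(\bar{\mathfrak u}^0_h\cdot\nabla)\Phi+A\,(\Phi\cdot\nabla)\bar{\mathfrak u}^0_h ,$$ taken in the sense of distributions, with domain $\{\Phi\in X_m : L_A\Phi\in X_m\}$. Then $\nabla^\perp\varphi_0\in X_m$, and $-\frac12$ belongs to the spectrum of $L_A$ and is a simple eigenvalue with eigenfunction $\nabla^\perp\varphi_0$,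 that is, $\nabla^\perp\varphi_0$ is in the domain, $\ker(L_A+\tfrac12)=\mathbb{C}\,\nabla^\perp\varphi_0$ and $X_m=\ker(L_A+\tfrac12)\oplus\operatorname{Ran}(L_A+\tfrac12)$. The rest of the spectrum of $L_A$ is contained in the half-plane $\{\lambda\in\mathbb{C}:\operatorname{Re}\lambda\le-1\}$. -/

import Mathlib

open MeasureTheory
open scoped ENNReal ContDiff Laplacian

noncomputable section

namespace OseenLinearization

/-- The plane `ℝ²` with its Euclidean norm. -/
abbrev Plane := EuclideanSpace ℝ (Fin 2)

/-- `ℂ²` with its Hermitian norm, the values of the (complexified) vector fields. -/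
abbrev CVec := EuclideanSpace ℂ (Fin 2)

/-- The partial derivative `∂ⱼ f`. -/
def partialD (j : Fin 2) (f : Plane → ℝ) (ξ : Plane) : ℝ :=
  fderiv ℝ f ξ (EuclideanSpace.single j 1)

/-- The divergence `∂₁v₁ + ∂₂v₂` of a real vector field. -/
def divergence (v : Plane → Plane) (ξ : Plane) : ℝ :=
  ∑ j, partialD j (fun z => v z j) ξ

/-- The Gaussian `φ₀(ξ) = (4π)⁻¹ exp(-|ξ|²/4)`. -/
def phi0 (ξ : Plane) : ℝ := 1 / (4 * Real.pi) * Real.exp (-‖ξ‖ ^ 2 / 4)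

/-- The Oseen vortex velocity field
`(1 - exp(-|ξ|²/4)) / (2π|ξ|²) (-ξ₂, ξ₁)`, which extends by `0` to `ξ = 0`. -/
def oseen (ξ : Plane) : Plane :=
  ((1 - Real.exp (-‖ξ‖ ^ 2 / 4)) / (2 * Real.pi * ‖ξ‖ ^ 2)) • !₂[-ξ 1, ξ 0]

/-- The skew gradient `∇^⊥ f = (∂₂ f, -∂₁ f)`, as a `ℂ²`-valued field. -/
def perpGrad (f : Plane → ℝ) (ξ : Plane) : CVec :=
  !₂[((partialD 1 f ξ : ℝ) : ℂ), ((-partialD 0 f ξ : ℝ) : ℂ)]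

/-- The measure `(1 + |ξ|²)^m dξ`, so that the norm of `L²` of this measure is
`‖(1 + |ξ|²)^(m/2) f‖_{L²(ℝ²)}`. -/
def weightMeasure (m : ℝ) : Measure Plane :=
  volume.withDensity fun ξ => ENNReal.ofReal ((1 + ‖ξ‖ ^ 2) ^ m)

/-- The weighted Hilbert space of `ℂ²`-valued fields on the plane. -/
abbrev WeightedL2 (m : ℝ) := Lp CVec 2 (weightMeasure m)

/-- Test functions: smooth with compact support. -/
def IsTest (η : Plane → ℝ) : Prop := ContDiff ℝ ∞ η ∧ HasCompactSupport η

/-- `Φ` is divergence free in the sense of distributions. -/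
def DivFree (Φ : Plane → CVec) : Prop :=
  ∀ η : Plane → ℝ, IsTest η → (∑ j, ∫ ξ, partialD j η ξ • Φ ξ j) = 0

/-- The formal adjoint of `𝓛 - A u⁰·∇` applied to a test function:
`Δη - ½ div(η ξ) + η + A div(η u⁰)`, where `𝓛 = Δ + ½ ξ·∇ + 1` and `u⁰` is the Oseen vortex. -/
def adjointOp (A : ℝ) (η : Plane → ℝ) (ξ : Plane) : ℝ :=
  Δ η ξ - 1 / 2 * divergence (fun z => η z • z) ξ + η ξ
    + A * divergence (fun z => η z • oseen z) ξ

/-- `𝓛Φ - A (u⁰·∇)Φ + A (Φ·∇)u⁰ = Ψ` in the sense of distributions, componentwise;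
`((Φ·∇)u⁰)ᵢ = ∑ⱼ Φⱼ ∂ⱼ u⁰ᵢ`. -/
def WeakEq (A : ℝ) (Φ Ψ : Plane → CVec) : Prop :=
  ∀ η : Plane → ℝ, IsTest η → ∀ i : Fin 2,
    (∫ ξ, adjointOp A η ξ • Φ ξ i)
      + A • (∑ j, ∫ ξ, (η ξ * partialD j (fun z => oseen z i) ξ) • Φ ξ j)
      = ∫ ξ, η ξ • Ψ ξ i

lemma continuous_weight (m : ℝ) : Continuous fun ξ : Plane => (1 + ‖ξ‖ ^ 2) ^ m := by
  refine Continuous.rpow_const (by fun_prop) fun ξ => Or.inl ?_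
  positivity

lemma weight_pos (m : ℝ) (ξ : Plane) : 0 < (1 + ‖ξ‖ ^ 2) ^ m := by positivity

instance (m : ℝ) : IsLocallyFiniteMeasure (weightMeasure m) :=
  IsLocallyFiniteMeasure.withDensity_ofReal (continuous_weight m)

lemma volume_ac (m : ℝ) : (volume : Measure Plane) ≪ weightMeasure m :=
  withDensity_absolutelyContinuous'
    (continuous_weight m).measurable.ennreal_ofReal.aemeasurable
    (Filter.Eventually.of_forall fun ξ => by simpa using weight_pos m ξ)

lemma ac_volume (m : ℝ) : weightMeasure m ≪ (volume : Measure Plane) :=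
  withDensity_absolutelyContinuous _ _

lemma locallyIntegrable_of_lp {m : ℝ} (Φ : WeightedL2 m) :
    LocallyIntegrable (fun ξ => Φ ξ) (volume : Measure Plane) := by
  have h1 : LocallyIntegrable (fun ξ => Φ ξ) (weightMeasure m) :=
    (Lp.memLp Φ).locallyIntegrable (by norm_num)
  rw [locallyIntegrable_iff] at h1 ⊢
  intro K hK
  have h2 := h1 K hK
  have hmeas := (continuous_weight m).measurable.ennreal_ofReal
  rw [IntegrableOn] at h2
  unfold weightMeasure at h2
  rw [restrict_withDensity hK.measurableSet,
    integrable_withDensity_iff_integrable_smul' hmeas (by simp)] at h2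
  have h3 : IntegrableOn (fun ξ => (1 + ‖ξ‖ ^ 2) ^ m • Φ ξ) K volume := by
    refine h2.congr (Filter.Eventually.of_forall fun ξ => ?_)
    simp only []
    rw [ENNReal.toReal_ofReal (weight_pos m ξ).le]
    rfl
  have h4 : IntegrableOn (fun ξ => (1 + ‖ξ‖ ^ 2) ^ (-m) • ((1 + ‖ξ‖ ^ 2) ^ m • Φ ξ)) K volume :=
    h3.continuousOn_smul (continuous_weight (-m)).continuousOn hK
  refine h4.congr (Filter.Eventually.of_forall fun ξ => ?_)
  simp only []
  rw [smul_smul, ← Real.rpow_add (by positivity)]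
  simp

lemma locallyIntegrable_comp {m : ℝ} (Φ : WeightedL2 m) (i : Fin 2) :
    LocallyIntegrable (fun ξ => Φ ξ i) (volume : Measure Plane) := by
  have h := locallyIntegrable_of_lp Φ
  rw [locallyIntegrable_iff] at h ⊢
  intro K hK
  exact (EuclideanSpace.proj i : CVec →L[ℂ] ℂ).integrable_comp (h K hK)

lemma integrable_test {m : ℝ} (Φ : WeightedL2 m) (i : Fin 2) {a : Plane → ℝ}
    (ha : Continuous a) (hs : HasCompactSupport a) :
    Integrable (fun ξ => a ξ • Φ ξ i) (volume : Measure Plane) :=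
  (locallyIntegrable_comp Φ i).integrable_smul_left_of_hasCompactSupport ha hs

lemma coe_add_ae {m : ℝ} (Φ Ψ : WeightedL2 m) :
    ∀ᵐ ξ ∂(volume : Measure Plane), ∀ i, (Φ + Ψ : WeightedL2 m) ξ i = Φ ξ i + Ψ ξ i := by
  filter_upwards [(volume_ac m).ae_eq (Lp.coeFn_add Φ Ψ)] with ξ h i
  rw [h]; rfl

lemma coe_smul_ae {m : ℝ} (c : ℂ) (Φ : WeightedL2 m) :
    ∀ᵐ ξ ∂(volume : Measure Plane), ∀ i, (c • Φ : WeightedL2 m) ξ i = c * Φ ξ i := by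
  filter_upwards [(volume_ac m).ae_eq (Lp.coeFn_smul c Φ)] with ξ h i
  rw [h]; rfl

lemma coe_zero_ae (m : ℝ) :
    ∀ᵐ ξ ∂(volume : Measure Plane), ∀ i, (0 : WeightedL2 m) ξ i = 0 := by
  filter_upwards [(volume_ac m).ae_eq (Lp.coeFn_zero CVec 2 (weightMeasure m))] with ξ h i
  rw [h]; rfl

lemma integral_add_test {m : ℝ} (Φ Ψ : WeightedL2 m) (i : Fin 2) {a : Plane → ℝ}
    (ha : Continuous a) (hs : HasCompactSupport a) :
    (∫ ξ, a ξ • (Φ + Ψ : WeightedL2 m) ξ i)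
      = (∫ ξ, a ξ • Φ ξ i) + ∫ ξ, a ξ • Ψ ξ i := by
  rw [← integral_add (integrable_test Φ i ha hs) (integrable_test Ψ i ha hs)]
  refine integral_congr_ae ?_
  filter_upwards [coe_add_ae Φ Ψ] with ξ h
  rw [h i, smul_add]

lemma integral_smul_test {m : ℝ} (c : ℂ) (Φ : WeightedL2 m) (i : Fin 2) (a : Plane → ℝ) :
    ∫ ξ, a ξ • (c • Φ : WeightedL2 m) ξ i = c * ∫ ξ, a ξ • Φ ξ i := by
  rw [← integral_const_mul]
  refine integral_congr_ae ?_
  filter_upwards [coe_smul_ae c Φ] with ξ h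
  rw [h i, mul_smul_comm]

lemma integral_zero_test (m : ℝ) (i : Fin 2) (a : Plane → ℝ) :
    ∫ ξ, a ξ • (0 : WeightedL2 m) ξ i = 0 := by
  rw [← integral_zero Plane ℂ (μ := volume)]
  refine integral_congr_ae ?_
  filter_upwards [coe_zero_ae m] with ξ h
  rw [h i, smul_zero]

lemma continuous_partialD {f : Plane → ℝ} (hf : ContDiff ℝ ∞ f) (j : Fin 2) :
    Continuous (partialD j f) :=
  (hf.continuous_fderiv (by simp)).clm_apply continuous_const

lemma compact_partialD {f : Plane → ℝ} (hf : HasCompactSupport f) (j : Fin 2) :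
    HasCompactSupport (partialD j f) :=
  hf.fderiv_apply (𝕜 := ℝ) _

lemma contDiff_oseen : ContDiff ℝ ∞ oseen := by
  set g : ℝ → ℝ := dslope (fun s => -Real.exp (-s / 4)) 0 with hg
  have hexp : ContDiff ℝ ω fun s : ℝ => -Real.exp (-s / 4) := by fun_prop
  have hgs : ContDiff ℝ ∞ g := by
    rw [contDiff_iff_contDiffAt]
    intro s
    by_cases hs : s = 0
    · subst hs
      obtain ⟨p, hp⟩ := hexp.contDiffAt.analyticAt (x := (0 : ℝ))
      have : AnalyticAt ℝ g 0 := ⟨_, hp.has_fpower_series_dslope_fslope⟩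
      exact this.contDiffAt
    · have h1 : g =ᶠ[nhds s] fun t => (1 - Real.exp (-t / 4)) / t := by
        filter_upwards [isOpen_ne.mem_nhds hs] with t ht
        rw [hg, dslope_of_ne _ ht, slope_def_field]
        simp
        ring
      refine ContDiffAt.congr_of_eventuallyEq ?_ h1
      exact ContDiffAt.div (by fun_prop) contDiffAt_id hs
  have h : oseen = fun ξ : Plane => (1 / (2 * Real.pi) * g (‖ξ‖ ^ 2)) • !₂[-ξ 1, ξ 0] := by
    funext ξ
    by_cases hξ : ξ = 0
    · subst hξ
      have : (!₂[-(0 : Plane) 1, (0 : Plane) 0] : Plane) = 0 := by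
        ext i; fin_cases i <;> simp
      rw [oseen, this, smul_zero, smul_zero]
    · have hn : ‖ξ‖ ^ 2 ≠ 0 := by simpa using hξ
      rw [oseen, hg, dslope_of_ne _ hn, slope_def_field]
      congr 1
      simp
      field_simp
      ring
  rw [h]
  refine ContDiff.smul (contDiff_const.mul (hgs.comp (contDiff_norm_sq ℝ))) ?_
  rw [contDiff_euclidean]
  intro i
  fin_cases i
  · simpa using (EuclideanSpace.proj 1 : Plane →L[ℝ] ℝ).contDiff.neg
  · simpa using (EuclideanSpace.proj 0 : Plane →L[ℝ] ℝ).contDiff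

lemma continuous_divergence {η : Plane → ℝ} (hη : IsTest η) {v : Plane → Plane}
    (hv : ContDiff ℝ ∞ v) : Continuous (divergence fun z => η z • v z) := by
  unfold divergence
  refine continuous_finsetSum _ fun j _ => continuous_partialD ?_ j
  have : ContDiff ℝ ∞ fun z => η z • v z := hη.1.smul hv
  exact (contDiff_euclidean.1 this) j

lemma compact_divergence {η : Plane → ℝ} (hη : IsTest η) (v : Plane → Plane) :
    HasCompactSupport (divergence fun z => η z • v z) := by
  have h : ∀ j : Fin 2, HasCompactSupport (partialD j fun z => (η z • v z) j) := fun j =>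
    compact_partialD (hη.2.mul_right (f' := fun z => v z j)) j
  have h2 : (divergence fun z => η z • v z) = fun ξ =>
      partialD 0 (fun z => (η z • v z) 0) ξ + partialD 1 (fun z => (η z • v z) 1) ξ := by
    funext ξ; simp [divergence]
  rw [h2]
  exact (h 0).add (h 1)

lemma continuous_adjointOp (A : ℝ) {η : Plane → ℝ} (hη : IsTest η) :
    Continuous (adjointOp A η) := by
  have h1 : Continuous (Δ η) := by
    rw [InnerProductSpace.laplacian_eq_iteratedFDeriv_stdOrthonormalBasis]
    refine continuous_finsetSum _ fun j _ => ?_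
    have := (contDiff_infty.1 hη.1 2).continuous_iteratedFDeriv (m := 2) le_rfl
    exact (ContinuousMultilinearMap.apply ℝ (fun _ : Fin 2 => Plane) ℝ _).continuous.comp this
  have h2 := continuous_divergence hη (contDiff_id (𝕜 := ℝ) (E := Plane))
  have h3 := continuous_divergence hη contDiff_oseen
  exact ((h1.sub (continuous_const.mul h2)).add hη.1.continuous).add (continuous_const.mul h3)

lemma compact_adjointOp (A : ℝ) {η : Plane → ℝ} (hη : IsTest η) :
    HasCompactSupport (adjointOp A η) := by
  have h1 : HasCompactSupport (Δ η) := by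
    refine (hη.2.iteratedFDeriv (𝕜 := ℝ) 2).mono' ?_
    intro x hx
    refine subset_tsupport _ ?_
    intro h
    apply hx
    simp only [InnerProductSpace.laplacian_eq_iteratedFDeriv_stdOrthonormalBasis] at *
    rw [h]; simp
  have h2 := compact_divergence hη (fun z => z)
  have h3 := compact_divergence hη oseen
  have h2' : HasCompactSupport fun ξ => -(1 / 2) * divergence (fun z => η z • z) ξ :=
    h2.mul_left
  have h3' : HasCompactSupport fun ξ => A * divergence (fun z => η z • oseen z) ξ :=
    h3.mul_left
  have h := ((h1.add h2').add hη.2).add h3'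
  have e : adjointOp A η = ((Δ η + fun ξ => -(1 / 2) * divergence (fun z => η z • z) ξ) + η +
      fun ξ => A * divergence (fun z => η z • oseen z) ξ) := by
    funext ξ
    simp [adjointOp]
    ring
  rw [e]
  exact h

lemma continuous_coupling {η : Plane → ℝ} (hη : IsTest η) (i j : Fin 2) :
    Continuous fun ξ => η ξ * partialD j (fun z => oseen z i) ξ :=
  hη.1.continuous.mul (continuous_partialD (contDiff_euclidean.1 contDiff_oseen i) j)

lemma compact_coupling {η : Plane → ℝ} (hη : IsTest η) (i j : Fin 2) :
    HasCompactSupport fun ξ => η ξ * partialD j (fun z => oseen z i) ξ :=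
  hη.2.mul_right

/-- The divergence-free fields in the weighted space. -/
def divFreeSpace (m : ℝ) : Submodule ℂ (WeightedL2 m) where
  carrier := {Φ | DivFree Φ}
  zero_mem' := fun η _ => by simp only [integral_zero_test, Finset.sum_const_zero]
  add_mem' := fun {Φ Ψ} hΦ hΨ η hη => by
    have := hΦ η hη
    have h2 := hΨ η hη
    simp only [fun j => integral_add_test Φ Ψ j (continuous_partialD hη.1 j)
      (compact_partialD hη.2 j), Finset.sum_add_distrib, this, h2, add_zero]
  smul_mem' := fun c Φ hΦ η hη => by
    simp only [integral_smul_test, ← Finset.mul_sum, hΦ η hη, mul_zero]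

/-- The graph of the linearized operator on the divergence-free space, with its maximal domain. -/
def linGraph (A m : ℝ) : Submodule ℂ (divFreeSpace m × divFreeSpace m) where
  carrier := {p | WeakEq A (p.1 : WeightedL2 m) (p.2 : WeightedL2 m)}
  zero_mem' := fun η _ i => by
    simp only [Prod.fst_zero, Prod.snd_zero, Submodule.coe_zero, integral_zero_test,
      Finset.sum_const_zero, smul_zero, add_zero]
  add_mem' := fun {p q} hp hq η hη i => by
    have h1 := hp η hη i
    have h2 := hq η hη i
    simp only [Prod.fst_add, Prod.snd_add, Submodule.coe_add]
    rw [integral_add_test _ _ i (continuous_adjointOp A hη) (compact_adjointOp A hη),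
      integral_add_test _ _ i hη.1.continuous hη.2]
    simp only [fun j => integral_add_test (p.1 : WeightedL2 m) (q.1 : WeightedL2 m) j
      (continuous_coupling hη i j) (compact_coupling hη i j), Finset.sum_add_distrib, smul_add]
    rw [← h1, ← h2]
    ring
  smul_mem' := fun c p hp η hη i => by
    have h1 := hp η hη i
    simp only [Prod.smul_fst, Prod.smul_snd, Submodule.coe_smul, integral_smul_test,
      ← Finset.mul_sum, ← h1, mul_add, mul_smul_comm]

/-- The graph is single valued. -/
lemma linGraph_single_valued (A m : ℝ) (p : divFreeSpace m × divFreeSpace m)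
    (hp : p ∈ linGraph A m) (h0 : p.1 = 0) : p.2 = 0 := by
  have key : ∀ i : Fin 2, ∀ᵐ ξ ∂(volume : Measure Plane), (p.2 : WeightedL2 m) ξ i = 0 := by
    intro i
    refine ae_eq_zero_of_integral_contDiff_smul_eq_zero (locallyIntegrable_comp _ i) ?_
    intro η h1 h2
    have h := hp η ⟨h1, h2⟩ i
    rw [h0] at h
    simp only [Submodule.coe_zero, integral_zero_test, Finset.sum_const_zero, smul_zero,
      add_zero] at h
    exact h.symm
  have h : ((p.2 : WeightedL2 m) : Plane → CVec) =ᵐ[weightMeasure m] 0 := by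
    refine (ac_volume m).ae_eq ?_
    filter_upwards [key 0, key 1] with ξ h0 h1
    ext i; fin_cases i
    · exact h0
    · exact h1
  exact Subtype.ext ((Lp.eq_zero_iff_ae_eq_zero).2 h)

/-- The unbounded operator `Φ ↦ 𝓛Φ - A (u⁰·∇)Φ + A (Φ·∇)u⁰` on the divergence-free fields of the
weighted space; its domain consists of all `Φ` in the space whose distributional image lies in
the space. -/
def linOp (A m : ℝ) : divFreeSpace m →ₗ.[ℂ] divFreeSpace m := (linGraph A m).toLinearPMap

/-- The operator has the graph it was built from. -/
lemma linOp_graph (A m : ℝ) : (linOp A m).graph = linGraph A m :=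
  Submodule.toLinearPMap_graph_eq _ (linGraph_single_valued A m)

section Spectrum

variable {X : Type*} [NormedAddCommGroup X] [NormedSpace ℂ X]

/-- `z` is in the resolvent set of the unbounded operator `T`: the map `z - T` from the domain of
`T` to the whole space has a bounded two-sided inverse. -/
def InResolventSet (T : X →ₗ.[ℂ] X) (z : ℂ) : Prop :=
  ∃ R : X →L[ℂ] X, (∀ x : T.domain, R (z • (x : X) - T x) = x) ∧
    ∀ y : X, ∃ h : R y ∈ T.domain, z • R y - T ⟨R y, h⟩ = y

/-- The spectrum of an unbounded operator. -/
def spectrumSet (T : X →ₗ.[ℂ] X) : Set ℂ := {z | ¬ InResolventSet T z}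

/-- `z` is a simple eigenvalue of `T` with eigenvector `e`: the eigenspace is the line `ℂ e`, and
the whole space is the algebraic direct sum of that line and the range of `T - z`
(geometric and algebraic multiplicity one). -/
def IsSimpleEigenvalue (T : X →ₗ.[ℂ] X) (z : ℂ) (e : X) : Prop :=
  e ≠ 0 ∧ (∃ h : e ∈ T.domain, T ⟨e, h⟩ = z • e) ∧
    (∀ x : T.domain, T x = z • (x : X) → (x : X) ∈ Submodule.span ℂ {e}) ∧
    IsCompl (Submodule.span ℂ {e}) (LinearMap.range (T.toFun - z • T.domain.subtype))

end Spectrum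

end OseenLinearization

end

noncomputable section

namespace OseenLinearization

/-! ### Partial derivatives of real functions on the plane -/

/-! Write a divergence-free field as `∇^⊥ψ`. Since `div u⁰ = 0`, the operator acts on the stream
function `ψ` as the scalar operator `M = Δ + ½ ξ·∇ + ½ - A u⁰·∇` (`perpR_streamOp`). In the Gaussian
weight `exp(|ξ|²/4)` the part of `M` without vortex is a shifted harmonic oscillator with
eigenvalues `-1/2, -1, -3/2, …`, and the vortex term is skew, because `u⁰` is divergence free and
tangent to circles. The eigenvalue `-1/2` belongs to `φ₀`, its dual eigenfunctional is the mean
`∫ψ`, and for mean zero the quadratic form of `-M` is at least `1`, whatever `A` is.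

Fields in the polynomially weighted space need not have stream functions in the Gaussian space. The
Gaussian weight is therefore replaced by `1 / (exp(-|ξ|²/4) + ε (1+|ξ|²)^(-k))` with `k = m - 1`,
which is comparable to the polynomial weight. Where `|ξ|` is moderate the oscillator gap survives up
to a small error; at infinity the drift `½ ξ·∇` alone contributes `k/2`, which exceeds `1` because
`m > 3`. This gives coercivity of `-M` with constant `1 - δ`, modulo the mean
(`exists_coercive_weight`). The bounds `stream_bound`, `gradient_bound`, `field_bound` and a Hardy
inequality lift it to a resolvent estimate for fields, uniform in `Re λ ≥ -1 + 2δ` and modulo the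
mean (`a_priori`).

All this is proved for compactly supported smooth `ψ`. It passes to the maximal domain because a
closed subspace containing the pairs `(∇^⊥p, L_A ∇^⊥p)` of test functions contains the whole graph
(`mem_of_weakEq`): mollify, integrate to a stream function, truncate. Bounded sequences converging
in the sense of distributions suffice, closed subspaces being weakly closed. In the same way the
mean becomes the moment functional `μ`, continuous on the space, with `μ ∘ L_A = -½ μ`
(`moment_of_weakEq`).

The conclusion is abstract (`spectrum_of_resolventBound`). A theorem of Lions gives dense range of
`c - L_A` at one point `c ≥ 0` (`exists_dense_range`), hence solvability there on the invariant
subspace `ker μ`. On `ker μ` the resolvent estimate has no exceptional point, so solvability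
continues to all of `Re z > -1`, including `z = -1/2`. The eigenvector `∇^⊥φ₀`, on which `μ` does
not vanish, spans a complement of `ker μ` and accounts for the eigenvalue `-1/2`. -/

lemma contDiff_partialD {f : Plane → ℝ} (hf : ContDiff ℝ ∞ f) (j : Fin 2) :
    ContDiff ℝ ∞ (partialD j f) :=
  (hf.fderiv_right (m := ∞) (by simp)).clm_apply contDiff_const

lemma ContDiff.diffAt {f : Plane → ℝ} (hf : ContDiff ℝ ∞ f) (x : Plane) :
    DifferentiableAt ℝ f x :=
  (hf.differentiable (by simp)) x

lemma partialD_add {f g : Plane → ℝ} (hf : ContDiff ℝ ∞ f) (hg : ContDiff ℝ ∞ g) (j : Fin 2)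
    (x : Plane) : partialD j (fun z => f z + g z) x = partialD j f x + partialD j g x := by
  unfold partialD
  rw [fderiv_fun_add (ContDiff.diffAt hf x) (ContDiff.diffAt hg x)]; rfl

lemma partialD_sub {f g : Plane → ℝ} (hf : ContDiff ℝ ∞ f) (hg : ContDiff ℝ ∞ g) (j : Fin 2)
    (x : Plane) : partialD j (fun z => f z - g z) x = partialD j f x - partialD j g x := by
  unfold partialD
  rw [fderiv_fun_sub (ContDiff.diffAt hf x) (ContDiff.diffAt hg x)]; rfl

lemma partialD_mul {f g : Plane → ℝ} (hf : ContDiff ℝ ∞ f) (hg : ContDiff ℝ ∞ g) (j : Fin 2)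
    (x : Plane) :
    partialD j (fun z => f z * g z) x = partialD j f x * g x + f x * partialD j g x := by
  unfold partialD
  rw [fderiv_fun_mul (ContDiff.diffAt hf x) (ContDiff.diffAt hg x)]
  simp; ring

lemma partialD_neg {f : Plane → ℝ} (j : Fin 2) (x : Plane) :
    partialD j (fun z => -f z) x = -partialD j f x := by
  unfold partialD
  rw [fderiv_fun_neg]; rfl

lemma partialD_const (c : ℝ) (j : Fin 2) (x : Plane) : partialD j (fun _ => c) x = 0 := by
  simp [partialD]

lemma partialD_const_mul {f : Plane → ℝ} (hf : ContDiff ℝ ∞ f) (c : ℝ) (j : Fin 2)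
    (x : Plane) : partialD j (fun z => c * f z) x = c * partialD j f x := by
  rw [partialD_mul contDiff_const hf, partialD_const]; ring

lemma partialD_comm {f : Plane → ℝ} (hf : ContDiff ℝ ∞ f) (i j : Fin 2) (x : Plane) :
    partialD i (partialD j f) x = partialD j (partialD i f) x := by
  have hd : DifferentiableAt ℝ (fderiv ℝ f) x :=
    (hf.fderiv_right (m := ∞) (by simp)).differentiable (by simp) x
  have key : ∀ i j : Fin 2, partialD i (partialD j f) x =
      fderiv ℝ (fderiv ℝ f) x (EuclideanSpace.single i 1) (EuclideanSpace.single j 1) := by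
    intro i j
    unfold partialD
    rw [fderiv_clm_apply hd (differentiableAt_const _)]
    simp
  rw [key, key]
  exact (hf.contDiffAt.isSymmSndFDerivAt (by simpa using ENat.LEInfty.out)) _ _

lemma contDiff_coord (i : Fin 2) : ContDiff ℝ ∞ fun x : Plane => x i :=
  (EuclideanSpace.proj i : Plane →L[ℝ] ℝ).contDiff

lemma partialD_coord (i j : Fin 2) (x : Plane) :
    partialD j (fun z : Plane => z i) x = if i = j then 1 else 0 := by
  have : fderiv ℝ (fun z : Plane => z i) x = (EuclideanSpace.proj i : Plane →L[ℝ] ℝ) :=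
    (EuclideanSpace.proj i : Plane →L[ℝ] ℝ).fderiv
  unfold partialD
  rw [this]
  simp

lemma norm_sq_eq (x : Plane) : ‖x‖ ^ 2 = x 0 ^ 2 + x 1 ^ 2 := by
  simp [EuclideanSpace.norm_sq_eq, Fin.sum_univ_two]

lemma contDiff_normsq : ContDiff ℝ ∞ fun x : Plane => ‖x‖ ^ 2 := contDiff_norm_sq ℝ

lemma partialD_normsq (j : Fin 2) (x : Plane) :
    partialD j (fun z : Plane => ‖z‖ ^ 2) x = 2 * x j := by
  have : (fun z : Plane => ‖z‖ ^ 2) = fun z => z 0 * z 0 + z 1 * z 1 := by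
    funext z; rw [norm_sq_eq]; ring
  rw [this, partialD_add ((contDiff_coord 0).mul (contDiff_coord 0))
    ((contDiff_coord 1).mul (contDiff_coord 1)), partialD_mul (contDiff_coord 0) (contDiff_coord 0),
    partialD_mul (contDiff_coord 1) (contDiff_coord 1)]
  simp only [partialD_coord]
  fin_cases j <;> simp <;> ring

lemma partialD_comp {f : Plane → ℝ} {h : ℝ → ℝ} {h' : ℝ} {x : Plane} (hf : ContDiff ℝ ∞ f)
    (hh : HasDerivAt h h' (f x)) (j : Fin 2) :
    partialD j (fun z => h (f z)) x = h' * partialD j f x := by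
  unfold partialD
  have := hh.comp_hasFDerivAt x (ContDiff.diffAt hf x).hasFDerivAt
  rw [show (fun z => h (f z)) = h ∘ f from rfl, this.fderiv]
  simp

/-- The derivative of a radial function. -/
lemma partialD_radial {h : ℝ → ℝ} {h' : ℝ} {x : Plane} (hh : HasDerivAt h h' (‖x‖ ^ 2))
    (j : Fin 2) : partialD j (fun z : Plane => h (‖z‖ ^ 2)) x = h' * (2 * x j) := by
  rw [partialD_comp contDiff_normsq hh, partialD_normsq]

lemma laplacian_eq {f : Plane → ℝ} (hf : ContDiff ℝ ∞ f) (x : Plane) :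
    Δ f x = partialD 0 (partialD 0 f) x + partialD 1 (partialD 1 f) x := by
  have hd : DifferentiableAt ℝ (fderiv ℝ f) x :=
    (hf.fderiv_right (m := ∞) (by simp)).differentiable (by simp) x
  have key : ∀ i : Fin 2, partialD i (partialD i f) x =
      fderiv ℝ (fderiv ℝ f) x (EuclideanSpace.single i 1) (EuclideanSpace.single i 1) := by
    intro i
    unfold partialD
    rw [fderiv_clm_apply hd (differentiableAt_const _)]
    simp
  rw [InnerProductSpace.laplacian_eq_iteratedFDeriv_orthonormalBasis f
    (EuclideanSpace.basisFun (Fin 2) ℝ)]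
  simp [Fin.sum_univ_two, key, iteratedFDeriv_two_apply]

lemma integrable_of_compact {f : Plane → ℝ} (hf : Continuous f) (hs : HasCompactSupport f) :
    Integrable f := hf.integrable_of_hasCompactSupport hs

lemma integral_mul_partialD {f g : Plane → ℝ} (hf : ContDiff ℝ ∞ f) (hg : ContDiff ℝ ∞ g)
    (hs : HasCompactSupport f) (j : Fin 2) :
    ∫ x, f x * partialD j g x = -∫ x, partialD j f x * g x :=
  integral_mul_fderiv_eq_neg_fderiv_mul_of_integrable
    (integrable_of_compact ((continuous_partialD hf j).mul hg.continuous)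
      (compact_partialD hs j).mul_right)
    (integrable_of_compact (hf.continuous.mul (continuous_partialD hg j)) hs.mul_right)
    (integrable_of_compact (hf.continuous.mul hg.continuous) hs.mul_right)
    (fun x _ => ContDiff.diffAt hf x) (fun x _ => ContDiff.diffAt hg x)

lemma integral_partialD_mul {f g : Plane → ℝ} (hf : ContDiff ℝ ∞ f) (hg : ContDiff ℝ ∞ g)
    (hs : HasCompactSupport f) (j : Fin 2) :
    ∫ x, partialD j g x * f x = -∫ x, g x * partialD j f x := by
  have := integral_mul_partialD hf hg hs j
  simpa only [mul_comm] using this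

lemma integral_partialD_eq_zero {f : Plane → ℝ} (hf : ContDiff ℝ ∞ f)
    (hs : HasCompactSupport f) (j : Fin 2) : ∫ x, partialD j f x = 0 := by
  have := integral_mul_partialD hf (contDiff_const (c := (1 : ℝ))) hs j
  simpa [partialD_const] using this.symm

lemma IsTest.partialD {η : Plane → ℝ} (hη : IsTest η) (j : Fin 2) : IsTest (partialD j η) :=
  ⟨contDiff_partialD hη.1 j, compact_partialD hη.2 j⟩

lemma IsTest.mul_smooth {η a : Plane → ℝ} (hη : IsTest η) (ha : ContDiff ℝ ∞ a) :
    IsTest fun x => η x * a x := ⟨hη.1.mul ha, hη.2.mul_right⟩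

lemma IsTest.smooth_mul {η a : Plane → ℝ} (hη : IsTest η) (ha : ContDiff ℝ ∞ a) :
    IsTest fun x => a x * η x := ⟨ha.mul hη.1, hη.2.mul_left⟩

lemma IsTest.add {η θ : Plane → ℝ} (hη : IsTest η) (hθ : IsTest θ) :
    IsTest fun x => η x + θ x := ⟨hη.1.add hθ.1, hη.2.add hθ.2⟩

lemma IsTest.const_mul {η : Plane → ℝ} (hη : IsTest η) (c : ℝ) :
    IsTest fun x => c * η x := hη.smooth_mul contDiff_const

lemma IsTest.sub {η θ : Plane → ℝ} (hη : IsTest η) (hθ : IsTest θ) :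
    IsTest fun x => η x - θ x := by
  simpa [sub_eq_add_neg] using hη.add (hθ.const_mul (-1))

lemma IsTest.integrable {η : Plane → ℝ} (hη : IsTest η) : Integrable η :=
  integrable_of_compact hη.1.continuous hη.2

/-! ### The Oseen vortex -/

/-- The angular velocity of the Oseen vortex, as a function of `|ξ|²`. -/
def angVel (t : ℝ) : ℝ := (1 - Real.exp (-t / 4)) / (2 * Real.pi * t)

lemma oseen_zero (x : Plane) : oseen x 0 = -(angVel (‖x‖ ^ 2) * x 1) := by
  simp [oseen, angVel]

lemma oseen_one (x : Plane) : oseen x 1 = angVel (‖x‖ ^ 2) * x 0 := by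
  simp [oseen, angVel]

lemma contDiff_oseen_apply (i : Fin 2) : ContDiff ℝ ∞ fun x => oseen x i :=
  contDiff_euclidean.1 contDiff_oseen i

lemma oseen_dot (x : Plane) : oseen x 0 * x 0 + oseen x 1 * x 1 = 0 := by
  rw [oseen_zero, oseen_one]; ring

/-- The derivative of the angular velocity. -/
def angVelDeriv (t : ℝ) : ℝ :=
  (Real.exp (-t / 4) / 4 * (2 * Real.pi * t) - (1 - Real.exp (-t / 4)) * (2 * Real.pi))
    / (2 * Real.pi * t) ^ 2

lemma hasDerivAt_angVel {t : ℝ} (ht : t ≠ 0) : HasDerivAt angVel (angVelDeriv t) t := by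
  have h1 : HasDerivAt (fun t : ℝ => 1 - Real.exp (-t / 4)) (Real.exp (-t / 4) / 4) t := by
    have : HasDerivAt (fun t : ℝ => -t / 4) (-1 / 4) t := ((hasDerivAt_id t).neg).div_const 4
    exact (this.exp.const_sub 1).congr_deriv (by ring)
  have h2 : HasDerivAt (fun t : ℝ => 2 * Real.pi * t) (2 * Real.pi) t := by
    simpa using (hasDerivAt_id t).const_mul (2 * Real.pi)
  exact h1.div h2 (by positivity)

lemma partialD_oseen_aux {x : Plane} (hx : x ≠ 0) (i j : Fin 2) :
    partialD j (fun z => angVel (‖z‖ ^ 2) * z i) x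
      = angVelDeriv (‖x‖ ^ 2) * (2 * x j) * x i
        + angVel (‖x‖ ^ 2) * (if i = j then 1 else 0) := by
  have hn : ‖x‖ ^ 2 ≠ 0 := by simpa using hx
  have h1 : HasFDerivAt (fun z : Plane => angVel (‖z‖ ^ 2)) _ x :=
    HasDerivAt.comp_hasFDerivAt (f := fun z : Plane => ‖z‖ ^ 2) x (hasDerivAt_angVel hn)
      (ContDiff.diffAt contDiff_normsq x).hasFDerivAt
  have h2 := (h1.mul (ContDiff.diffAt (contDiff_coord i) x).hasFDerivAt).fderiv
  have e1 := partialD_normsq j x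
  have e2 := partialD_coord i j x
  unfold partialD at *
  rw [show (fun z : Plane => angVel (‖z‖ ^ 2) * z i)
    = ((fun z : Plane => angVel (‖z‖ ^ 2)) * fun z => z i) from rfl, h2]
  simp only [add_apply, smul_apply, smul_eq_mul, e1, e2]
  ring

lemma partialD_oseen_zero {x : Plane} (hx : x ≠ 0) (j : Fin 2) :
    partialD j (fun z => oseen z 0) x
      = -(angVelDeriv (‖x‖ ^ 2) * (2 * x j) * x 1
        + angVel (‖x‖ ^ 2) * (if 1 = j then 1 else 0)) := by
  simp only [oseen_zero]
  rw [partialD_neg, partialD_oseen_aux hx]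

lemma partialD_oseen_one {x : Plane} (hx : x ≠ 0) (j : Fin 2) :
    partialD j (fun z => oseen z 1) x
      = angVelDeriv (‖x‖ ^ 2) * (2 * x j) * x 0
        + angVel (‖x‖ ^ 2) * (if 0 = j then 1 else 0) := by
  simp only [oseen_one]
  rw [partialD_oseen_aux hx]

/-- Away from the origin the explicit derivatives cancel. The formulas divide by `|ξ|²`, so the
origin itself is reached by continuity and density. -/
lemma div_oseen (x : Plane) :
    partialD 0 (fun z => oseen z 0) x + partialD 1 (fun z => oseen z 1) x = 0 := by
  have hc : Continuous fun x => partialD 0 (fun z => oseen z 0) x + partialD 1 (fun z => oseen z 1) x :=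
    (continuous_partialD (contDiff_oseen_apply 0) 0).add
      (continuous_partialD (contDiff_oseen_apply 1) 1)
  have hd : Dense ({0}ᶜ : Set Plane) := dense_compl_singleton 0
  have : (fun x => partialD 0 (fun z => oseen z 0) x + partialD 1 (fun z => oseen z 1) x)
      = fun _ => 0 := by
    refine hc.ext_on hd continuous_const fun x hx => ?_
    have hx : x ≠ 0 := hx
    simp only [partialD_oseen_zero hx, partialD_oseen_one hx]
    simp
    ring
  exact congrFun this x

lemma abs_angVel_le {t : ℝ} (ht : 1 ≤ t) : |angVel t| ≤ 1 / t := by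
  have h1 : Real.exp (-t / 4) ≤ 1 := Real.exp_le_one_iff.2 (by linarith)
  have h2 := Real.exp_pos (-t / 4)
  have h3 := Real.pi_gt_three
  rw [angVel, abs_div, abs_of_nonneg (by linarith), abs_of_pos (by positivity),
    div_le_div_iff₀ (by positivity) (by positivity)]
  nlinarith

/-- Over the denominator `2πt²` the numerator is `(t/4) e^(-t/4) - (1 - e^(-t/4))`, a difference of
two numbers in `[0, 1]`. -/
lemma abs_angVelDeriv_le {t : ℝ} (ht : 1 ≤ t) : |angVelDeriv t| ≤ 1 / t ^ 2 := by
  have h1 : Real.exp (-t / 4) ≤ 1 := Real.exp_le_one_iff.2 (by linarith)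
  have h2 := Real.exp_pos (-t / 4)
  have h3 := Real.pi_gt_three
  have h4 : Real.exp (-t / 4) * (t / 4) ≤ 1 := by
    have := Real.add_one_le_exp (t / 4)
    have e : Real.exp (-t / 4) * Real.exp (t / 4) = 1 := by rw [← Real.exp_add]; simp; ring
    nlinarith
  have e : angVelDeriv t = (Real.exp (-t / 4) * (t / 4) - (1 - Real.exp (-t / 4)))
      / (2 * Real.pi * t ^ 2) := by
    unfold angVelDeriv
    have : Real.pi ≠ 0 := by positivity
    have : t ≠ 0 := by positivity
    field_simp
  have h5 : |Real.exp (-t / 4) * (t / 4) - (1 - Real.exp (-t / 4))| ≤ 1 := by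
    have : 0 ≤ Real.exp (-t / 4) * (t / 4) := by positivity
    rw [abs_le]; constructor <;> linarith
  rw [e, abs_div, abs_of_pos (a := 2 * Real.pi * t ^ 2) (by positivity),
    div_le_div_iff₀ (by positivity) (by positivity)]
  have : t ^ 2 ≤ 2 * Real.pi * t ^ 2 := by nlinarith [sq_nonneg t]
  nlinarith [sq_nonneg t]

lemma abs_coord_le (x : Plane) (i : Fin 2) : |x i| ≤ ‖x‖ := by
  simpa using PiLp.norm_apply_le x i

/-- The velocity decays like `|ξ|⁻¹`, so its gradient decays like `|ξ|⁻²`. This gain of one power of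
`1 + |ξ|²` makes the coupling `A (Φ·∇)u⁰` a lower-order term in every weighted estimate, for
arbitrary `A`. -/
lemma exists_bound_partialD_oseen :
    ∃ C, 0 ≤ C ∧ ∀ (i j : Fin 2) (x : Plane),
      |partialD j (fun z => oseen z i) x| * (1 + ‖x‖ ^ 2) ≤ C := by
  have h1 : ∀ i j : Fin 2, ∃ C, ∀ x ∈ Metric.closedBall (0 : Plane) 1,
      |partialD j (fun z => oseen z i) x| * (1 + ‖x‖ ^ 2) ≤ C := by
    intro i j
    obtain ⟨C, hC⟩ := (isCompact_closedBall (0 : Plane) 1).exists_bound_of_continuousOn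
      (f := fun x => |partialD j (fun z => oseen z i) x| * (1 + ‖x‖ ^ 2))
      (Continuous.continuousOn
        ((continuous_partialD (contDiff_oseen_apply i) j).abs.mul (by fun_prop)))
    exact ⟨C, fun x hx => (le_abs_self _).trans (hC x hx)⟩
  choose C hC using h1
  -- The sum covers the unit ball by compactness. Outside it, with `t = |ξ|² ≥ 1`, the derivative is
  -- at most `3/t`, and `(3/t)(1 + t) ≤ 6`.
  refine ⟨∑ i, ∑ j, |C i j| + 6, by positivity, fun i j x => ?_⟩
  have hsum : 0 ≤ ∑ i, ∑ j, |C i j| := by positivity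
  by_cases hx : ‖x‖ ≤ 1
  · have h2 : |C i j| ≤ ∑ i, ∑ j, |C i j| := by
      refine le_trans ?_ (Finset.single_le_sum (f := fun i => ∑ j, |C i j|)
        (fun i _ => Finset.sum_nonneg fun j _ => abs_nonneg _) (Finset.mem_univ i))
      exact Finset.single_le_sum (f := fun j => |C i j|) (fun j _ => abs_nonneg _)
        (Finset.mem_univ j)
    have := hC i j x (by simpa using hx)
    linarith [le_abs_self (C i j)]
  · push Not at hx
    have hx0 : x ≠ 0 := by rintro rfl; simp at hx; linarith
    have ht : 1 ≤ ‖x‖ ^ 2 := by nlinarith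
    have a1 := abs_angVel_le ht
    have a2 := abs_angVelDeriv_le ht
    have key : ∀ (l : Fin 2) (c : ℝ), |c| ≤ 1 →
        |angVelDeriv (‖x‖ ^ 2) * (2 * x j) * x l + angVel (‖x‖ ^ 2) * c| * (1 + ‖x‖ ^ 2) ≤ 6 := by
      intro l c hc
      have b1 : |angVelDeriv (‖x‖ ^ 2) * (2 * x j) * x l| ≤ 2 / ‖x‖ ^ 2 := by
        rw [abs_mul, abs_mul, abs_mul, abs_two]
        calc |angVelDeriv (‖x‖ ^ 2)| * (2 * |x j|) * |x l|
            ≤ 1 / (‖x‖ ^ 2) ^ 2 * (2 * ‖x‖) * ‖x‖ := by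
              gcongr
              · exact abs_coord_le x j
              · exact abs_coord_le x l
          _ = 2 / ‖x‖ ^ 2 := by field_simp
      have b2 : |angVel (‖x‖ ^ 2) * c| ≤ 1 / ‖x‖ ^ 2 := by
        rw [abs_mul]
        calc _ ≤ 1 / ‖x‖ ^ 2 * 1 := by gcongr
          _ = _ := mul_one _
      calc _ ≤ (2 / ‖x‖ ^ 2 + 1 / ‖x‖ ^ 2) * (1 + ‖x‖ ^ 2) := by
            gcongr; exact (abs_add_le _ _).trans (add_le_add b1 b2)
        _ = 3 / ‖x‖ ^ 2 + 3 := by field_simp; ring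
        _ ≤ 6 := by
          have : 3 / ‖x‖ ^ 2 ≤ 3 := by rw [div_le_iff₀ (by positivity)]; linarith
          linarith
    have h6 : |partialD j (fun z => oseen z i) x| * (1 + ‖x‖ ^ 2) ≤ 6 := by
      fin_cases i
      · simp only [Fin.zero_eta]
        rw [partialD_oseen_zero hx0, abs_neg]
        exact key 1 _ (by split_ifs <;> simp)
      · simp only [Fin.mk_one]
        rw [partialD_oseen_one hx0]
        exact key 0 _ (by split_ifs <;> simp)
    linarith

/-! ### The operator on stream functions -/

/-- The drift `ξ/2 - A u⁰`. -/
def drift (A : ℝ) (x : Plane) (j : Fin 2) : ℝ := x j / 2 - A * oseen x j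

/-- The Laplacian, as a sum of second partial derivatives. -/
def lap (f : Plane → ℝ) (x : Plane) : ℝ :=
  partialD 0 (partialD 0 f) x + partialD 1 (partialD 1 f) x

/-- `v · ∇f` for a field `v`. -/
def advect (v : Plane → Fin 2 → ℝ) (f : Plane → ℝ) (x : Plane) : ℝ :=
  v x 0 * partialD 0 f x + v x 1 * partialD 1 f x

/-- The drift-diffusion operator `Δ + ½ ξ·∇ - A u⁰·∇`. -/
def driftOp (A : ℝ) (f : Plane → ℝ) (x : Plane) : ℝ := lap f x + advect (drift A) f x

/-- The operator induced on stream functions, `Δ + ½ ξ·∇ + ½ - A u⁰·∇`. -/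
def streamOp (A : ℝ) (f : Plane → ℝ) (x : Plane) : ℝ := driftOp A f x + f x / 2

lemma contDiff_drift (A : ℝ) (j : Fin 2) : ContDiff ℝ ∞ fun x => drift A x j :=
  ((contDiff_coord j).div_const 2).sub (contDiff_const.mul (contDiff_oseen_apply j))

lemma contDiff_lap {f : Plane → ℝ} (hf : ContDiff ℝ ∞ f) : ContDiff ℝ ∞ (lap f) :=
  (contDiff_partialD (contDiff_partialD hf 0) 0).add (contDiff_partialD (contDiff_partialD hf 1) 1)

lemma contDiff_advect {v : Plane → Fin 2 → ℝ} (hv : ∀ j, ContDiff ℝ ∞ fun x => v x j)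
    {f : Plane → ℝ} (hf : ContDiff ℝ ∞ f) : ContDiff ℝ ∞ (advect v f) :=
  ((hv 0).mul (contDiff_partialD hf 0)).add ((hv 1).mul (contDiff_partialD hf 1))

lemma contDiff_driftOp (A : ℝ) {f : Plane → ℝ} (hf : ContDiff ℝ ∞ f) :
    ContDiff ℝ ∞ (driftOp A f) :=
  (contDiff_lap hf).add (contDiff_advect (contDiff_drift A) hf)

lemma contDiff_streamOp (A : ℝ) {f : Plane → ℝ} (hf : ContDiff ℝ ∞ f) :
    ContDiff ℝ ∞ (streamOp A f) :=
  (contDiff_driftOp A hf).add (hf.div_const 2)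

lemma IsTest.lap {η : Plane → ℝ} (hη : IsTest η) : IsTest (lap η) :=
  ((hη.partialD 0).partialD 0).add ((hη.partialD 1).partialD 1)

lemma IsTest.advect {v : Plane → Fin 2 → ℝ} (hv : ∀ j, ContDiff ℝ ∞ fun x => v x j)
    {η : Plane → ℝ} (hη : IsTest η) : IsTest (advect v η) :=
  ((hη.partialD 0).smooth_mul (hv 0)).add ((hη.partialD 1).smooth_mul (hv 1))

lemma IsTest.driftOp (A : ℝ) {η : Plane → ℝ} (hη : IsTest η) : IsTest (driftOp A η) :=
  hη.lap.add (hη.advect (contDiff_drift A))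

lemma IsTest.streamOp (A : ℝ) {η : Plane → ℝ} (hη : IsTest η) : IsTest (streamOp A η) := by
  have := (hη.driftOp A).add (hη.const_mul (1 / 2))
  convert this using 2
  unfold OseenLinearization.streamOp
  ring

lemma partialD_drift (A : ℝ) (i j : Fin 2) (x : Plane) :
    partialD j (fun z => drift A z i) x
      = (if i = j then 1 / 2 else 0) - A * partialD j (fun z => oseen z i) x := by
  unfold drift
  have e : (fun z : Plane => z i / 2) = fun z => (1 / 2) * z i := by funext z; ring
  rw [partialD_sub ((contDiff_coord i).div_const 2) (contDiff_const.mul (contDiff_oseen_apply i)),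
    e, partialD_const_mul (contDiff_coord i), partialD_const_mul (contDiff_oseen_apply i),
    partialD_coord]
  split_ifs <;> ring

/-- The derivative commutes with `Δ`, so the commutator comes only from the drift: `½` from `ξ/2`
and the velocity gradient from `-A u⁰`. -/
lemma partialD_driftOp (A : ℝ) {f : Plane → ℝ} (hf : ContDiff ℝ ∞ f) (j : Fin 2) (x : Plane) :
    partialD j (driftOp A f) x = driftOp A (partialD j f) x + partialD j f x / 2
      - A * (partialD j (fun z => oseen z 0) x * partialD 0 f x
        + partialD j (fun z => oseen z 1) x * partialD 1 f x) := by
  have h0 := contDiff_partialD hf 0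
  have h1 := contDiff_partialD hf 1
  have hc : ∀ i, partialD j (partialD i f) = partialD i (partialD j f) := fun i => by
    funext y; exact partialD_comm hf j i y
  have hl : partialD j (lap f) x = lap (partialD j f) x := by
    unfold lap
    rw [partialD_add (contDiff_partialD h0 0) (contDiff_partialD h1 1),
      partialD_comm h0, partialD_comm h1, hc, hc]
  have ha : partialD j (advect (drift A) f) x
      = partialD j (fun z => drift A z 0) x * partialD 0 f x
        + partialD j (fun z => drift A z 1) x * partialD 1 f x
        + advect (drift A) (partialD j f) x := by
    unfold advect
    rw [partialD_add ((contDiff_drift A 0).mul h0) ((contDiff_drift A 1).mul h1),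
      partialD_mul (contDiff_drift A 0) h0, partialD_mul (contDiff_drift A 1) h1, hc, hc]
    ring
  have e : driftOp A f = fun z => lap f z + advect (drift A) f z := rfl
  rw [e, partialD_add (contDiff_lap hf) (contDiff_advect (contDiff_drift A) hf), hl, ha,
    partialD_drift, partialD_drift]
  unfold driftOp
  fin_cases j <;> simp <;> ring

lemma partialD_streamOp (A : ℝ) {f : Plane → ℝ} (hf : ContDiff ℝ ∞ f) (j : Fin 2) (x : Plane) :
    partialD j (streamOp A f) x = driftOp A (partialD j f) x + partialD j f x
      - A * (partialD j (fun z => oseen z 0) x * partialD 0 f x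
        + partialD j (fun z => oseen z 1) x * partialD 1 f x) := by
  have e : streamOp A f = fun z => driftOp A f z + (1 / 2) * f z := by
    funext z; unfold streamOp; ring
  rw [e, partialD_add (contDiff_driftOp A hf) (contDiff_const.mul hf), partialD_const_mul hf,
    partialD_driftOp A hf]
  ring

/-- The components of `∇^⊥ f`. -/
def perpR (f : Plane → ℝ) (i : Fin 2) (x : Plane) : ℝ :=
  if i = 0 then partialD 1 f x else -partialD 0 f x

lemma perpR_zero (f : Plane → ℝ) : perpR f 0 = partialD 1 f := by funext x; simp [perpR]
lemma perpR_one (f : Plane → ℝ) : perpR f 1 = fun x => -partialD 0 f x := by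
  funext x; simp [perpR]

lemma contDiff_perpR {f : Plane → ℝ} (hf : ContDiff ℝ ∞ f) (i : Fin 2) :
    ContDiff ℝ ∞ (perpR f i) := by
  fin_cases i
  · simp only [Fin.zero_eta, perpR_zero]; exact contDiff_partialD hf 1
  · simp only [Fin.mk_one, perpR_one]; exact (contDiff_partialD hf 0).neg

/-- The linearized operator on pairs of components. -/
def linOpR (A : ℝ) (φ : Fin 2 → Plane → ℝ) (i : Fin 2) (x : Plane) : ℝ :=
  driftOp A (φ i) x + φ i x + A * (φ 0 x * partialD 0 (fun z => oseen z i) x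
    + φ 1 x * partialD 1 (fun z => oseen z i) x)

lemma driftOp_neg (A : ℝ) (f : Plane → ℝ) (x : Plane) :
    driftOp A (fun z => -f z) x = -driftOp A f x := by
  unfold driftOp lap advect
  have h : ∀ j (g : Plane → ℝ), partialD j (fun z => -g z) = fun z => -partialD j g z :=
    fun j g => by funext y; exact partialD_neg j y
  simp only [h]
  ring

/-- The linearized operator acts on `∇^⊥ f` through the operator on stream functions. -/
lemma perpR_streamOp (A : ℝ) {f : Plane → ℝ} (hf : ContDiff ℝ ∞ f) (i : Fin 2) (x : Plane) :
    perpR (streamOp A f) i x = linOpR A (perpR f) i x := by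
  have hd := div_oseen x
  fin_cases i
  · simp only [Fin.zero_eta, perpR_zero, linOpR, perpR_one, partialD_streamOp A hf]
    -- The commutator yields the transposed velocity gradient applied to `∇f`. After rotation it
    -- differs from `(∇^⊥f·∇)u⁰` by a multiple of `div u⁰`.
    linear_combination (-A * partialD 1 f x) * hd
  · simp only [Fin.mk_one, perpR_zero, linOpR, perpR_one, partialD_streamOp A hf, driftOp_neg]
    linear_combination (A * partialD 0 f x) * hd

/-! ### Weak formulations for smooth fields -/

lemma integral_lap_mul {η f : Plane → ℝ} (hη : IsTest η) (hf : ContDiff ℝ ∞ f) :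
    ∫ x, lap η x * f x = ∫ x, η x * lap f x := by
  have h : ∀ j, ∫ x, partialD j (partialD j η) x * f x = ∫ x, η x * partialD j (partialD j f) x := by
    intro j
    have h1 := integral_mul_partialD (hη.partialD j).1 hf (hη.partialD j).2 j
    have h2 := integral_mul_partialD hη.1 (contDiff_partialD hf j) hη.2 j
    linarith
  unfold lap
  simp only [add_mul, mul_add]
  rw [integral_add, integral_add, h 0, h 1]
  · exact (hη.mul_smooth (contDiff_partialD (contDiff_partialD hf 0) 0)).integrable
  · exact (hη.mul_smooth (contDiff_partialD (contDiff_partialD hf 1) 1)).integrable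
  · exact (((hη.partialD 0).partialD 0).mul_smooth hf).integrable
  · exact (((hη.partialD 1).partialD 1).mul_smooth hf).integrable

lemma divergence_smul_eq (η : Plane → ℝ) (v : Plane → Plane) (x : Plane) :
    divergence (fun z => η z • v z) x
      = partialD 0 (fun z => η z * v z 0) x + partialD 1 (fun z => η z * v z 1) x := by
  simp [divergence, Fin.sum_univ_two]

lemma integral_divergence_mul {η f : Plane → ℝ} (hη : IsTest η) (hf : ContDiff ℝ ∞ f)
    {v : Plane → Plane} (hv : ∀ j, ContDiff ℝ ∞ fun x => v x j) :
    ∫ x, divergence (fun z => η z • v z) x * f x = -∫ x, η x * advect (fun x => v x) f x := by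
  have h : ∀ j, ∫ x, partialD j (fun z => η z * v z j) x * f x
      = -∫ x, η x * (v x j * partialD j f x) := by
    intro j
    have ht := hη.mul_smooth (hv j)
    have h1 := integral_mul_partialD ht.1 hf ht.2 j
    simp only [mul_assoc] at h1 ⊢
    linarith
  simp only [divergence_smul_eq, advect, add_mul, mul_add]
  rw [integral_add, integral_add, h 0, h 1]
  · ring
  · exact (hη.mul_smooth ((hv 0).mul (contDiff_partialD hf 0))).integrable
  · exact (hη.mul_smooth ((hv 1).mul (contDiff_partialD hf 1))).integrable
  · exact (((hη.mul_smooth (hv 0)).partialD 0).mul_smooth hf).integrable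
  · exact (((hη.mul_smooth (hv 1)).partialD 1).mul_smooth hf).integrable

lemma IsTest.divergence {η : Plane → ℝ} (hη : IsTest η) {v : Plane → Plane}
    (hv : ∀ j, ContDiff ℝ ∞ fun x => v x j) : IsTest (divergence fun z => η z • v z) := by
  have := ((hη.mul_smooth (hv 0)).partialD 0).add ((hη.mul_smooth (hv 1)).partialD 1)
  convert this using 2
  exact divergence_smul_eq _ _ _

lemma adjointOp_eq (A : ℝ) {η : Plane → ℝ} (hη : IsTest η) (x : Plane) :
    adjointOp A η x = lap η x - 1 / 2 * divergence (fun z => η z • z) x + η x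
      + A * divergence (fun z => η z • oseen z) x := by
  unfold adjointOp
  rw [laplacian_eq hη.1]; rfl

lemma integral_adjointOp_mul (A : ℝ) {η f : Plane → ℝ} (hη : IsTest η) (hf : ContDiff ℝ ∞ f) :
    ∫ x, adjointOp A η x * f x = ∫ x, η x * (driftOp A f x + f x) := by
  have h1 := integral_lap_mul hη hf
  have h2 := integral_divergence_mul hη hf (v := fun z => z) contDiff_coord
  have h3 := integral_divergence_mul hη hf (v := oseen) contDiff_oseen_apply
  have i1 := (hη.lap.mul_smooth hf).integrable
  have i2 := ((hη.divergence (v := fun z => z) contDiff_coord).mul_smooth hf).integrable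
  have i3 := ((hη.divergence (v := oseen) contDiff_oseen_apply).mul_smooth hf).integrable
  have i4 := (hη.mul_smooth hf).integrable
  have j1 := (hη.mul_smooth (contDiff_lap hf)).integrable
  have j2 := (hη.mul_smooth (contDiff_advect (v := fun x => x) contDiff_coord hf)).integrable
  have j3 := (hη.mul_smooth
    (contDiff_advect (v := fun x => oseen x) contDiff_oseen_apply hf)).integrable
  calc ∫ x, adjointOp A η x * f x
      = ∫ x, (lap η x * f x - (1 / 2) * (divergence (fun z => η z • z) x * f x) + η x * f x
          + A * (divergence (fun z => η z • oseen z) x * f x)) := by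
        congr 1; funext x; rw [adjointOp_eq A hη]; ring
    _ = (∫ x, η x * lap f x) - (1 / 2) * (-∫ x, η x * advect (fun x => x) f x)
          + (∫ x, η x * f x) + A * (-∫ x, η x * advect (fun x => oseen x) f x) := by
        rw [integral_add, integral_add, integral_sub, integral_const_mul, integral_const_mul,
          h1, h2, h3]
        exacts [i1, i2.const_mul _, i1.sub (i2.const_mul _), i4,
          (i1.sub (i2.const_mul _)).add i4, i3.const_mul _]
    _ = ∫ x, (η x * lap f x + (1 / 2) * (η x * advect (fun x => x) f x) + η x * f x
          - A * (η x * advect (fun x => oseen x) f x)) := by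
        rw [integral_sub, integral_add, integral_add, integral_const_mul, integral_const_mul]
        · ring
        exacts [j1, j2.const_mul _, j1.add (j2.const_mul _), i4,
          (j1.add (j2.const_mul _)).add i4, j3.const_mul _]
    _ = _ := by
        congr 1; funext x; unfold driftOp advect drift; ring

/-- A smooth field satisfies the weak equation with its classical image. -/
lemma integral_adjointOp_linOpR (A : ℝ) {η : Plane → ℝ} (hη : IsTest η) {φ : Fin 2 → Plane → ℝ}
    (hφ : ∀ i, ContDiff ℝ ∞ (φ i)) (i : Fin 2) :
    (∫ x, adjointOp A η x * φ i x)
      + A * (∑ j, ∫ x, (η x * partialD j (fun z => oseen z i) x) * φ j x)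
      = ∫ x, η x * linOpR A φ i x := by
  have c : ∀ j, Integrable fun x => (η x * partialD j (fun z => oseen z i) x) * φ j x := fun j =>
    ((hη.mul_smooth (contDiff_partialD (contDiff_oseen_apply i) j)).mul_smooth (hφ j)).integrable
  rw [integral_adjointOp_mul A hη (hφ i), Fin.sum_univ_two, ← integral_add (c 0) (c 1),
    ← integral_const_mul, ← integral_add]
  · congr 1; funext x; unfold linOpR; ring
  · exact (hη.mul_smooth ((contDiff_driftOp A (hφ i)).add (hφ i))).integrable
  · exact ((c 0).add (c 1)).const_mul A

lemma sum_integral_partialD_perpR {η f : Plane → ℝ} (hη : IsTest η) (hf : ContDiff ℝ ∞ f) :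
    ∑ j, ∫ x, partialD j η x * perpR f j x = 0 := by
  rw [Fin.sum_univ_two, perpR_zero, perpR_one]
  have h1 := integral_mul_partialD (hη.partialD 0).1 hf (hη.partialD 0).2 1
  have h2 := integral_mul_partialD (hη.partialD 1).1 hf (hη.partialD 1).2 0
  have h3 : partialD 1 (partialD 0 η) = partialD 0 (partialD 1 η) := by
    funext x; exact partialD_comm hη.1 1 0 x
  simp only [mul_neg, integral_neg]
  rw [h1, h2, h3]; ring

/-! ### Energy identities -/

/-- Integration by parts for `c p ξ·∇p`. -/
lemma integral_mul_radial {p c : Plane → ℝ} (hp : IsTest p) (hc : ContDiff ℝ ∞ c) :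
    ∫ x, c x * p x * advect (fun x => x) p x
      = ∫ x, -(1 / 2) * (2 * c x + advect (fun x => x) c x) * p x ^ 2 := by
  have h : ∀ j : Fin 2, ∫ x, c x * p x * (x j * partialD j p x)
      = ∫ x, -(1 / 2) * (c x + x j * partialD j c x) * p x ^ 2 := by
    intro j
    have hs : ContDiff ℝ ∞ fun x => c x * x j := hc.mul (contDiff_coord j)
    have h2 := (hp.mul_smooth hs)
    have h1 := integral_mul_partialD h2.1 hp.1 h2.2 j
    have e : ∀ x, partialD j (fun x => p x * (c x * x j)) x * p x
        = p x * (c x * x j) * partialD j p x + (c x + x j * partialD j c x) * p x ^ 2 := by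
      intro x
      rw [partialD_mul hp.1 hs, partialD_mul hc (contDiff_coord j), partialD_coord]
      simp; ring
    simp only [e] at h1
    rw [integral_add] at h1
    · have e1 : ∫ x, -(1 / 2) * (c x + x j * partialD j c x) * p x ^ 2
          = -(1 / 2) * ∫ x, (c x + x j * partialD j c x) * p x ^ 2 := by
        rw [← integral_const_mul]; congr 1; funext x; ring
      have e2 : ∫ x, c x * p x * (x j * partialD j p x)
          = ∫ x, p x * (c x * x j) * partialD j p x := by congr 1; funext x; ring
      rw [e1, e2]; linarith
    · exact (h2.mul_smooth (contDiff_partialD hp.1 j)).integrable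
    · have := (hp.mul_smooth hp.1).smooth_mul
        (hc.add ((contDiff_coord j).mul (contDiff_partialD hc j)))
      refine this.integrable.congr (Filter.Eventually.of_forall fun x => ?_)
      simp only []; ring
  have i1 : ∀ j : Fin 2, Integrable fun x => c x * p x * (x j * partialD j p x) := fun j =>
    ((hp.smooth_mul hc).mul_smooth
      ((contDiff_coord j).mul (contDiff_partialD hp.1 j))).integrable
  have i2 : ∀ j : Fin 2, Integrable fun x => -(1 / 2) * (c x + x j * partialD j c x) * p x ^ 2 := by
    intro j
    have := (hp.mul_smooth hp.1).smooth_mul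
      ((contDiff_const (c := (-(1 / 2) : ℝ))).mul
        (hc.add ((contDiff_coord j).mul (contDiff_partialD hc j))))
    refine this.integrable.congr (Filter.Eventually.of_forall fun x => ?_)
    simp only []; ring
  calc _ = ∫ x, (c x * p x * (x 0 * partialD 0 p x) + c x * p x * (x 1 * partialD 1 p x)) := by
        congr 1; funext x; unfold advect; ring
    _ = ∫ x, (-(1 / 2) * (c x + x 0 * partialD 0 c x) * p x ^ 2
          + -(1 / 2) * (c x + x 1 * partialD 1 c x) * p x ^ 2) := by
        rw [integral_add (i1 0) (i1 1), integral_add (i2 0) (i2 1), h, h]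
    _ = _ := by congr 1; funext x; unfold advect; ring

/-- `|∇p|²`. -/
def gradSq (p : Plane → ℝ) (x : Plane) : ℝ := partialD 0 p x ^ 2 + partialD 1 p x ^ 2

lemma IsTest.gradSq {p : Plane → ℝ} (hp : IsTest p) : IsTest (gradSq p) := by
  have := ((hp.partialD 0).mul_smooth (hp.partialD 0).1).add
    ((hp.partialD 1).mul_smooth (hp.partialD 1).1)
  convert this using 2
  unfold OseenLinearization.gradSq; ring

lemma gradSq_nonneg (p : Plane → ℝ) (x : Plane) : 0 ≤ gradSq p x := by
  unfold gradSq; positivity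

/-- The energy identity for the drift-diffusion operator in a radial weight: the vortex
does not contribute. -/
lemma energy_identity (A : ℝ) {p v dv : Plane → ℝ} (hp : IsTest p) (hv : ContDiff ℝ ∞ v)
    (hdv : ContDiff ℝ ∞ dv) (h : ∀ j x, partialD j v x = 2 * x j * dv x) :
    -∫ x, driftOp A p x * p x * v x
      = ∫ x, (gradSq p x * v x + (2 * dv x - v x / 2) * p x * advect (fun x => x) p x) := by
  have hpv := hp.mul_smooth hv
  have hpp := hpv.mul_smooth hp.1
  have h1 : ∀ j, ∫ x, partialD j (partialD j p) x * (p x * v x)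
      = -∫ x, partialD j p x * (partialD j p x * v x + p x * (2 * x j * dv x)) := by
    intro j
    have := integral_partialD_mul hpv.1 (contDiff_partialD hp.1 j) hpv.2 j
    rw [this]
    congr 2; funext x
    rw [partialD_mul hp.1 hv, h]
  -- The integrand is `½ v u⁰·∇(p²)`. Integrating by parts, `div u⁰ = 0` and `u⁰·∇v = 0`, the latter
  -- because `∇v` is parallel to `ξ` and `u⁰` is orthogonal to it.
  have h2 : ∫ x, advect (fun x => oseen x) p x * (p x * v x) = 0 := by
    have e := integral_divergence_mul (η := fun x => p x * v x) hpv hp.1 (v := oseen)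
      contDiff_oseen_apply
    have e2 : ∀ x, divergence (fun z => (p z * v z) • oseen z) x * p x
        = (p x * v x) * advect (fun x => oseen x) p x := by
      intro x
      rw [divergence_smul_eq, partialD_mul hpv.1 (contDiff_oseen_apply 0),
        partialD_mul hpv.1 (contDiff_oseen_apply 1), partialD_mul hp.1 hv,
        partialD_mul hp.1 hv, h, h]
      have d1 := div_oseen x
      have d2 := oseen_dot x
      unfold advect
      linear_combination (p x ^ 2 * v x) * d1 + (2 * p x ^ 2 * dv x) * d2
    simp only [e2] at e
    have e3 : ∫ x, advect (fun x => oseen x) p x * (p x * v x)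
      = ∫ x, p x * v x * advect (fun x => oseen x) p x := by congr 1; funext x; ring
    rw [e3]; linarith
  have i1 : ∀ j, Integrable fun x => partialD j (partialD j p) x * (p x * v x) := fun j =>
    (((hp.partialD j).partialD j).mul_smooth hpv.1).integrable
  have i2 : Integrable fun x => advect (fun x => x) p x * (p x * v x) :=
    ((hp.advect (v := fun x => x) contDiff_coord).mul_smooth hpv.1).integrable
  have i3 : Integrable fun x => advect (fun x => oseen x) p x * (p x * v x) :=
    ((hp.advect (v := fun x => oseen x) contDiff_oseen_apply).mul_smooth hpv.1).integrable
  have i4 : ∀ j : Fin 2, Integrable fun x =>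
      partialD j p x * (partialD j p x * v x + p x * (2 * x j * dv x)) := fun j =>
    ((hp.partialD j).mul_smooth (((contDiff_partialD hp.1 j).mul hv).add
      (hp.1.mul ((contDiff_const.mul (contDiff_coord j)).mul hdv)))).integrable
  have e : ∫ x, driftOp A p x * p x * v x
      = ∫ x, ((partialD 0 (partialD 0 p) x * (p x * v x)
          + partialD 1 (partialD 1 p) x * (p x * v x))
        + (1 / 2) * (advect (fun x => x) p x * (p x * v x))
        - A * (advect (fun x => oseen x) p x * (p x * v x))) := by
    congr 1; funext x; unfold driftOp lap advect drift; ring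
  have e2 : ∫ x, driftOp A p x * p x * v x
      = (-∫ x, partialD 0 p x * (partialD 0 p x * v x + p x * (2 * x 0 * dv x)))
        + (-∫ x, partialD 1 p x * (partialD 1 p x * v x + p x * (2 * x 1 * dv x)))
        + (1 / 2) * ∫ x, advect (fun x => x) p x * (p x * v x) := by
    rw [e, integral_sub, integral_add, integral_add, integral_const_mul, integral_const_mul, h2,
      h1, h1]
    · ring
    exacts [i1 0, i1 1, (i1 0).add (i1 1), i2.const_mul _, ((i1 0).add (i1 1)).add (i2.const_mul _),
      i3.const_mul _]
  have e3 : ∫ x, (gradSq p x * v x + (2 * dv x - v x / 2) * p x * advect (fun x => x) p x)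
      = ∫ x, ((partialD 0 p x * (partialD 0 p x * v x + p x * (2 * x 0 * dv x))
          + partialD 1 p x * (partialD 1 p x * v x + p x * (2 * x 1 * dv x)))
        - (1 / 2) * (advect (fun x => x) p x * (p x * v x))) := by
    congr 1; funext x; unfold gradSq advect; ring
  rw [e2, e3, integral_sub, integral_add, integral_const_mul]
  · ring
  exacts [i4 0, i4 1, (i4 0).add (i4 1), i2.const_mul _]

/-! ### The spectral gap of the harmonic oscillator -/

/-- The (unnormalized) ground state `exp(-x²/8)`. -/
def ground (x : ℝ) : ℝ := Real.exp (-x ^ 2 / 8)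

lemma ground_pos (x : ℝ) : 0 < ground x := Real.exp_pos _

lemma hasDerivAt_ground (x : ℝ) : HasDerivAt ground (-(x / 4) * ground x) x := by
  have h : HasDerivAt (fun x : ℝ => -x ^ 2 / 8) (-(x / 4)) x := by
    have := ((hasDerivAt_pow 2 x).neg).div_const 8
    exact this.congr_deriv (by simp; ring)
  exact h.exp.congr_deriv (by unfold ground; ring)

lemma contDiff_ground : ContDiff ℝ ∞ ground := by
  unfold ground; fun_prop

lemma continuous_ground : Continuous ground := contDiff_ground.continuous

lemma integrable_ground_sq : Integrable fun x => ground x ^ 2 := by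
  have := integrable_exp_neg_mul_sq (b := 1 / 4) (by norm_num)
  refine this.congr (Filter.Eventually.of_forall fun x => ?_)
  simp only [ground, ← Real.exp_nat_mul]
  congr 1; push_cast; ring

/-- `∫ exp(-x²/4) dx`. -/
def groundMass : ℝ := ∫ x, ground x ^ 2

lemma groundMass_pos : 0 < groundMass := by
  unfold groundMass
  rw [integral_pos_iff_support_of_nonneg (fun x => by positivity) integrable_ground_sq]
  have : (Function.support fun x => ground x ^ 2) = Set.univ := by
    ext x; simpa using (ground_pos x).ne'
  rw [this]; simp

lemma integrable_compact_real {f : ℝ → ℝ} (hf : Continuous f) (hs : HasCompactSupport f) :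
    Integrable f := hf.integrable_of_hasCompactSupport hs

lemma hasCompactSupport_sq {X : Type*} [TopologicalSpace X] {f : X → ℝ}
    (hs : HasCompactSupport f) : HasCompactSupport fun x => f x ^ 2 :=
  hs.comp_left (g := fun y : ℝ => y ^ 2) (by simp)

lemma hasCompactSupport_of_zero {X : Type*} [TopologicalSpace X] {f g : X → ℝ}
    (hf : HasCompactSupport f) (h : ∀ x, f x = 0 → g x = 0) : HasCompactSupport g :=
  hf.mono fun x hx h0 => hx (h x h0)

lemma integral_sub_add {X : Type*} [MeasurableSpace X] {μ : Measure X} {f g h : X → ℝ}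
    (hf : Integrable f μ) (hg : Integrable g μ) (hh : Integrable h μ) (a b : ℝ) :
    ∫ x, (f x - a * g x + b * h x) ∂μ
      = (∫ x, f x ∂μ) - a * (∫ x, g x ∂μ) + b * ∫ x, h x ∂μ := by
  rw [integral_add, integral_sub, integral_const_mul, integral_const_mul]
  exacts [hf, hg.const_mul a, hf.sub (hg.const_mul a), hh.const_mul b]

/-- With `D = d/dx + x/4`, orthogonality to the ground state allows one to write `p = -D*n` with `n`
compactly supported. The commutator `[D, D*] = ½` gives `‖p‖² = ‖D*n‖² = ‖Dn‖² + ½‖n‖²`, so `½‖n‖² ≤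
‖p‖²`. Also `‖p‖² = -⟨Dp, n⟩ ≤ ‖Dp‖² + ¼‖n‖² ≤ ‖Dp‖² + ½‖p‖²`. -/
lemma oscillator_gap_orthogonal {p p' : ℝ → ℝ} (hp : ∀ x, HasDerivAt p (p' x) x)
    (hp' : Continuous p') (hs : HasCompactSupport p) (h0 : ∫ x, p x * ground x = 0) :
    ∫ x, p x ^ 2 ≤ 2 * ∫ x, (p' x + x / 4 * p x) ^ 2 := by
  have hpc : Continuous p := continuous_iff_continuousAt.2 fun x => (hp x).continuousAt
  obtain ⟨R, hR, hsub⟩ : ∃ R : ℝ, 0 < R ∧ ∀ x, p x ≠ 0 → |x| ≤ R := by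
    obtain ⟨R, hR⟩ := hs.isCompact.isBounded.exists_norm_le
    exact ⟨max R 1, by positivity, fun x hx =>
      (hR x (subset_tsupport _ hx)).trans (le_max_left _ _)⟩
  have hpg : Continuous fun x => p x * ground x := hpc.mul continuous_ground
  -- The lower limit lies to the left of the support of `p`, so `N` is the primitive vanishing near
  -- `-∞`.
  set N : ℝ → ℝ := fun x => ∫ y in (-R - 1)..x, p y * ground y with hN
  have hNd : ∀ x, HasDerivAt N (p x * ground x) x := fun x =>
    intervalIntegral.integral_hasDerivAt_right (hpg.intervalIntegrable _ _)
      (hpg.stronglyMeasurableAtFilter _ _) hpg.continuousAt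
  have hzero : ∀ x, R < |x| → p x = 0 := fun x hx => by
    by_contra h; exact absurd (hsub x h) (not_le.2 hx)
  -- To the right of the support `N` equals the full integral; this is where orthogonality enters,
  -- and it makes `n = N / ground` compactly supported although `1 / ground` grows.
  have hN0 : ∀ x, R + 1 < |x| → N x = 0 := by
    intro x hx
    rcases le_or_gt 0 x with h | h
    · rw [abs_of_nonneg h] at hx
      have : N x = ∫ y, p y * ground y := by
        rw [hN]
        refine intervalIntegral.integral_eq_integral_of_support_subset fun y hy => ?_
        have hy' : p y ≠ 0 := fun h' => hy (by simp [h'])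
        have := abs_le.1 (hsub y hy')
        exact ⟨by linarith, by linarith⟩
      rw [this, h0]
    · rw [abs_of_neg h] at hx
      rw [hN]
      refine intervalIntegral.integral_zero_ae (Filter.Eventually.of_forall fun y hy => ?_)
      rw [Set.uIoc_of_ge (by linarith)] at hy
      rw [hzero y, zero_mul]
      rw [abs_of_nonpos (by linarith [hy.2])]; linarith [hy.2]
  set n : ℝ → ℝ := fun x => N x / ground x with hn
  have hnd : ∀ x, HasDerivAt n (p x + x / 4 * n x) x := fun x => by
    have := (hNd x).div (hasDerivAt_ground x) (ground_pos x).ne'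
    refine this.congr_deriv ?_
    have := (ground_pos x).ne'
    simp only [hn]; field_simp; ring
  have hnc : Continuous n := continuous_iff_continuousAt.2 fun x => (hnd x).continuousAt
  have hns : HasCompactSupport n := by
    refine HasCompactSupport.intro (isCompact_Icc (a := -(R + 1)) (b := R + 1)) fun x hx => ?_
    have : R + 1 < |x| := by
      by_contra h; exact hx (Set.mem_Icc.2 (abs_le.1 (not_lt.1 h)))
    simp [hn, hN0 x this]
  have hdx : Continuous fun x : ℝ => x / 4 := by fun_prop
  have ip2 : Integrable fun x => p x ^ 2 :=
    integrable_compact_real (hpc.pow 2) (hasCompactSupport_sq hs)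
  have in2 : Integrable fun x => n x ^ 2 :=
    integrable_compact_real (hnc.pow 2) (hasCompactSupport_sq hns)
  have hDs : HasCompactSupport fun x => p' x + x / 4 * p x := by
    have : p' = deriv p := funext fun x => ((hp x).deriv).symm
    rw [this]
    exact hs.deriv.add hs.mul_left
  have hDc : Continuous fun x => p' x + x / 4 * p x := hp'.add (hdx.mul hpc)
  have iD : Integrable fun x => (p' x + x / 4 * p x) ^ 2 :=
    integrable_compact_real (hDc.pow 2) (hasCompactSupport_sq hDs)
  have iDn : Integrable fun x => (p' x + x / 4 * p x) * n x :=
    integrable_compact_real (hDc.mul hnc) hDs.mul_right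
  have iE : Integrable fun x => (p x + 2 * (x / 4) * n x) ^ 2 := by
    refine integrable_compact_real (by fun_prop) ?_
    have : HasCompactSupport fun x => p x + 2 * (x / 4) * n x := hs.add hns.mul_left
    exact hasCompactSupport_sq this
  have e1 : ∫ x, p x ^ 2 = -∫ x, (p' x + x / 4 * p x) * n x := by
    have hd : ∀ x, HasDerivAt (fun x => p x * n x) ((p' x + x / 4 * p x) * n x + p x ^ 2) x :=
      fun x => ((hp x).mul (hnd x)).congr_deriv (by ring)
    have := integral_eq_zero_of_hasDerivAt_of_integrable hd (iDn.add ip2)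
      (integrable_compact_real (hpc.mul hnc) hs.mul_right)
    rw [integral_add iDn ip2] at this
    linarith
  -- Since `n' = p + (x/4) n`, the square on the right is `(Dn)²`; the difference of the two sides
  -- is the integral of the derivative of `(x/2) n²`.
  have e2 : ∫ x, p x ^ 2 = (∫ x, (p x + 2 * (x / 4) * n x) ^ 2) + (1 / 2) * ∫ x, n x ^ 2 := by
    have hd : ∀ x, HasDerivAt (fun x => x / 2 * n x ^ 2)
        ((p x + 2 * (x / 4) * n x) ^ 2 + (1 / 2) * n x ^ 2 - p x ^ 2) x := fun x =>
      (((hasDerivAt_id x).div_const 2).mul ((hnd x).pow 2)).congr_deriv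
        (by simp; ring)
    have := integral_eq_zero_of_hasDerivAt_of_integrable hd
      ((iE.add (in2.const_mul _)).sub ip2)
      (integrable_compact_real (by fun_prop)
        (hasCompactSupport_sq hns).mul_left)
    rw [integral_sub, integral_add, integral_const_mul] at this
    · linarith
    exacts [iE, in2.const_mul _, iE.add (in2.const_mul _), ip2]
  have e3 : 0 ≤ ∫ x, (p x + 2 * (x / 4) * n x) ^ 2 := integral_nonneg fun x => by positivity
  have e4 : -∫ x, (p' x + x / 4 * p x) * n x
      ≤ (∫ x, (p' x + x / 4 * p x) ^ 2) + (1 / 4) * ∫ x, n x ^ 2 := by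
    rw [← integral_neg, ← integral_const_mul, ← integral_add iD (in2.const_mul _)]
    refine integral_mono iDn.neg (iD.add (in2.const_mul _)) fun x => ?_
    simp only
    nlinarith [sq_nonneg ((p' x + x / 4 * p x) + n x / 2)]
  linarith

/-- Dominated convergence. It removes the cutoffs by which the ground state, which is not compactly
supported, is made an admissible function. -/
lemma tendsto_integral_mul_dilate {h k : ℝ → ℝ} (hh : Integrable h) (hk : Continuous k)
    {C : ℝ} (hC : ∀ x, |k x| ≤ C) :
    Filter.Tendsto (fun n : ℕ => ∫ x, h x * k (x / (n + 1))) Filter.atTop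
      (nhds ((∫ x, h x) * k 0)) := by
  rw [← integral_mul_const]
  refine tendsto_integral_of_dominated_convergence (fun x => |h x| * C) (fun n => ?_)
    (hh.abs.mul_const C) (fun n => Filter.Eventually.of_forall fun x => ?_)
    (Filter.Eventually.of_forall fun x => ?_)
  · exact hh.aestronglyMeasurable.mul (by fun_prop : Continuous _).aestronglyMeasurable
  · rw [Real.norm_eq_abs, abs_mul]
    exact mul_le_mul_of_nonneg_left (hC _) (abs_nonneg _)
  · refine Filter.Tendsto.const_mul _ ?_
    have h1 : Filter.Tendsto (fun n : ℕ => x / ((n : ℝ) + 1)) Filter.atTop (nhds 0) :=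
      tendsto_const_nhds.div_atTop (Filter.tendsto_atTop_add_const_right _ _
        tendsto_natCast_atTop_atTop)
    exact (hk.tendsto 0).comp h1

/-- The component of `p` along the ground state `g` is subtracted. To stay within compact support,
`g` is replaced by `χ(x/(n+1)) g`, and `n → ∞`. As `Dg = 0`, the subtraction disturbs `Dp` only
through `χ'`, with a factor `1/(n+1)`. -/
lemma oscillator_gap {p p' : ℝ → ℝ} (hp : ∀ x, HasDerivAt p (p' x) x)
    (hp' : Continuous p') (hs : HasCompactSupport p) :
    ∫ x, p x ^ 2 ≤ 2 * (∫ x, (p' x + x / 4 * p x) ^ 2)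
      + (∫ x, p x * ground x) ^ 2 / groundMass := by
  have hpc : Continuous p := continuous_iff_continuousAt.2 fun x => (hp x).continuousAt
  let β : ContDiffBump (0 : ℝ) := ⟨1, 2, by norm_num, by norm_num⟩
  set χ : ℝ → ℝ := fun x => β x with hχ
  have hχs : ContDiff ℝ 1 χ := β.contDiff
  have hχc : HasCompactSupport χ := β.hasCompactSupport
  have hχ0 : χ 0 = 1 := β.one_of_mem_closedBall (by simp [β])
  have hχ1 : ∀ x, |χ x| ≤ 1 := fun x => by
    rw [abs_of_nonneg β.nonneg]; exact β.le_one
  have hdc : Continuous (deriv χ) := hχs.continuous_deriv le_rfl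
  obtain ⟨K, hK⟩ := hχc.deriv.exists_bound_of_continuous hdc
  have hK' : ∀ x, |deriv χ x| ≤ K := hK
  set D : ℝ → ℝ := fun x => p' x + x / 4 * p x with hD
  have hDs : HasCompactSupport D := by
    have : p' = deriv p := funext fun x => ((hp x).deriv).symm
    rw [hD, this]
    exact hs.deriv.add hs.mul_left
  have hDc : Continuous D := hp'.add ((by fun_prop : Continuous fun x : ℝ => x / 4).mul hpc)
  have ipg : Integrable fun x => p x * ground x :=
    integrable_compact_real (hpc.mul continuous_ground) hs.mul_right
  have iDg : Integrable fun x => D x * ground x :=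
    integrable_compact_real (hDc.mul continuous_ground) hDs.mul_right
  set a := ∫ x, p x * ground x with ha
  -- the five limits
  have t1 := tendsto_integral_mul_dilate ipg hχs.continuous hχ1
  have t2 := tendsto_integral_mul_dilate integrable_ground_sq hχs.continuous hχ1
  have t3 := tendsto_integral_mul_dilate integrable_ground_sq (k := fun x => χ x ^ 2)
    (hχs.continuous.pow 2) (C := 1)
    (fun x => by rw [abs_pow]; exact pow_le_one₀ (abs_nonneg _) (hχ1 x))
  have t4 := tendsto_integral_mul_dilate iDg hdc hK'
  have t5 := tendsto_integral_mul_dilate integrable_ground_sq (k := fun x => deriv χ x ^ 2)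
    (hdc.pow 2) (C := K ^ 2)
    (fun x => by rw [abs_pow]; exact pow_le_pow_left₀ (abs_nonneg _) (hK' x) 2)
  have t6 : Filter.Tendsto (fun n : ℕ => 1 / ((n : ℝ) + 1)) Filter.atTop (nhds 0) :=
    tendsto_one_div_add_atTop_nhds_zero_nat
  rw [hχ0] at t1 t2 t3
  simp only [one_pow, mul_one] at t1 t2 t3
  have t7 := t1.div t2 groundMass_pos.ne'
  have ip2 : Integrable fun x => p x ^ 2 :=
    integrable_compact_real (hpc.pow 2) (hasCompactSupport_sq hs)
  have iD2 : Integrable fun x => D x ^ 2 :=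
    integrable_compact_real (hDc.pow 2) (hasCompactSupport_sq hDs)
  have key : ∀ᶠ n : ℕ in Filter.atTop,
      (∫ x, p x ^ 2)
        - 2 * (a / ∫ x, ground x ^ 2 * χ (x / (n + 1))) * (∫ x, p x * ground x * χ (x / (n + 1)))
        + (a / ∫ x, ground x ^ 2 * χ (x / (n + 1))) ^ 2
            * (∫ x, ground x ^ 2 * χ (x / (n + 1)) ^ 2)
      ≤ 2 * ((∫ x, D x ^ 2)
        - 2 * (a / ∫ x, ground x ^ 2 * χ (x / (n + 1))) * (1 / ((n : ℝ) + 1))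
            * (∫ x, D x * ground x * deriv χ (x / (n + 1)))
        + (a / ∫ x, ground x ^ 2 * χ (x / (n + 1))) ^ 2 * (1 / ((n : ℝ) + 1)) ^ 2
            * (∫ x, ground x ^ 2 * deriv χ (x / (n + 1)) ^ 2)) := by
    have h1 : ∀ᶠ n : ℕ in Filter.atTop, ∫ x, p x * ground x * χ (x / (n + 1)) = a := by
      obtain ⟨R, hR⟩ := hs.isCompact.isBounded.exists_norm_le
      obtain ⟨n0, hn0⟩ := exists_nat_gt R
      filter_upwards [Filter.eventually_ge_atTop n0] with n hn
      rw [ha]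
      congr 1; funext x
      by_cases hx : p x = 0
      · simp [hx]
      · have h2 : |x| ≤ R := hR x (subset_tsupport _ hx)
        have h3 : (n0 : ℝ) ≤ n := by exact_mod_cast hn
        have : χ (x / (n + 1)) = 1 := β.one_of_mem_closedBall (by
          have : (0 : ℝ) < n + 1 := by positivity
          simp only [β, mem_closedBall_zero_iff, Real.norm_eq_abs, abs_div, abs_of_pos this]
          rw [div_le_one this]; linarith)
        rw [this, mul_one]
    have h2 : ∀ᶠ n : ℕ in Filter.atTop, 0 < ∫ x, ground x ^ 2 * χ (x / (n + 1)) :=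
      t2.eventually (lt_mem_nhds groundMass_pos)
    filter_upwards [h1, h2] with n h1 h2
    have hn : (0 : ℝ) < n + 1 := by positivity
    set Zn := ∫ x, ground x ^ 2 * χ (x / (n + 1)) with hZn
    -- The coefficient for which `p - c χ(x/(n+1)) g` is exactly orthogonal to the untruncated
    -- ground state.
    set c := a / Zn with hc
    set r : ℝ := 1 / ((n : ℝ) + 1) with hr
    have hζ : ∀ x, HasDerivAt (fun x => χ (x / (n + 1)) * ground x)
        (r * deriv χ (x / (n + 1)) * ground x - x / 4 * (χ (x / (n + 1)) * ground x)) x := by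
      intro x
      have e1 : HasDerivAt (fun x : ℝ => x / ((n : ℝ) + 1)) r x := by
        simpa [hr] using (hasDerivAt_id x).div_const ((n : ℝ) + 1)
      have e2 : HasDerivAt χ (deriv χ (x / (n + 1))) (x / (n + 1)) :=
        ((hχs.differentiable (by simp)) _).hasDerivAt
      have e3 := (e2.comp x e1).mul (hasDerivAt_ground x)
      exact e3.congr_deriv (by simp only [Function.comp_apply]; ring)
    have hζs : HasCompactSupport fun x => χ (x / (n + 1)) * ground x := by
      refine HasCompactSupport.mul_right ?_
      have := hχc.comp_homeomorph (Homeomorph.mulRight₀ (((n : ℝ) + 1)⁻¹) (by positivity))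
      exact this
    have hcx : Continuous fun x : ℝ => χ (x / (n + 1)) :=
      hχs.continuous.comp (by fun_prop)
    have hcd : Continuous fun x : ℝ => deriv χ (x / (n + 1)) :=
      hdc.comp (by fun_prop)
    have hds : HasCompactSupport fun x : ℝ => deriv χ (x / (n + 1)) :=
      hχc.deriv.comp_homeomorph (Homeomorph.mulRight₀ (((n : ℝ) + 1)⁻¹) (by positivity))
    have hg := continuous_ground
    have main := oscillator_gap_orthogonal
      (p := fun x => p x - c * (χ (x / (n + 1)) * ground x))
      (p' := fun x => p' x - c * (r * deriv χ (x / (n + 1)) * ground x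
        - x / 4 * (χ (x / (n + 1)) * ground x)))
      (fun x => (hp x).sub ((hζ x).const_mul c)) (by fun_prop)
      (hs.sub (hζs.mul_left (f := fun _ => c)))
      (by
        have i1 : Integrable fun x => χ (x / (n + 1)) * ground x * ground x :=
          integrable_compact_real (by fun_prop) hζs.mul_right
        have : ∀ x, (p x - c * (χ (x / (n + 1)) * ground x)) * ground x
          = p x * ground x - c * (χ (x / (n + 1)) * ground x * ground x) := fun x => by ring
        simp only [this]
        rw [integral_sub ipg (i1.const_mul c), integral_const_mul]
        have : ∫ x, χ (x / (n + 1)) * ground x * ground x = Zn := by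
          rw [hZn]; congr 1; funext x; ring
        rw [this, hc, ← ha]; field_simp; ring)
    have l1 : ∫ x, (p x - c * (χ (x / (n + 1)) * ground x)) ^ 2
        = (∫ x, p x ^ 2) - 2 * c * (∫ x, p x * ground x * χ (x / (n + 1)))
          + c ^ 2 * ∫ x, ground x ^ 2 * χ (x / (n + 1)) ^ 2 := by
      have i1 : Integrable fun x => p x * ground x * χ (x / (n + 1)) :=
        integrable_compact_real (by fun_prop) (hs.mul_right.mul_right)
      have i2 : Integrable fun x => ground x ^ 2 * χ (x / (n + 1)) ^ 2 := by
        refine integrable_compact_real (by fun_prop) ?_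
        refine hasCompactSupport_of_zero hζs fun x hx => ?_
        rw [← mul_pow, mul_comm, hx]; simp
      rw [← integral_sub_add ip2 i1 i2]
      congr 1; funext x; ring
    have l2 : ∫ x, (p' x - c * (r * deriv χ (x / (n + 1)) * ground x
          - x / 4 * (χ (x / (n + 1)) * ground x))
          + x / 4 * (p x - c * (χ (x / (n + 1)) * ground x))) ^ 2
        = (∫ x, D x ^ 2) - 2 * c * r * (∫ x, D x * ground x * deriv χ (x / (n + 1)))
          + c ^ 2 * r ^ 2 * ∫ x, ground x ^ 2 * deriv χ (x / (n + 1)) ^ 2 := by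
      have i1 : Integrable fun x => D x * ground x * deriv χ (x / (n + 1)) :=
        integrable_compact_real (by fun_prop) (hDs.mul_right.mul_right)
      have i2 : Integrable fun x => ground x ^ 2 * deriv χ (x / (n + 1)) ^ 2 := by
        refine integrable_compact_real (by fun_prop) ?_
        refine hasCompactSupport_of_zero hds fun x hx => ?_
        simp [hx]
      rw [← integral_sub_add iD2 i1 i2]
      congr 1; funext x; simp only [hD]; ring
    rw [l1, l2] at main
    exact main
  have t8 : Filter.Tendsto (fun n : ℕ => a / ∫ x, ground x ^ 2 * χ (x / (n + 1))) Filter.atTop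
      (nhds (a / groundMass)) := tendsto_const_nhds.div t2 groundMass_pos.ne'
  have lim := le_of_tendsto_of_tendsto
    (((tendsto_const_nhds (x := ∫ x, p x ^ 2)).sub ((t8.const_mul 2).mul t1)).add
      ((t8.pow 2).mul t3))
    ((((tendsto_const_nhds (x := ∫ x, D x ^ 2)).sub (((t8.const_mul 2).mul t6).mul t4)).add
      (((t8.pow 2).mul (t6.pow 2)).mul t5)).const_mul 2) key
  have hZ := groundMass_pos.ne'
  rw [← ha, ← groundMass] at lim
  -- In the limit the left side of `key` is `‖p‖² - 2ca + c²Z` with `c = a/Z`, that is, `‖p‖² -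
  -- a²/Z`.
  have e : a ^ 2 / groundMass = 2 * (a / groundMass) * a - (a / groundMass) ^ 2 * groundMass := by
    field_simp; ring
  rw [e]
  nlinarith [lim]

/-- Cauchy–Schwarz for integrals of real functions. -/
lemma sq_integral_mul_le {X : Type*} [MeasurableSpace X] {μ : Measure X} {f g : X → ℝ}
    (hf : Integrable (fun x => f x ^ 2) μ) (hg : Integrable (fun x => g x ^ 2) μ)
    (hfg : Integrable (fun x => f x * g x) μ) :
    (∫ x, f x * g x ∂μ) ^ 2 ≤ (∫ x, f x ^ 2 ∂μ) * ∫ x, g x ^ 2 ∂μ := by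
  have h : ∀ s : ℝ, 0 ≤ (∫ x, g x ^ 2 ∂μ) * (s * s) + (-2 * ∫ x, f x * g x ∂μ) * s
      + ∫ x, f x ^ 2 ∂μ := by
    intro s
    have h1 := integral_sub_add hf hfg hg (2 * s) (s ^ 2)
    have h2 : 0 ≤ ∫ x, (f x ^ 2 - 2 * s * (f x * g x) + s ^ 2 * g x ^ 2) ∂μ :=
      integral_nonneg fun x => by
        have : f x ^ 2 - 2 * s * (f x * g x) + s ^ 2 * g x ^ 2 = (f x - s * g x) ^ 2 := by ring
        simp only [this]; positivity
    rw [h1] at h2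
    linarith
  have := discrim_le_zero h
  unfold discrim at this
  nlinarith

/-! ### The oscillator on the plane -/

/-- The point with coordinates `x`, `y`. -/
def pt (z : ℝ × ℝ) : Plane := !₂[z.1, z.2]

lemma pt_zero (z : ℝ × ℝ) : pt z 0 = z.1 := by simp [pt]
lemma pt_one (z : ℝ × ℝ) : pt z 1 = z.2 := by simp [pt]

lemma pt_eq (z : ℝ × ℝ) :
    pt z = z.1 • EuclideanSpace.single 0 1 + z.2 • EuclideanSpace.single 1 1 := by
  ext i; fin_cases i <;> simp [pt]

lemma contDiff_pt : ContDiff ℝ ∞ pt := by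
  rw [show pt = fun z : ℝ × ℝ => z.1 • (EuclideanSpace.single 0 1 : Plane)
    + z.2 • EuclideanSpace.single 1 1 from funext pt_eq]
  fun_prop

lemma norm_sq_pt (z : ℝ × ℝ) : ‖pt z‖ ^ 2 = z.1 ^ 2 + z.2 ^ 2 := by
  rw [norm_sq_eq, pt_zero, pt_one]

lemma measurePreserving_pt : MeasurePreserving pt := by
  have h := (EuclideanSpace.volume_preserving_symm_measurableEquiv_toLp (Fin 2)).symm.comp
    (volume_preserving_finTwoArrow ℝ).symm
  have e : pt = ⇑(MeasurableEquiv.toLp 2 (Fin 2 → ℝ)).symm.symm ∘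
      ⇑(MeasurableEquiv.finTwoArrow (α := ℝ)).symm := by
    funext z; ext i; fin_cases i <;> rfl
  rw [e]
  exact h

lemma measurableEmbedding_pt : MeasurableEmbedding pt := by
  have h := (MeasurableEquiv.toLp 2 (Fin 2 → ℝ)).measurableEmbedding.comp
    (MeasurableEquiv.finTwoArrow (α := ℝ)).symm.measurableEmbedding
  have e : pt = ⇑(MeasurableEquiv.toLp 2 (Fin 2 → ℝ)) ∘
      ⇑(MeasurableEquiv.finTwoArrow (α := ℝ)).symm := by
    funext z; ext i; fin_cases i <;> rfl
  rw [e]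
  exact h

lemma integral_pt (f : Plane → ℝ) : ∫ z : ℝ × ℝ, f (pt z) = ∫ x, f x :=
  measurePreserving_pt.integral_comp measurableEmbedding_pt f

lemma integrable_pt {f : Plane → ℝ} (hf : Integrable f) : Integrable fun z => f (pt z) :=
  (measurePreserving_pt.integrable_comp_emb measurableEmbedding_pt).2 hf

lemma integral_pt_iterate' {f : Plane → ℝ} (hf : Integrable f) :
    ∫ x, f x = ∫ y, ∫ x, f (pt (x, y)) := by
  rw [← integral_pt, Measure.volume_eq_prod, integral_prod_symm _ (integrable_pt hf)]

lemma hasDerivAt_slice_fst {p : Plane → ℝ} (hp : ContDiff ℝ ∞ p) (x y : ℝ) :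
    HasDerivAt (fun x => p (pt (x, y))) (partialD 0 p (pt (x, y))) x := by
  have h1 : HasDerivAt (fun x : ℝ => pt (x, y)) (EuclideanSpace.single 0 1) x := by
    simp only [pt_eq]
    simpa using ((hasDerivAt_id x).smul_const (EuclideanSpace.single 0 1 : Plane)).add_const
      (y • (EuclideanSpace.single 1 1 : Plane))
  exact (ContDiff.diffAt hp _).hasFDerivAt.comp_hasDerivAt x h1

lemma hasDerivAt_slice_snd {p : Plane → ℝ} (hp : ContDiff ℝ ∞ p) (x y : ℝ) :
    HasDerivAt (fun y => p (pt (x, y))) (partialD 1 p (pt (x, y))) y := by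
  have h1 : HasDerivAt (fun y : ℝ => pt (x, y)) (EuclideanSpace.single 1 1) y := by
    simp only [pt_eq]
    simpa using ((hasDerivAt_id y).smul_const (EuclideanSpace.single 1 1 : Plane)).const_add
      (x • (EuclideanSpace.single 0 1 : Plane))
  exact (ContDiff.diffAt hp _).hasFDerivAt.comp_hasDerivAt y h1

lemma integrable_ground : Integrable ground := by
  have := integrable_exp_neg_mul_sq (b := 1 / 8) (by norm_num)
  refine this.congr (Filter.Eventually.of_forall fun x => ?_)
  simp only [ground]
  congr 1; ring

lemma IsTest.exists_radius {p : Plane → ℝ} (hp : IsTest p) :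
    ∃ R : ℝ, ∀ x, R < ‖x‖ → p x = 0 := by
  obtain ⟨R, hR⟩ := hp.2.isCompact.isBounded.exists_norm_le
  exact ⟨R, fun x hx => by_contra fun h => absurd (hR x (subset_tsupport _ h)) (not_le.2 hx)⟩

lemma abs_le_norm_pt_fst (x y : ℝ) : |x| ≤ ‖pt (x, y)‖ := by
  simpa [pt_zero] using abs_coord_le (pt (x, y)) 0

lemma abs_le_norm_pt_snd (x y : ℝ) : |y| ≤ ‖pt (x, y)‖ := by
  simpa [pt_one] using abs_coord_le (pt (x, y)) 1

lemma hasCompactSupport_of_abs {f : ℝ → ℝ} (R : ℝ) (h : ∀ x, R < |x| → f x = 0) :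
    HasCompactSupport f := by
  refine HasCompactSupport.intro (isCompact_Icc (a := -R) (b := R)) fun x hx => h x ?_
  by_contra h'
  exact hx (Set.mem_Icc.2 (abs_le.1 (not_lt.1 h')))

/-- The one-dimensional gap tensorizes. Applied in the first variable on each slice, it leaves the
partial overlap `P(y) = ∫ p(x,y) g(x) dx`; applied to `P`, it leaves the full overlap with the
planar ground state, whose squared norm is `groundMass ^ 2`. -/
lemma oscillator_gap_plane {p : Plane → ℝ} (hp : IsTest p) :
    ∫ x, p x ^ 2 ≤ 2 * (∫ x, ((partialD 0 p x + x 0 / 4 * p x) ^ 2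
        + (partialD 1 p x + x 1 / 4 * p x) ^ 2))
      + (∫ x, p x * Real.exp (-‖x‖ ^ 2 / 8)) ^ 2 / groundMass ^ 2 := by
  have hZ := groundMass_pos
  obtain ⟨R, hR⟩ := hp.exists_radius
  have hcp : Continuous pt := contDiff_pt.continuous
  set D0 : Plane → ℝ := fun x => partialD 0 p x + x 0 / 4 * p x with hD0
  set D1 : Plane → ℝ := fun x => partialD 1 p x + x 1 / 4 * p x with hD1
  have tD : ∀ j : Fin 2, IsTest fun x => partialD j p x + x j / 4 * p x := fun j =>
    (hp.partialD j).add (hp.smooth_mul ((contDiff_coord j).div_const 4))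
  have t0 : IsTest D0 := tD 0
  have t1 : IsTest D1 := tD 1
  obtain ⟨R1, hR1⟩ := t1.exists_radius
  have isq : ∀ {f : Plane → ℝ}, IsTest f → Integrable fun x => f x ^ 2 := fun {f} hf =>
    integrable_of_compact (hf.1.continuous.pow 2) (hasCompactSupport_sq hf.2)
  set P : ℝ → ℝ := fun y => ∫ x, p (pt (x, y)) * ground x with hP
  set Q : ℝ → ℝ := fun y => ∫ x, partialD 1 p (pt (x, y)) * ground x with hQ
  obtain ⟨K, hK⟩ := (hp.partialD 1).2.exists_bound_of_continuous (hp.partialD 1).1.continuous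
  obtain ⟨K0, hK0⟩ := hp.2.exists_bound_of_continuous hp.1.continuous
  have hg := continuous_ground
  have hpc := hp.1.continuous
  have hp1c := (hp.partialD 1).1.continuous
  have ipx : ∀ y, Integrable fun x => p (pt (x, y)) * ground x := fun y =>
    (integrable_ground.const_mul K0).mono' (by fun_prop) (Filter.Eventually.of_forall fun x => by
      rw [norm_mul, Real.norm_of_nonneg (ground_pos x).le]
      exact mul_le_mul_of_nonneg_right (hK0 _) (ground_pos x).le)
  have iqx : ∀ y, Integrable fun x => partialD 1 p (pt (x, y)) * ground x := fun y =>
    (integrable_ground.const_mul K).mono' (by fun_prop) (Filter.Eventually.of_forall fun x => by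
      rw [norm_mul, Real.norm_of_nonneg (ground_pos x).le]
      exact mul_le_mul_of_nonneg_right (hK _) (ground_pos x).le)
  have hPd : ∀ y, HasDerivAt P (Q y) y := by
    intro y
    refine (hasDerivAt_integral_of_dominated_loc_of_deriv_le (s := Set.univ)
      (F := fun y x => p (pt (x, y)) * ground x)
      (F' := fun y x => partialD 1 p (pt (x, y)) * ground x) (bound := fun x => K * ground x) Filter.univ_mem
      (Filter.Eventually.of_forall fun y => (ipx y).aestronglyMeasurable) (ipx y)
      (iqx y).aestronglyMeasurable (Filter.Eventually.of_forall fun x y _ => ?_)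
      (integrable_ground.const_mul K) (Filter.Eventually.of_forall fun x y _ => ?_)).2
    · rw [norm_mul, Real.norm_of_nonneg (ground_pos x).le]
      exact mul_le_mul_of_nonneg_right (hK _) (ground_pos x).le
    · exact (hasDerivAt_slice_snd hp.1 x y).mul_const _
  have hQc : Continuous Q := by
    refine continuous_of_dominated (bound := fun x => K * ground x)
      (fun y => (iqx y).aestronglyMeasurable) (fun y => Filter.Eventually.of_forall fun x => ?_)
      (integrable_ground.const_mul K) (Filter.Eventually.of_forall fun x => by fun_prop)
    rw [norm_mul, Real.norm_of_nonneg (ground_pos x).le]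
    exact mul_le_mul_of_nonneg_right (hK _) (ground_pos x).le
  have hPc : Continuous P := continuous_iff_continuousAt.2 fun y => (hPd y).continuousAt
  have hPs : HasCompactSupport P := hasCompactSupport_of_abs R fun y hy => by
    simp only [hP]
    have : ∀ x, p (pt (x, y)) = 0 := fun x => hR _ (hy.trans_le (abs_le_norm_pt_snd x y))
    simp [this]
  -- the gap in the first variable
  have hx : ∀ y, ∫ x, p (pt (x, y)) ^ 2 ≤ 2 * (∫ x, D0 (pt (x, y)) ^ 2) + P y ^ 2 / groundMass := by
    intro y
    have := oscillator_gap (p := fun x => p (pt (x, y))) (p' := fun x => partialD 0 p (pt (x, y)))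
      (fun x => hasDerivAt_slice_fst hp.1 x y) ((hp.partialD 0).1.continuous.comp (by fun_prop))
      (hasCompactSupport_of_abs R fun x hx => hR _ (hx.trans_le (abs_le_norm_pt_fst x y)))
    simpa only [hD0, pt_zero] using this
  -- the gap in the second variable
  have hy := oscillator_gap hPd hQc hPs
  have eD : ∀ y, Q y + y / 4 * P y = ∫ x, D1 (pt (x, y)) * ground x := by
    intro y
    simp only [hQ, hP, hD1, pt_one]
    rw [← integral_const_mul, ← integral_add (iqx y) ((ipx y).const_mul _)]
    congr 1; funext x; ring
  have iD1 : ∀ y, Integrable fun x => D1 (pt (x, y)) ^ 2 := fun y => by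
    have := t1.1.continuous
    exact integrable_compact_real (by fun_prop) (hasCompactSupport_sq
      (hasCompactSupport_of_abs R1 fun x hx => hR1 _ (hx.trans_le (abs_le_norm_pt_fst x y))))
  -- Averaging against `g` commutes with the operator in `y`, so `DP` is the average of `D1`.
  -- Cauchy–Schwarz costs one factor `groundMass`, compensating the division by it in the first
  -- step.
  have hcs : ∀ y, (Q y + y / 4 * P y) ^ 2 ≤ (∫ x, D1 (pt (x, y)) ^ 2) * groundMass := by
    intro y
    rw [eD]
    refine sq_integral_mul_le (iD1 y) integrable_ground_sq ?_
    have := t1.1.continuous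
    exact integrable_compact_real (by fun_prop) (HasCompactSupport.mul_right
      (hasCompactSupport_of_abs R1 fun x hx => hR1 _ (hx.trans_le (abs_le_norm_pt_fst x y))))
  have slice : ∀ {f : Plane → ℝ}, Integrable f → Integrable fun y => ∫ x, f (pt (x, y)) :=
    fun {f} hf => by
      have h := integrable_pt hf
      rw [Measure.volume_eq_prod] at h
      exact h.integral_prod_right
  have hDs : HasCompactSupport fun y => Q y + y / 4 * P y :=
    hasCompactSupport_of_abs R1 fun y hy => by
      rw [eD]
      have : ∀ x, D1 (pt (x, y)) = 0 := fun x => hR1 _ (hy.trans_le (abs_le_norm_pt_snd x y))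
      simp [this]
  have iP2 : Integrable fun y => P y ^ 2 :=
    integrable_compact_real (hPc.pow 2) (hasCompactSupport_sq hPs)
  have s1 : ∫ x, p x ^ 2 ≤ 2 * (∫ x, D0 x ^ 2) + (∫ y, P y ^ 2) / groundMass := by
    rw [integral_pt_iterate' (isq hp), integral_pt_iterate' (isq t0), ← integral_const_mul,
      ← integral_div, ← integral_add ((slice (isq t0)).const_mul 2) (iP2.div_const _)]
    exact integral_mono (slice (isq hp))
      (((slice (isq t0)).const_mul 2).add (iP2.div_const _)) hx
  have s2 : ∫ y, (Q y + y / 4 * P y) ^ 2 ≤ (∫ x, D1 x ^ 2) * groundMass := by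
    rw [integral_pt_iterate' (isq t1), ← integral_mul_const]
    exact integral_mono (integrable_compact_real (by fun_prop) (hasCompactSupport_sq hDs))
      ((slice (isq t1)).mul_const _) hcs
  have s3 : ∫ y, P y * ground y = ∫ x, p x * Real.exp (-‖x‖ ^ 2 / 8) := by
    have : IsTest fun x => p x * Real.exp (-‖x‖ ^ 2 / 8) :=
      hp.mul_smooth (Real.contDiff_exp.comp (contDiff_normsq.neg.div_const 8))
    rw [integral_pt_iterate' this.integrable]
    congr 1; funext y
    rw [hP, ← integral_mul_const]
    congr 1; funext x
    rw [norm_sq_pt, mul_assoc]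
    congr 1
    rw [ground, ground, ← Real.exp_add]
    congr 1; simp; ring
  rw [s3] at hy
  have s4 : ∫ x, (D0 x ^ 2 + D1 x ^ 2) = (∫ x, D0 x ^ 2) + ∫ x, D1 x ^ 2 :=
    integral_add (isq t0) (isq t1)
  rw [s4]
  have s5 : (∫ y, P y ^ 2) / groundMass ≤ 2 * (∫ x, D1 x ^ 2)
      + (∫ x, p x * Real.exp (-‖x‖ ^ 2 / 8)) ^ 2 / groundMass ^ 2 := by
    rw [div_le_iff₀ hZ]
    calc _ ≤ _ := hy
      _ ≤ 2 * ((∫ x, D1 x ^ 2) * groundMass)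
          + (∫ x, p x * Real.exp (-‖x‖ ^ 2 / 8)) ^ 2 / groundMass := by gcongr
      _ = _ := by field_simp
  linarith

/-- The gap of the harmonic oscillator, in the form of a lower bound for its quadratic form. -/
lemma oscillator_form_lower {p : Plane → ℝ} (hp : IsTest p) :
    ∫ x, (1 - ‖x‖ ^ 2 / 16) * p x ^ 2 ≤ (∫ x, gradSq p x)
      + (∫ x, p x * Real.exp (-‖x‖ ^ 2 / 8)) ^ 2 / (2 * groundMass ^ 2) := by
  have h1 := oscillator_gap_plane hp
  have h2 := integral_mul_radial hp (contDiff_const (c := (1 : ℝ)))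
  have hZ := groundMass_pos
  have i1 := hp.gradSq.integrable
  have i2 : Integrable fun x => 1 * p x * advect (fun x => x) p x :=
    ((hp.const_mul 1).mul_smooth (contDiff_advect (v := fun x => x) contDiff_coord hp.1)).integrable
  have i3 : Integrable fun x => p x ^ 2 :=
    integrable_of_compact (hp.1.continuous.pow 2) (hasCompactSupport_sq hp.2)
  have i4 : Integrable fun x => ‖x‖ ^ 2 / 16 * p x ^ 2 :=
    integrable_of_compact (by have := hp.1.continuous; fun_prop) (hasCompactSupport_sq hp.2).mul_left
  -- Expanding the squares leaves the cross term `½ p ξ·∇p`, whose integral is `-½ ∫ p²`; twice it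
  -- combines with the left side of `h1`, and division by two gives the form `1 - |ξ|²/16`.
  have e1 : ∫ x, ((partialD 0 p x + x 0 / 4 * p x) ^ 2 + (partialD 1 p x + x 1 / 4 * p x) ^ 2)
      = (∫ x, gradSq p x) - (-1 / 2) * (∫ x, 1 * p x * advect (fun x => x) p x)
        + 1 * ∫ x, ‖x‖ ^ 2 / 16 * p x ^ 2 := by
    rw [← integral_sub_add i1 i2 i4]
    congr 1; funext x; unfold gradSq advect; rw [norm_sq_eq]; ring
  have e2 : ∫ x, 1 * p x * advect (fun x => x) p x = -∫ x, p x ^ 2 := by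
    rw [h2, ← integral_neg]
    congr 1; funext x; unfold advect; simp [partialD_const]
  have e3 : ∫ x, (1 - ‖x‖ ^ 2 / 16) * p x ^ 2
      = (∫ x, p x ^ 2) - ∫ x, ‖x‖ ^ 2 / 16 * p x ^ 2 := by
    rw [← integral_sub i3 i4]; congr 1; funext x; ring
  rw [e1, e2] at h1
  rw [e3]
  have e4 : (∫ x, p x * Real.exp (-‖x‖ ^ 2 / 8)) ^ 2 / (2 * groundMass ^ 2)
    = (∫ x, p x * Real.exp (-‖x‖ ^ 2 / 8)) ^ 2 / groundMass ^ 2 / 2 := by field_simp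
  rw [e4]
  linarith

/-! ### Polynomial weights -/

/-- The weight `(1 + |ξ|²)^s`. -/
def wt (s : ℝ) (x : Plane) : ℝ := (1 + ‖x‖ ^ 2) ^ s

lemma wt_pos (s : ℝ) (x : Plane) : 0 < wt s x := weight_pos s x

lemma one_add_pos (x : Plane) : 0 < 1 + ‖x‖ ^ 2 := by positivity

lemma contDiff_wt (s : ℝ) : ContDiff ℝ ∞ (wt s) :=
  (contDiff_const.add contDiff_normsq).rpow_const_of_ne fun x => (one_add_pos x).ne'

lemma wt_add (a b : ℝ) (x : Plane) : wt (a + b) x = wt a x * wt b x :=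
  Real.rpow_add (one_add_pos x) a b

lemma wt_zero (x : Plane) : wt 0 x = 1 := by simp [wt]

lemma wt_one (x : Plane) : wt 1 x = 1 + ‖x‖ ^ 2 := by simp [wt]

lemma wt_mono {a b : ℝ} (h : a ≤ b) (x : Plane) : wt a x ≤ wt b x :=
  Real.rpow_le_rpow_of_exponent_le (by nlinarith [sq_nonneg ‖x‖]) h

lemma wt_neg_mul (s : ℝ) (x : Plane) : wt (-s) x * wt s x = 1 := by
  rw [← wt_add, neg_add_cancel, wt_zero]

lemma wt_eq_mul_sub_one (s : ℝ) (x : Plane) : wt s x = wt (s - 1) x * (1 + ‖x‖ ^ 2) := by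
  rw [← wt_one, ← wt_add, sub_add_cancel]

lemma partialD_wt (s : ℝ) (j : Fin 2) (x : Plane) :
    partialD j (wt s) x = 2 * x j * (s * wt (s - 1) x) := by
  have h : HasDerivAt (fun t : ℝ => (1 + t) ^ s) (s * (1 + ‖x‖ ^ 2) ^ (s - 1)) (‖x‖ ^ 2) := by
    have h1 : HasDerivAt (fun t : ℝ => 1 + t) 1 (‖x‖ ^ 2) := (hasDerivAt_id _).const_add 1
    refine (h1.rpow_const (p := s) (Or.inl (one_add_pos x).ne')).congr_deriv (by ring)
  have := partialD_radial h j
  unfold wt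
  rw [this]; ring

lemma integrable_wt_neg {s : ℝ} (hs : 1 < s) : Integrable (wt (-s)) := by
  have := integrable_rpow_neg_one_add_norm_sq (E := Plane) (μ := volume) (r := 2 * s)
    (by simp; linarith)
  refine this.congr (Filter.Eventually.of_forall fun x => ?_)
  simp only [wt]; congr 1; ring

/-- Gaussian decay beats polynomial weights. -/
lemma exists_exp_le_wt (s : ℝ) :
    ∃ C, 0 < C ∧ ∀ x : Plane, Real.exp (-‖x‖ ^ 2 / 4) ≤ C * wt (-s) x := by
  obtain ⟨N, hN⟩ := exists_nat_ge s
  refine ⟨4 ^ N * N.factorial * Real.exp (1 / 4), by positivity, fun x => ?_⟩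
  have h1 := Real.pow_div_factorial_le_exp ((1 + ‖x‖ ^ 2) / 4) (by positivity) N
  have h2 : wt s x ≤ (1 + ‖x‖ ^ 2) ^ N := by
    have := wt_mono hN x
    unfold wt at this ⊢
    rwa [Real.rpow_natCast] at this
  have h3 : (1 + ‖x‖ ^ 2) ^ N ≤ 4 ^ N * N.factorial * Real.exp ((1 + ‖x‖ ^ 2) / 4) := by
    rw [div_pow, div_div, div_le_iff₀ (by positivity)] at h1
    linarith
  have h4 : Real.exp ((1 + ‖x‖ ^ 2) / 4) * Real.exp (-‖x‖ ^ 2 / 4) = Real.exp (1 / 4) := by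
    rw [← Real.exp_add]; congr 1; ring
  have h5 : wt s x * Real.exp (-‖x‖ ^ 2 / 4) ≤ 4 ^ N * N.factorial * Real.exp (1 / 4) := by
    calc _ ≤ 4 ^ N * N.factorial * Real.exp ((1 + ‖x‖ ^ 2) / 4) * Real.exp (-‖x‖ ^ 2 / 4) := by
          gcongr; exact h2.trans h3
      _ = _ := by rw [mul_assoc, h4]
  calc Real.exp (-‖x‖ ^ 2 / 4) = wt (-s) x * (wt s x * Real.exp (-‖x‖ ^ 2 / 4)) := by
        rw [← mul_assoc, wt_neg_mul, one_mul]
    _ ≤ wt (-s) x * (4 ^ N * N.factorial * Real.exp (1 / 4)) :=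
        mul_le_mul_of_nonneg_left h5 (wt_pos _ x).le
    _ = _ := mul_comm _ _

/-- The energy inequality in a polynomial weight. -/
lemma energy_wt (s : ℝ) : ∃ C, 0 ≤ C ∧ ∀ (A : ℝ) (p : Plane → ℝ), IsTest p →
    (∫ x, gradSq p x * wt s x) + (1 + s) / 2 * (∫ x, p x ^ 2 * wt s x)
      - C * (∫ x, p x ^ 2 * wt (s - 1) x) ≤ -∫ x, driftOp A p x * p x * wt s x := by
  -- The coefficients of `wt (s - 1)` and `wt (s - 2)` left over in `e3`, the latter weight being
  -- bounded by the former. The leading coefficient `(1 + s)/2` comes from the drift `½ ξ·∇` alone.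
  refine ⟨|5 / 2 * s + 2 * s * (s - 1)| + |2 * s * (s - 1)|, by positivity, fun A p hp => ?_⟩
  set C := |5 / 2 * s + 2 * s * (s - 1)| + |2 * s * (s - 1)| with hC
  have hdv : ContDiff ℝ ∞ fun x => s * wt (s - 1) x := contDiff_const.mul (contDiff_wt _)
  have h1 := energy_identity A hp (contDiff_wt s) hdv (partialD_wt s)
  have hc : ContDiff ℝ ∞ fun x => 2 * (s * wt (s - 1) x) - wt s x / 2 :=
    (contDiff_const.mul hdv).sub ((contDiff_wt s).div_const 2)
  have h2 := integral_mul_radial hp hc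
  have hpp := hp.mul_smooth hp.1
  have i1 := (hp.gradSq.mul_smooth (contDiff_wt s)).integrable
  have i2 : Integrable fun x => (2 * (s * wt (s - 1) x) - wt s x / 2) * p x
      * advect (fun x => x) p x :=
    ((hp.smooth_mul hc).mul_smooth
      (contDiff_advect (v := fun x => x) contDiff_coord hp.1)).integrable
  have ip : ∀ r, Integrable fun x => p x ^ 2 * wt r x := fun r => by
    refine (hpp.mul_smooth (contDiff_wt r)).integrable.congr (Filter.Eventually.of_forall fun x => ?_)
    simp only []; ring
  rw [h1, integral_add i1 i2, h2]
  have e : (1 + s) / 2 * (∫ x, p x ^ 2 * wt s x) - C * (∫ x, p x ^ 2 * wt (s - 1) x)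
      = ∫ x, ((1 + s) / 2 * (p x ^ 2 * wt s x) - C * (p x ^ 2 * wt (s - 1) x)) := by
    rw [integral_sub, integral_const_mul, integral_const_mul]
    exacts [(ip s).const_mul _, (ip (s - 1)).const_mul _]
  have key : (1 + s) / 2 * (∫ x, p x ^ 2 * wt s x) - C * (∫ x, p x ^ 2 * wt (s - 1) x)
      ≤ ∫ x, -(1 / 2) * (2 * (2 * (s * wt (s - 1) x) - wt s x / 2)
        + advect (fun x => x) (fun x => 2 * (s * wt (s - 1) x) - wt s x / 2) x) * p x ^ 2 := by
    rw [e]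
    refine integral_mono (((ip s).const_mul _).sub ((ip (s - 1)).const_mul _)) ?_ fun x => ?_
    · have := hpp.smooth_mul ((contDiff_const (c := (-(1 / 2) : ℝ))).mul
        ((contDiff_const (c := (2 : ℝ)).mul hc).add
          (contDiff_advect (v := fun x => x) contDiff_coord hc)))
      refine this.integrable.congr (Filter.Eventually.of_forall fun x => ?_)
      simp only []; ring
    · simp only
      have hd : ∀ j, partialD j (fun x => 2 * (s * wt (s - 1) x) - wt s x / 2) x
          = 2 * x j * (2 * s * ((s - 1) * wt (s - 1 - 1) x) - s / 2 * wt (s - 1) x) := by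
        intro j
        have e1 : (fun x => 2 * (s * wt (s - 1) x) - wt s x / 2)
            = fun x => (2 * s) * wt (s - 1) x - (1 / 2) * wt s x := by funext x; ring
        rw [e1, partialD_sub (contDiff_const.mul (contDiff_wt _))
          (contDiff_const.mul (contDiff_wt _)), partialD_const_mul (contDiff_wt _),
          partialD_const_mul (contDiff_wt _), partialD_wt, partialD_wt]
        ring
      have ha : advect (fun x => x) (fun x => 2 * (s * wt (s - 1) x) - wt s x / 2) x
          = 2 * ‖x‖ ^ 2 * (2 * s * ((s - 1) * wt (s - 1 - 1) x) - s / 2 * wt (s - 1) x) := by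
        unfold advect
        rw [hd, hd, norm_sq_eq]; ring
      have w1 := wt_eq_mul_sub_one s x
      have w2 := wt_eq_mul_sub_one (s - 1) x
      have w3 := wt_pos (s - 1) x
      have w4 := wt_pos (s - 1 - 1) x
      have w5 := wt_mono (by linarith : s - 1 - 1 ≤ s - 1) x
      rw [ha]
      have e3 : -(1 / 2) * (2 * (2 * (s * wt (s - 1) x) - wt s x / 2)
          + 2 * ‖x‖ ^ 2 * (2 * s * ((s - 1) * wt (s - 1 - 1) x) - s / 2 * wt (s - 1) x))
          = (1 + s) / 2 * wt s x - (5 / 2 * s + 2 * s * (s - 1)) * wt (s - 1) x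
            + 2 * s * (s - 1) * wt (s - 1 - 1) x := by
        linear_combination (-s / 2) * w1 + 2 * s * (s - 1) * w2
      rw [e3]
      have b1 : (5 / 2 * s + 2 * s * (s - 1)) * wt (s - 1) x
          ≤ |5 / 2 * s + 2 * s * (s - 1)| * wt (s - 1) x :=
        mul_le_mul_of_nonneg_right (le_abs_self _) w3.le
      have b2 : -(|2 * s * (s - 1)| * wt (s - 1) x) ≤ 2 * s * (s - 1) * wt (s - 1 - 1) x := by
        have a1 : -(|2 * s * (s - 1)| * wt (s - 1 - 1) x) ≤ 2 * s * (s - 1) * wt (s - 1 - 1) x := by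
          rw [← neg_mul]; exact mul_le_mul_of_nonneg_right (neg_abs_le _) w4.le
        have a2 : |2 * s * (s - 1)| * wt (s - 1 - 1) x ≤ |2 * s * (s - 1)| * wt (s - 1) x :=
          mul_le_mul_of_nonneg_left w5 (abs_nonneg _)
        linarith
      have b3 : (1 + s) / 2 * wt s x - C * wt (s - 1) x ≤ (1 + s) / 2 * wt s x
          - (5 / 2 * s + 2 * s * (s - 1)) * wt (s - 1) x + 2 * s * (s - 1) * wt (s - 1 - 1) x := by
        rw [hC]; linarith
      calc _ = ((1 + s) / 2 * wt s x - C * wt (s - 1) x) * p x ^ 2 := by ring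
        _ ≤ _ := mul_le_mul_of_nonneg_right b3 (sq_nonneg _)
  linarith

/-! ### Coercivity in a truncated Gaussian weight -/

/-- The reciprocal `exp(-|ξ|²/4) + ε (1 + |ξ|²)^(-k)` of the truncated Gaussian weight. -/
def recWeight (k ε : ℝ) (x : Plane) : ℝ := Real.exp (-‖x‖ ^ 2 / 4) + ε * wt (-k) x

/-- The Gaussian weight `exp(|ξ|²/4)`, truncated to `ε⁻¹ (1 + |ξ|²)^k` at infinity. -/
def truncWeight (k ε : ℝ) (x : Plane) : ℝ := (recWeight k ε x)⁻¹

/-- The logarithmic derivative of the truncated Gaussian weight with respect to `|ξ|²`. -/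
def truncSlope (k ε : ℝ) (x : Plane) : ℝ :=
  (Real.exp (-‖x‖ ^ 2 / 4) / 4 + ε * k * wt (-k - 1) x) * truncWeight k ε x

lemma contDiff_gauss : ContDiff ℝ ∞ fun x : Plane => Real.exp (-‖x‖ ^ 2 / 4) :=
  Real.contDiff_exp.comp (contDiff_normsq.neg.div_const 4)

lemma recWeight_pos {k ε : ℝ} (hε : 0 < ε) (x : Plane) : 0 < recWeight k ε x := by
  have := wt_pos (-k) x
  unfold recWeight; positivity

lemma truncWeight_pos {k ε : ℝ} (hε : 0 < ε) (x : Plane) : 0 < truncWeight k ε x :=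
  inv_pos.2 (recWeight_pos hε x)

lemma contDiff_recWeight (k ε : ℝ) : ContDiff ℝ ∞ (recWeight k ε) :=
  contDiff_gauss.add (contDiff_const.mul (contDiff_wt _))

lemma contDiff_truncWeight {k ε : ℝ} (hε : 0 < ε) : ContDiff ℝ ∞ (truncWeight k ε) :=
  (contDiff_recWeight k ε).inv fun x => (recWeight_pos hε x).ne'

lemma contDiff_truncSlope {k ε : ℝ} (hε : 0 < ε) : ContDiff ℝ ∞ (truncSlope k ε) :=
  ((contDiff_gauss.div_const 4).add (contDiff_const.mul (contDiff_wt _))).mul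
    (contDiff_truncWeight hε)

lemma partialD_gauss (j : Fin 2) (x : Plane) :
    partialD j (fun x : Plane => Real.exp (-‖x‖ ^ 2 / 4)) x
      = 2 * x j * (-(Real.exp (-‖x‖ ^ 2 / 4) / 4)) := by
  have h : HasDerivAt (fun t : ℝ => Real.exp (-t / 4)) (-(Real.exp (-‖x‖ ^ 2 / 4) / 4))
      (‖x‖ ^ 2) := by
    have h1 : HasDerivAt (fun t : ℝ => -t / 4) (-1 / 4) (‖x‖ ^ 2) :=
      ((hasDerivAt_id _).neg).div_const 4
    exact h1.exp.congr_deriv (by ring)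
  rw [partialD_radial h]; ring

lemma partialD_recWeight (k ε : ℝ) (j : Fin 2) (x : Plane) :
    partialD j (recWeight k ε) x
      = -(2 * x j * (Real.exp (-‖x‖ ^ 2 / 4) / 4 + ε * k * wt (-k - 1) x)) := by
  unfold recWeight
  rw [partialD_add contDiff_gauss (contDiff_const.mul (contDiff_wt _)),
    partialD_const_mul (contDiff_wt _), partialD_wt, partialD_gauss]
  ring

lemma partialD_truncWeight {k ε : ℝ} (hε : 0 < ε) (j : Fin 2) (x : Plane) :
    partialD j (truncWeight k ε) x = 2 * x j * (truncSlope k ε x * truncWeight k ε x) := by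
  have hS := (recWeight_pos (k := k) hε x).ne'
  have := partialD_comp (contDiff_recWeight k ε) (hasDerivAt_inv hS) j
  unfold truncSlope truncWeight
  rw [this, partialD_recWeight]
  field_simp

/-- The square root of the truncated Gaussian weight. -/
def sqrtWeight (k ε : ℝ) (x : Plane) : ℝ := recWeight k ε x ^ (-(1 / 2) : ℝ)

lemma contDiff_sqrtWeight {k ε : ℝ} (hε : 0 < ε) : ContDiff ℝ ∞ (sqrtWeight k ε) :=
  (contDiff_recWeight k ε).rpow_const_of_ne fun x => (recWeight_pos hε x).ne'

lemma sqrtWeight_pos {k ε : ℝ} (hε : 0 < ε) (x : Plane) : 0 < sqrtWeight k ε x :=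
  Real.rpow_pos_of_pos (recWeight_pos hε x) _

lemma sqrtWeight_sq {k ε : ℝ} (hε : 0 < ε) (x : Plane) :
    sqrtWeight k ε x ^ 2 = truncWeight k ε x := by
  unfold sqrtWeight truncWeight
  rw [← Real.rpow_natCast, ← Real.rpow_mul (recWeight_pos hε x).le, ← Real.rpow_neg_one]
  norm_num

lemma partialD_sqrtWeight {k ε : ℝ} (hε : 0 < ε) (j : Fin 2) (x : Plane) :
    partialD j (sqrtWeight k ε) x = x j * truncSlope k ε x * sqrtWeight k ε x := by
  have hS := recWeight_pos (k := k) hε x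
  have := partialD_comp (contDiff_recWeight k ε)
    (Real.hasDerivAt_rpow_const (p := -(1 / 2)) (Or.inl hS.ne')) j
  unfold truncSlope truncWeight sqrtWeight
  rw [this, partialD_recWeight, Real.rpow_sub_one hS.ne']
  field_simp

/-- The ground state substitution. -/
lemma gradSq_sqrtWeight_mul {k ε : ℝ} (hε : 0 < ε) {p : Plane → ℝ} (hp : ContDiff ℝ ∞ p)
    (x : Plane) : gradSq (fun z => sqrtWeight k ε z * p z) x
      = truncWeight k ε x * (gradSq p x + 2 * truncSlope k ε x * p x * advect (fun x => x) p x
        + truncSlope k ε x ^ 2 * ‖x‖ ^ 2 * p x ^ 2) := by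
  unfold gradSq advect
  rw [partialD_mul (contDiff_sqrtWeight hε) hp, partialD_mul (contDiff_sqrtWeight hε) hp,
    partialD_sqrtWeight hε, partialD_sqrtWeight hε, ← sqrtWeight_sq hε, norm_sq_eq]
  ring

/-- Writing the form through `√w p` absorbs the cross terms between `∇p` and `∇w`. With `a` the
logarithmic slope of `w` in `|ξ|²`, there remains the potential `½ + |ξ|² a (½ - a)`. For the full
Gaussian `a = ¼`, which gives the oscillator potential `½ + |ξ|²/16`. -/
lemma energy_truncWeight (A : ℝ) {k ε : ℝ} (hε : 0 < ε) {p : Plane → ℝ} (hp : IsTest p) :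
    -∫ x, driftOp A p x * p x * truncWeight k ε x
      = (∫ x, gradSq (fun z => sqrtWeight k ε z * p z) x)
        + ∫ x, (1 / 2 + ‖x‖ ^ 2 * truncSlope k ε x * (1 / 2 - truncSlope k ε x))
          * (p x ^ 2 * truncWeight k ε x) := by
  have hw := contDiff_truncWeight (k := k) hε
  have ha := contDiff_truncSlope (k := k) hε
  have h1 := energy_identity A hp hw (ha.mul hw) (partialD_truncWeight hε)
  have h2 := integral_mul_radial hp hw
  have hadv : ContDiff ℝ ∞ (advect (fun x => x) p) :=
    contDiff_advect (v := fun x => x) contDiff_coord hp.1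
  have i1 : Integrable fun x => gradSq (fun z => sqrtWeight k ε z * p z) x :=
    (hp.smooth_mul (contDiff_sqrtWeight hε)).gradSq.integrable
  have i2 : Integrable fun x => truncWeight k ε x * p x * advect (fun x => x) p x :=
    ((hp.smooth_mul hw).mul_smooth hadv).integrable
  have i3 : Integrable fun x => ‖x‖ ^ 2 * truncSlope k ε x ^ 2 * (p x ^ 2 * truncWeight k ε x) := by
    have := (hp.mul_smooth hp.1).smooth_mul ((contDiff_normsq.mul (ha.pow 2)).mul hw)
    refine this.integrable.congr (Filter.Eventually.of_forall fun x => ?_)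
    simp only []; ring
  have i4 : Integrable fun x => (1 + ‖x‖ ^ 2 * truncSlope k ε x) * (p x ^ 2 * truncWeight k ε x) := by
    have := (hp.mul_smooth hp.1).smooth_mul
      (((contDiff_const (c := (1 : ℝ))).add (contDiff_normsq.mul ha)).mul hw)
    refine this.integrable.congr (Filter.Eventually.of_forall fun x => ?_)
    simp only []; ring
  rw [h1]
  have e1 : ∫ x, (gradSq p x * truncWeight k ε x
      + (2 * (truncSlope k ε x * truncWeight k ε x) - truncWeight k ε x / 2) * p x
        * advect (fun x => x) p x)
      = (∫ x, gradSq (fun z => sqrtWeight k ε z * p z) x)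
        - (1 / 2) * (∫ x, truncWeight k ε x * p x * advect (fun x => x) p x)
        + (-1) * ∫ x, ‖x‖ ^ 2 * truncSlope k ε x ^ 2 * (p x ^ 2 * truncWeight k ε x) := by
    rw [← integral_sub_add i1 i2 i3]
    congr 1; funext x; rw [gradSq_sqrtWeight_mul hε hp.1]; ring
  have e2 : ∫ x, truncWeight k ε x * p x * advect (fun x => x) p x
      = -∫ x, (1 + ‖x‖ ^ 2 * truncSlope k ε x) * (p x ^ 2 * truncWeight k ε x) := by
    rw [h2, ← integral_neg]
    congr 1; funext x; unfold advect
    rw [partialD_truncWeight hε, partialD_truncWeight hε, norm_sq_eq]; ring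
  have e3 : ∫ x, (1 / 2 + ‖x‖ ^ 2 * truncSlope k ε x * (1 / 2 - truncSlope k ε x))
          * (p x ^ 2 * truncWeight k ε x)
      = (1 / 2) * (∫ x, (1 + ‖x‖ ^ 2 * truncSlope k ε x) * (p x ^ 2 * truncWeight k ε x))
        - ∫ x, ‖x‖ ^ 2 * truncSlope k ε x ^ 2 * (p x ^ 2 * truncWeight k ε x) := by
    rw [← integral_const_mul, ← integral_sub (i4.const_mul _) i3]
    congr 1; funext x; ring
  rw [e1, e2, e3]; ring

/-- The localizing factor `(1 + β²|ξ|⁴)^(-1/2)`. -/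
def cutFactor (β : ℝ) (x : Plane) : ℝ := (1 + β ^ 2 * (‖x‖ ^ 2) ^ 2) ^ (-(1 / 2) : ℝ)

lemma cutFactor_base_pos (β : ℝ) (x : Plane) : 0 < 1 + β ^ 2 * (‖x‖ ^ 2) ^ 2 := by positivity

lemma contDiff_cutFactor (β : ℝ) : ContDiff ℝ ∞ (cutFactor β) :=
  (contDiff_const.add (contDiff_const.mul (contDiff_normsq.pow 2))).rpow_const_of_ne
    fun x => (cutFactor_base_pos β x).ne'

lemma cutFactor_sq (β : ℝ) (x : Plane) :
    cutFactor β x ^ 2 * (1 + β ^ 2 * (‖x‖ ^ 2) ^ 2) = 1 := by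
  have h := cutFactor_base_pos β x
  unfold cutFactor
  rw [← Real.rpow_natCast, ← Real.rpow_mul h.le]
  norm_num
  rw [Real.rpow_neg_one, inv_mul_cancel₀ h.ne']

lemma cutFactor_pos (β : ℝ) (x : Plane) : 0 < cutFactor β x :=
  Real.rpow_pos_of_pos (cutFactor_base_pos β x) _

lemma cutFactor_sq_le (β : ℝ) (x : Plane) : cutFactor β x ^ 2 ≤ 1 := by
  have h1 := cutFactor_sq β x
  nlinarith [sq_nonneg (cutFactor β x), mul_nonneg (sq_nonneg (cutFactor β x))
    (mul_nonneg (sq_nonneg β) (sq_nonneg (‖x‖ ^ 2)))]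

lemma partialD_cutFactor (β : ℝ) (j : Fin 2) (x : Plane) :
    partialD j (cutFactor β) x = -(2 * β ^ 2 * ‖x‖ ^ 2 * x j * cutFactor β x ^ 3) := by
  have h := cutFactor_base_pos β x
  have h1 : HasDerivAt (fun t : ℝ => (1 + β ^ 2 * t ^ 2) ^ (-(1 / 2) : ℝ))
      ((β ^ 2 * (2 * ‖x‖ ^ 2)) * (-(1 / 2))
        * (1 + β ^ 2 * (‖x‖ ^ 2) ^ 2) ^ (-(1 / 2) - 1 : ℝ)) (‖x‖ ^ 2) := by
    have h2 : HasDerivAt (fun t : ℝ => 1 + β ^ 2 * t ^ 2) (β ^ 2 * (2 * ‖x‖ ^ 2)) (‖x‖ ^ 2) := by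
      have := ((hasDerivAt_pow 2 (‖x‖ ^ 2)).const_mul (β ^ 2)).const_add 1
      exact this.congr_deriv (by push_cast; ring)
    exact h2.rpow_const (Or.inl h.ne')
  have h3 : (1 + β ^ 2 * (‖x‖ ^ 2) ^ 2) ^ (-(1 / 2) - 1 : ℝ) = cutFactor β x ^ 3 := by
    have h4 : ∀ y : ℝ, 0 < y → y ^ (-(1 / 2) - 1 : ℝ) = (y ^ (-(1 / 2) : ℝ)) ^ 3 := fun y hy => by
      rw [← Real.rpow_natCast, ← Real.rpow_mul hy.le]
      norm_num
    exact h4 _ h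
  have := partialD_radial h1 j
  unfold cutFactor at *
  rw [this, h3]; ring

/-- A localization formula for the pair `c`, `s = β|ξ|² c` with `c² + s² = 1`, that is, `cos θ` and
`sin θ` with `tan θ = β|ξ|²`. Then `|∇(cg)|² + |∇(sg)|² = |∇g|² + |∇θ|² g²`, and `|∇θ|² = 4β²c⁴|ξ|²
≤ 2β`. -/
lemma gradSq_cutFactor_mul_le {β : ℝ} (hβ : 0 < β) {g : Plane → ℝ} (hg : ContDiff ℝ ∞ g)
    (x : Plane) :
    gradSq (fun z => cutFactor β z * g z) x ≤ gradSq g x + 2 * β * g x ^ 2 := by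
  have h1 := cutFactor_sq β x
  set c := cutFactor β x with hc
  have hcp : 0 < c := cutFactor_pos β x
  set t := ‖x‖ ^ 2 with ht
  have ht0 : 0 ≤ t := by positivity
  unfold gradSq
  rw [partialD_mul (contDiff_cutFactor β) hg, partialD_mul (contDiff_cutFactor β) hg,
    partialD_cutFactor, partialD_cutFactor, ← hc]
  set a := partialD 0 g x
  set b := partialD 1 g x
  have hs : c ^ 2 + (β * t * c) ^ 2 = 1 := by rw [← h1]; ring
  -- The two squares subtracted on the right are the components of `∇(sg)`; they are discarded at
  -- the end.
  have e : (-(2 * β ^ 2 * t * x 0 * c ^ 3) * g x + c * a) ^ 2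
      + (-(2 * β ^ 2 * t * x 1 * c ^ 3) * g x + c * b) ^ 2
      = (c ^ 2 + (β * t * c) ^ 2) * (a ^ 2 + b ^ 2 + 4 * β ^ 2 * c ^ 4 * t * g x ^ 2)
        - ((β * t * c) * a + c * (2 * β * c ^ 2 * x 0 * g x)) ^ 2
        - ((β * t * c) * b + c * (2 * β * c ^ 2 * x 1 * g x)) ^ 2 := by
    have : t = x 0 ^ 2 + x 1 ^ 2 := norm_sq_eq x
    have h2 : 4 * β ^ 2 * c ^ 4 * t * g x ^ 2
      = (2 * β * c ^ 2 * x 0 * g x) ^ 2 + (2 * β * c ^ 2 * x 1 * g x) ^ 2 := by rw [this]; ring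
    rw [h2]; ring
  rw [e, hs]
  have h3 : 2 * (β * t) * c ^ 4 ≤ 1 := by
    have h4 : c ^ 2 ≤ 1 := cutFactor_sq_le β x
    have h5 : 2 * (β * t) * c ^ 2 ≤ 1 := by
      rw [← h1]
      nlinarith [mul_nonneg (sq_nonneg c) (sq_nonneg (β * t - 1))]
    have h6 : 0 ≤ 2 * (β * t) * c ^ 2 := by positivity
    calc 2 * (β * t) * c ^ 4 = (2 * (β * t) * c ^ 2) * c ^ 2 := by ring
      _ ≤ 1 * 1 := by gcongr
      _ = 1 := one_mul 1
  have h7 : 4 * β ^ 2 * c ^ 4 * t * g x ^ 2 ≤ 2 * β * g x ^ 2 := by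
    have : 4 * β ^ 2 * c ^ 4 * t * g x ^ 2 = (2 * (β * t) * c ^ 4) * (2 * β * g x ^ 2) := by ring
    rw [this]
    have h8 : 0 ≤ 2 * β * g x ^ 2 := by positivity
    nlinarith
  nlinarith [sq_nonneg ((β * t * c) * a + c * (2 * β * c ^ 2 * x 0 * g x)),
    sq_nonneg ((β * t * c) * b + c * (2 * β * c ^ 2 * x 1 * g x))]

/-! The pointwise lower bound of the potential. -/

/-- The slope is a convex combination, with weight `exp(-|ξ|²/4) w` in `[0, 1]`, of the Gaussian
slope `¼` and the slope `k/(1+|ξ|²)` of the polynomial weight. -/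
lemma truncSlope_eq {k ε : ℝ} (hε : 0 < ε) (x : Plane) :
    truncSlope k ε x = Real.exp (-‖x‖ ^ 2 / 4) * truncWeight k ε x * (1 / 4)
      + (1 - Real.exp (-‖x‖ ^ 2 / 4) * truncWeight k ε x) * (k / (1 + ‖x‖ ^ 2)) := by
  have hS := (recWeight_pos (k := k) hε x)
  have h1 := wt_eq_mul_sub_one (-k) x
  have h2 := one_add_pos x
  have h3 : wt (-k - 1) x = wt (-k) x / (1 + ‖x‖ ^ 2) := by rw [h1]; field_simp
  have h4 : 1 - Real.exp (-‖x‖ ^ 2 / 4) * truncWeight k ε x = ε * wt (-k) x * truncWeight k ε x := by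
    unfold truncWeight
    rw [← mul_inv_cancel₀ hS.ne']
    unfold recWeight; ring
  rw [h4]
  unfold truncSlope
  rw [h3]; field_simp

set_option maxHeartbeats 800000 in
-- The sum of the localized oscillator bound and the potential of the truncated weight is nearly at
-- least `1` everywhere. For `t = |ξ|² ≤ T` small `ε` forces the slope close to `¼`, so `t a(½ - a)
-- ≈ t/16` cancels the negative part of `1 - t/16`. For `t > T` the slope lies between `k/(1+t)` and
-- `¼`, so `t a(½ - a)` is at least about `k/2 > 1`, while the cutoff makes `t c²/16` small. The two
-- errors `(k-2)/4` use up exactly `k/2 - 1`.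
lemma potential_lower {k δ β ε T : ℝ} (hk : 2 < k) (hβ : 0 < β) (hδ1 : δ ≤ 1)
    (hβδ : β ≤ δ / 256) (hε : 0 < ε) (hT : 4 * k ≤ T)
    (hT1 : k * (1 + 2 * k) / (2 * (1 + T)) ≤ (k - 2) / 4)
    (hT2 : 1 / (16 * β ^ 2 * T) ≤ (k - 2) / 4)
    (hεT : T * ((k + 1) * (ε * Real.exp (T / 4))) ^ 2 ≤ δ / 4) (x : Plane) :
    1 - δ / 2 ≤ (1 - ‖x‖ ^ 2 / 16) * cutFactor β x ^ 2 - 2 * β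
      + ‖x‖ ^ 2 * truncSlope k ε x * (1 / 2 - truncSlope k ε x) := by
  have hS := recWeight_pos (k := k) hε x
  have ha := truncSlope_eq (k := k) hε x
  have hc1 := cutFactor_sq β x
  have hc2 := cutFactor_sq_le β x
  set a := truncSlope k ε x
  set c2 := cutFactor β x ^ 2 with hc2d
  have hc0 : 0 ≤ c2 := sq_nonneg _
  have ht0 : 0 ≤ ‖x‖ ^ 2 := by positivity
  have hϑ1 : Real.exp (-‖x‖ ^ 2 / 4) * truncWeight k ε x ≤ 1 := by
    unfold truncWeight
    rw [← div_eq_mul_inv, div_le_one hS]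
    have := wt_pos (-k) x
    unfold recWeight
    nlinarith [mul_pos hε this]
  have hϑ0 : 0 ≤ Real.exp (-‖x‖ ^ 2 / 4) * truncWeight k ε x :=
    mul_nonneg (Real.exp_pos _).le (truncWeight_pos hε x).le
  have hϑ2 : 1 - Real.exp (-‖x‖ ^ 2 / 4) * truncWeight k ε x ≤ ε * Real.exp (‖x‖ ^ 2 / 4) := by
    have h1 : wt (-k) x ≤ 1 := by
      have := wt_mono (by linarith : -k ≤ 0) x; rwa [wt_zero] at this
    have h2 : Real.exp (‖x‖ ^ 2 / 4) * Real.exp (-‖x‖ ^ 2 / 4) = 1 := by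
      rw [← Real.exp_add]; simp; ring
    have h4 : 1 - Real.exp (-‖x‖ ^ 2 / 4) * truncWeight k ε x
        = ε * wt (-k) x * truncWeight k ε x := by
      unfold truncWeight
      rw [← mul_inv_cancel₀ hS.ne']
      unfold recWeight; ring
    rw [h4]
    unfold truncWeight
    rw [← div_eq_mul_inv, div_le_iff₀ hS]
    unfold recWeight
    have h5 : 0 ≤ ε * Real.exp (‖x‖ ^ 2 / 4) * (ε * wt (-k) x) := by
      have := wt_pos (-k) x; positivity
    calc ε * wt (-k) x ≤ ε * 1 := by gcongr
      _ = ε * (Real.exp (‖x‖ ^ 2 / 4) * Real.exp (-‖x‖ ^ 2 / 4)) := by rw [h2]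
      _ ≤ _ := by linarith
  set ϑ := Real.exp (-‖x‖ ^ 2 / 4) * truncWeight k ε x
  set t := ‖x‖ ^ 2
  have hβ1 : 256 * β ^ 2 ≤ β := by nlinarith
  have hT0 : 0 ≤ T := by linarith
  rcases le_or_gt t T with h | h
  · have hb : |k / (1 + t) - 1 / 4| ≤ k + 1 := by
      have h1 : k / (1 + t) ≤ k := div_le_self (by linarith) (by linarith)
      have h2 : 0 ≤ k / (1 + t) := by positivity
      rw [abs_le]; constructor <;> linarith
    have h1 : |a - 1 / 4| ≤ (k + 1) * (ε * Real.exp (T / 4)) := by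
      have : a - 1 / 4 = (1 - ϑ) * (k / (1 + t) - 1 / 4) := by rw [ha]; ring
      rw [this, abs_mul, abs_of_nonneg (by linarith), mul_comm]
      have h3 : Real.exp (t / 4) ≤ Real.exp (T / 4) := Real.exp_le_exp.2 (by linarith)
      have h4 : 1 - ϑ ≤ ε * Real.exp (T / 4) := hϑ2.trans (by gcongr)
      exact mul_le_mul hb h4 (by linarith) (by linarith)
    have h2 : t * (a - 1 / 4) ^ 2 ≤ δ / 4 := by
      refine le_trans ?_ hεT
      have : (a - 1 / 4) ^ 2 ≤ ((k + 1) * (ε * Real.exp (T / 4))) ^ 2 := by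
        rw [← sq_abs]; gcongr
      gcongr
    -- For `t ≥ 16` the product is not positive. For `t < 16` one has `1 - c² ≤ β²t² ≤ 16²β²`.
    have h3 : (1 - c2) * (1 - t / 16) ≤ 256 * β ^ 2 := by
      rcases le_or_gt 16 t with h4 | h4
      · have : (1 - c2) * (1 - t / 16) ≤ 0 :=
          mul_nonpos_of_nonneg_of_nonpos (by linarith) (by linarith)
        nlinarith
      · have h5 : 1 - c2 ≤ β ^ 2 * t ^ 2 := by
          have : 1 - c2 = c2 * (β ^ 2 * t ^ 2) := by linarith
          rw [this]
          have : 0 ≤ β ^ 2 * t ^ 2 := by positivity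
          nlinarith
        have h6 : β ^ 2 * t ^ 2 ≤ β ^ 2 * 256 := by
          have : t ^ 2 ≤ 256 := by nlinarith
          gcongr
        nlinarith
    -- Completing the square: `t a(½ - a) = t/16 - t (a - ¼)²`, and the terms `t/16` compensate.
    have e : (1 - t / 16) * c2 - 2 * β + t * a * (1 / 2 - a)
        = 1 - (1 - c2) * (1 - t / 16) - 2 * β - t * (a - 1 / 4) ^ 2 := by ring
    rw [e]
    linarith
  · have hτ : 0 < 1 + t := by linarith
    have hb4 : k / (1 + t) ≤ 1 / 4 := by rw [div_le_iff₀ hτ]; linarith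
    have h1 : k / (1 + t) ≤ a := by
      have e : a = k / (1 + t) + ϑ * (1 / 4 - k / (1 + t)) := by rw [ha]; ring
      have := mul_nonneg hϑ0 (sub_nonneg.2 hb4)
      linarith
    have h2 : a ≤ 1 / 4 := by
      have e : a = 1 / 4 - (1 - ϑ) * (1 / 4 - k / (1 + t)) := by rw [ha]; ring
      have := mul_nonneg (sub_nonneg.2 hϑ1) (sub_nonneg.2 hb4)
      linarith
    set b := k / (1 + t) with hb
    -- The function `a(½ - a)` increases up to `a = ¼`, so the purely polynomial slope is the worst
    -- case.
    have h3 : b * (1 / 2 - b) ≤ a * (1 / 2 - a) := by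
      have e : a * (1 / 2 - a) - b * (1 / 2 - b) = (a - b) * (1 / 2 - a - b) := by ring
      have := mul_nonneg (sub_nonneg.2 h1) (by linarith : 0 ≤ 1 / 2 - a - b)
      linarith
    have h4 : k / 2 - k * (1 + 2 * k) / (2 * (1 + t)) ≤ t * (b * (1 / 2 - b)) := by
      have e : t * (b * (1 / 2 - b)) = k / 2 - k * (1 + 2 * k) / (2 * (1 + t)) + b ^ 2 := by
        rw [hb]; field_simp; ring
      rw [e]; linarith [sq_nonneg b]
    have h5 : k * (1 + 2 * k) / (2 * (1 + t)) ≤ (k - 2) / 4 := by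
      refine le_trans ?_ hT1
      have : (0 : ℝ) < 1 + T := by linarith
      gcongr
    have h6 : t * c2 / 16 ≤ (k - 2) / 4 := by
      refine le_trans ?_ hT2
      have hTp : 0 < T := by linarith
      rw [div_le_div_iff₀ (by norm_num) (by positivity)]
      have h8 : c2 * β ^ 2 * t * T ≤ c2 * β ^ 2 * t * t := by gcongr
      have h9 : c2 * β ^ 2 * t * t ≤ 1 := by linarith
      linarith
    have h7 : t * (b * (1 / 2 - b)) ≤ t * (a * (1 / 2 - a)) := by gcongr
    have e : (1 - t / 16) * c2 = c2 - t * c2 / 16 := by ring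
    rw [e, mul_assoc]
    linarith

/-! ### Overlap with the ground state and the coercivity estimate -/

lemma integrable_sq_norm_gauss :
    Integrable fun x : Plane => (‖x‖ ^ 2) ^ 2 * Real.exp (-‖x‖ ^ 2 / 4) := by
  obtain ⟨C, hC, h⟩ := exists_exp_le_wt 4
  refine ((integrable_wt_neg (s := 2) (by norm_num)).const_mul C).mono'
    (Continuous.aestronglyMeasurable (by fun_prop)) (Filter.Eventually.of_forall fun x => ?_)
  have e : wt (-2) x = (1 + ‖x‖ ^ 2) ^ 2 * wt (-4) x := by
    rw [wt_eq_mul_sub_one (-2), show (-2 - 1 : ℝ) = -3 by norm_num, wt_eq_mul_sub_one (-3),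
      show (-3 - 1 : ℝ) = -4 by norm_num]
    ring
  rw [Real.norm_of_nonneg (by positivity), e]
  have h4 := wt_pos (-4) x
  calc (‖x‖ ^ 2) ^ 2 * Real.exp (-‖x‖ ^ 2 / 4) ≤ (1 + ‖x‖ ^ 2) ^ 2 * (C * wt (-4) x) := by
        gcongr
        · linarith
        · exact h x
    _ = _ := by ring

/-- The defect between the constant function and the localized ground state, relative to the
truncated weight. -/
lemma trial_defect_le {k ε β : ℝ} (hε : 0 < ε) (x : Plane) :
    ((1 - cutFactor β x * (sqrtWeight k ε x * Real.exp (-‖x‖ ^ 2 / 8))) / sqrtWeight k ε x) ^ 2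
      ≤ β ^ 2 * ((‖x‖ ^ 2) ^ 2 * Real.exp (-‖x‖ ^ 2 / 4)) + ε * wt (-k) x := by
  have hq := sqrtWeight_pos (k := k) hε x
  have hq2 := sqrtWeight_sq (k := k) hε x
  have hr := recWeight_pos (k := k) hε x
  have hG : Real.exp (-‖x‖ ^ 2 / 4) = Real.exp (-‖x‖ ^ 2 / 8) ^ 2 := by
    rw [← Real.exp_nat_mul]; congr 1; push_cast; ring
  have hh := Real.exp_pos (-‖x‖ ^ 2 / 8)
  have hc := cutFactor_pos β x
  have hc1 := cutFactor_sq β x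
  have hc2 := cutFactor_sq_le β x
  have hJ := wt_pos (-k) x
  have hrd : recWeight k ε x = Real.exp (-‖x‖ ^ 2 / 8) ^ 2 + ε * wt (-k) x := by
    rw [← hG]; rfl
  rw [hG]
  unfold truncWeight at hq2
  set q := sqrtWeight k ε x
  set h := Real.exp (-‖x‖ ^ 2 / 8)
  set c := cutFactor β x
  set r := recWeight k ε x
  set J := wt (-k) x
  have hqr : q ^ 2 * r = 1 := by rw [hq2, inv_mul_cancel₀ hr.ne']
  -- Here `r = 1/q² = h² + εJ`. Since `qh ≤ 1` gives `h/q ≥ h²`, the right side is at most `(1 - c)²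
  -- h² + εJ`.
  have e1 : ((1 - c * (q * h)) / q) ^ 2 = r - 2 * c * (h / q) + c ^ 2 * h ^ 2 := by
    have : r = 1 / q ^ 2 := by field_simp; linarith
    rw [this]; field_simp; ring
  have h1 : q * h ≤ 1 := by
    have : (q * h) ^ 2 ≤ 1 := by
      rw [← hqr, mul_pow, hrd]
      have : 0 < ε * J := by positivity
      have := mul_pos (pow_pos hq 2) this
      nlinarith
    nlinarith [mul_pos hq hh]
  have h2 : h ^ 2 ≤ h / q := by
    rw [le_div_iff₀ hq]
    nlinarith
  have h3 : c ≤ 1 := by nlinarith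
  have h4 : (1 - c) ^ 2 ≤ β ^ 2 * (‖x‖ ^ 2) ^ 2 := by
    have h5 : 1 - c ^ 2 = c ^ 2 * (β ^ 2 * (‖x‖ ^ 2) ^ 2) := by linarith
    have h6 : c ^ 2 * (β ^ 2 * (‖x‖ ^ 2) ^ 2) ≤ 1 * (β ^ 2 * (‖x‖ ^ 2) ^ 2) := by gcongr
    nlinarith
  rw [e1, hrd]
  have h7 := mul_le_mul_of_nonneg_left h2 hc.le
  have h8 := mul_le_mul_of_nonneg_right h4 (sq_nonneg h)
  nlinarith

/-- The gap inequality loses the overlap of `c √w p` with `exp(-|ξ|²/8)`. Without truncation and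
localization this overlap is exactly `∫ p`. In general the difference is a pairing of `√w p` with
the defect of `trial_defect_le`, small with `β` and `ε`. -/
lemma sq_integral_trial_le {k ε β : ℝ} (hk : 1 < k) (hε : 0 < ε) {p : Plane → ℝ}
    (hp : IsTest p) :
    (∫ x, cutFactor β x * (sqrtWeight k ε x * p x) * Real.exp (-‖x‖ ^ 2 / 8)) ^ 2
      ≤ 2 * (∫ x, p x) ^ 2 + 2 * ((∫ x, p x ^ 2 * truncWeight k ε x)
        * (β ^ 2 * (∫ x : Plane, (‖x‖ ^ 2) ^ 2 * Real.exp (-‖x‖ ^ 2 / 4))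
          + ε * ∫ x, wt (-k) x)) := by
  have hq := contDiff_sqrtWeight (k := k) hε
  have hqn : ∀ x, sqrtWeight k ε x ≠ 0 := fun x => (sqrtWeight_pos hε x).ne'
  have hh : ContDiff ℝ ∞ fun x : Plane => Real.exp (-‖x‖ ^ 2 / 8) :=
    Real.contDiff_exp.comp (contDiff_normsq.neg.div_const 8)
  have tg := hp.smooth_mul hq
  set f : Plane → ℝ := fun x =>
    (1 - cutFactor β x * (sqrtWeight k ε x * Real.exp (-‖x‖ ^ 2 / 8))) / sqrtWeight k ε x with hf
  have hfs : ContDiff ℝ ∞ f :=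
    (contDiff_const.sub ((contDiff_cutFactor β).mul (hq.mul hh))).div hq hqn
  have i0 : Integrable fun x : Plane => β ^ 2 * ((‖x‖ ^ 2) ^ 2 * Real.exp (-‖x‖ ^ 2 / 4))
      + ε * wt (-k) x :=
    (integrable_sq_norm_gauss.const_mul _).add ((integrable_wt_neg hk).const_mul ε)
  have i1 : Integrable fun x => f x ^ 2 :=
    i0.mono' (hfs.continuous.pow 2).aestronglyMeasurable (Filter.Eventually.of_forall fun x => by
      rw [Real.norm_of_nonneg (sq_nonneg _)]; exact trial_defect_le hε x)
  have i2 : Integrable fun x => (sqrtWeight k ε x * p x) ^ 2 := by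
    have := (tg.mul_smooth tg.1).integrable
    refine this.congr (Filter.Eventually.of_forall fun x => ?_)
    simp only []; ring
  have cs := sq_integral_mul_le i2 i1 (tg.mul_smooth hfs).integrable
  have e1 : ∫ x, (sqrtWeight k ε x * p x) * f x = (∫ x, p x)
      - ∫ x, cutFactor β x * (sqrtWeight k ε x * p x) * Real.exp (-‖x‖ ^ 2 / 8) := by
    rw [← integral_sub hp.integrable
      ((tg.smooth_mul (contDiff_cutFactor β)).mul_smooth hh).integrable]
    congr 1; funext x
    have := hqn x
    simp only [hf]; field_simp
  have e2 : ∫ x, (sqrtWeight k ε x * p x) ^ 2 = ∫ x, p x ^ 2 * truncWeight k ε x := by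
    congr 1; funext x; rw [← sqrtWeight_sq hε]; ring
  have e3 : ∫ x, f x ^ 2 ≤ β ^ 2 * (∫ x : Plane, (‖x‖ ^ 2) ^ 2 * Real.exp (-‖x‖ ^ 2 / 4))
          + ε * ∫ x, wt (-k) x := by
    rw [← integral_const_mul, ← integral_const_mul, ← integral_add
      (integrable_sq_norm_gauss.const_mul _) ((integrable_wt_neg hk).const_mul ε)]
    exact integral_mono i1 i0 fun x => trial_defect_le hε x
  rw [e1, e2] at cs
  have e4 : 0 ≤ ∫ x, p x ^ 2 * truncWeight k ε x :=
    integral_nonneg fun x => mul_nonneg (sq_nonneg _) (truncWeight_pos hε x).le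
  have e5 := mul_le_mul_of_nonneg_left e3 e4
  set a := ∫ x, p x
  set b := ∫ x, cutFactor β x * (sqrtWeight k ε x * p x) * Real.exp (-‖x‖ ^ 2 / 8)
  -- The inequality `b² ≤ 2a² + 2(a - b)²`, with `(a - b)²` bounded by `cs`.
  nlinarith [sq_nonneg (2 * a - b)]

/-- The gradient part of `energy_truncWeight` is bounded below by its localization to `c √w p`, at
the cost `2β`, and then by the oscillator gap. The hypothesis on the potential leaves `1 - δ/2 + ½`,
where the `½` pays for the zero-order term of `streamOp`, and the overlap error costs the other
`δ/2`. -/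
lemma form_truncWeight_lower (A : ℝ) {k ε β δ : ℝ} (hk : 1 < k) (hβ : 0 < β) (hε : 0 < ε)
    (hpot : ∀ x, 1 - δ / 2 ≤ (1 - ‖x‖ ^ 2 / 16) * cutFactor β x ^ 2 - 2 * β
      + ‖x‖ ^ 2 * truncSlope k ε x * (1 / 2 - truncSlope k ε x))
    (hE : β ^ 2 * (∫ x : Plane, (‖x‖ ^ 2) ^ 2 * Real.exp (-‖x‖ ^ 2 / 4))
          + ε * (∫ x, wt (-k) x) ≤ groundMass ^ 2 * (δ / 2)) {p : Plane → ℝ} (hp : IsTest p) :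
    (1 - δ) * (∫ x, p x ^ 2 * truncWeight k ε x)
      ≤ -(∫ x, streamOp A p x * p x * truncWeight k ε x)
        + (1 / groundMass ^ 2) * (∫ x, p x) ^ 2 := by
  have hw := contDiff_truncWeight (k := k) hε
  have tg := hp.smooth_mul (contDiff_sqrtWeight (k := k) hε)
  have tP := tg.smooth_mul (contDiff_cutFactor β)
  have ha := contDiff_truncSlope (k := k) hε
  have hZ := groundMass_pos
  have t2 : IsTest fun x => p x * p x * truncWeight k ε x := (hp.mul_smooth hp.1).mul_smooth hw
  have i2 : Integrable fun x => p x ^ 2 * truncWeight k ε x :=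
    t2.integrable.congr (Filter.Eventually.of_forall fun x => by simp only []; ring)
  have o1 := oscillator_form_lower tP
  have o2 := sq_integral_trial_le (β := β) hk hε hp
  have g1 : ∫ x, gradSq (fun z => cutFactor β z * (sqrtWeight k ε z * p z)) x
      ≤ (∫ x, gradSq (fun z => sqrtWeight k ε z * p z) x)
        + 2 * β * ∫ x, p x ^ 2 * truncWeight k ε x := by
    rw [← integral_const_mul, ← integral_add tg.gradSq.integrable (i2.const_mul _)]
    refine integral_mono tP.gradSq.integrable (tg.gradSq.integrable.add (i2.const_mul _))
      fun x => ?_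
    have := gradSq_cutFactor_mul_le hβ tg.1 x
    rw [← sqrtWeight_sq hε]
    linarith [this]
  have iU : Integrable fun x => (1 / 2 + ‖x‖ ^ 2 * truncSlope k ε x * (1 / 2 - truncSlope k ε x))
      * (p x ^ 2 * truncWeight k ε x) := by
    have := t2.smooth_mul ((contDiff_const (c := (1 / 2 : ℝ))).add ((contDiff_normsq.mul ha).mul
      ((contDiff_const (c := (1 / 2 : ℝ))).sub ha)))
    exact this.integrable.congr (Filter.Eventually.of_forall fun x => by simp only []; ring)
  have iP : Integrable fun x => (1 - ‖x‖ ^ 2 / 16)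
      * (cutFactor β x * (sqrtWeight k ε x * p x)) ^ 2 := by
    have := (tP.mul_smooth tP.1).smooth_mul
      ((contDiff_const (c := (1 : ℝ))).sub (contDiff_normsq.div_const 16))
    exact this.integrable.congr (Filter.Eventually.of_forall fun x => by simp only []; ring)
  have pot : (1 - δ / 2 + 2 * β + 1 / 2) * (∫ x, p x ^ 2 * truncWeight k ε x)
      ≤ (∫ x, (1 - ‖x‖ ^ 2 / 16) * (cutFactor β x * (sqrtWeight k ε x * p x)) ^ 2)
        + ∫ x, (1 / 2 + ‖x‖ ^ 2 * truncSlope k ε x * (1 / 2 - truncSlope k ε x))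
      * (p x ^ 2 * truncWeight k ε x) := by
    rw [← integral_const_mul, ← integral_add iP iU]
    refine integral_mono (i2.const_mul _) (iP.add iU) fun x => ?_
    have h1 := mul_le_mul_of_nonneg_right (hpot x)
      (mul_nonneg (sq_nonneg (p x)) (truncWeight_pos (k := k) hε x).le)
    have h2 : (cutFactor β x * (sqrtWeight k ε x * p x)) ^ 2
        = cutFactor β x ^ 2 * (p x ^ 2 * truncWeight k ε x) := by
      rw [← sqrtWeight_sq hε]; ring
    simp only [h2]
    linarith
  have en := energy_truncWeight (k := k) A hε hp
  have st : ∫ x, streamOp A p x * p x * truncWeight k ε x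
      = (∫ x, driftOp A p x * p x * truncWeight k ε x)
        + (1 / 2) * ∫ x, p x ^ 2 * truncWeight k ε x := by
    rw [← integral_const_mul, ← integral_add
      (((hp.driftOp A).mul_smooth hp.1).mul_smooth hw).integrable (i2.const_mul _)]
    congr 1; funext x; unfold streamOp; ring
  rw [st]
  have hI : 0 ≤ ∫ x, p x ^ 2 * truncWeight k ε x :=
    integral_nonneg fun x => mul_nonneg (sq_nonneg _) (truncWeight_pos hε x).le
  set I := ∫ x, p x ^ 2 * truncWeight k ε x
  set E := β ^ 2 * (∫ x : Plane, (‖x‖ ^ 2) ^ 2 * Real.exp (-‖x‖ ^ 2 / 4))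
          + ε * (∫ x, wt (-k) x)
  set S := ∫ x, cutFactor β x * (sqrtWeight k ε x * p x) * Real.exp (-‖x‖ ^ 2 / 8)
  have h3 : S ^ 2 / (2 * groundMass ^ 2)
      ≤ (1 / groundMass ^ 2) * (∫ x, p x) ^ 2 + δ / 2 * I := by
    rw [div_le_iff₀ (by positivity)]
    have h4 := mul_le_mul_of_nonneg_left hE hI
    have h5 : ((1 / groundMass ^ 2) * (∫ x, p x) ^ 2 + δ / 2 * I) * (2 * groundMass ^ 2)
        = 2 * (∫ x, p x) ^ 2 + 2 * (I * (groundMass ^ 2 * (δ / 2))) := by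
      field_simp
    rw [h5]; linarith
  linarith

/-- Coercivity modulo the mean, in a weight comparable to `(1 + |ξ|²)^k`. -/
lemma exists_coercive_weight {k δ : ℝ} (hk : 2 < k) (hδ : 0 < δ) (hδ1 : δ ≤ 1) :
    ∃ ε > 0, ∀ A p, IsTest p → (1 - δ) * (∫ x, p x ^ 2 * truncWeight k ε x)
      ≤ -(∫ x, streamOp A p x * p x * truncWeight k ε x)
        + (1 / groundMass ^ 2) * (∫ x, p x) ^ 2 := by
  set M₁ := ∫ x : Plane, (‖x‖ ^ 2) ^ 2 * Real.exp (-‖x‖ ^ 2 / 4) with hM₁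
  set M₂ := ∫ x, wt (-k) x with hM₂
  have h1 : 0 ≤ M₁ := integral_nonneg fun x => by positivity
  have h2 : 0 ≤ M₂ := integral_nonneg fun x => (wt_pos _ x).le
  have hZ : 0 < groundMass ^ 2 := pow_pos groundMass_pos 2
  -- The parameters are chosen in the order `β`, `T`, `ε`. The first bound on `β` controls the
  -- localization error, the second the part of the overlap error due to the cutoff.
  set β := min (δ / 256) (groundMass ^ 2 * (δ / 4) / (M₁ + 1)) with hβd
  have hβ : 0 < β := by positivity
  have hβδ : β ≤ δ / 256 := min_le_left _ _
  have hβM : β ^ 2 * M₁ ≤ groundMass ^ 2 * (δ / 4) := by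
    have h3 : β * (M₁ + 1) ≤ groundMass ^ 2 * (δ / 4) :=
      (le_div_iff₀ (by positivity)).1 (min_le_right _ _)
    have h4 : β ^ 2 * M₁ ≤ β * M₁ := by
      have : β ≤ 1 := by linarith
      gcongr; nlinarith
    nlinarith
  -- The three terms secure, in order, `k/(1+t) ≤ ¼` beyond `T`, the smallness of the correction to
  -- `k/2`, and that of `t c²/16`.
  set T := 4 * k + 2 * (k * (1 + 2 * k)) / (k - 2) + 1 / (4 * β ^ 2 * (k - 2)) with hTd
  have hk2 : 0 < k - 2 := by linarith
  have p1 : 0 < 2 * (k * (1 + 2 * k)) / (k - 2) := by positivity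
  have p2 : 0 < 1 / (4 * β ^ 2 * (k - 2)) := by positivity
  have hT0 : 0 < T := by positivity
  have hT : 4 * k ≤ T := by linarith
  have hT1 : k * (1 + 2 * k) / (2 * (1 + T)) ≤ (k - 2) / 4 := by
    have : 2 * (k * (1 + 2 * k)) / (k - 2) ≤ 1 + T := by linarith
    rw [div_le_iff₀ hk2] at this
    rw [div_le_div_iff₀ (by positivity) (by norm_num)]
    nlinarith
  have hT2 : 1 / (16 * β ^ 2 * T) ≤ (k - 2) / 4 := by
    have : 1 / (4 * β ^ 2 * (k - 2)) ≤ T := by linarith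
    rw [div_le_iff₀ (by positivity)] at this
    rw [div_le_div_iff₀ (by positivity) (by norm_num)]
    nlinarith
  set D := (k + 1) * Real.exp (T / 4) with hD
  have hDp : 0 < D := by positivity
  -- The bound `1` gives `ε² ≤ ε`; the second bound keeps the slope near `¼` up to `T`; the third
  -- handles the part of the overlap error due to truncation.
  set ε := min 1 (min (δ / 4 / (T * D ^ 2)) (groundMass ^ 2 * (δ / 4) / (M₂ + 1))) with hεd
  have hε : 0 < ε := by positivity
  have hε1 : ε ≤ 1 := min_le_left _ _
  have hε2 : ε * (T * D ^ 2) ≤ δ / 4 :=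
    (le_div_iff₀ (by positivity)).1 ((min_le_right _ _).trans (min_le_left _ _))
  have hε3 : ε * (M₂ + 1) ≤ groundMass ^ 2 * (δ / 4) :=
    (le_div_iff₀ (by positivity)).1 ((min_le_right _ _).trans (min_le_right _ _))
  have hεT : T * ((k + 1) * (ε * Real.exp (T / 4))) ^ 2 ≤ δ / 4 := by
    have e : T * ((k + 1) * (ε * Real.exp (T / 4))) ^ 2 = ε * (ε * (T * D ^ 2)) := by
      rw [hD]; ring
    rw [e]
    have : 0 ≤ ε * (T * D ^ 2) := by positivity
    nlinarith
  refine ⟨ε, hε, fun A p hp => form_truncWeight_lower A (by linarith) hβ hε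
    (potential_lower hk hβ hδ1 hβδ hε hT hT1 hT2 hεT) ?_ hp⟩
  nlinarith

/-- Once `ε` is fixed, the truncated weight may be exchanged for the polynomial one: the term `ε
(1+|ξ|²)^(-k)` bounds the reciprocal below, and Gaussian decay bounds it above. -/
lemma exists_truncWeight_le {k ε : ℝ} (hε : 0 < ε) :
    ∃ c > 0, ∀ x, c * wt k x ≤ truncWeight k ε x ∧ truncWeight k ε x ≤ ε⁻¹ * wt k x := by
  obtain ⟨C, hC, h⟩ := exists_exp_le_wt k
  refine ⟨(C + ε)⁻¹, by positivity, fun x => ?_⟩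
  have hk := wt_pos k x
  have e : wt (-k) x = (wt k x)⁻¹ := eq_inv_of_mul_eq_one_left (wt_neg_mul k x)
  have h1 := h x
  have hJ := wt_pos (-k) x
  have hr := recWeight_pos (k := k) hε x
  have e2 : ∀ c : ℝ, c⁻¹ * wt k x = (c * wt (-k) x)⁻¹ := fun c => by
    rw [e, mul_inv, inv_inv]
  rw [e2, e2]
  unfold truncWeight
  constructor
  · refine inv_anti₀ hr ?_
    unfold recWeight; linarith
  · refine inv_anti₀ (by positivity) ?_
    unfold recWeight; linarith [Real.exp_pos (-‖x‖ ^ 2 / 4)]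

/-! ### A priori estimates for test fields -/

lemma IsTest.integrable_mul_mul {f g W : Plane → ℝ} (hf : IsTest f) (hg : IsTest g)
    (hW : ContDiff ℝ ∞ W) : Integrable fun x => f x * g x * W x :=
  ((hf.mul_smooth hg.1).mul_smooth hW).integrable

lemma IsTest.integrable_sq_mul {f W : Plane → ℝ} (hf : IsTest f) (hW : ContDiff ℝ ∞ W) :
    Integrable fun x => f x ^ 2 * W x := by
  simpa only [sq] using hf.integrable_mul_mul hf hW

lemma integral_sq_mul_nonneg (f : Plane → ℝ) {W : Plane → ℝ} (hW : ∀ x, 0 ≤ W x) :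
    0 ≤ ∫ x, f x ^ 2 * W x :=
  integral_nonneg fun x => mul_nonneg (sq_nonneg _) (hW x)

lemma integral_mul_mul_le {f g W : Plane → ℝ} (hf : IsTest f) (hg : IsTest g)
    (hW : ContDiff ℝ ∞ W) (hW0 : ∀ x, 0 ≤ W x) {δ : ℝ} (hδ : 0 < δ) :
    ∫ x, f x * g x * W x ≤ δ / 2 * (∫ x, g x ^ 2 * W x) + 1 / (2 * δ) * ∫ x, f x ^ 2 * W x := by
  have i1 := (hg.integrable_sq_mul hW).const_mul (δ / 2)
  have i2 := (hf.integrable_sq_mul hW).const_mul (1 / (2 * δ))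
  rw [← integral_const_mul, ← integral_const_mul, ← integral_add i1 i2]
  refine integral_mono (hf.integrable_mul_mul hg hW) (i1.add i2) fun x => ?_
  have h : f x * g x ≤ δ / 2 * g x ^ 2 + 1 / (2 * δ) * f x ^ 2 := by
    have e : δ / 2 * g x ^ 2 + 1 / (2 * δ) * f x ^ 2 - f x * g x
        = (δ * g x - f x) ^ 2 / (2 * δ) := by field_simp; ring
    have : 0 ≤ (δ * g x - f x) ^ 2 / (2 * δ) := by positivity
    linarith
  have := mul_le_mul_of_nonneg_right h (hW0 x)
  simp only []
  linarith

/-- The real part of the pairing of `(λ - M)(p + iq)` with `p + iq`, where `λ = a + ib`. The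
imaginary part `b` cancels, which makes the estimates uniform along vertical lines. -/
lemma integral_pair_eq {p q P Q W : Plane → ℝ} (hp : IsTest p) (hq : IsTest q) (hP : IsTest P)
    (hQ : IsTest Q) (hW : ContDiff ℝ ∞ W) (a b : ℝ) :
    (∫ x, (a * p x - b * q x - P x) * p x * W x) + (∫ x, (b * p x + a * q x - Q x) * q x * W x)
      = a * ((∫ x, p x ^ 2 * W x) + ∫ x, q x ^ 2 * W x) - (∫ x, P x * p x * W x)
        - ∫ x, Q x * q x * W x := by
  have e1 : ∫ x, (a * p x - b * q x - P x) * p x * W x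
      = a * (∫ x, p x ^ 2 * W x) - b * (∫ x, p x * q x * W x) - ∫ x, P x * p x * W x := by
    rw [← integral_const_mul, ← integral_const_mul, ← integral_sub, ← integral_sub]
    · congr 1; funext x; ring
    exacts [((hp.integrable_sq_mul hW).const_mul a).sub ((hp.integrable_mul_mul hq hW).const_mul b),
      hP.integrable_mul_mul hp hW, (hp.integrable_sq_mul hW).const_mul a,
      (hp.integrable_mul_mul hq hW).const_mul b]
  have e2 : ∫ x, (b * p x + a * q x - Q x) * q x * W x
      = b * (∫ x, p x * q x * W x) + a * (∫ x, q x ^ 2 * W x) - ∫ x, Q x * q x * W x := by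
    rw [← integral_const_mul, ← integral_const_mul, ← integral_add, ← integral_sub]
    · congr 1; funext x; ring
    exacts [((hp.integrable_mul_mul hq hW).const_mul b).add ((hq.integrable_sq_mul hW).const_mul a),
      hQ.integrable_mul_mul hq hW, (hp.integrable_mul_mul hq hW).const_mul b,
      (hq.integrable_sq_mul hW).const_mul a]
  rw [e1, e2]; ring

lemma sq_advect_id_le (p : Plane → ℝ) (x : Plane) :
    advect (fun x => x) p x ^ 2 ≤ ‖x‖ ^ 2 * gradSq p x := by
  unfold advect gradSq
  rw [norm_sq_eq]
  nlinarith [sq_nonneg (x 0 * partialD 1 p x - x 1 * partialD 0 p x)]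

/-- A Hardy inequality for weights that increase along rays. -/
lemma hardy_monotone {p W : Plane → ℝ} (hp : IsTest p) (hW : ContDiff ℝ ∞ W) (hW0 : ∀ x, 0 ≤ W x)
    (hmono : ∀ x, 0 ≤ advect (fun x => x) W x) :
    ∫ x, p x ^ 2 * W x ≤ ∫ x, advect (fun x => x) p x ^ 2 * W x := by
  have hadv : IsTest (advect (fun x => x) p) := hp.advect (v := fun x => x) contDiff_coord
  have h1 := integral_mul_radial hp hW
  have i1 := hp.integrable_sq_mul hW
  have h2 := integral_mul_mul_le (hadv.const_mul (-1)) hp hW hW0 one_pos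
  have e1 : ∫ x, -1 * advect (fun x => x) p x * p x * W x
      = -∫ x, W x * p x * advect (fun x => x) p x := by
    rw [← integral_neg]; congr 1; funext x; ring
  have e2 : ∫ x, (-1 * advect (fun x => x) p x) ^ 2 * W x
      = ∫ x, advect (fun x => x) p x ^ 2 * W x := by
    congr 1; funext x; ring
  have h4 : ∫ x, p x ^ 2 * W x
      ≤ -∫ x, -(1 / 2) * (2 * W x + advect (fun x => x) W x) * p x ^ 2 := by
    rw [← integral_neg]
    have i2 : Integrable fun x =>
        -(-(1 / 2) * (2 * W x + advect (fun x => x) W x) * p x ^ 2) := by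
      have := ((hp.mul_smooth hp.1).smooth_mul ((contDiff_const (c := (1 / 2 : ℝ))).mul
        ((contDiff_const (c := (2 : ℝ))).mul hW |>.add
          (contDiff_advect (v := fun x => x) contDiff_coord hW))))
      exact this.integrable.congr (Filter.Eventually.of_forall fun x => by simp only []; ring)
    refine integral_mono i1 i2 fun x => ?_
    simp only []
    nlinarith [mul_nonneg (hmono x) (sq_nonneg (p x))]
  rw [e1, e2, h1] at h2
  linarith

lemma sq_advect_mul_wt_le (k : ℝ) (p : Plane → ℝ) (x : Plane) :
    advect (fun x => x) p x ^ 2 * wt k x ≤ gradSq p x * wt (k + 1) x := by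
  have := sq_advect_id_le p x
  have hg := gradSq_nonneg p x
  rw [wt_add, wt_one]
  have hk := wt_pos k x
  have h4 : advect (fun x => x) p x ^ 2 ≤ gradSq p x * (1 + ‖x‖ ^ 2) := by linarith
  calc _ ≤ gradSq p x * (1 + ‖x‖ ^ 2) * wt k x := by gcongr
    _ = _ := by ring

/-- One power of weight is traded for one derivative. This is why stream functions live in weight `m
- 1` when fields live in weight `m`. -/
lemma hardy_test {k : ℝ} (hk : 0 ≤ k) {p : Plane → ℝ} (hp : IsTest p) :
    ∫ x, p x ^ 2 * wt k x ≤ ∫ x, gradSq p x * wt (k + 1) x := by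
  have hadv : IsTest (advect (fun x => x) p) := hp.advect (v := fun x => x) contDiff_coord
  refine (hardy_monotone hp (contDiff_wt k) (fun x => (wt_pos k x).le) fun x => ?_).trans
    (integral_mono (hadv.integrable_sq_mul (contDiff_wt k))
      (hp.gradSq.mul_smooth (contDiff_wt (k + 1))).integrable (sq_advect_mul_wt_le k p))
  have e : advect (fun x => x) (wt k) x = 2 * k * wt (k - 1) x * ‖x‖ ^ 2 := by
    unfold advect; rw [partialD_wt, partialD_wt, norm_sq_eq]; ring
  rw [e]
  have := wt_pos (k - 1) x
  positivity

lemma gradSq_eq_perpR (p : Plane → ℝ) (x : Plane) :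
    gradSq p x = perpR p 0 x ^ 2 + perpR p 1 x ^ 2 := by
  rw [perpR_zero, perpR_one]; unfold gradSq; ring

lemma IsTest.perpR {p : Plane → ℝ} (hp : IsTest p) (i : Fin 2) : IsTest (perpR p i) := by
  fin_cases i
  · simp only [Fin.zero_eta, perpR_zero]; exact hp.partialD 1
  · simp only [Fin.mk_one, perpR_one]
    exact ⟨(hp.partialD 0).1.neg, by simpa using ((hp.partialD 0).const_mul (-1)).2⟩

lemma integral_gradSq_eq {p W : Plane → ℝ} (hp : IsTest p) (hW : ContDiff ℝ ∞ W) :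
    ∫ x, gradSq p x * W x
      = (∫ x, OseenLinearization.perpR p 0 x ^ 2 * W x)
        + ∫ x, OseenLinearization.perpR p 1 x ^ 2 * W x := by
  rw [← integral_add ((hp.perpR 0).integrable_sq_mul hW) ((hp.perpR 1).integrable_sq_mul hW)]
  congr 1; funext x; rw [gradSq_eq_perpR]; ring

lemma IsTest.linOpR_perpR (A : ℝ) {p : Plane → ℝ} (hp : IsTest p) (i : Fin 2) :
    IsTest (linOpR A (OseenLinearization.perpR p) i) := by
  have : linOpR A (OseenLinearization.perpR p) i = OseenLinearization.perpR (OseenLinearization.streamOp A p) i :=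
    funext fun x => (perpR_streamOp A hp.1 i x).symm
  rw [this]
  exact (hp.streamOp A).perpR i

/-- Energy estimate for the operator on fields. -/
lemma energy_linOpR (A m : ℝ) : ∃ C, 0 ≤ C ∧ ∀ p : Plane → ℝ, IsTest p →
    (m - 1) / 2 * (∫ x, gradSq p x * wt m x) - C * (∫ x, gradSq p x * wt (m - 1) x)
      ≤ -(∫ x, linOpR A (perpR p) 0 x * perpR p 0 x * wt m x)
        - ∫ x, linOpR A (perpR p) 1 x * perpR p 1 x * wt m x := by
  obtain ⟨C, hC, hE⟩ := energy_wt m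
  obtain ⟨D, hD, hu⟩ := exists_bound_partialD_oseen
  refine ⟨C + 2 * |A| * D, by positivity, fun p hp => ?_⟩
  have hw := contDiff_wt m
  set cpl : Fin 2 → Plane → ℝ := fun i x => perpR p 0 x * partialD 0 (fun z => oseen z i) x
    + perpR p 1 x * partialD 1 (fun z => oseen z i) x with hcpl
  have tc : ∀ i, IsTest (cpl i) := fun i =>
    ((hp.perpR 0).mul_smooth (contDiff_partialD (contDiff_oseen_apply i) 0)).add
      ((hp.perpR 1).mul_smooth (contDiff_partialD (contDiff_oseen_apply i) 1))
  have split : ∀ i, ∫ x, linOpR A (perpR p) i x * perpR p i x * wt m x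
      = (∫ x, driftOp A (perpR p i) x * perpR p i x * wt m x)
        + (∫ x, perpR p i x ^ 2 * wt m x) + A * ∫ x, cpl i x * perpR p i x * wt m x := by
    intro i
    have i1 := ((hp.perpR i).driftOp A).integrable_mul_mul (hp.perpR i) hw
    have i2 := (hp.perpR i).integrable_sq_mul hw
    have i3 := (tc i).integrable_mul_mul (hp.perpR i) hw
    rw [← integral_const_mul, ← integral_add i1 i2, ← integral_add]
    · congr 1; funext x; simp only [hcpl, linOpR]; ring
    exacts [i1.add i2, i3.const_mul A]
  have iG := (hp.gradSq.mul_smooth (contDiff_wt (m - 1))).integrable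
  -- The velocity gradient decays like `(1+|ξ|²)⁻¹`, so the coupling is controlled in weight `m -
  -- 1`, independently of the size of `A` relative to the leading term.
  have cb : |∫ x, (cpl 0 x * perpR p 0 x * wt m x + cpl 1 x * perpR p 1 x * wt m x)|
      ≤ 2 * D * ∫ x, gradSq p x * wt (m - 1) x := by
    rw [← integral_const_mul, ← Real.norm_eq_abs]
    refine norm_integral_le_of_norm_le (iG.const_mul _) (Filter.Eventually.of_forall fun x => ?_)
    have hb : ∀ i j : Fin 2, |partialD j (fun z => oseen z i) x| * wt m x ≤ D * wt (m - 1) x := by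
      intro i j
      rw [wt_eq_mul_sub_one m]
      have := mul_le_mul_of_nonneg_right (hu i j x) (wt_pos (m - 1) x).le
      linarith
    rw [Real.norm_eq_abs, gradSq_eq_perpR]
    simp only [hcpl]
    set y := perpR p 0 x
    set z := perpR p 1 x
    have h00 := hb 0 0
    have h01 := hb 0 1
    have h10 := hb 1 0
    have h11 := hb 1 1
    have hwp := wt_pos m x
    set B := D * wt (m - 1) x
    have e : (y * partialD 0 (fun z => oseen z 0) x + z * partialD 1 (fun z => oseen z 0) x) * y
          * wt m x
        + (y * partialD 0 (fun z => oseen z 1) x + z * partialD 1 (fun z => oseen z 1) x) * z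
          * wt m x
        = y * y * (partialD 0 (fun z => oseen z 0) x * wt m x)
          + z * y * (partialD 1 (fun z => oseen z 0) x * wt m x)
          + y * z * (partialD 0 (fun z => oseen z 1) x * wt m x)
          + z * z * (partialD 1 (fun z => oseen z 1) x * wt m x) := by ring
    rw [e]
    have hm : ∀ c d r : ℝ, |r| * wt m x ≤ B → |c * d * (r * wt m x)| ≤ |c| * |d| * B := by
      intro c d r hr
      rw [abs_mul, abs_mul, abs_mul, abs_of_pos hwp]
      gcongr
    calc _ ≤ |y| * |y| * B + |z| * |y| * B + |y| * |z| * B + |z| * |z| * B := by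
          refine (abs_add_le _ _).trans (add_le_add ((abs_add_le _ _).trans
            (add_le_add ((abs_add_le _ _).trans (add_le_add ?_ ?_)) ?_)) ?_)
          exacts [hm _ _ _ h00, hm _ _ _ h01, hm _ _ _ h10, hm _ _ _ h11]
      _ = (|y| + |z|) ^ 2 * B := by ring
      _ ≤ (2 * (y ^ 2 + z ^ 2)) * B := by
          have hB : 0 ≤ B := by
            have := wt_pos (m - 1) x
            positivity
          gcongr
          rw [← sq_abs y, ← sq_abs z]
          nlinarith [sq_nonneg (|y| - |z|)]
      _ = 2 * D * ((y ^ 2 + z ^ 2) * wt (m - 1) x) := by ring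
  rw [integral_add ((tc 0).integrable_mul_mul (hp.perpR 0) hw)
    ((tc 1).integrable_mul_mul (hp.perpR 1) hw)] at cb
  have E0 := hE A _ (hp.perpR 0)
  have E1 := hE A _ (hp.perpR 1)
  rw [split 0, split 1, integral_gradSq_eq hp hw, integral_gradSq_eq hp (contDiff_wt (m - 1))]
  rw [integral_gradSq_eq hp (contDiff_wt (m - 1))] at cb
  have G0 : 0 ≤ ∫ x, gradSq (perpR p 0) x * wt m x :=
    integral_nonneg fun x => mul_nonneg (gradSq_nonneg _ _) (wt_pos _ _).le
  have G1 : 0 ≤ ∫ x, gradSq (perpR p 1) x * wt m x :=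
    integral_nonneg fun x => mul_nonneg (gradSq_nonneg _ _) (wt_pos _ _).le
  have cb2 : A * ((∫ x, cpl 0 x * perpR p 0 x * wt m x) + ∫ x, cpl 1 x * perpR p 1 x * wt m x)
      ≤ |A| * (2 * D * ((∫ x, perpR p 0 x ^ 2 * wt (m - 1) x)
        + ∫ x, perpR p 1 x ^ 2 * wt (m - 1) x)) := by
    refine (le_abs_self _).trans ?_
    rw [abs_mul]
    gcongr
  linarith

/-- The real part of `(λ - M)(p + iq)`, where `λ = a + ib` and `M` is a real operator. -/
def shiftRe (a b : ℝ) (p q P : Plane → ℝ) (x : Plane) : ℝ := a * p x - b * q x - P x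

/-- The imaginary part of `(λ - M)(p + iq)`, where `λ = a + ib` and `M` is a real operator. -/
def shiftIm (a b : ℝ) (p q Q : Plane → ℝ) (x : Plane) : ℝ := b * p x + a * q x - Q x

lemma IsTest.shiftRe {p q P : Plane → ℝ} (hp : IsTest p) (hq : IsTest q) (hP : IsTest P)
    (a b : ℝ) : IsTest (shiftRe a b p q P) := ((hp.const_mul a).sub (hq.const_mul b)).sub hP

lemma IsTest.shiftIm {p q Q : Plane → ℝ} (hp : IsTest p) (hq : IsTest q) (hQ : IsTest Q)
    (a b : ℝ) : IsTest (shiftIm a b p q Q) := ((hp.const_mul b).add (hq.const_mul a)).sub hQ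

lemma perpR_shiftRe {p q P : Plane → ℝ} (hp : ContDiff ℝ ∞ p) (hq : ContDiff ℝ ∞ q)
    (hP : ContDiff ℝ ∞ P) (a b : ℝ) (i : Fin 2) (x : Plane) :
    perpR (shiftRe a b p q P) i x = shiftRe a b (perpR p i) (perpR q i) (perpR P i) x := by
  have h : ∀ j, partialD j (shiftRe a b p q P) x
      = a * partialD j p x - b * partialD j q x - partialD j P x := fun j => by
    unfold shiftRe
    rw [partialD_sub ((contDiff_const.mul hp).sub (contDiff_const.mul hq)) hP,
      partialD_sub (contDiff_const.mul hp) (contDiff_const.mul hq), partialD_const_mul hp,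
      partialD_const_mul hq]
  unfold perpR
  split_ifs <;> simp only [h] <;> unfold shiftRe <;> ring

lemma perpR_shiftIm {p q Q : Plane → ℝ} (hp : ContDiff ℝ ∞ p) (hq : ContDiff ℝ ∞ q)
    (hQ : ContDiff ℝ ∞ Q) (a b : ℝ) (i : Fin 2) (x : Plane) :
    perpR (shiftIm a b p q Q) i x = shiftIm a b (perpR p i) (perpR q i) (perpR Q i) x := by
  have h : ∀ j, partialD j (shiftIm a b p q Q) x
      = b * partialD j p x + a * partialD j q x - partialD j Q x := fun j => by
    unfold shiftIm
    rw [partialD_sub ((contDiff_const.mul hp).add (contDiff_const.mul hq)) hQ,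
      partialD_add (contDiff_const.mul hp) (contDiff_const.mul hq), partialD_const_mul hp,
      partialD_const_mul hq]
  unfold perpR
  split_ifs <;> simp only [h] <;> unfold shiftIm <;> ring

/-- A bound for the stream function by the image, modulo the mean. -/
lemma stream_bound (A : ℝ) {k δ : ℝ} (hk : 2 < k) (hδ : 0 < δ) (hδ1 : δ ≤ 1) :
    ∃ C, 0 ≤ C ∧ ∀ a b : ℝ, -1 + 2 * δ ≤ a → ∀ p q : Plane → ℝ, IsTest p → IsTest q →
    (∫ x, p x ^ 2 * wt k x) + (∫ x, q x ^ 2 * wt k x)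
      ≤ C * ((∫ x, shiftRe a b p q (streamOp A p) x ^ 2 * wt k x)
        + (∫ x, shiftIm a b p q (streamOp A q) x ^ 2 * wt k x)
        + ((∫ x, p x) ^ 2 + (∫ x, q x) ^ 2)) := by
  obtain ⟨ε, hε, hco⟩ := exists_coercive_weight hk hδ hδ1
  obtain ⟨c, hc, hcmp⟩ := exists_truncWeight_le (k := k) hε
  have hZ : 0 < groundMass ^ 2 := pow_pos groundMass_pos 2
  set K := max (1 / (2 * δ) * ε⁻¹) (1 / groundMass ^ 2) with hK
  refine ⟨2 / (δ * c) * K, by positivity, fun a b ha p q hp hq => ?_⟩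
  set w := truncWeight k ε with hwd
  have hw : ContDiff ℝ ∞ w := contDiff_truncWeight hε
  have hw0 : ∀ x, 0 ≤ w x := fun x => (truncWeight_pos hε x).le
  have hMp := hp.streamOp A
  have hMq := hq.streamOp A
  have tf := hp.shiftRe hq hMp a b
  have tg := hp.shiftIm hq hMq a b
  set f := shiftRe a b p q (streamOp A p) with hf
  set g := shiftIm a b p q (streamOp A q) with hg
  have pair := integral_pair_eq hp hq hMp hMq hw a b
  have y1 := integral_mul_mul_le tf hp hw hw0 hδ
  have y2 := integral_mul_mul_le tg hq hw hw0 hδ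
  have c1 := hco A p hp
  have c2 := hco A q hq
  have n1 := integral_sq_mul_nonneg p hw0
  have n2 := integral_sq_mul_nonneg q hw0
  have up : ∀ h : Plane → ℝ, IsTest h → ∫ x, h x ^ 2 * w x ≤ ε⁻¹ * ∫ x, h x ^ 2 * wt k x := by
    intro h th
    rw [← integral_const_mul]
    refine integral_mono (th.integrable_sq_mul hw)
      ((th.integrable_sq_mul (contDiff_wt k)).const_mul _) fun x => ?_
    have := mul_le_mul_of_nonneg_left (hcmp x).2 (sq_nonneg (h x))
    simp only []; linarith
  have lo : ∀ h : Plane → ℝ, IsTest h → c * (∫ x, h x ^ 2 * wt k x) ≤ ∫ x, h x ^ 2 * w x := by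
    intro h th
    rw [← integral_const_mul]
    refine integral_mono ((th.integrable_sq_mul (contDiff_wt k)).const_mul _)
      (th.integrable_sq_mul hw) fun x => ?_
    have := mul_le_mul_of_nonneg_left (hcmp x).1 (sq_nonneg (h x))
    simp only []; linarith
  have u1 := up f tf
  have u2 := up g tg
  have l1 := lo p hp
  have l2 := lo q hq
  have f0 := integral_sq_mul_nonneg f fun x => (wt_pos k x).le
  have g0 := integral_sq_mul_nonneg g fun x => (wt_pos k x).le
  have e1 : (∫ x, (a * p x - b * q x - streamOp A p x) * p x * w x) = ∫ x, f x * p x * w x := rfl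
  have e2 : (∫ x, (b * p x + a * q x - streamOp A q x) * q x * w x) = ∫ x, g x * q x * w x := rfl
  rw [e1, e2] at pair
  have k1 : 1 / (2 * δ) * ((∫ x, f x ^ 2 * w x) + ∫ x, g x ^ 2 * w x)
      ≤ K * ((∫ x, f x ^ 2 * wt k x) + ∫ x, g x ^ 2 * wt k x) := by
    calc _ ≤ 1 / (2 * δ) * (ε⁻¹ * (∫ x, f x ^ 2 * wt k x) + ε⁻¹ * ∫ x, g x ^ 2 * wt k x) := by
          gcongr
      _ = (1 / (2 * δ) * ε⁻¹) * ((∫ x, f x ^ 2 * wt k x) + ∫ x, g x ^ 2 * wt k x) := by ring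
      _ ≤ _ := by
        have : 1 / (2 * δ) * ε⁻¹ ≤ K := le_max_left _ _
        gcongr
  have k2 : 1 / groundMass ^ 2 * ((∫ x, p x) ^ 2 + (∫ x, q x) ^ 2)
      ≤ K * ((∫ x, p x) ^ 2 + (∫ x, q x) ^ 2) := by
    have : 1 / groundMass ^ 2 ≤ K := le_max_right _ _
    gcongr
  have a1 := mul_le_mul_of_nonneg_right ha (add_nonneg n1 n2)
  -- Coercivity gives `1 - δ`, the spectral parameter adds `a ≥ -1 + 2δ`, and Young's inequality
  -- spends `δ/2` of the remaining `δ`.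
  have main : δ / 2 * ((∫ x, p x ^ 2 * w x) + ∫ x, q x ^ 2 * w x)
      ≤ K * ((∫ x, f x ^ 2 * wt k x) + (∫ x, g x ^ 2 * wt k x)
        + ((∫ x, p x) ^ 2 + (∫ x, q x) ^ 2)) := by linarith
  have main2 : δ * c / 2 * ((∫ x, p x ^ 2 * wt k x) + ∫ x, q x ^ 2 * wt k x)
      ≤ K * ((∫ x, f x ^ 2 * wt k x) + (∫ x, g x ^ 2 * wt k x)
        + ((∫ x, p x) ^ 2 + (∫ x, q x) ^ 2)) := by
    refine le_trans ?_ main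
    have := mul_le_mul_of_nonneg_left (add_le_add l1 l2) (half_pos hδ).le
    linarith
  have e3 : 2 / (δ * c) * K * ((∫ x, f x ^ 2 * wt k x) + (∫ x, g x ^ 2 * wt k x)
        + ((∫ x, p x) ^ 2 + (∫ x, q x) ^ 2))
      = (K * ((∫ x, f x ^ 2 * wt k x) + (∫ x, g x ^ 2 * wt k x)
        + ((∫ x, p x) ^ 2 + (∫ x, q x) ^ 2))) / (δ * c / 2) := by field_simp
  rw [e3, le_div_iff₀ (by positivity)]
  linarith

/-- The gradient is controlled by the stream function and its image. -/
lemma gradient_bound (A k : ℝ) (hk : 0 ≤ k) : ∃ C, 0 ≤ C ∧ ∀ a b : ℝ, -1 ≤ a →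
    ∀ p q : Plane → ℝ, IsTest p → IsTest q →
    (∫ x, gradSq p x * wt k x) + (∫ x, gradSq q x * wt k x)
      ≤ C * ((∫ x, p x ^ 2 * wt k x) + (∫ x, q x ^ 2 * wt k x))
        + ((∫ x, shiftRe a b p q (streamOp A p) x ^ 2 * wt k x)
        + (∫ x, shiftIm a b p q (streamOp A q) x ^ 2 * wt k x)) := by
  obtain ⟨C, hC, hE⟩ := energy_wt k
  refine ⟨C + 2, by positivity, fun a b ha p q hp hq => ?_⟩
  have hw := contDiff_wt k
  have hw0 : ∀ x, 0 ≤ wt k x := fun x => (wt_pos k x).le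
  have hMp := hp.streamOp A
  have hMq := hq.streamOp A
  have tf := hp.shiftRe hq hMp a b
  have tg := hp.shiftIm hq hMq a b
  have pair := integral_pair_eq hp hq hMp hMq hw a b
  have y1 := integral_mul_mul_le tf hp hw hw0 one_pos
  have y2 := integral_mul_mul_le tg hq hw hw0 one_pos
  set f := shiftRe a b p q (streamOp A p) with hf
  set g := shiftIm a b p q (streamOp A q) with hg
  have st : ∀ p : Plane → ℝ, IsTest p → ∫ x, streamOp A p x * p x * wt k x
      = (∫ x, driftOp A p x * p x * wt k x) + (1 / 2) * ∫ x, p x ^ 2 * wt k x := by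
    intro p hp
    rw [← integral_const_mul, ← integral_add ((hp.driftOp A).integrable_mul_mul hp hw)
      ((hp.integrable_sq_mul hw).const_mul _)]
    congr 1; funext x; unfold streamOp; ring
  have mono : ∀ p : Plane → ℝ, IsTest p →
      ∫ x, p x ^ 2 * wt (k - 1) x ≤ ∫ x, p x ^ 2 * wt k x := by
    intro p hp
    refine integral_mono (hp.integrable_sq_mul (contDiff_wt (k - 1))) (hp.integrable_sq_mul hw)
      fun x => ?_
    exact mul_le_mul_of_nonneg_left (wt_mono (by linarith) x) (sq_nonneg _)
  have E1 := hE A p hp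
  have E2 := hE A q hq
  have n1 := integral_sq_mul_nonneg p hw0
  have n2 := integral_sq_mul_nonneg q hw0
  have f0 := integral_sq_mul_nonneg f hw0
  have g0 := integral_sq_mul_nonneg g hw0
  have m1 := mul_le_mul_of_nonneg_left (mono p hp) hC
  have m2 := mul_le_mul_of_nonneg_left (mono q hq) hC
  have a1 := mul_le_mul_of_nonneg_right ha (add_nonneg n1 n2)
  have k1 := mul_nonneg hk (add_nonneg n1 n2)
  rw [st p hp, st q hq] at pair
  have e1 : (∫ x, (a * p x - b * q x - streamOp A p x) * p x * wt k x)
      = ∫ x, f x * p x * wt k x := rfl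
  have e2 : (∫ x, (b * p x + a * q x - streamOp A q x) * q x * wt k x)
      = ∫ x, g x * q x * wt k x := rfl
  rw [e1, e2] at pair
  linarith

/-- The field is controlled by its image, modulo a weaker norm. -/
lemma field_bound (A : ℝ) {m : ℝ} (hm : 3 < m) : ∃ C, 0 ≤ C ∧ ∀ a b : ℝ, -1 ≤ a →
    ∀ p q : Plane → ℝ, IsTest p → IsTest q →
    (∫ x, gradSq p x * wt m x) + (∫ x, gradSq q x * wt m x)
      ≤ C * ((∫ x, gradSq p x * wt (m - 1) x) + (∫ x, gradSq q x * wt (m - 1) x)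
        + ((∫ x, gradSq (shiftRe a b p q (streamOp A p)) x * wt m x)
        + (∫ x, gradSq (shiftIm a b p q (streamOp A q)) x * wt m x))) := by
  obtain ⟨C, hC, hE⟩ := energy_linOpR A m
  -- The leading constant `(m - 1)/2` of `energy_linOpR` plus `a ≥ -1` leaves `(m - 3)/2`, positive
  -- because `m > 3`.
  set γ := (m - 3) / 2 with hγ
  have hγ0 : 0 < γ := by rw [hγ]; linarith
  set K := max C (1 / (2 * γ)) with hK
  have hK0 : 0 ≤ K := hC.trans (le_max_left _ _)
  refine ⟨2 / γ * K, by positivity, fun a b ha p q hp hq => ?_⟩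
  have hw := contDiff_wt m
  have hw0 : ∀ x, 0 ≤ wt m x := fun x => (wt_pos m x).le
  have tf := hp.shiftRe hq (hp.streamOp A) a b
  have tg := hp.shiftIm hq (hq.streamOp A) a b
  have E1 := hE p hp
  have E2 := hE q hq
  have comp : ∀ i : Fin 2, -(∫ x, linOpR A (perpR p) i x * perpR p i x * wt m x)
        - (∫ x, linOpR A (perpR q) i x * perpR q i x * wt m x)
      + a * ((∫ x, perpR p i x ^ 2 * wt m x) + ∫ x, perpR q i x ^ 2 * wt m x)
      ≤ γ / 2 * ((∫ x, perpR p i x ^ 2 * wt m x) + ∫ x, perpR q i x ^ 2 * wt m x)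
        + 1 / (2 * γ) * ((∫ x, perpR (shiftRe a b p q (streamOp A p)) i x ^ 2 * wt m x)
          + ∫ x, perpR (shiftIm a b p q (streamOp A q)) i x ^ 2 * wt m x) := by
    intro i
    have pair := integral_pair_eq (hp.perpR i) (hq.perpR i) (hp.linOpR_perpR A i)
      (hq.linOpR_perpR A i) hw a b
    have y1 := integral_mul_mul_le (tf.perpR i) (hp.perpR i) hw hw0 hγ0
    have y2 := integral_mul_mul_le (tg.perpR i) (hq.perpR i) hw hw0 hγ0
    have e1 : ∀ x, a * perpR p i x - b * perpR q i x - linOpR A (perpR p) i x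
        = perpR (shiftRe a b p q (streamOp A p)) i x := fun x => by
      rw [perpR_shiftRe hp.1 hq.1 (hp.streamOp A).1, ← perpR_streamOp A hp.1]
      unfold shiftRe
      rw [perpR_streamOp A hp.1]
    have e2 : ∀ x, b * perpR p i x + a * perpR q i x - linOpR A (perpR q) i x
        = perpR (shiftIm a b p q (streamOp A q)) i x := fun x => by
      rw [perpR_shiftIm hp.1 hq.1 (hq.streamOp A).1]
      unfold shiftIm
      rw [perpR_streamOp A hq.1]
    simp only [e1, e2] at pair
    linarith
  have c0 := comp 0
  have c1 := comp 1
  have nD : ∀ p : Plane → ℝ, 0 ≤ ∫ x, gradSq p x * wt (m - 1) x := fun p =>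
    integral_nonneg fun x => mul_nonneg (gradSq_nonneg _ _) (wt_pos _ _).le
  have nV : ∀ p : Plane → ℝ, 0 ≤ ∫ x, gradSq p x * wt m x := fun p =>
    integral_nonneg fun x => mul_nonneg (gradSq_nonneg _ _) (wt_pos _ _).le
  have n1 := nV p
  have n2 := nV q
  have d1 := nD p
  have d2 := nD q
  have f1 := nV (shiftRe a b p q (streamOp A p))
  have f2 := nV (shiftIm a b p q (streamOp A q))
  have s1 := integral_gradSq_eq hp hw
  have s2 := integral_gradSq_eq hq hw
  have s3 := integral_gradSq_eq tf hw
  have s4 := integral_gradSq_eq tg hw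
  set V := (∫ x, gradSq p x * wt m x) + (∫ x, gradSq q x * wt m x) with hV
  set D := (∫ x, gradSq p x * wt (m - 1) x) + (∫ x, gradSq q x * wt (m - 1) x) with hD
  set F := (∫ x, gradSq (shiftRe a b p q (streamOp A p)) x * wt m x)
        + (∫ x, gradSq (shiftIm a b p q (streamOp A q)) x * wt m x) with hF
  have main : (m - 1) / 2 * V - C * D + a * V ≤ γ / 2 * V + 1 / (2 * γ) * F := by
    rw [hV, hD, hF, s3, s4]
    rw [s1] at E1
    rw [s2] at E2
    rw [s1, s2]
    linarith
  have a1 : -1 * V ≤ a * V := by gcongr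
  have k1 : C * D ≤ K * D := by
    have : C ≤ K := le_max_left _ _
    gcongr
  have k2 : 1 / (2 * γ) * F ≤ K * F := by
    have : 1 / (2 * γ) ≤ K := le_max_right _ _
    gcongr
  have e : (m - 1) / 2 * V - V = γ * V := by rw [hγ]; ring
  have main2 : γ / 2 * V ≤ K * (D + F) := by linarith
  have e3 : 2 / γ * K * (D + F) = K * (D + F) / (γ / 2) := by field_simp
  rw [e3, le_div_iff₀ (by positivity)]
  linarith

/-- The a priori estimate: away from the mean, `λ - L_A` is bounded below uniformly in the
half-plane `Re λ ≥ -1 + 2δ`. -/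
lemma a_priori (A : ℝ) {m δ : ℝ} (hm : 3 < m) (hδ : 0 < δ) (hδ1 : δ ≤ 1) :
    ∃ C, 0 ≤ C ∧ ∀ a b : ℝ, -1 + 2 * δ ≤ a → ∀ p q : Plane → ℝ, IsTest p → IsTest q →
    (∫ x, gradSq p x * wt m x) + (∫ x, gradSq q x * wt m x)
      ≤ C * ((∫ x, gradSq (shiftRe a b p q (streamOp A p)) x * wt m x)
        + (∫ x, gradSq (shiftIm a b p q (streamOp A q)) x * wt m x)
        + ((∫ x, p x) ^ 2 + (∫ x, q x) ^ 2)) := by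
  -- The exponent `k = m - 1` exceeds `2`, as the coercivity of the stream operator requires.
  obtain ⟨C₁, h1, H1⟩ := stream_bound A (k := m - 1) (by linarith) hδ hδ1
  obtain ⟨C₂, h2, H2⟩ := gradient_bound A (m - 1) (by linarith)
  obtain ⟨C₃, h3, H3⟩ := field_bound A hm
  refine ⟨C₃ * (C₂ * C₁ + 2), by positivity, fun a b ha p q hp hq => ?_⟩
  have tf := hp.shiftRe hq (hp.streamOp A) a b
  have tg := hp.shiftIm hq (hq.streamOp A) a b
  have G1 := H1 a b ha p q hp hq
  have G2 := H2 a b (by linarith) p q hp hq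
  have G3 := H3 a b (by linarith) p q hp hq
  -- The stream function of the right side is estimated in weight `m - 1` by its gradient in weight
  -- `m`, so the final bound involves only the field norm of the right side.
  have R1 := hardy_test (k := m - 1) (by linarith) tf
  have R2 := hardy_test (k := m - 1) (by linarith) tg
  rw [sub_add_cancel] at R1 R2
  have n1 := integral_sq_mul_nonneg (shiftRe a b p q (streamOp A p)) fun x => (wt_pos (m - 1) x).le
  have n2 := integral_sq_mul_nonneg (shiftIm a b p q (streamOp A q)) fun x => (wt_pos (m - 1) x).le
  set F := (∫ x, gradSq (shiftRe a b p q (streamOp A p)) x * wt m x)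
        + (∫ x, gradSq (shiftIm a b p q (streamOp A q)) x * wt m x)
  set F' := (∫ x, shiftRe a b p q (streamOp A p) x ^ 2 * wt (m - 1) x)
        + (∫ x, shiftIm a b p q (streamOp A q) x ^ 2 * wt (m - 1) x)
  set J := (∫ x, p x ^ 2 * wt (m - 1) x) + (∫ x, q x ^ 2 * wt (m - 1) x)
  set S := (∫ x, p x) ^ 2 + (∫ x, q x) ^ 2
  have hS : 0 ≤ S := by positivity
  have hF : F' ≤ F := by linarith
  have hF0 : 0 ≤ F' := by linarith
  calc _ ≤ C₃ * (C₂ * (C₁ * (F + S)) + F + F) := by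
        refine G3.trans ?_
        have : C₂ * J ≤ C₂ * (C₁ * (F + S)) := by
          have : J ≤ C₁ * (F + S) := G1.trans (by gcongr)
          gcongr
        have : (∫ x, gradSq p x * wt (m - 1) x) + (∫ x, gradSq q x * wt (m - 1) x)
          ≤ C₂ * (C₁ * (F + S)) + F := by linarith
        gcongr
    _ ≤ C₃ * ((C₂ * C₁ + 2) * (F + S)) := by
        have : C₂ * (C₁ * (F + S)) + F + F ≤ (C₂ * C₁ + 2) * (F + S) := by nlinarith
        gcongr
    _ = _ := by ring

/-! ### Mollification in weighted spaces -/

/-- Membership in the real weighted space `L²((1 + |ξ|²)^m dξ)`. -/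
structure InL2 (m : ℝ) (g : Plane → ℝ) : Prop where
  meas : AEStronglyMeasurable g (volume : Measure Plane)
  int : Integrable fun x => g x ^ 2 * wt m x

lemma continuous_wt (m : ℝ) : Continuous (wt m) := (contDiff_wt m).continuous

lemma InL2.integrable {m : ℝ} (hm : 1 < m) {g : Plane → ℝ} (hg : InL2 m g) : Integrable g := by
  refine (hg.int.add (integrable_wt_neg hm)).mono' hg.meas (Filter.Eventually.of_forall fun x => ?_)
  have h1 := wt_pos m x
  have h2 := wt_pos (-m) x
  have h3 := wt_neg_mul m x
  rw [Real.norm_eq_abs]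
  simp only [Pi.add_apply]
  rw [← sq_abs]
  -- A completed square certifying `|g| ≤ g² (1+|ξ|²)^m + (1+|ξ|²)^(-m)`.
  have : wt (-m) x * (|g x| ^ 2 * wt m x + wt (-m) x - |g x|)
      = (|g x| - wt (-m) x / 2) ^ 2 + 3 / 4 * wt (-m) x ^ 2 := by
    linear_combination |g x| ^ 2 * h3
  have h5 : 0 ≤ wt (-m) x * (|g x| ^ 2 * wt m x + wt (-m) x - |g x|) := by rw [this]; positivity
  have := nonneg_of_mul_nonneg_right h5 h2
  linarith

lemma InL2.mono {m s : ℝ} (hs : s ≤ m) {g : Plane → ℝ} (hg : InL2 m g) : InL2 s g := by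
  refine ⟨hg.meas, hg.int.mono' ((hg.meas.pow 2).mul (continuous_wt s).aestronglyMeasurable)
    (Filter.Eventually.of_forall fun x => ?_)⟩
  rw [Real.norm_of_nonneg (mul_nonneg (sq_nonneg _) (wt_pos _ _).le)]
  exact mul_le_mul_of_nonneg_left (wt_mono hs x) (sq_nonneg _)

lemma InL2.integrable_sq {m : ℝ} (hm : 0 ≤ m) {g : Plane → ℝ} (hg : InL2 m g) :
    Integrable fun x => g x ^ 2 := by
  simpa only [wt_zero, mul_one] using (hg.mono hm).int

lemma InL2.of_le {m C : ℝ} {g h : Plane → ℝ} (hh : InL2 m h)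
    (hg : AEStronglyMeasurable g (volume : Measure Plane)) (hle : ∀ x, g x ^ 2 ≤ C * h x ^ 2) :
    InL2 m g := by
  refine ⟨hg, (hh.int.const_mul C).mono' ((hg.pow 2).mul (continuous_wt m).aestronglyMeasurable)
    (Filter.Eventually.of_forall fun x => ?_)⟩
  rw [Real.norm_of_nonneg (mul_nonneg (sq_nonneg _) (wt_pos _ _).le), ← mul_assoc]
  exact mul_le_mul_of_nonneg_right (hle x) (wt_pos _ _).le

lemma InL2.const_mul {m : ℝ} {g : Plane → ℝ} (hg : InL2 m g) (c : ℝ) :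
    InL2 m fun x => c * g x :=
  hg.of_le (C := c ^ 2) (hg.meas.const_mul c) fun _ => (mul_pow _ _ _).le

lemma InL2.abs {m : ℝ} {g : Plane → ℝ} (hg : InL2 m g) : InL2 m fun x => |g x| :=
  hg.of_le (C := 1) hg.meas.norm fun x => by rw [sq_abs, one_mul]

lemma InL2.add {m : ℝ} {g h : Plane → ℝ} (hg : InL2 m g) (hh : InL2 m h) :
    InL2 m fun x => g x + h x := by
  refine ⟨hg.meas.add hh.meas, ((hg.int.add hh.int).const_mul 2).mono'
    (((hg.meas.add hh.meas).pow 2).mul (continuous_wt m).aestronglyMeasurable)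
    (Filter.Eventually.of_forall fun x => ?_)⟩
  rw [Real.norm_of_nonneg (mul_nonneg (sq_nonneg _) (wt_pos _ _).le)]
  have h1 : (g x + h x) ^ 2 ≤ 2 * (g x ^ 2 + h x ^ 2) := by nlinarith [sq_nonneg (g x - h x)]
  have := mul_le_mul_of_nonneg_right h1 (wt_pos m x).le
  simp only [Pi.add_apply]
  linarith

lemma InL2.integrable_mul {m : ℝ} {g h : Plane → ℝ} (hg : InL2 m g) (hh : InL2 m h) :
    Integrable fun x => g x * h x * wt m x := by
  refine (hg.int.add hh.int).mono' ((hg.meas.mul hh.meas).mul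
    (continuous_wt m).aestronglyMeasurable) (Filter.Eventually.of_forall fun x => ?_)
  rw [Real.norm_eq_abs, abs_mul, abs_of_pos (wt_pos m x)]
  have h1 : |g x * h x| ≤ g x ^ 2 + h x ^ 2 := by
    rw [abs_mul, ← sq_abs (g x), ← sq_abs (h x)]
    nlinarith [sq_nonneg (|g x| - |h x|), sq_nonneg (|g x|), sq_nonneg (|h x|)]
  have := mul_le_mul_of_nonneg_right h1 (wt_pos m x).le
  simp only [Pi.add_apply]
  linarith

lemma IsTest.inL2 {p : Plane → ℝ} (hp : IsTest p) (m : ℝ) : InL2 m p :=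
  ⟨hp.1.continuous.aestronglyMeasurable, hp.integrable_sq_mul (contDiff_wt m)⟩

/-- The convolution `∫ g(t) η(x - t) dt`. -/
def moll (g η : Plane → ℝ) (x : Plane) : ℝ := ∫ t, g t * η (x - t)

lemma moll_eq_convolution (g η : Plane → ℝ) :
    moll g η = MeasureTheory.convolution g η (ContinuousLinearMap.mul ℝ ℝ) volume := rfl

lemma contDiff_moll {g η : Plane → ℝ} (hg : Integrable g) (hη : IsTest η) :
    ContDiff ℝ ∞ (moll g η) := by
  rw [moll_eq_convolution]
  exact hη.2.contDiff_convolution_right _ hg.locallyIntegrable hη.1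

lemma continuous_moll {g η : Plane → ℝ} (hg : Integrable g) (hη : Continuous η)
    (hs : HasCompactSupport η) : Continuous (moll g η) := by
  rw [moll_eq_convolution]
  exact hs.continuous_convolution_right _ hg.locallyIntegrable hη

lemma integrable_mul_comp_sub {g η : Plane → ℝ} (hg : Integrable g) (hη : Continuous η)
    (hs : HasCompactSupport η) (x : Plane) : Integrable fun t => g t * η (x - t) := by
  obtain ⟨C, hC⟩ := hη.bounded_above_of_compact_support hs
  exact hg.mul_bdd (c := C) (hη.comp (by fun_prop)).aestronglyMeasurable
    (Filter.Eventually.of_forall fun t => hC _)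

lemma partialD_moll {g η : Plane → ℝ} (hg : Integrable g) (hη : IsTest η) (j : Fin 2) :
    partialD j (moll g η) = moll g (partialD j η) := by
  funext x
  have h := hη.2.hasFDerivAt_convolution_right (ContinuousLinearMap.mul ℝ ℝ)
    hg.locallyIntegrable (hη.1.of_le (by simp)) x
  have h2 : fderiv ℝ (moll g η) x = _ := h.fderiv
  unfold partialD
  rw [h2]
  have hi : ConvolutionExistsAt g (fderiv ℝ η) x
      ((ContinuousLinearMap.mul ℝ ℝ).precompR Plane) volume :=
    (hη.2.fderiv (𝕜 := ℝ)).convolutionExists_right _ hg.locallyIntegrable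
      (hη.1.continuous_fderiv (by simp)) x
  have hi' : Integrable (fun t => (ContinuousLinearMap.mul ℝ ℝ).precompR Plane (g t)
    (fderiv ℝ η (x - t))) := hi
  exact ContinuousLinearMap.integral_apply hi' _

lemma integrable_moll {g η : Plane → ℝ} (hg : Integrable g) (hη : Integrable η) :
    Integrable (moll g η) := by
  rw [moll_eq_convolution]; exact hg.integrable_convolution _ hη

lemma integral_moll {g η : Plane → ℝ} (hg : Integrable g) (hη : Integrable η) :
    ∫ x, moll g η x = (∫ x, g x) * ∫ x, η x := by
  rw [moll_eq_convolution, integral_convolution _ hg hη]; rfl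

/-- The weight varies slowly: it changes by at most a fixed factor over unit distance. Hence
convolution with kernels supported in the unit ball is bounded on the weighted spaces, uniformly in
the concentration of the kernel. -/
lemma wt_le_of_norm_sub_le {m : ℝ} (hm : 0 ≤ m) {x t : Plane} (h : ‖x - t‖ ≤ 1) :
    wt m x ≤ 3 ^ m * wt m t := by
  unfold wt
  rw [← Real.mul_rpow (by norm_num) (by positivity)]
  refine Real.rpow_le_rpow (by positivity) ?_ hm
  have h1 : ‖x‖ ≤ ‖t‖ + 1 := by
    have := norm_add_le (x - t) t
    rw [sub_add_cancel] at this; linarith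
  have h2 : ‖x‖ ^ 2 ≤ (‖t‖ + 1) ^ 2 := by gcongr
  nlinarith [sq_nonneg (‖t‖ - 1)]

/-- Kernels that are nonnegative, continuous and supported in the unit ball. -/
structure IsKernel (κ : Plane → ℝ) : Prop where
  cont : Continuous κ
  nonneg : ∀ z, 0 ≤ κ z
  supp : ∀ z, 1 < ‖z‖ → κ z = 0

lemma hasCompactSupport_of_ball {κ : Plane → ℝ} {R : ℝ} (h : ∀ z, R < ‖z‖ → κ z = 0) :
    HasCompactSupport κ :=
  HasCompactSupport.intro (isCompact_closedBall (0 : Plane) R) fun z hz =>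
    h z (by simpa using hz)

lemma IsKernel.compact {κ : Plane → ℝ} (hκ : IsKernel κ) : HasCompactSupport κ :=
  hasCompactSupport_of_ball hκ.supp

lemma IsKernel.integrable {κ : Plane → ℝ} (hκ : IsKernel κ) : Integrable κ :=
  integrable_of_compact hκ.cont hκ.compact

/-- Cauchy–Schwarz with the kernel split as `√κ √κ`, after which the weight is moved from `x` to `t`
at the cost `3^m`. -/
lemma young_pointwise {m : ℝ} (hm : 0 ≤ m) {g κ : Plane → ℝ} (hg : InL2 m g)
    (hg1 : Integrable g) (hκ : IsKernel κ)
    (x : Plane) : moll (fun t => |g t|) κ x ^ 2 * wt m x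
      ≤ 3 ^ m * (∫ z, κ z) * moll (fun t => g t ^ 2 * wt m t) κ x := by
  have i0 : Integrable fun t => κ (x - t) := hκ.integrable.comp_sub_left x
  have i1 : Integrable fun t => g t ^ 2 * wt m t * κ (x - t) :=
    integrable_mul_comp_sub hg.int hκ.cont hκ.compact x
  have i2 : Integrable fun t => g t ^ 2 * κ (x - t) :=
    integrable_mul_comp_sub (hg.integrable_sq hm) hκ.cont hκ.compact x
  have i3 : Integrable fun t => |g t| * κ (x - t) :=
    integrable_mul_comp_sub hg1.abs hκ.cont hκ.compact x
  have e1 : ∀ t, (|g t| * Real.sqrt (κ (x - t))) ^ 2 = g t ^ 2 * κ (x - t) := fun t => by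
    rw [mul_pow, sq_abs, Real.sq_sqrt (hκ.nonneg _)]
  have e2 : ∀ t, Real.sqrt (κ (x - t)) ^ 2 = κ (x - t) := fun t => Real.sq_sqrt (hκ.nonneg _)
  have e3 : ∀ t, |g t| * Real.sqrt (κ (x - t)) * Real.sqrt (κ (x - t)) = |g t| * κ (x - t) :=
    fun t => by rw [mul_assoc, ← sq, e2]
  have cs := sq_integral_mul_le (μ := volume) (f := fun t => |g t| * Real.sqrt (κ (x - t)))
    (g := fun t => Real.sqrt (κ (x - t))) (by simpa only [e1] using i2)
    (by simpa only [e2] using i0) (by simpa only [e3] using i3)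
  simp only [e1, e2, e3] at cs
  have e4 : ∫ t, κ (x - t) = ∫ z, κ z := integral_sub_left_eq_self κ volume x
  rw [e4] at cs
  have hK : 0 ≤ ∫ z, κ z := integral_nonneg hκ.nonneg
  have h1 : (∫ t, g t ^ 2 * κ (x - t)) * wt m x ≤ 3 ^ m * moll (fun t => g t ^ 2 * wt m t) κ x := by
    unfold moll
    rw [← integral_mul_const, ← integral_const_mul]
    refine integral_mono (i2.mul_const _) (i1.const_mul _) fun t => ?_
    rcases le_or_gt ‖x - t‖ 1 with h | h
    · have h2 := wt_le_of_norm_sub_le hm h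
      have h3 : 0 ≤ g t ^ 2 * κ (x - t) := mul_nonneg (sq_nonneg _) (hκ.nonneg _)
      calc _ ≤ g t ^ 2 * κ (x - t) * (3 ^ m * wt m t) := mul_le_mul_of_nonneg_left h2 h3
        _ = _ := by ring
    · simp [hκ.supp _ h]
  calc _ ≤ ((∫ t, g t ^ 2 * κ (x - t)) * ∫ z, κ z) * wt m x :=
        mul_le_mul_of_nonneg_right cs (wt_pos _ _).le
    _ = (∫ z, κ z) * ((∫ t, g t ^ 2 * κ (x - t)) * wt m x) := by ring
    _ ≤ (∫ z, κ z) * (3 ^ m * moll (fun t => g t ^ 2 * wt m t) κ x) := by gcongr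
    _ = _ := by ring

lemma inL2_moll_abs {m : ℝ} (hm : 0 ≤ m) {g κ : Plane → ℝ} (hg : InL2 m g) (hg1 : Integrable g)
    (hκ : IsKernel κ) : InL2 m (moll (fun t => |g t|) κ) ∧
      ∫ x, moll (fun t => |g t|) κ x ^ 2 * wt m x
        ≤ 3 ^ m * (∫ z, κ z) ^ 2 * ∫ x, g x ^ 2 * wt m x := by
  have hc := continuous_moll hg1.abs hκ.cont hκ.compact
  have iM := (integrable_moll hg.int hκ.integrable).const_mul (3 ^ m * ∫ z, κ z)
  have h1 : Integrable fun x => moll (fun t => |g t|) κ x ^ 2 * wt m x := by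
    refine iM.mono' ((hc.pow 2).mul (continuous_wt m)).aestronglyMeasurable
      (Filter.Eventually.of_forall fun x => ?_)
    rw [Real.norm_of_nonneg (mul_nonneg (sq_nonneg _) (wt_pos _ _).le)]
    exact young_pointwise hm hg hg1 hκ x
  refine ⟨⟨hc.aestronglyMeasurable, h1⟩, ?_⟩
  calc _ ≤ ∫ x, 3 ^ m * (∫ z, κ z) * moll (fun t => g t ^ 2 * wt m t) κ x :=
        integral_mono h1 iM fun x => young_pointwise hm hg hg1 hκ x
    _ = _ := by rw [integral_const_mul, integral_moll hg.int hκ.integrable]; ring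

/-- A bounded kernel turns the weighted `L²` bound into pointwise decay of order `|ξ|^(-m)`. The
constant depends on the kernel, which is harmless since decay is used only qualitatively. -/
lemma moll_abs_decay {m : ℝ} (hm : 0 ≤ m) {g κ : Plane → ℝ} (hg : InL2 m g)
    (hg1 : Integrable g) (hκ : IsKernel κ) :
    ∃ C, ∀ x, moll (fun t => |g t|) κ x ^ 2 * wt m x ≤ C := by
  obtain ⟨B, hB⟩ := hκ.cont.bounded_above_of_compact_support hκ.compact
  refine ⟨3 ^ m * (∫ z, κ z) * ∫ t, g t ^ 2 * wt m t * B, fun x => ?_⟩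
  refine (young_pointwise hm hg hg1 hκ x).trans ?_
  have hK : 0 ≤ ∫ z, κ z := integral_nonneg hκ.nonneg
  refine mul_le_mul_of_nonneg_left ?_ (by positivity)
  refine integral_mono (integrable_mul_comp_sub hg.int hκ.cont hκ.compact x)
    (hg.int.mul_const B) fun t => ?_
  exact mul_le_mul_of_nonneg_left ((le_abs_self _).trans (hB _))
    (mul_nonneg (sq_nonneg _) (wt_pos _ _).le)

lemma abs_moll_le {g η κ : Plane → ℝ} (hg : Integrable g) (hη : Continuous η)
    (hs : HasCompactSupport η) (hκ : Continuous κ) (hκs : HasCompactSupport κ)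
    (h : ∀ z, |η z| ≤ κ z) (x : Plane) : |moll g η x| ≤ moll (fun t => |g t|) κ x := by
  refine (abs_integral_le_integral_abs).trans (integral_mono
    (integrable_mul_comp_sub hg hη hs x).abs (integrable_mul_comp_sub hg.abs hκ hκs x)
    fun t => ?_)
  simp only [abs_mul]
  exact mul_le_mul_of_nonneg_left (h _) (abs_nonneg _)

/-- The rescaled kernel `N² κ(N z)`. -/
def rescale (N : ℝ) (κ : Plane → ℝ) (z : Plane) : ℝ := N ^ 2 * κ (N • z)

lemma integral_rescale {N : ℝ} (hN : 0 < N) (κ F : Plane → ℝ) :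
    ∫ z, F z * rescale N κ z = ∫ z, F (N⁻¹ • z) * κ z := by
  have h := Measure.integral_comp_smul (volume : Measure Plane)
    (fun z => F (N⁻¹ • z) * κ z) N
  have e : ∀ z : Plane, F (N⁻¹ • N • z) * κ (N • z) = F z * κ (N • z) := fun z => by
    rw [smul_smul, inv_mul_cancel₀ hN.ne', one_smul]
  simp only [e, finrank_euclideanSpace, Fintype.card_fin, smul_eq_mul] at h
  rw [abs_of_pos (by positivity)] at h
  unfold rescale
  have e2 : ∀ z, F z * (N ^ 2 * κ (N • z)) = N ^ 2 * (F z * κ (N • z)) := fun z => by ring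
  simp only [e2]
  rw [integral_const_mul, h]
  field_simp

lemma integral_rescale_one {N : ℝ} (hN : 0 < N) (κ : Plane → ℝ) :
    ∫ z, rescale N κ z = ∫ z, κ z := by
  simpa using integral_rescale hN κ fun _ => 1

lemma IsKernel.rescale {N : ℝ} (hN : 1 ≤ N) {κ : Plane → ℝ} (hκ : IsKernel κ) :
    IsKernel (rescale N κ) := by
  refine ⟨?_, fun z => mul_nonneg (sq_nonneg _) (hκ.nonneg _), fun z hz => ?_⟩
  · exact continuous_const.mul (hκ.cont.comp (continuous_const_smul N))
  · unfold OseenLinearization.rescale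
    rw [hκ.supp, mul_zero]
    rw [norm_smul, Real.norm_of_nonneg (by linarith)]
    nlinarith

lemma IsTest.rescale {N : ℝ} (hN : 1 ≤ N) {ρ : Plane → ℝ} (hρ : IsTest ρ) :
    IsTest (rescale N ρ) :=
  ⟨contDiff_const.mul (hρ.1.comp (contDiff_const_smul N)),
    (hρ.2.comp_smul (by linarith : N ≠ 0)).mul_left⟩

lemma partialD_comp_smul {ρ : Plane → ℝ} (hρ : ContDiff ℝ ∞ ρ) (N : ℝ) (j : Fin 2) (z : Plane) :
    partialD j (fun z => ρ (N • z)) z = N * partialD j ρ (N • z) := by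
  unfold partialD
  have h : HasFDerivAt (fun z => ρ (N • z))
      ((fderiv ℝ ρ (N • z)).comp (N • ContinuousLinearMap.id ℝ Plane)) z :=
    (ContDiff.diffAt hρ _).hasFDerivAt.comp z ((hasFDerivAt_id z).const_smul N)
  rw [h.fderiv]; simp

lemma partialD_rescale {ρ : Plane → ℝ} (hρ : ContDiff ℝ ∞ ρ) (N : ℝ) (j : Fin 2) (z : Plane) :
    partialD j (rescale N ρ) z = N * rescale N (partialD j ρ) z := by
  unfold rescale
  have h : ContDiff ℝ ∞ fun z : Plane => ρ (N • z) := hρ.comp (contDiff_const_smul N)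
  rw [partialD_const_mul h, partialD_comp_smul hρ]
  ring

/-- Fubini and the translation `x = t + z` transfer the mollification to the bounded continuous
function `ζ`. -/
lemma integral_mul_moll {g ζ κ : Plane → ℝ} (hg : Integrable g) (hζ : Continuous ζ)
    {B : ℝ} (hB : ∀ x, |ζ x| ≤ B) (hκ : Integrable κ) :
    ∫ x, ζ x * moll g κ x = ∫ t, g t * ∫ z, ζ (t + z) * κ z := by
  have h1 : Integrable (fun p : Plane × Plane => ζ p.1 * (g p.2 * κ (p.1 - p.2)))
      (volume.prod volume) := by
    have h2 : Integrable (fun p : Plane × Plane => g p.2 * κ (p.1 - p.2)) (volume.prod volume) :=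
      hg.convolution_integrand (ContinuousLinearMap.mul ℝ ℝ) hκ
    exact h2.bdd_mul (c := B) (hζ.comp continuous_fst).aestronglyMeasurable
      (Filter.Eventually.of_forall fun p => hB _)
  have e1 : ∀ x, ζ x * moll g κ x = ∫ t, ζ x * (g t * κ (x - t)) := fun x => by
    rw [integral_const_mul]; rfl
  simp only [e1]
  rw [integral_integral_swap h1]
  congr 1; funext t
  rw [← integral_const_mul]
  have := integral_add_right_eq_self (μ := volume) (fun x => ζ x * (g t * κ (x - t))) t
  rw [← this]
  congr 1; funext z
  rw [add_sub_cancel_right, add_comm]; ring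

/-- Mollified functions converge in the sense of distributions. -/
lemma tendsto_integral_mul_moll {g ζ κ : Plane → ℝ} (hg : Integrable g) (hζ : Continuous ζ)
    (hs : HasCompactSupport ζ) (hκ : IsKernel κ) (h1 : ∫ z, κ z = 1) :
    Filter.Tendsto (fun n : ℕ => ∫ x, ζ x * moll g (rescale (n + 1) κ) x) Filter.atTop
      (nhds (∫ x, ζ x * g x)) := by
  obtain ⟨B, hB⟩ := hζ.bounded_above_of_compact_support hs
  have hB0 : 0 ≤ B := (norm_nonneg _).trans (hB 0)
  have hn : ∀ n : ℕ, (1 : ℝ) ≤ n + 1 := fun n => by linarith [n.cast_nonneg (α := ℝ)]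
  have e : ∀ n : ℕ, ∫ x, ζ x * moll g (rescale (n + 1) κ) x
      = ∫ t, g t * ∫ z, ζ (t + ((n : ℝ) + 1)⁻¹ • z) * κ z := fun n => by
    rw [integral_mul_moll hg hζ hB (hκ.rescale (hn n)).integrable]
    congr 1; funext t
    rw [integral_rescale (by linarith [hn n]) κ fun z => ζ (t + z)]
  simp only [e]
  have ik : ∀ (c : ℝ) (t : Plane), Integrable fun z => ζ (t + c • z) * κ z := fun c t =>
    hκ.integrable.bdd_mul (c := B) (hζ.comp (by fun_prop)).aestronglyMeasurable
      (Filter.Eventually.of_forall fun z => hB _)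
  have bd : ∀ (c : ℝ) (t : Plane), |∫ z, ζ (t + c • z) * κ z| ≤ B := fun c t => by
    have := norm_integral_le_of_norm_le (hκ.integrable.const_mul B)
      (f := fun z => ζ (t + c • z) * κ z) (Filter.Eventually.of_forall fun z => by
        rw [norm_mul, Real.norm_of_nonneg (hκ.nonneg z)]
        exact mul_le_mul_of_nonneg_right (hB _) (hκ.nonneg z))
    rwa [integral_const_mul, h1, mul_one] at this
  have lim : ∀ t, Filter.Tendsto (fun n : ℕ => ∫ z, ζ (t + ((n : ℝ) + 1)⁻¹ • z) * κ z)
      Filter.atTop (nhds (ζ t)) := by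
    intro t
    have e2 : ζ t = ∫ z, ζ t * κ z := by rw [integral_const_mul, h1, mul_one]
    rw [e2]
    refine tendsto_integral_of_dominated_convergence (fun z => B * κ z)
      (fun n => (ik _ t).aestronglyMeasurable) (hκ.integrable.const_mul B)
      (fun n => Filter.Eventually.of_forall fun z => ?_) (Filter.Eventually.of_forall fun z => ?_)
    · rw [norm_mul, Real.norm_of_nonneg (hκ.nonneg z)]
      exact mul_le_mul_of_nonneg_right (hB _) (hκ.nonneg z)
    · refine Filter.Tendsto.mul_const _ ?_
      have h0 : Filter.Tendsto (fun n : ℕ => t + ((n : ℝ) + 1)⁻¹ • z) Filter.atTop (nhds t) := by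
        have := (tendsto_one_div_add_atTop_nhds_zero_nat (𝕜 := ℝ)).smul_const z
        simpa using this.const_add t
      exact (hζ.tendsto t).comp h0
  have cont : ∀ c : ℝ, Continuous fun t => ∫ z, ζ (t + c • z) * κ z := fun c => by
    refine continuous_of_dominated (fun t => (ik c t).aestronglyMeasurable)
      (bound := fun z => B * κ z) (fun t => Filter.Eventually.of_forall fun z => ?_)
      (hκ.integrable.const_mul B) (Filter.Eventually.of_forall fun z => by fun_prop)
    rw [norm_mul, Real.norm_of_nonneg (hκ.nonneg z)]
    exact mul_le_mul_of_nonneg_right (hB _) (hκ.nonneg z)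
  have e3 : ∀ x, ζ x * g x = g x * ζ x := fun x => mul_comm _ _
  simp only [e3]
  refine tendsto_integral_of_dominated_convergence (fun t => |g t| * B)
    (fun n => hg.aestronglyMeasurable.mul (cont _).aestronglyMeasurable) (hg.abs.mul_const B)
    (fun n => Filter.Eventually.of_forall fun t => ?_)
    (Filter.Eventually.of_forall fun t => (lim t).const_mul _)
  rw [norm_mul]
  exact mul_le_mul_of_nonneg_left (bd _ t) (norm_nonneg _)

/-! ### Mean value estimates and potentials -/

lemma fderiv_eq_partialD (f : Plane → ℝ) (x v : Plane) :
    fderiv ℝ f x v = v 0 * partialD 0 f x + v 1 * partialD 1 f x := by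
  have e : v = v 0 • EuclideanSpace.single 0 1 + v 1 • EuclideanSpace.single 1 1 := by
    ext i; fin_cases i <;> simp
  conv_lhs => rw [e]
  simp [partialD]

lemma abs_sub_le_of_abs_partialD_le {f : Plane → ℝ} (hf : ContDiff ℝ ∞ f) {s : Set Plane}
    (hs : Convex ℝ s) {C : ℝ} (hC : ∀ z ∈ s, ∀ j, |partialD j f z| ≤ C) {x y : Plane}
    (hx : x ∈ s) (hy : y ∈ s) : |f y - f x| ≤ 2 * C * ‖y - x‖ := by
  have hC0 : 0 ≤ C := (abs_nonneg _).trans (hC x hx 0)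
  refine hs.norm_image_sub_le_of_norm_fderiv_le (fun z _ => ContDiff.diffAt hf z)
    (fun z hz => ?_) hx hy
  refine ContinuousLinearMap.opNorm_le_bound _ (by positivity) fun v => ?_
  rw [fderiv_eq_partialD, Real.norm_eq_abs]
  refine (abs_add_le _ _).trans ?_
  rw [abs_mul, abs_mul]
  have h0 := abs_coord_le v 0
  have h1 := abs_coord_le v 1
  have a := mul_le_mul h0 (hC z hz 0) (abs_nonneg _) (norm_nonneg v)
  have b := mul_le_mul h1 (hC z hz 1) (abs_nonneg _) (norm_nonneg v)
  linarith

/-- The Poincaré lemma on the plane: the closed form `a dξ₁ + b dξ₂` is exact. -/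
lemma exists_potential {a b : Plane → ℝ} (ha : ContDiff ℝ ∞ a) (hb : ContDiff ℝ ∞ b)
    (h : ∀ x, partialD 1 a x = partialD 0 b x) :
    ∃ ψ : Plane → ℝ, ContDiff ℝ ∞ ψ ∧ partialD 0 ψ = a ∧ partialD 1 ψ = b := by
  set e0 : Plane →L[ℝ] ℝ := EuclideanSpace.proj 0
  set e1 : Plane →L[ℝ] ℝ := EuclideanSpace.proj 1
  set θ : Plane → Plane →L[ℝ] ℝ := fun x => a x • e0 + b x • e1 with hθ
  have hθs : ContDiff ℝ ∞ θ := (ha.smul contDiff_const).add (hb.smul contDiff_const)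
  have hd : ∀ x, HasFDerivAt θ ((fderiv ℝ a x).smulRight e0 + (fderiv ℝ b x).smulRight e1) x :=
    fun x => ((ContDiff.diffAt ha x).hasFDerivAt.smul_const e0).add
      ((ContDiff.diffAt hb x).hasFDerivAt.smul_const e1)
  obtain ⟨ψ, hψ⟩ := convex_univ.exists_forall_hasFDerivAt_of_fderiv_symmetric
    isOpen_univ (fun x _ => (hd x).differentiableAt.differentiableWithinAt) (fun x _ u v => by
      rw [(hd x).fderiv]
      simp only [add_apply, ContinuousLinearMap.smulRight_apply, smul_apply,
        smul_eq_mul, fderiv_eq_partialD]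
      have h0 : ∀ w : Plane, e0 w = w 0 := fun w => rfl
      have h1 : ∀ w : Plane, e1 w = w 1 := fun w => rfl
      rw [h0, h0, h1, h1, h x]
      ring)
  have hf : fderiv ℝ ψ = θ := funext fun x => (hψ x (Set.mem_univ x)).fderiv
  refine ⟨ψ, contDiff_infty_iff_fderiv.2 ⟨fun x => (hψ x (Set.mem_univ x)).differentiableAt,
    hf ▸ hθs⟩, ?_, ?_⟩
  · funext x
    unfold partialD
    rw [hf]; simp [hθ, e0, e1]
  · funext x
    unfold partialD
    rw [hf]; simp [hθ, e0, e1]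

/-! ### Decay of potentials -/

/-- Two vectors of length at least `r` at a non-obtuse angle span a segment avoiding the disc of
radius `r/2`, since the cross term is nonnegative and `a² + b² ≥ ¼` when `a + b = 1`. The gradient
bound can then be integrated along the segment. -/
lemma norm_segment_ge {x y : Plane} {r : ℝ} (hr : 0 ≤ r) (hx : r ≤ ‖x‖) (hy : r ≤ ‖y‖)
    (hxy : 0 ≤ inner ℝ x y) {z : Plane} (hz : z ∈ segment ℝ x y) : r / 2 ≤ ‖z‖ := by
  obtain ⟨a, b, ha, hb, hab, rfl⟩ := hz
  have h1 : ‖a • x + b • y‖ ^ 2 = a ^ 2 * ‖x‖ ^ 2 + 2 * (a * b * inner ℝ x y)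
      + b ^ 2 * ‖y‖ ^ 2 := by
    rw [norm_add_sq_real, norm_smul, norm_smul, Real.norm_of_nonneg ha, Real.norm_of_nonneg hb,
      inner_smul_left, inner_smul_right]
    simp; ring
  have h2 : (r / 2) ^ 2 ≤ ‖a • x + b • y‖ ^ 2 := by
    rw [h1]
    have h3 : r ^ 2 ≤ ‖x‖ ^ 2 := by gcongr
    have h4 : r ^ 2 ≤ ‖y‖ ^ 2 := by gcongr
    have h5 := mul_le_mul_of_nonneg_left h3 (sq_nonneg a)
    have h6 := mul_le_mul_of_nonneg_left h4 (sq_nonneg b)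
    have h7 : 0 ≤ a * b * inner ℝ x y := by positivity
    have h8 : 1 / 4 ≤ a ^ 2 + b ^ 2 := by nlinarith [sq_nonneg (a - b)]
    nlinarith [sq_nonneg r]
  exact (sq_le_sq₀ (by positivity) (norm_nonneg _)).1 h2

lemma abs_sub_le_of_decay {ψ : Plane → ℝ} (hψ : ContDiff ℝ ∞ ψ) {C : ℝ}
    (hC : ∀ z j, |partialD j ψ z| * ‖z‖ ^ 3 ≤ C) {x y : Plane} {r : ℝ} (hr : 0 < r)
    (hx : r ≤ ‖x‖) (hy : r ≤ ‖y‖) (hxy : 0 ≤ inner ℝ x y) :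
    |ψ y - ψ x| ≤ 16 * C / r ^ 3 * ‖y - x‖ := by
  have := abs_sub_le_of_abs_partialD_le hψ (convex_segment x y) (C := 8 * C / r ^ 3)
    (fun z hz j => by
      have h1 := norm_segment_ge hr.le hx hy hxy hz
      have h2 := hC z j
      rw [le_div_iff₀ (by positivity)]
      have h3 : (r / 2) ^ 3 ≤ ‖z‖ ^ 3 := by gcongr
      have := mul_le_mul_of_nonneg_left h3 (abs_nonneg (partialD j ψ z))
      nlinarith) (left_mem_segment ℝ x y) (right_mem_segment ℝ x y)
  calc _ ≤ _ := this
    _ = _ := by ring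

/-- A function whose gradient decays like `|ξ|⁻³` tends to a constant at the rate `|ξ|⁻²`. -/
lemma exists_limit_of_decay {ψ : Plane → ℝ} (hψ : ContDiff ℝ ∞ ψ) {C : ℝ}
    (hC : ∀ z j, |partialD j ψ z| * ‖z‖ ^ 3 ≤ C) :
    ∃ c C', ∀ x, 1 ≤ ‖x‖ → |ψ x - c| * ‖x‖ ^ 2 ≤ C' := by
  have hC0 : 0 ≤ C := (by positivity : 0 ≤ |partialD 0 ψ 0| * ‖(0 : Plane)‖ ^ 3).trans (hC 0 0)
  have hpow : ∀ (k : ℕ) (x : Plane), ‖(2 ^ k : ℝ) • x‖ = 2 ^ k * ‖x‖ := fun k x => by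
    rw [norm_smul, Real.norm_of_nonneg (by positivity)]
  -- At scale `2^k` the gradient is of order `8^(-k)` and the segment has length of order `2^k`. The
  -- resulting `4^(-k)` is weakened to `2^(-k)`.
  have step : ∀ x y : Plane, ∀ r : ℝ, 0 < r → r ≤ ‖x‖ → r ≤ ‖y‖ → 0 ≤ inner ℝ x y → ∀ k : ℕ,
      |ψ ((2 ^ k : ℝ) • y) - ψ ((2 ^ k : ℝ) • x)| ≤ 16 * C / r ^ 3 * ‖y - x‖ * (1 / 2) ^ k := by
    intro x y r hr hx hy hxy k
    have h := abs_sub_le_of_decay hψ hC (x := (2 ^ k : ℝ) • x) (y := (2 ^ k : ℝ) • y)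
      (r := 2 ^ k * r) (by positivity) (by rw [hpow]; gcongr) (by rw [hpow]; gcongr) (by
        rw [inner_smul_left, inner_smul_right]; simp; positivity)
    rw [← smul_sub, hpow] at h
    refine h.trans ?_
    have e : 16 * C / (2 ^ k * r) ^ 3 * (2 ^ k * ‖y - x‖)
        = 16 * C / r ^ 3 * ‖y - x‖ * ((1 / 2) ^ k * (1 / 2) ^ k) := by
      rw [one_div, inv_pow]; field_simp
    rw [e]
    refine mul_le_mul_of_nonneg_left ?_ (by positivity)
    have h1 : ((1 : ℝ) / 2) ^ k ≤ 1 := pow_le_one₀ (by norm_num) (by norm_num)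
    have h2 : (0 : ℝ) ≤ (1 / 2) ^ k := by positivity
    nlinarith
  -- Along the dyadic ray `2^k x` the increments are geometric, so the limit exists; the tail sum
  -- gives the rate `|ξ|⁻²`.
  have lim : ∀ x : Plane, 1 ≤ ‖x‖ → ∃ l, Filter.Tendsto (fun k : ℕ => ψ ((2 ^ k : ℝ) • x))
      Filter.atTop (nhds l) ∧ |ψ x - l| ≤ 16 * C / ‖x‖ ^ 2 / (1 - 1 / 2) := by
    intro x hx
    have hx0 : 0 < ‖x‖ := by linarith
    have hu : ∀ k : ℕ, dist (ψ ((2 ^ k : ℝ) • x)) (ψ ((2 ^ (k + 1) : ℝ) • x))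
        ≤ 16 * C / ‖x‖ ^ 2 * (1 / 2) ^ k := by
      intro k
      have h := step x ((2 : ℝ) • x) ‖x‖ hx0 le_rfl (by rw [norm_smul]; norm_num; linarith)
        (by rw [inner_smul_right, real_inner_self_eq_norm_sq]; positivity) k
      rw [smul_smul, ← pow_succ, two_smul, add_sub_cancel_right] at h
      rw [dist_comm, Real.dist_eq]
      refine h.trans (le_of_eq ?_)
      field_simp
    obtain ⟨l, hl⟩ := cauchySeq_tendsto_of_complete
      (cauchySeq_of_le_geometric (1 / 2) _ (by norm_num) hu)
    refine ⟨l, hl, ?_⟩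
    have := dist_le_of_le_geometric_of_tendsto₀ (1 / 2) _ (by norm_num) hu hl
    simpa [Real.dist_eq] using this
  choose! l hl1 hl2 using lim
  -- Points at a non-obtuse angle have the same limit, because their difference at scale `2^k` tends
  -- to zero.
  have same : ∀ x y : Plane, 1 ≤ ‖x‖ → 1 ≤ ‖y‖ → 0 ≤ inner ℝ x y → l x = l y := by
    intro x y hx hy hxy
    have h1 := (hl1 y hy).sub (hl1 x hx)
    have h2 : Filter.Tendsto (fun k : ℕ => ψ ((2 ^ k : ℝ) • y) - ψ ((2 ^ k : ℝ) • x))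
        Filter.atTop (nhds 0) := by
      refine squeeze_zero_norm (step x y 1 one_pos hx hy hxy) ?_
      have := (tendsto_pow_atTop_nhds_zero_of_lt_one (by norm_num : (0 : ℝ) ≤ 1 / 2)
        (by norm_num)).const_mul (16 * C / 1 ^ 3 * ‖y - x‖)
      simpa using this
    have := tendsto_nhds_unique h1 h2
    linarith
  set e : Plane := EuclideanSpace.single 0 1 with he
  have hen : 1 ≤ ‖e‖ := by simp [he]
  have main : ∀ x : Plane, 1 ≤ ‖x‖ → l x = l e := by
    intro x hx
    -- Any direction reaches the reference direction `e` in two steps, through a vector orthogonal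
    -- to `x` whose sign makes its angle with `e` non-obtuse.
    have key : ∃ y : Plane, ‖y‖ = ‖x‖ ∧ inner ℝ x y = (0 : ℝ) ∧ 0 ≤ inner ℝ y e := by
      have hn : ∀ s : ℝ, s ^ 2 = 1 → ‖(!₂[-s * x 1, s * x 0] : Plane)‖ = ‖x‖ := by
        intro s hs
        rw [← sq_eq_sq₀ (norm_nonneg _) (norm_nonneg _), norm_sq_eq, norm_sq_eq]
        simp
        linear_combination (x 0 ^ 2 + x 1 ^ 2) * hs
      have hi : ∀ s : ℝ, inner ℝ x (!₂[-s * x 1, s * x 0] : Plane) = 0 := by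
        intro s
        simp [PiLp.inner_apply, Fin.sum_univ_two]; ring
      have hj : ∀ s : ℝ, inner ℝ (!₂[-s * x 1, s * x 0] : Plane) e = -s * x 1 := by
        intro s
        simp [PiLp.inner_apply, he]
      rcases le_total 0 (x 1) with h | h
      · exact ⟨_, hn (-1) (by norm_num), hi _, by rw [hj]; linarith⟩
      · exact ⟨_, hn 1 (by norm_num), hi _, by rw [hj]; linarith⟩
    obtain ⟨y, hy1, hy2, hy3⟩ := key
    rw [same x y hx (hy1 ▸ hx) hy2.ge, same y e (hy1 ▸ hx) hen hy3]
  refine ⟨l e, 32 * C, fun x hx => ?_⟩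
  have h := hl2 x hx
  rw [main x hx] at h
  have hx0 : 0 < ‖x‖ ^ 2 := by positivity
  calc |ψ x - l e| * ‖x‖ ^ 2 ≤ (16 * C / ‖x‖ ^ 2 / (1 - 1 / 2)) * ‖x‖ ^ 2 := by gcongr
    _ = 32 * C := by field_simp; norm_num; ring

/-! ### Radial cutoff functions -/

/-- A radial bump function. -/
def bump (x : Plane) : ℝ := Real.smoothTransition (2 - ‖x‖ ^ 2)

/-- The bump function at scale `R`. -/
def cut (R : ℝ) (x : Plane) : ℝ := bump (R⁻¹ • x)

lemma contDiff_bump : ContDiff ℝ ∞ bump :=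
  Real.smoothTransition.contDiff.comp (contDiff_const.sub contDiff_normsq)

lemma bump_eq_zero {x : Plane} (hx : 2 < ‖x‖) : bump x = 0 :=
  Real.smoothTransition.zero_of_nonpos (by nlinarith)

lemma bump_eq_one {x : Plane} (hx : ‖x‖ ≤ 1) : bump x = 1 :=
  Real.smoothTransition.one_of_one_le (by nlinarith [norm_nonneg x])

lemma isTest_bump : IsTest bump :=
  ⟨contDiff_bump, hasCompactSupport_of_ball (R := 2) fun _ => bump_eq_zero⟩

lemma cut_mem (R : ℝ) (x : Plane) : 0 ≤ cut R x ∧ cut R x ≤ 1 :=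
  ⟨Real.smoothTransition.nonneg _, Real.smoothTransition.le_one _⟩

lemma isTest_cut {R : ℝ} (hR : 0 < R) : IsTest (cut R) :=
  ⟨contDiff_bump.comp (contDiff_const_smul _), isTest_bump.2.comp_smul (inv_ne_zero hR.ne')⟩

lemma cut_eq_one {R : ℝ} (hR : 0 < R) {x : Plane} (hx : ‖x‖ ≤ R) : cut R x = 1 := by
  refine bump_eq_one ?_
  rw [norm_smul, norm_inv, Real.norm_of_nonneg hR.le, inv_mul_le_iff₀ hR]; simpa using hx

lemma partialD_eq_zero_of_ball {f : Plane → ℝ} {r : ℝ} (h : ∀ x, r < ‖x‖ → f x = 0)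
    (j : Fin 2) {x : Plane} (hx : r < ‖x‖) : partialD j f x = 0 := by
  have : f =ᶠ[nhds x] fun _ => 0 := by
    filter_upwards [(isOpen_lt continuous_const continuous_norm).mem_nhds hx] with y hy
    exact h y hy
  unfold partialD
  rw [this.fderiv_eq]; simp

lemma partialD_bump_inner (j : Fin 2) {x : Plane} (hx : ‖x‖ < 1) : partialD j bump x = 0 := by
  have : bump =ᶠ[nhds x] fun _ => 1 := by
    filter_upwards [(isOpen_lt continuous_norm continuous_const).mem_nhds hx] with y hy
    exact bump_eq_one (le_of_lt hy)
  unfold partialD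
  rw [this.fderiv_eq]; simp

lemma partialD_bump (j : Fin 2) (x : Plane) :
    partialD j bump x = -deriv Real.smoothTransition (2 - ‖x‖ ^ 2) * (2 * x j) := by
  have h1 : HasDerivAt Real.smoothTransition (deriv Real.smoothTransition (2 - ‖x‖ ^ 2))
      (2 - ‖x‖ ^ 2) :=
    ((Real.smoothTransition.contDiff (n := 1)).differentiable (by simp) _).hasDerivAt
  have h2 : HasDerivAt (fun t : ℝ => Real.smoothTransition (2 - t))
      (-deriv Real.smoothTransition (2 - ‖x‖ ^ 2)) (‖x‖ ^ 2) := by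
    have := h1.comp (‖x‖ ^ 2) ((hasDerivAt_id (‖x‖ ^ 2)).const_sub 2)
    exact this.congr_deriv (by ring)
  exact partialD_radial h2 j

lemma partialD_cut (R : ℝ) (j : Fin 2) (x : Plane) :
    partialD j (cut R) x = R⁻¹ * partialD j bump (R⁻¹ • x) :=
  partialD_comp_smul contDiff_bump R⁻¹ j x

/-- The cutoff is radial and the vortex is tangent to circles, so truncation does not interact with
the vortex. -/
lemma advect_oseen_cut (R : ℝ) (x : Plane) : advect (fun x => oseen x) (cut R) x = 0 := by
  unfold advect
  rw [partialD_cut, partialD_cut, partialD_bump, partialD_bump]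
  simp only [PiLp.smul_apply, smul_eq_mul]
  linear_combination (-(R⁻¹ * deriv Real.smoothTransition (2 - ‖R⁻¹ • x‖ ^ 2) * 2 * R⁻¹))
    * oseen_dot x

/-- The radial derivative of the bump function. -/
def radBump : Plane → ℝ := advect (fun x => x) bump

lemma isTest_radBump : IsTest radBump := isTest_bump.advect (v := fun x => x) contDiff_coord

lemma advect_cut (R : ℝ) (x : Plane) :
    advect (fun x => x) (cut R) x = radBump (R⁻¹ • x) := by
  unfold radBump advect
  rw [partialD_cut, partialD_cut]
  simp only [PiLp.smul_apply, smul_eq_mul]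
  ring

lemma radBump_inner {x : Plane} (hx : ‖x‖ < 1) : radBump x = 0 := by
  unfold radBump advect
  rw [partialD_bump_inner _ hx, partialD_bump_inner _ hx]; ring

/-! ### Hardy's inequality for decaying functions -/

/-- The weight `((1 + |ξ|²)/(1 + η|ξ|²))^k`. -/
def boundedWt (k η : ℝ) (x : Plane) : ℝ := wt k x * (1 + η * ‖x‖ ^ 2) ^ (-k)

lemma contDiff_boundedWt (k : ℝ) {η : ℝ} (hη : 0 < η) : ContDiff ℝ ∞ (boundedWt k η) :=
  (contDiff_wt k).mul ((contDiff_const.add (contDiff_const.mul contDiff_normsq)).rpow_const_of_ne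
    fun x => by positivity)

lemma boundedWt_pos (k : ℝ) {η : ℝ} (hη : 0 < η) (x : Plane) : 0 < boundedWt k η x :=
  mul_pos (wt_pos k x) (Real.rpow_pos_of_pos (by positivity) _)

lemma boundedWt_le_wt {k η : ℝ} (hk : 0 ≤ k) (hη : 0 < η) (x : Plane) :
    boundedWt k η x ≤ wt k x := by
  unfold boundedWt
  refine mul_le_of_le_one_right (wt_pos k x).le (Real.rpow_le_one_of_one_le_of_nonpos ?_ ?_)
  · have : 0 ≤ η * ‖x‖ ^ 2 := by positivity
    linarith
  · linarith

lemma boundedWt_le {k η : ℝ} (hk : 0 ≤ k) (hη : 0 < η) (hη1 : η ≤ 1) (x : Plane) :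
    boundedWt k η x ≤ η ^ (-k) := by
  have h0 : 0 < 1 + η * ‖x‖ ^ 2 := by positivity
  have h1 := one_add_pos x
  unfold boundedWt wt
  rw [Real.rpow_neg h0.le, Real.rpow_neg hη.le, ← div_eq_mul_inv, ← Real.div_rpow h1.le h0.le,
    ← Real.inv_rpow hη.le]
  refine Real.rpow_le_rpow (by positivity) ?_ hk
  rw [div_le_iff₀ h0, inv_mul_eq_div, le_div_iff₀ hη]
  nlinarith

lemma le_boundedWt {k η : ℝ} (hk : 0 ≤ k) (hη : 0 < η) {x : Plane} (hx : η * ‖x‖ ^ 2 ≤ 1) :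
    wt k x ≤ 2 ^ k * boundedWt k η x := by
  have h0 : 0 < 1 + η * ‖x‖ ^ 2 := by positivity
  have h1 : (1 : ℝ) ≤ 2 ^ k * (1 + η * ‖x‖ ^ 2) ^ (-k) := by
    rw [Real.rpow_neg h0.le, ← div_eq_mul_inv, one_le_div (by positivity)]
    exact Real.rpow_le_rpow h0.le (by linarith) hk
  unfold boundedWt
  have := mul_le_mul_of_nonneg_left h1 (wt_pos k x).le
  linarith

/-- The quotient `(1+t)/(1+ηt)` increases in `t` when `η ≤ 1`. This weight therefore satisfies
`hardy_monotone`, yet it is bounded, which keeps the truncation error finite. -/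
lemma advect_boundedWt_nonneg {k η : ℝ} (hk : 0 ≤ k) (hη : 0 < η) (hη1 : η ≤ 1) (x : Plane) :
    0 ≤ advect (fun x => x) (boundedWt k η) x := by
  have h0 : 0 < 1 + η * ‖x‖ ^ 2 := by positivity
  have hs : ContDiff ℝ ∞ fun x : Plane => (1 + η * ‖x‖ ^ 2) ^ (-k) :=
    (contDiff_const.add (contDiff_const.mul contDiff_normsq)).rpow_const_of_ne
      fun x => by positivity
  have hd : HasDerivAt (fun t : ℝ => (1 + η * t) ^ (-k))
      (η * (-k) * (1 + η * ‖x‖ ^ 2) ^ (-k - 1)) (‖x‖ ^ 2) := by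
    have h2 : HasDerivAt (fun t : ℝ => 1 + η * t) η (‖x‖ ^ 2) := by
      have := ((hasDerivAt_id (‖x‖ ^ 2)).const_mul η).const_add 1
      exact this.congr_deriv (by ring)
    exact h2.rpow_const (Or.inl h0.ne')
  unfold advect boundedWt
  rw [partialD_mul (contDiff_wt k) hs, partialD_mul (contDiff_wt k) hs, partialD_wt, partialD_wt,
    partialD_radial hd, partialD_radial hd, Real.rpow_sub_one h0.ne', wt_eq_mul_sub_one k]
  have e : ∀ (a b c d y z : ℝ), y * ((2 * y * (k * a)) * b + a * c * (d * (2 * y)))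
      + z * ((2 * z * (k * a)) * b + a * c * (d * (2 * z)))
      = 2 * (y ^ 2 + z ^ 2) * a * (k * b + c * d) := fun a b c d y z => by ring
  have h3 : k * (1 + η * ‖x‖ ^ 2) ^ (-k) + (1 + ‖x‖ ^ 2)
      * (η * -k * ((1 + η * ‖x‖ ^ 2) ^ (-k) / (1 + η * ‖x‖ ^ 2)))
      = k * (1 + η * ‖x‖ ^ 2) ^ (-k) * ((1 - η) / (1 + η * ‖x‖ ^ 2)) := by
    field_simp; ring
  have h4 : 0 < (1 + η * ‖x‖ ^ 2) ^ (-k) := Real.rpow_pos_of_pos h0 _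
  have h5 := wt_pos (k - 1) x
  have h6 : 0 ≤ 1 - η := by linarith
  calc 0 ≤ 2 * (x 0 ^ 2 + x 1 ^ 2) * wt (k - 1) x
        * (k * (1 + η * ‖x‖ ^ 2) ^ (-k) * ((1 - η) / (1 + η * ‖x‖ ^ 2))) := by positivity
    _ = _ := by rw [← h3]; ring

/-- Hardy's inequality cannot be applied directly, since integrability of `ψ` is the conclusion. It
is applied to a truncation of `ψ` in the bounded weight with parameter `η`, with a bound independent
of `η`; letting `η → 0` on balls gives the claim. -/
lemma inL2_of_gradient {m C : ℝ} (hm : 2 ≤ m) {ψ : Plane → ℝ} (hψ : ContDiff ℝ ∞ ψ)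
    (hC : ∀ x, 1 ≤ ‖x‖ → |ψ x| * ‖x‖ ^ 2 ≤ C) (hg : ∀ j, InL2 m (partialD j ψ)) :
    InL2 (m - 1) ψ := by
  set k := m - 1 with hk
  have hk1 : 1 ≤ k := by linarith
  have hk0 : 0 ≤ k := by linarith
  have hG : Integrable fun x => gradSq ψ x * wt m x :=
    ((hg 0).int.add (hg 1).int).congr (Filter.Eventually.of_forall fun x => by
      simp only [Pi.add_apply, gradSq]; ring)
  have hE : Integrable fun x => radBump x ^ 2 := by
    simpa only [sq] using (isTest_radBump.mul_smooth isTest_radBump.1).integrable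
  set B := 2 * (∫ x, gradSq ψ x * wt m x) + 2 * C ^ 2 * ∫ x, radBump x ^ 2 with hB
  -- The cutoff error lives at `|ξ| ∼ R`, where `ψ² ≤ C²/R⁴`; the area is of order `R²` and the
  -- weight at most `η^(-k)`. The choice `R² = η^(-k)` keeps the product bounded.
  have main : ∀ η R : ℝ, 0 < η → η ≤ 1 → 1 ≤ R → R ^ 2 = η ^ (-k) →
      ∫ x, (cut R x * ψ x) ^ 2 * boundedWt k η x ≤ B := by
    intro η R hη hη1 hR hRη
    have hR0 : 0 < R := by linarith
    have tp : IsTest fun x => cut R x * ψ x := (isTest_cut hR0).mul_smooth hψ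
    have hW := contDiff_boundedWt k hη
    refine (hardy_monotone tp hW (fun x => (boundedWt_pos k hη x).le)
      (advect_boundedWt_nonneg hk0 hη hη1)).trans ?_
    have iE : Integrable fun x : Plane => radBump (R⁻¹ • x) ^ 2 :=
      hE.comp_smul (inv_ne_zero hR0.ne')
    have eE : ∫ x : Plane, radBump (R⁻¹ • x) ^ 2 = R ^ 2 * ∫ x, radBump x ^ 2 := by
      rw [Measure.integral_comp_smul (volume : Measure Plane) (fun x => radBump x ^ 2) R⁻¹]
      simp
    have eB : B = ∫ x, (2 * (gradSq ψ x * wt m x) + 2 * C ^ 2 / R ^ 2 * radBump (R⁻¹ • x) ^ 2) := by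
      rw [integral_add (hG.const_mul 2) (iE.const_mul _), integral_const_mul, integral_const_mul,
        eE, hB]
      field_simp
    rw [eB]
    refine integral_mono ((tp.advect (v := fun x => x) contDiff_coord).integrable_sq_mul hW)
      ((hG.const_mul 2).add (iE.const_mul _)) fun x => ?_
    have e1 : advect (fun x => x) (fun x => cut R x * ψ x) x
        = cut R x * advect (fun x => x) ψ x + ψ x * radBump (R⁻¹ • x) := by
      rw [← advect_cut]
      unfold advect
      rw [partialD_mul (isTest_cut hR0).1 hψ, partialD_mul (isTest_cut hR0).1 hψ]
      ring
    simp only [e1]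
    have hW0 := boundedWt_pos k hη x
    have hc := cut_mem R x
    have hc2 : cut R x ^ 2 ≤ 1 := by nlinarith
    have p1 : (cut R x * advect (fun x => x) ψ x) ^ 2 * boundedWt k η x
        ≤ gradSq ψ x * wt m x := by
      have h1 := sq_advect_mul_wt_le k ψ x
      rw [hk, sub_add_cancel, ← hk] at h1
      refine le_trans ?_ h1
      have h2 := boundedWt_le_wt hk0 hη x
      rw [mul_pow]
      have h3 := sq_nonneg (advect (fun x => x) ψ x)
      calc _ ≤ 1 * advect (fun x => x) ψ x ^ 2 * wt k x := by gcongr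
        _ = _ := by ring
    have p2 : (ψ x * radBump (R⁻¹ • x)) ^ 2 * boundedWt k η x
        ≤ C ^ 2 / R ^ 2 * radBump (R⁻¹ • x) ^ 2 := by
      rcases lt_or_ge ‖x‖ R with h | h
      · rw [radBump_inner]
        · simp
        · rw [norm_smul, norm_inv, Real.norm_of_nonneg hR0.le, inv_mul_lt_iff₀ hR0]; simpa using h
      · have h1 := hC x (hR.trans h)
        have h2 : ψ x ^ 2 * R ^ 4 ≤ C ^ 2 := by
          have h3 : (|ψ x| * ‖x‖ ^ 2) ^ 2 ≤ C ^ 2 := by gcongr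
          have h4 : R ^ 4 ≤ ‖x‖ ^ 4 := by gcongr
          calc _ ≤ ψ x ^ 2 * ‖x‖ ^ 4 := by gcongr
            _ = (|ψ x| * ‖x‖ ^ 2) ^ 2 := by rw [mul_pow, sq_abs]; ring
            _ ≤ _ := h3
        have h5 := boundedWt_le hk0 hη hη1 x
        rw [← hRη] at h5
        have h6 : ψ x ^ 2 * R ^ 2 ≤ C ^ 2 / R ^ 2 := by
          rw [le_div_iff₀ (by positivity)]
          calc _ = ψ x ^ 2 * R ^ 4 := by ring
            _ ≤ _ := h2
        calc _ ≤ (ψ x * radBump (R⁻¹ • x)) ^ 2 * R ^ 2 := by gcongr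
          _ = (ψ x ^ 2 * R ^ 2) * radBump (R⁻¹ • x) ^ 2 := by ring
          _ ≤ _ := by gcongr
    have p3 := sq_nonneg (cut R x * advect (fun x => x) ψ x - ψ x * radBump (R⁻¹ • x))
    have p4 := mul_nonneg p3 hW0.le
    have e2 : 2 * C ^ 2 / R ^ 2 = 2 * (C ^ 2 / R ^ 2) := by ring
    rw [e2]
    linarith
  refine ⟨hψ.continuous.aestronglyMeasurable, ?_⟩
  refine (aecover_closedBall (μ := (volume : Measure Plane)) (x := 0)
    tendsto_natCast_atTop_atTop).integrable_of_integral_bounded_of_nonneg_ae (2 ^ k * B)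
    (fun n => ?_) (Filter.Eventually.of_forall fun x => mul_nonneg (sq_nonneg _) (wt_pos _ _).le)
    (Filter.Eventually.of_forall fun n => ?_)
  · exact ((hψ.continuous.pow 2).mul (continuous_wt k)).continuousOn.integrableOn_compact
      (isCompact_closedBall _ _)
  -- On the ball of radius `n` this gives `η|ξ|² ≤ 1`, so the bounded weight is comparable to the
  -- full one; as `k ≥ 1`, also `R ≥ n`, so the cutoff equals one there.
  set η : ℝ := ((n : ℝ) ^ 2 + 1)⁻¹ with hη
  have hn : (0 : ℝ) ≤ n := n.cast_nonneg
  have hn1 : (1 : ℝ) ≤ (n : ℝ) ^ 2 + 1 := by nlinarith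
  have hη0 : 0 < η := by positivity
  have hη1 : η ≤ 1 := inv_le_one_of_one_le₀ hn1
  set R : ℝ := ((n : ℝ) ^ 2 + 1) ^ (k / 2) with hR
  have hR2 : R ^ 2 = η ^ (-k) := by
    rw [hR, hη, Real.inv_rpow (by positivity), Real.rpow_neg (by positivity), inv_inv,
      ← Real.rpow_natCast, ← Real.rpow_mul (by positivity)]
    congr 1; push_cast; ring
  have hRn2 : (n : ℝ) ^ 2 + 1 ≤ R ^ 2 := by
    rw [hR2, hη, Real.inv_rpow (by positivity), Real.rpow_neg (by positivity), inv_inv]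
    calc (n : ℝ) ^ 2 + 1 = ((n : ℝ) ^ 2 + 1) ^ (1 : ℝ) := (Real.rpow_one _).symm
      _ ≤ _ := Real.rpow_le_rpow_of_exponent_le hn1 hk1
  have hRp : 0 < R := Real.rpow_pos_of_pos (by positivity) _
  have hR1 : 1 ≤ R := by nlinarith
  have hRn : (n : ℝ) ≤ R := by nlinarith
  have tp : IsTest fun x => cut R x * ψ x := (isTest_cut hRp).mul_smooth hψ
  have iW := tp.integrable_sq_mul (contDiff_boundedWt k hη0)
  calc ∫ x in Metric.closedBall (0 : Plane) n, ψ x ^ 2 * wt k x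
      ≤ ∫ x in Metric.closedBall (0 : Plane) n, 2 ^ k * ((cut R x * ψ x) ^ 2
        * boundedWt k η x) := by
        refine setIntegral_mono_on (((hψ.continuous.pow 2).mul
          (continuous_wt k)).continuousOn.integrableOn_compact (isCompact_closedBall _ _))
          (iW.const_mul _).integrableOn Metric.isClosed_closedBall.measurableSet fun x hx => ?_
        have hx' : ‖x‖ ≤ n := by simpa using hx
        rw [cut_eq_one hRp (hx'.trans hRn), one_mul]
        have h1 : η * ‖x‖ ^ 2 ≤ 1 := by
          rw [hη, inv_mul_le_iff₀ (by positivity)]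
          have : ‖x‖ ^ 2 ≤ (n : ℝ) ^ 2 := by gcongr
          linarith
        have := mul_le_mul_of_nonneg_left (le_boundedWt hk0 hη0 h1) (sq_nonneg (ψ x))
        linarith
    _ ≤ ∫ x, 2 ^ k * ((cut R x * ψ x) ^ 2 * boundedWt k η x) :=
        setIntegral_le_integral (iW.const_mul _) (Filter.Eventually.of_forall fun x =>
          mul_nonneg (by positivity) (mul_nonneg (sq_nonneg _) (boundedWt_pos k hη0 x).le))
    _ ≤ 2 ^ k * B := by
        rw [integral_const_mul]
        have := main η R hη0 hη1 hR1 hR2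
        gcongr

/-! ### Truncation of stream functions -/

/-- The Japanese bracket `(1 + |ξ|²)^(1/2)`. -/
def bracket (x : Plane) : ℝ := Real.sqrt (1 + ‖x‖ ^ 2)

lemma bracket_sq (x : Plane) : bracket x ^ 2 = 1 + ‖x‖ ^ 2 := Real.sq_sqrt (one_add_pos x).le

lemma bracket_pos (x : Plane) : 0 < bracket x := Real.sqrt_pos.2 (one_add_pos x)

lemma norm_le_bracket (x : Plane) : ‖x‖ ≤ bracket x :=
  Real.le_sqrt_of_sq_le (by linarith)

lemma InL2.div_bracket {m : ℝ} {ψ : Plane → ℝ} (h : InL2 (m - 1) ψ) :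
    InL2 m fun x => |ψ x| / bracket x := by
  have hc : Continuous bracket := by unfold bracket; fun_prop
  refine ⟨h.meas.norm.div₀ hc.aestronglyMeasurable,
    h.int.congr (Filter.Eventually.of_forall fun x => ?_)⟩
  simp only []
  rw [div_pow, bracket_sq, sq_abs, wt_eq_mul_sub_one m]
  have := (one_add_pos x).ne'
  field_simp

/-- A derivative of the cutoff at scale `R` gains `1/R` and is supported in `|ξ| ≤ 2R`, where the
bracket is at most `3R`. Each such derivative is thus worth one inverse bracket, uniformly in `R`.
-/
lemma scaled_mul_bracket_le {D : Plane → ℝ} {C R : ℝ} (hC : ∀ z, |D z| ≤ C)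
    (hD : ∀ z, 2 < ‖z‖ → D z = 0) (hR : 1 ≤ R) (x : Plane) :
    |R⁻¹ * D (R⁻¹ • x)| * bracket x ≤ 3 * C := by
  have hC0 : 0 ≤ C := (abs_nonneg _).trans (hC 0)
  have hR0 : 0 < R := by linarith
  rcases lt_or_ge 2 ‖R⁻¹ • x‖ with h | h
  · rw [hD _ h]; simp; positivity
  · rw [norm_smul, norm_inv, Real.norm_of_nonneg hR0.le, inv_mul_le_iff₀ hR0] at h
    have h1 : bracket x ≤ 3 * R := by
      refine Real.sqrt_le_iff.2 ⟨by positivity, ?_⟩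
      have : ‖x‖ ^ 2 ≤ (R * 2) ^ 2 := by gcongr
      nlinarith
    rw [abs_mul, abs_of_pos (inv_pos.2 hR0)]
    calc R⁻¹ * |D (R⁻¹ • x)| * bracket x ≤ R⁻¹ * C * (3 * R) := by
          gcongr
          · exact (bracket_pos x).le
          · exact hC _
      _ = 3 * C := by field_simp

lemma IsTest.exists_bound {D : Plane → ℝ} (hD : IsTest D) : ∃ C, ∀ x, |D x| ≤ C :=
  hD.1.continuous.bounded_above_of_compact_support hD.2

lemma driftOp_mul (A : ℝ) {f g : Plane → ℝ} (hf : ContDiff ℝ ∞ f) (hg : ContDiff ℝ ∞ g)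
    (x : Plane) : driftOp A (fun z => f z * g z) x = f x * driftOp A g x + g x * driftOp A f x
      + 2 * (partialD 0 f x * partialD 0 g x + partialD 1 f x * partialD 1 g x) := by
  have h1 : ∀ j, partialD j (fun z => f z * g z)
      = fun x => partialD j f x * g x + f x * partialD j g x :=
    fun j => funext fun x => partialD_mul hf hg j x
  have h2 : ∀ j, partialD j (partialD j fun z => f z * g z) x
      = partialD j (partialD j f) x * g x + 2 * (partialD j f x * partialD j g x)
        + f x * partialD j (partialD j g) x := fun j => by
    rw [h1, partialD_add ((contDiff_partialD hf j).mul hg) (hf.mul (contDiff_partialD hg j)),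
      partialD_mul (contDiff_partialD hf j) hg, partialD_mul hf (contDiff_partialD hg j)]
    ring
  unfold driftOp lap advect
  rw [h2, h2, h1, h1]
  ring

lemma driftOp_cut (A R : ℝ) (x : Plane) : driftOp A (cut R) x
    = R⁻¹ * (R⁻¹ * lap bump (R⁻¹ • x)) + 1 / 2 * radBump (R⁻¹ • x) := by
  have h2 : ∀ j, partialD j (partialD j (cut R)) x
      = R⁻¹ * (R⁻¹ * partialD j (partialD j bump) (R⁻¹ • x)) := fun j => by
    have e : partialD j (cut R) = fun x => R⁻¹ * partialD j bump (R⁻¹ • x) :=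
      funext fun x => partialD_cut R j x
    have hs : ContDiff ℝ ∞ fun x : Plane => partialD j bump (R⁻¹ • x) :=
      (contDiff_partialD contDiff_bump j).comp (contDiff_const_smul _)
    rw [e, partialD_const_mul hs, partialD_comp_smul (contDiff_partialD contDiff_bump j)]
  have h3 := advect_oseen_cut R x
  have h4 := advect_cut R x
  unfold driftOp lap
  rw [h2, h2, ← h4]
  unfold advect drift at *
  linear_combination (-A) * h3

lemma streamOp_cut_mul (A : ℝ) {R : ℝ} (hR : 0 < R) {ψ : Plane → ℝ} (hψ : ContDiff ℝ ∞ ψ) :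
    streamOp A (fun z => cut R z * ψ z) = fun x => cut R x * streamOp A ψ x
      + ψ x * driftOp A (cut R) x
      + 2 * (partialD 0 (cut R) x * partialD 0 ψ x + partialD 1 (cut R) x * partialD 1 ψ x) := by
  funext x
  unfold streamOp
  rw [driftOp_mul A (isTest_cut hR).1 hψ]
  ring

lemma partialD_streamOp_cut_mul (A : ℝ) {R : ℝ} (hR : 0 < R) {ψ : Plane → ℝ}
    (hψ : ContDiff ℝ ∞ ψ) (j : Fin 2) (x : Plane) :
    partialD j (streamOp A fun z => cut R z * ψ z) x
      = partialD j (cut R) x * streamOp A ψ x + cut R x * partialD j (streamOp A ψ) x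
      + (partialD j ψ x * driftOp A (cut R) x + ψ x * partialD j (driftOp A (cut R)) x)
      + 2 * ((partialD j (partialD 0 (cut R)) x * partialD 0 ψ x
          + partialD 0 (cut R) x * partialD j (partialD 0 ψ) x)
        + (partialD j (partialD 1 (cut R)) x * partialD 1 ψ x
          + partialD 1 (cut R) x * partialD j (partialD 1 ψ) x)) := by
  have tc := isTest_cut hR
  have c1 : ContDiff ℝ ∞ fun x => cut R x * streamOp A ψ x := tc.1.mul (contDiff_streamOp A hψ)
  have c2 : ContDiff ℝ ∞ fun x => ψ x * driftOp A (cut R) x := hψ.mul (contDiff_driftOp A tc.1)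
  have c3 : ∀ i, ContDiff ℝ ∞ fun x => partialD i (cut R) x * partialD i ψ x := fun i =>
    (contDiff_partialD tc.1 i).mul (contDiff_partialD hψ i)
  rw [streamOp_cut_mul A hR hψ, partialD_add (c1.add c2) (contDiff_const.mul ((c3 0).add (c3 1))),
    partialD_add c1 c2, partialD_const_mul ((c3 0).add (c3 1)), partialD_add (c3 0) (c3 1),
    partialD_mul tc.1 (contDiff_streamOp A hψ), partialD_mul hψ (contDiff_driftOp A tc.1),
    partialD_mul (contDiff_partialD tc.1 0) (contDiff_partialD hψ 0),
    partialD_mul (contDiff_partialD tc.1 1) (contDiff_partialD hψ 1)]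

/-- The bounds are uniform in `R`: the vortex drops out, `ξ·∇` is invariant under dilation, and
every other term carries negative powers of `R`. -/
lemma cut_bounds (A : ℝ) : ∃ K, 0 ≤ K ∧ ∀ R, 1 ≤ R → ∀ (x : Plane) (i j : Fin 2),
    |partialD i (cut R) x| ≤ K ∧ |partialD i (cut R) x| * bracket x ≤ K ∧
    |partialD j (partialD i (cut R)) x| ≤ K ∧ |driftOp A (cut R) x| ≤ K ∧
    |partialD j (driftOp A (cut R)) x| * bracket x ≤ K := by
  have tb := isTest_bump
  have z0 : ∀ i z, 2 < ‖z‖ → partialD i bump z = 0 := fun i z hz =>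
    partialD_eq_zero_of_ball (fun _ => bump_eq_zero) i hz
  have zr : ∀ z, 2 < ‖z‖ → radBump z = 0 := fun z hz => by
    unfold radBump advect; rw [z0 _ z hz, z0 _ z hz]; ring
  have zl : ∀ z, 2 < ‖z‖ → lap bump z = 0 := fun z hz => by
    unfold lap
    rw [partialD_eq_zero_of_ball (z0 0) 0 hz, partialD_eq_zero_of_ball (z0 1) 1 hz]; ring
  choose B1 hB1 using fun i => (tb.partialD i).exists_bound
  choose B2 hB2 using fun i j => ((tb.partialD i).partialD j).exists_bound
  obtain ⟨B3, hB3⟩ := tb.lap.exists_bound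
  obtain ⟨B4, hB4⟩ := isTest_radBump.exists_bound
  choose B5 hB5 using fun j => (tb.lap.partialD j).exists_bound
  choose B6 hB6 using fun j => (isTest_radBump.partialD j).exists_bound
  set K := 3 * (∑ i, |B1 i|) + (∑ i, ∑ j, |B2 i j|) + |B3| + |B4| + 3 * (∑ j, |B5 j|)
    + 3 * ∑ j, |B6 j| with hK
  have n1 : 0 ≤ ∑ i, |B1 i| := Finset.sum_nonneg fun _ _ => abs_nonneg _
  have n2 : 0 ≤ ∑ i, ∑ j, |B2 i j| :=
    Finset.sum_nonneg fun _ _ => Finset.sum_nonneg fun _ _ => abs_nonneg _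
  have n3 := abs_nonneg B3
  have n4 := abs_nonneg B4
  have n5 : 0 ≤ ∑ j, |B5 j| := Finset.sum_nonneg fun _ _ => abs_nonneg _
  have n6 : 0 ≤ ∑ j, |B6 j| := Finset.sum_nonneg fun _ _ => abs_nonneg _
  refine ⟨K, by positivity, fun R hR x i j => ?_⟩
  have hR0 : 0 < R := by linarith
  have hRi : R⁻¹ ≤ 1 := inv_le_one_of_one_le₀ hR
  have hRp : 0 < R⁻¹ := inv_pos.2 hR0
  have l1 : B1 i ≤ ∑ i, |B1 i| := (le_abs_self _).trans
    (Finset.single_le_sum (f := fun i => |B1 i|) (fun _ _ => abs_nonneg _) (Finset.mem_univ i))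
  have l2 : B2 i j ≤ ∑ i, ∑ j, |B2 i j| := (le_abs_self _).trans
    ((Finset.single_le_sum (f := fun j => |B2 i j|) (fun _ _ => abs_nonneg _)
      (Finset.mem_univ j)).trans (Finset.single_le_sum (f := fun i => ∑ j, |B2 i j|)
      (fun _ _ => Finset.sum_nonneg fun _ _ => abs_nonneg _) (Finset.mem_univ i)))
  have l5 : B5 j ≤ ∑ j, |B5 j| := (le_abs_self _).trans
    (Finset.single_le_sum (f := fun i => |B5 i|) (fun _ _ => abs_nonneg _) (Finset.mem_univ j))
  have l6 : B6 j ≤ ∑ j, |B6 j| := (le_abs_self _).trans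
    (Finset.single_le_sum (f := fun i => |B6 i|) (fun _ _ => abs_nonneg _) (Finset.mem_univ j))
  have l3 := le_abs_self B3
  have l4 := le_abs_self B4
  have scale : ∀ a : ℝ, |R⁻¹ * a| ≤ |a| := fun a => by
    rw [abs_mul, abs_of_pos hRp]
    exact mul_le_of_le_one_left (abs_nonneg _) hRi
  have dd : partialD j (partialD i (cut R)) x
      = R⁻¹ * (R⁻¹ * partialD j (partialD i bump) (R⁻¹ • x)) := by
    have e : partialD i (cut R) = fun x => R⁻¹ * partialD i bump (R⁻¹ • x) :=
      funext fun x => partialD_cut R i x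
    have hs : ContDiff ℝ ∞ fun x : Plane => partialD i bump (R⁻¹ • x) :=
      (contDiff_partialD contDiff_bump i).comp (contDiff_const_smul _)
    rw [e, partialD_const_mul hs, partialD_comp_smul (contDiff_partialD contDiff_bump i)]
  have de : partialD j (driftOp A (cut R)) x
      = R⁻¹ * (R⁻¹ * R⁻¹ * partialD j (lap bump) (R⁻¹ • x))
        + 1 / 2 * (R⁻¹ * partialD j radBump (R⁻¹ • x)) := by
    have e : driftOp A (cut R) = fun x => R⁻¹ * (R⁻¹ * lap bump (R⁻¹ • x))
        + 1 / 2 * radBump (R⁻¹ • x) := funext fun x => driftOp_cut A R x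
    have s1 : ContDiff ℝ ∞ fun x : Plane => lap bump (R⁻¹ • x) :=
      tb.lap.1.comp (contDiff_const_smul _)
    have s2 : ContDiff ℝ ∞ fun x : Plane => radBump (R⁻¹ • x) :=
      isTest_radBump.1.comp (contDiff_const_smul _)
    rw [e, partialD_add (contDiff_const.mul (contDiff_const.mul s1)) (contDiff_const.mul s2),
      partialD_const_mul (contDiff_const.mul s1), partialD_const_mul s1, partialD_const_mul s2,
      partialD_comp_smul tb.lap.1, partialD_comp_smul isTest_radBump.1]
    ring
  refine ⟨?_, ?_, ?_, ?_, ?_⟩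
  · rw [partialD_cut]
    have := (scale _).trans (hB1 i (R⁻¹ • x))
    linarith
  · rw [partialD_cut]
    have := scaled_mul_bracket_le (hB1 i) (z0 i) hR x
    linarith
  · rw [dd]
    have := (scale _).trans ((scale _).trans (hB2 i j (R⁻¹ • x)))
    linarith
  · rw [driftOp_cut]
    have a1 := (scale _).trans ((scale _).trans (hB3 (R⁻¹ • x)))
    have a2 := hB4 (R⁻¹ • x)
    refine (abs_add_le _ _).trans ?_
    rw [abs_mul (1 / 2 : ℝ), abs_of_pos (by norm_num : (0 : ℝ) < 1 / 2)]
    have a3 := abs_nonneg (radBump (R⁻¹ • x))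
    linarith
  · rw [de]
    have a1 := scaled_mul_bracket_le (D := fun z => R⁻¹ * R⁻¹ * partialD j (lap bump) z)
      (fun z => by
        rw [mul_assoc]; exact (scale _).trans ((scale _).trans (hB5 j z)))
      (fun z hz => by rw [partialD_eq_zero_of_ball zl j hz, mul_zero]) hR x
    have a2 := scaled_mul_bracket_le (hB6 j) (fun z hz => partialD_eq_zero_of_ball zr j hz) hR x
    have hb := bracket_pos x
    refine (mul_le_mul_of_nonneg_right (abs_add_le _ _) hb.le).trans ?_
    rw [abs_mul (1 / 2 : ℝ), abs_of_pos (by norm_num : (0 : ℝ) < 1 / 2)]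
    have a3 : 0 ≤ |R⁻¹ * partialD j radBump (R⁻¹ • x)| * bracket x := by positivity
    linarith

/-- The drift is globally Lipschitz and vanishes at the origin, hence grows at most linearly. The
Lipschitz bound serves the mollification commutator, the growth bound the truncation. -/
lemma exists_drift_bound (A : ℝ) : ∃ L, 0 ≤ L ∧ (∀ x y i, |drift A x i - drift A y i| ≤ L * ‖x - y‖)
    ∧ ∀ x i, |drift A x i| ≤ L * bracket x := by
  obtain ⟨D, hD, hu⟩ := exists_bound_partialD_oseen
  have hu1 : ∀ i j x, |partialD j (fun z => oseen z i) x| ≤ D := fun i j x => by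
    refine le_trans (le_mul_of_one_le_right (abs_nonneg _) ?_) (hu i j x)
    nlinarith [sq_nonneg ‖x‖]
  have lip : ∀ x y i, |drift A x i - drift A y i| ≤ 2 * (1 + |A| * D) * ‖x - y‖ := fun x y i =>
    abs_sub_le_of_abs_partialD_le (contDiff_drift A i) convex_univ (fun z _ j => by
      rw [partialD_drift]
      refine (abs_sub _ _).trans (add_le_add ?_ ?_)
      · split_ifs <;> norm_num
      · rw [abs_mul]; exact mul_le_mul_of_nonneg_left (hu1 i j z) (abs_nonneg _))
      (Set.mem_univ y) (Set.mem_univ x)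
  refine ⟨2 * (1 + |A| * D), by positivity, lip, fun x i => ?_⟩
  have h0 : drift A 0 i = 0 := by
    unfold drift
    fin_cases i <;> simp [oseen_zero, oseen_one]
  have := lip x 0 i
  rw [h0, sub_zero, sub_zero] at this
  exact this.trans (by have := norm_le_bracket x; gcongr)

lemma integral_gradSq_le {m c : ℝ} {p G : Plane → ℝ} (hp : IsTest p)
    (hG : InL2 m G) (h : ∀ x j, |partialD j p x| ≤ c * G x) :
    ∫ x, gradSq p x * wt m x ≤ 2 * c ^ 2 * ∫ x, G x ^ 2 * wt m x := by
  rw [← integral_const_mul]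
  refine integral_mono (hp.gradSq.mul_smooth (contDiff_wt m)).integrable (hG.int.const_mul _)
    fun x => ?_
  have h1 : ∀ j, partialD j p x ^ 2 ≤ c ^ 2 * G x ^ 2 := fun j => by
    rw [← sq_abs, ← mul_pow]
    exact pow_le_pow_left₀ (abs_nonneg _) (h x j) 2
  have h2 : gradSq p x ≤ 2 * c ^ 2 * G x ^ 2 := by
    unfold gradSq; linarith [h1 0, h1 1]
  have := mul_le_mul_of_nonneg_right h2 (wt_pos m x).le
  simp only []
  linarith

/-- Truncations of a stream function are bounded in the energy norm. -/
lemma exists_bound_gradient_cut {m : ℝ} {ψ : Plane → ℝ} (hψ : ContDiff ℝ ∞ ψ)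
    (h0 : InL2 (m - 1) ψ) (h1 : ∀ j, InL2 m (partialD j ψ)) :
    ∃ C, ∀ R, 1 ≤ R → ∫ x, gradSq (fun z => cut R z * ψ z) x * wt m x ≤ C := by
  obtain ⟨K, hK, hc⟩ := cut_bounds 0
  -- A majorant independent of `R`. The function `ψ` itself is only in weight `m - 1`; it enters
  -- divided by the bracket, which a derivative of the cutoff supplies.
  set G : Plane → ℝ := fun x => |partialD 0 ψ x| + |partialD 1 ψ x| + |ψ x| / bracket x with hG
  have hGL : InL2 m G := ((h1 0).abs.add (h1 1).abs).add h0.div_bracket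
  refine ⟨_, fun R hR => integral_gradSq_le (c := 1 + K)
    ((isTest_cut (by linarith)).mul_smooth hψ) hGL fun x j => ?_⟩
  have hb := bracket_pos x
  obtain ⟨-, c2, -⟩ := hc R hR x j j
  have hcm := cut_mem R x
  rw [partialD_mul (isTest_cut (by linarith)).1 hψ]
  have a1 : |partialD j (cut R) x * ψ x| ≤ K * (|ψ x| / bracket x) := by
    rw [abs_mul]
    calc _ = (|partialD j (cut R) x| * bracket x) * (|ψ x| / bracket x) := by field_simp
      _ ≤ _ := by gcongr
  have a2 : |cut R x * partialD j ψ x| ≤ |partialD j ψ x| := by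
    rw [abs_mul, abs_of_nonneg hcm.1]
    exact mul_le_of_le_one_left (abs_nonneg _) hcm.2
  have a3 : |partialD j ψ x| ≤ |partialD 0 ψ x| + |partialD 1 ψ x| := by
    fin_cases j
    · exact le_add_of_nonneg_right (abs_nonneg _)
    · exact le_add_of_nonneg_left (abs_nonneg _)
  have n0 := abs_nonneg (partialD 0 ψ x)
  have n1 := abs_nonneg (partialD 1 ψ x)
  have n2 : 0 ≤ |ψ x| / bracket x := by positivity
  refine (abs_add_le _ _).trans ?_
  simp only [hG]
  have := mul_nonneg hK (add_nonneg n0 n1)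
  linarith

/-- The images of truncations of a stream function are bounded in the energy norm. -/
lemma exists_bound_gradient_streamOp_cut (A : ℝ) {m : ℝ} {ψ : Plane → ℝ} (hψ : ContDiff ℝ ∞ ψ)
    (h0 : InL2 (m - 1) ψ) (h1 : ∀ j, InL2 m (partialD j ψ))
    (h2 : ∀ i j, InL2 m (partialD i (partialD j ψ)))
    (h3 : ∀ j, InL2 m (partialD j (streamOp A ψ))) :
    ∃ C, ∀ R, 1 ≤ R → ∫ x, gradSq (streamOp A fun z => cut R z * ψ z) x * wt m x ≤ C := by
  obtain ⟨K, hK, hc⟩ := cut_bounds A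
  obtain ⟨L, hL, -, hdr⟩ := exists_drift_bound A
  set G : Plane → ℝ := fun x => |partialD 0 (streamOp A ψ) x| + |partialD 1 (streamOp A ψ) x|
    + (|partialD 0 ψ x| + |partialD 1 ψ x|)
    + ((|partialD 0 (partialD 0 ψ) x| + |partialD 0 (partialD 1 ψ) x|)
      + (|partialD 1 (partialD 0 ψ) x| + |partialD 1 (partialD 1 ψ) x|))
    + |ψ x| / bracket x with hG
  have hGL : InL2 m G := ((((h3 0).abs.add (h3 1).abs).add ((h1 0).abs.add (h1 1).abs)).add
    (((h2 0 0).abs.add (h2 0 1).abs).add ((h2 1 0).abs.add (h2 1 1).abs))).add h0.div_bracket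
  refine ⟨_, fun R hR => integral_gradSq_le (c := 1 + 4 * K + K * L)
    (((isTest_cut (by linarith)).mul_smooth hψ).streamOp A) hGL fun x j => ?_⟩
  have hb := bracket_pos x
  have hcm := cut_mem R x
  have hR0 : 0 < R := by linarith
  obtain ⟨c1, c2, -, c4, c5⟩ := hc R hR x j j
  rw [partialD_streamOp_cut_mul A hR0 hψ]
  have n2 : 0 ≤ |ψ x| / bracket x := by positivity
  -- Here the unbounded drift meets a derivative of the cutoff, whose inverse bracket absorbs the
  -- linear growth.
  have q1 : |partialD j (cut R) x * streamOp A ψ x| ≤ K * (|partialD 0 (partialD 0 ψ) x|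
      + |partialD 1 (partialD 1 ψ) x|) + K * L * (|partialD 0 ψ x| + |partialD 1 ψ x|)
      + K * (|ψ x| / bracket x) := by
    have e : streamOp A ψ x = (partialD 0 (partialD 0 ψ) x + partialD 1 (partialD 1 ψ) x)
        + (drift A x 0 * partialD 0 ψ x + drift A x 1 * partialD 1 ψ x) + ψ x / 2 := rfl
    rw [e, mul_add, mul_add]
    refine (abs_add_le _ _).trans (add_le_add ((abs_add_le _ _).trans (add_le_add ?_ ?_)) ?_)
    · rw [abs_mul]
      exact mul_le_mul c1 (abs_add_le _ _) (abs_nonneg _) hK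
    · have h4 : |drift A x 0 * partialD 0 ψ x + drift A x 1 * partialD 1 ψ x|
          ≤ L * bracket x * (|partialD 0 ψ x| + |partialD 1 ψ x|) := by
        refine (abs_add_le _ _).trans ?_
        rw [abs_mul, abs_mul, mul_add]
        have := hdr x 0
        have := hdr x 1
        gcongr
      rw [abs_mul]
      calc _ ≤ |partialD j (cut R) x| * (L * bracket x * (|partialD 0 ψ x| + |partialD 1 ψ x|)) := by
            gcongr
        _ = (|partialD j (cut R) x| * bracket x) * L * (|partialD 0 ψ x| + |partialD 1 ψ x|) := by
            ring
        _ ≤ _ := by gcongr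
    · rw [abs_mul, abs_div, abs_two]
      calc _ = (|partialD j (cut R) x| * bracket x) * (|ψ x| / bracket x) / 2 := by field_simp
        _ ≤ K * (|ψ x| / bracket x) / 2 := by gcongr
        _ ≤ _ := by linarith [mul_nonneg hK n2]
  have q2 : |cut R x * partialD j (streamOp A ψ) x| ≤ |partialD j (streamOp A ψ) x| := by
    rw [abs_mul, abs_of_nonneg hcm.1]
    exact mul_le_of_le_one_left (abs_nonneg _) hcm.2
  have q3 : |partialD j ψ x * driftOp A (cut R) x| ≤ K * |partialD j ψ x| := by
    rw [abs_mul, mul_comm]; gcongr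
  have q4 : |ψ x * partialD j (driftOp A (cut R)) x| ≤ K * (|ψ x| / bracket x) := by
    rw [abs_mul]
    calc _ = (|partialD j (driftOp A (cut R)) x| * bracket x) * (|ψ x| / bracket x) := by field_simp
      _ ≤ _ := by gcongr
  have q5 : ∀ i, |partialD j (partialD i (cut R)) x * partialD i ψ x| ≤ K * |partialD i ψ x| :=
    fun i => by
      rw [abs_mul]
      have := (hc R hR x i j).2.2.1
      gcongr
  have q6 : ∀ i, |partialD i (cut R) x * partialD j (partialD i ψ) x|
      ≤ K * |partialD j (partialD i ψ) x| := fun i => by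
    rw [abs_mul]
    have := (hc R hR x i j).1
    gcongr
  have tri : ∀ a b c d e f g h : ℝ, |a + b + (c + d) + 2 * ((e + f) + (g + h))|
      ≤ |a| + |b| + (|c| + |d|) + 2 * ((|e| + |f|) + (|g| + |h|)) := by
    intro a b c d e f g h
    refine (abs_add_le _ _).trans (add_le_add ((abs_add_le _ _).trans
      (add_le_add (abs_add_le _ _) (abs_add_le _ _))) ?_)
    rw [abs_mul, abs_two]
    refine mul_le_mul_of_nonneg_left ?_ (by norm_num)
    exact (abs_add_le _ _).trans (add_le_add (abs_add_le _ _) (abs_add_le _ _))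
  refine (tri _ _ _ _ _ _ _ _).trans ?_
  have r5 := q5 0
  have r5' := q5 1
  have r6 := q6 0
  have r6' := q6 1
  have s1 : |partialD j (streamOp A ψ) x|
      ≤ |partialD 0 (streamOp A ψ) x| + |partialD 1 (streamOp A ψ) x| := by
    fin_cases j
    · exact le_add_of_nonneg_right (abs_nonneg _)
    · exact le_add_of_nonneg_left (abs_nonneg _)
  have s2 : |partialD j ψ x| ≤ |partialD 0 ψ x| + |partialD 1 ψ x| := by
    fin_cases j
    · exact le_add_of_nonneg_right (abs_nonneg _)
    · exact le_add_of_nonneg_left (abs_nonneg _)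
  have s3 : |partialD j (partialD 0 ψ) x| + |partialD j (partialD 1 ψ) x|
      ≤ (|partialD 0 (partialD 0 ψ) x| + |partialD 0 (partialD 1 ψ) x|)
      + (|partialD 1 (partialD 0 ψ) x| + |partialD 1 (partialD 1 ψ) x|) := by
    fin_cases j
    · exact le_add_of_nonneg_right (by positivity)
    · exact le_add_of_nonneg_left (by positivity)
  have s4 : |partialD 0 (partialD 0 ψ) x| + |partialD 1 (partialD 1 ψ) x|
      ≤ (|partialD 0 (partialD 0 ψ) x| + |partialD 0 (partialD 1 ψ) x|)
      + (|partialD 1 (partialD 0 ψ) x| + |partialD 1 (partialD 1 ψ) x|) := by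
    linarith [abs_nonneg (partialD 0 (partialD 1 ψ) x), abs_nonneg (partialD 1 (partialD 0 ψ) x)]
  have k2 := mul_le_mul_of_nonneg_left s2 hK
  have k3 := mul_le_mul_of_nonneg_left s3 hK
  have k4 := mul_le_mul_of_nonneg_left s4 hK
  simp only [hG]
  set S := |partialD 0 (streamOp A ψ) x| + |partialD 1 (streamOp A ψ) x|
  set D := |partialD 0 ψ x| + |partialD 1 ψ x| with hD
  set H := (|partialD 0 (partialD 0 ψ) x| + |partialD 0 (partialD 1 ψ) x|)
      + (|partialD 1 (partialD 0 ψ) x| + |partialD 1 (partialD 1 ψ) x|)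
  set P := |ψ x| / bracket x
  have nS : 0 ≤ S := by positivity
  have nD : 0 ≤ D := by positivity
  have nH : 0 ≤ H := by positivity
  have hKL : 0 ≤ K * L := by positivity
  have m1 := mul_nonneg hK nS
  have m2 := mul_nonneg hK nD
  have m3 := mul_nonneg hK nH
  have m4 := mul_nonneg hK n2
  have m5 := mul_nonneg hKL nS
  have m6 := mul_nonneg hKL nH
  have m7 := mul_nonneg hKL n2
  have e5 : K * |partialD 0 ψ x| + K * |partialD 1 ψ x| = K * D := by rw [hD]; ring
  linarith

/-! ### Mollified solutions -/

/-- Real fields that are divergence free in the sense of distributions. -/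
def DivFreeR (φ : Fin 2 → Plane → ℝ) : Prop :=
  ∀ η, IsTest η → ∑ j, ∫ x, partialD j η x * φ j x = 0

/-- The equation `L_A φ = f` for real fields, in the sense of distributions. -/
def WeakEqR (A : ℝ) (φ f : Fin 2 → Plane → ℝ) : Prop :=
  ∀ η, IsTest η → ∀ i, (∫ x, adjointOp A η x * φ i x)
      + A * (∑ j, ∫ x, (η x * partialD j (fun z => oseen z i) x) * φ j x) = ∫ x, η x * f i x

lemma IsTest.comp_sub {ρ : Plane → ℝ} (hρ : IsTest ρ) (x : Plane) : IsTest fun t => ρ (x - t) :=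
  ⟨hρ.1.comp (contDiff_const.sub contDiff_id), hρ.2.comp_homeomorph (Homeomorph.subLeft x)⟩

lemma partialD_comp_sub {ρ : Plane → ℝ} (hρ : ContDiff ℝ ∞ ρ) (x : Plane) (j : Fin 2) (t : Plane) :
    partialD j (fun t => ρ (x - t)) t = -partialD j ρ (x - t) := by
  unfold partialD
  have h : HasFDerivAt (fun t => ρ (x - t))
      ((fderiv ℝ ρ (x - t)).comp (-ContinuousLinearMap.id ℝ Plane)) t :=
    (ContDiff.diffAt hρ _).hasFDerivAt.comp t ((hasFDerivAt_id t).const_sub x)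
  rw [h.fderiv]; simp

lemma lap_comp_sub {ρ : Plane → ℝ} (hρ : ContDiff ℝ ∞ ρ) (x t : Plane) :
    lap (fun t => ρ (x - t)) t = lap ρ (x - t) := by
  have h : ∀ j, partialD j (partialD j fun t => ρ (x - t)) t = partialD j (partialD j ρ) (x - t) := by
    intro j
    have e : (partialD j fun t => ρ (x - t)) = fun t => -partialD j ρ (x - t) :=
      funext fun t => partialD_comp_sub hρ x j t
    rw [e, partialD_neg, partialD_comp_sub (contDiff_partialD hρ j), neg_neg]
  unfold lap
  rw [h, h]

/-- In two dimensions `-½ div(ηξ)` contributes `-η`, which cancels the zero-order term `+η`, and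
`div(ηu⁰) = u⁰·∇η`. -/
lemma adjointOp_eq_sub_advect (A : ℝ) {η : Plane → ℝ} (hη : IsTest η) (x : Plane) :
    adjointOp A η x = lap η x - advect (drift A) η x := by
  rw [adjointOp_eq A hη, divergence_smul_eq, divergence_smul_eq,
    partialD_mul hη.1 (contDiff_coord 0), partialD_mul hη.1 (contDiff_coord 1),
    partialD_mul hη.1 (contDiff_oseen_apply 0), partialD_mul hη.1 (contDiff_oseen_apply 1),
    partialD_coord, partialD_coord]
  unfold advect drift
  simp only [if_true]
  linear_combination (A * η x) * div_oseen x

lemma adjointOp_comp_sub (A : ℝ) {ρ : Plane → ℝ} (hρ : IsTest ρ) (x t : Plane) :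
    adjointOp A (fun t => ρ (x - t)) t = lap ρ (x - t)
      + (drift A t 0 * partialD 0 ρ (x - t) + drift A t 1 * partialD 1 ρ (x - t)) := by
  rw [adjointOp_eq_sub_advect A (hρ.comp_sub x), lap_comp_sub hρ.1]
  unfold advect
  rw [partialD_comp_sub hρ.1, partialD_comp_sub hρ.1]
  ring

lemma divFree_moll {φ : Fin 2 → Plane → ℝ} (hi : ∀ i, Integrable (φ i)) (hφ : DivFreeR φ)
    {ρ : Plane → ℝ} (hρ : IsTest ρ) (x : Plane) :
    partialD 0 (moll (φ 0) ρ) x + partialD 1 (moll (φ 1) ρ) x = 0 := by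
  have h := hφ _ (hρ.comp_sub x)
  rw [partialD_moll (hi 0) hρ, partialD_moll (hi 1) hρ]
  unfold moll
  simp only [Fin.sum_univ_two, partialD_comp_sub hρ.1] at h
  simp only [neg_mul, integral_neg] at h
  simp only [mul_comm (φ _ _)]
  linarith

/-- The kernel that dominates the commutator of a mollification with the operator. -/
def commKernel (ρ : Plane → ℝ) (z : Plane) : ℝ :=
  |ρ z| + ‖z‖ * (|partialD 0 ρ z| + |partialD 1 ρ z|)

lemma isKernel_commKernel {ρ : Plane → ℝ} (hρ : ContDiff ℝ ∞ ρ) (h : ∀ z, 1 < ‖z‖ → ρ z = 0) :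
    IsKernel (commKernel ρ) := by
  refine ⟨?_, fun z => by unfold commKernel; positivity, fun z hz => ?_⟩
  · exact hρ.continuous.abs.add (continuous_norm.mul
      ((continuous_partialD hρ 0).abs.add (continuous_partialD hρ 1).abs))
  · unfold commKernel
    rw [h z hz, partialD_eq_zero_of_ball h 0 hz, partialD_eq_zero_of_ball h 1 hz]; simp

/-- The factor `|z|` compensates the derivative, so concentrating the mollifier does not change the
`L¹` norm of the commutator kernel. The commutator estimate is therefore uniform along the
mollification. -/
lemma commKernel_rescale {ρ : Plane → ℝ} (hρ : ContDiff ℝ ∞ ρ) {N : ℝ} (hN : 0 < N) :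
    commKernel (rescale N ρ) = rescale N (commKernel ρ) := by
  funext z
  unfold commKernel
  rw [partialD_rescale hρ, partialD_rescale hρ]
  unfold rescale
  beta_reduce
  rw [norm_smul, Real.norm_of_nonneg hN.le]
  simp only [abs_mul, abs_pow, abs_of_pos hN]
  ring

/-- A Friedrichs commutator estimate. Inserting `ρ(x - ·)` in the weak equation expresses `L_A(φ *
ρ)(x)` by `f * ρ`, the terms `(b(x) - b(t))·∇ρ(x-t) φ(t)` with `b` the Lipschitz drift, and
zero-order terms. All are dominated by `commKernel`. Only boundedness is claimed, not that the
commutator tends to zero. -/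
lemma abs_linOpR_moll_le (A : ℝ) : ∃ C, 0 ≤ C ∧ ∀ (φ f : Fin 2 → Plane → ℝ) (ρ : Plane → ℝ),
    (∀ i, Integrable (φ i)) → (∀ i, Integrable (f i)) → WeakEqR A φ f → IsTest ρ →
    ∀ i x, |linOpR A (fun i => moll (φ i) ρ) i x|
      ≤ C * moll (fun t => |(|f i t| + (|φ 0 t| + |φ 1 t|))|) (commKernel ρ) x := by
  obtain ⟨D, hD, hu⟩ := exists_bound_partialD_oseen
  obtain ⟨L, hL, hlip, -⟩ := exists_drift_bound A
  have hu1 : ∀ i j x, |partialD j (fun z => oseen z i) x| ≤ D := fun i j x => by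
    refine le_trans (le_mul_of_one_le_right (abs_nonneg _) ?_) (hu i j x)
    nlinarith [sq_nonneg ‖x‖]
  refine ⟨1 + L + |A| * (2 * D), by positivity, fun φ f ρ hi hf hw hρ i x => ?_⟩
  have tη := hρ.comp_sub x
  have h := hw _ tη i
  have I : ∀ (g : Plane → ℝ) (η : Plane → ℝ), Integrable g → IsTest η →
      Integrable fun t => η (x - t) * g t := fun g η hg hη =>
    (integrable_mul_comp_sub hg hη.1.continuous hη.2 x).congr
      (Filter.Eventually.of_forall fun t => mul_comm _ _)
  have J : ∀ (g b : Plane → ℝ) (η : Plane → ℝ), Integrable g → IsTest η → ContDiff ℝ ∞ b →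
      Integrable fun t => b t * η (x - t) * g t := fun g b η hg hη hb => by
    have tb := (hη.comp_sub x).smooth_mul hb
    obtain ⟨B, hB⟩ := tb.exists_bound
    exact hg.bdd_mul (c := B) tb.1.continuous.aestronglyMeasurable
      (Filter.Eventually.of_forall hB)
  simp only [adjointOp_comp_sub A hρ, Fin.sum_univ_two] at h
  have e1 : ∫ t, (lap ρ (x - t) + (drift A t 0 * partialD 0 ρ (x - t)
        + drift A t 1 * partialD 1 ρ (x - t))) * φ i t
      = (∫ t, lap ρ (x - t) * φ i t) + ((∫ t, drift A t 0 * partialD 0 ρ (x - t) * φ i t)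
        + ∫ t, drift A t 1 * partialD 1 ρ (x - t) * φ i t) := by
    rw [← integral_add, ← integral_add]
    · congr 1; funext t; ring
    exacts [I _ _ (hi i) hρ.lap, (J _ _ _ (hi i) (hρ.partialD 0) (contDiff_drift A 0)).add
        (J _ _ _ (hi i) (hρ.partialD 1) (contDiff_drift A 1)),
      J _ _ _ (hi i) (hρ.partialD 0) (contDiff_drift A 0),
      J _ _ _ (hi i) (hρ.partialD 1) (contDiff_drift A 1)]
  rw [e1] at h
  have m1 : ∀ (g η : Plane → ℝ), moll g η x = ∫ t, η (x - t) * g t := fun g η => by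
    unfold moll; congr 1; funext t; ring
  have hlap : lap (moll (φ i) ρ) x = ∫ t, lap ρ (x - t) * φ i t := by
    unfold lap
    rw [partialD_moll (hi i) hρ, partialD_moll (hi i) hρ, partialD_moll (hi i) (hρ.partialD 0),
      partialD_moll (hi i) (hρ.partialD 1), m1, m1, ← integral_add]
    · congr 1; funext t; ring
    exacts [I _ _ (hi i) ((hρ.partialD 0).partialD 0), I _ _ (hi i) ((hρ.partialD 1).partialD 1)]
  -- The summand `ρ φᵢ` is the zero-order term of `linOpR`, which has no counterpart in the formal
  -- adjoint.
  set Q : Plane → ℝ := fun t => ρ (x - t) * f i t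
    + ((drift A x 0 - drift A t 0) * (partialD 0 ρ (x - t) * φ i t)
      + (drift A x 1 - drift A t 1) * (partialD 1 ρ (x - t) * φ i t))
    + ρ (x - t) * φ i t
    + A * ((partialD 0 (fun z => oseen z i) x - partialD 0 (fun z => oseen z i) t)
        * (ρ (x - t) * φ 0 t)
      + (partialD 1 (fun z => oseen z i) x - partialD 1 (fun z => oseen z i) t)
        * (ρ (x - t) * φ 1 t)) with hQ
  have key : linOpR A (fun i => moll (φ i) ρ) i x = ∫ t, Q t := by
    have d0 : ∀ j, Integrable fun t => (drift A x j - drift A t j)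
        * (partialD j ρ (x - t) * φ i t) := fun j => by
      refine (((I _ _ (hi i) (hρ.partialD j)).const_mul (drift A x j)).sub
        (J _ _ _ (hi i) (hρ.partialD j) (contDiff_drift A j))).congr
        (Filter.Eventually.of_forall fun t => ?_)
      simp only [Pi.sub_apply]; ring
    have u0 : ∀ j, Integrable fun t => ρ (x - t) * partialD j (fun z => oseen z i) t * φ j t :=
      fun j => (J _ _ _ (hi j) hρ (contDiff_partialD (contDiff_oseen_apply i) j)).congr
        (Filter.Eventually.of_forall fun t => by simp only []; ring)
    have u1 : ∀ j, Integrable fun t => (partialD j (fun z => oseen z i) x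
        - partialD j (fun z => oseen z i) t) * (ρ (x - t) * φ j t) := fun j => by
      refine (((I _ _ (hi j) hρ).const_mul (partialD j (fun z => oseen z i) x)).sub (u0 j)).congr
        (Filter.Eventually.of_forall fun t => ?_)
      simp only [Pi.sub_apply]; ring
    have q1 : ∫ t, Q t = (∫ t, ρ (x - t) * f i t)
        + ((∫ t, (drift A x 0 - drift A t 0) * (partialD 0 ρ (x - t) * φ i t))
          + ∫ t, (drift A x 1 - drift A t 1) * (partialD 1 ρ (x - t) * φ i t))
        + (∫ t, ρ (x - t) * φ i t)
        + A * ((∫ t, (partialD 0 (fun z => oseen z i) x - partialD 0 (fun z => oseen z i) t)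
            * (ρ (x - t) * φ 0 t))
          + ∫ t, (partialD 1 (fun z => oseen z i) x - partialD 1 (fun z => oseen z i) t)
            * (ρ (x - t) * φ 1 t)) := by
      rw [hQ, integral_add, integral_add, integral_add, integral_add (d0 0) (d0 1),
        integral_const_mul, integral_add (u1 0) (u1 1)]
      exacts [I _ _ (hf i) hρ, (d0 0).add (d0 1), (I _ _ (hf i) hρ).add ((d0 0).add (d0 1)),
        I _ _ (hi i) hρ, ((I _ _ (hf i) hρ).add ((d0 0).add (d0 1))).add (I _ _ (hi i) hρ),
        ((u1 0).add (u1 1)).const_mul A]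
    have q2 : ∀ j, ∫ t, (drift A x j - drift A t j) * (partialD j ρ (x - t) * φ i t)
        = drift A x j * (∫ t, partialD j ρ (x - t) * φ i t)
          - ∫ t, drift A t j * partialD j ρ (x - t) * φ i t := fun j => by
      rw [← integral_const_mul, ← integral_sub]
      · congr 1; funext t; ring
      exacts [(I _ _ (hi i) (hρ.partialD j)).const_mul _,
        J _ _ _ (hi i) (hρ.partialD j) (contDiff_drift A j)]
    have q3 : ∀ j, ∫ t, (partialD j (fun z => oseen z i) x - partialD j (fun z => oseen z i) t)
            * (ρ (x - t) * φ j t)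
        = partialD j (fun z => oseen z i) x * (∫ t, ρ (x - t) * φ j t)
          - ∫ t, ρ (x - t) * partialD j (fun z => oseen z i) t * φ j t := fun j => by
      rw [← integral_const_mul, ← integral_sub]
      · congr 1; funext t; ring
      exacts [(I _ _ (hi j) hρ).const_mul _, u0 j]
    rw [q1, q2, q2, q3, q3, ← h]
    unfold linOpR driftOp
    rw [hlap]
    unfold advect
    rw [partialD_moll (hi i) hρ, partialD_moll (hi i) hρ]
    simp only [m1]
    ring
  rw [key]
  have tk : Continuous (commKernel ρ) := hρ.1.continuous.abs.add (continuous_norm.mul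
      ((continuous_partialD hρ.1 0).abs.add (continuous_partialD hρ.1 1).abs))
  have sk : HasCompactSupport (commKernel ρ) := hρ.2.norm.add
    (HasCompactSupport.mul_left ((hρ.partialD 0).2.norm.add (hρ.partialD 1).2.norm))
  have iG : Integrable fun t => |f i t| + (|φ 0 t| + |φ 1 t|) :=
    (hf i).abs.add ((hi 0).abs.add (hi 1).abs)
  have iR := (integrable_mul_comp_sub iG.abs tk sk x).const_mul (1 + L + |A| * (2 * D))
  unfold moll
  rw [← integral_const_mul, ← Real.norm_eq_abs]
  refine norm_integral_le_of_norm_le iR (Filter.Eventually.of_forall fun t => ?_)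
  have hG0 : 0 ≤ |f i t| + (|φ 0 t| + |φ 1 t|) := by positivity
  beta_reduce
  rw [abs_of_nonneg hG0, Real.norm_eq_abs]
  have hφi : |φ i t| ≤ |φ 0 t| + |φ 1 t| := by
    fin_cases i
    · exact le_add_of_nonneg_right (abs_nonneg _)
    · exact le_add_of_nonneg_left (abs_nonneg _)
  set Gs := |φ 0 t| + |φ 1 t| with hGs
  set k0 := |ρ (x - t)| with hk0
  set k1 := ‖x - t‖ * (|partialD 0 ρ (x - t)| + |partialD 1 ρ (x - t)|) with hk1
  have hk : commKernel ρ (x - t) = k0 + k1 := rfl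
  have n0 : 0 ≤ k0 := abs_nonneg _
  have n1 : 0 ≤ k1 := by positivity
  have nG : 0 ≤ Gs := by positivity
  have nf := abs_nonneg (f i t)
  have b1 : |ρ (x - t) * f i t| ≤ k0 * |f i t| := (abs_mul _ _).le
  have b2 : |(drift A x 0 - drift A t 0) * (partialD 0 ρ (x - t) * φ i t)
      + (drift A x 1 - drift A t 1) * (partialD 1 ρ (x - t) * φ i t)| ≤ L * (k1 * Gs) := by
    refine (abs_add_le _ _).trans ?_
    rw [abs_mul, abs_mul, abs_mul, abs_mul]
    calc _ ≤ (L * ‖x - t‖) * (|partialD 0 ρ (x - t)| * Gs)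
          + (L * ‖x - t‖) * (|partialD 1 ρ (x - t)| * Gs) := by
          gcongr <;> exact hlip _ _ _
      _ = _ := by rw [hk1]; ring
  have b3 : |ρ (x - t) * φ i t| ≤ k0 * Gs := by rw [abs_mul]; gcongr
  have hdiff : ∀ j, |partialD j (fun z => oseen z i) x - partialD j (fun z => oseen z i) t|
      ≤ 2 * D := fun j => (abs_sub _ _).trans (by linarith [hu1 i j x, hu1 i j t])
  have b4 : |A * ((partialD 0 (fun z => oseen z i) x - partialD 0 (fun z => oseen z i) t)
        * (ρ (x - t) * φ 0 t)
      + (partialD 1 (fun z => oseen z i) x - partialD 1 (fun z => oseen z i) t)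
        * (ρ (x - t) * φ 1 t))| ≤ |A| * (2 * D) * (k0 * Gs) := by
    rw [abs_mul, mul_assoc]
    refine mul_le_mul_of_nonneg_left ((abs_add_le _ _).trans ?_) (abs_nonneg _)
    rw [abs_mul, abs_mul, abs_mul, abs_mul]
    calc _ ≤ (2 * D) * (k0 * |φ 0 t|) + (2 * D) * (k0 * |φ 1 t|) := by
          gcongr <;> exact hdiff _
      _ = _ := by rw [hGs]; ring
  rw [hk, hQ]
  refine ((abs_add_le _ _).trans (add_le_add ((abs_add_le _ _).trans (add_le_add
    ((abs_add_le _ _).trans (add_le_add b1 b2)) b3)) b4)).trans ?_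
  have p1 := mul_nonneg n0 nf
  have p2 := mul_nonneg n1 nf
  have p3 := mul_nonneg n0 nG
  have p4 := mul_nonneg n1 nG
  have hAD : 0 ≤ |A| * (2 * D) := by positivity
  have s1 := mul_nonneg hL p1
  have s2 := mul_nonneg hL p2
  have s3 := mul_nonneg hL p3
  have t1 := mul_nonneg hAD p1
  have t2 := mul_nonneg hAD p2
  have t4 := mul_nonneg hAD p4
  linarith

/-! ### The weighted Hilbert space -/

lemma integral_weightMeasure {E : Type*} [NormedAddCommGroup E] [NormedSpace ℝ E] (m : ℝ)
    (g : Plane → E) : ∫ x, g x ∂weightMeasure m = ∫ x, wt m x • g x := by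
  unfold weightMeasure
  rw [integral_withDensity_eq_integral_toReal_smul
    (continuous_weight m).measurable.ennreal_ofReal (by simp)]
  congr 1; funext x
  rw [ENNReal.toReal_ofReal (weight_pos m x).le]; rfl

lemma integrable_weightMeasure_iff {E : Type*} [NormedAddCommGroup E] [NormedSpace ℝ E] {m : ℝ}
    {g : Plane → E} : Integrable g (weightMeasure m) ↔ Integrable fun x => wt m x • g x := by
  unfold weightMeasure
  rw [integrable_withDensity_iff_integrable_smul'
    (continuous_weight m).measurable.ennreal_ofReal (by simp)]
  refine integrable_congr (Filter.Eventually.of_forall fun x => ?_)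
  simp only []
  rw [ENNReal.toReal_ofReal (weight_pos m x).le]; rfl

/-- A pair of real functions as a `ℂ²`-valued field. -/
def cvec (φ : Fin 2 → Plane → ℝ) (x : Plane) : CVec := WithLp.toLp 2 fun i => (φ i x : ℂ)

lemma norm_sq_cvec (φ : Fin 2 → Plane → ℝ) (x : Plane) :
    ‖cvec φ x‖ ^ 2 = φ 0 x ^ 2 + φ 1 x ^ 2 := by
  rw [EuclideanSpace.norm_sq_eq]
  simp [cvec, Fin.sum_univ_two]

lemma memLp_cvec {m : ℝ} {φ : Fin 2 → Plane → ℝ} (h : ∀ i, InL2 m (φ i)) :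
    MemLp (cvec φ) 2 (weightMeasure m) := by
  have hm : AEStronglyMeasurable (cvec φ) volume := by
    have h1 : ∀ i, AEMeasurable (fun x => (φ i x : ℂ)) (volume : Measure Plane) := fun i =>
      Complex.measurable_ofReal.comp_aemeasurable (h i).meas.aemeasurable
    exact ((WithLp.measurable_toLp 2 _).comp_aemeasurable
      (aemeasurable_pi_lambda _ h1)).aestronglyMeasurable
  rw [memLp_two_iff_integrable_sq_norm (hm.mono_ac (ac_volume m)), integrable_weightMeasure_iff]
  refine ((h 0).int.add (h 1).int).congr (Filter.Eventually.of_forall fun x => ?_)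
  simp only [norm_sq_cvec, Pi.add_apply, smul_eq_mul]
  ring

open Classical in
/-- The element of the weighted space given by a pair of real functions. -/
def emb (m : ℝ) (φ : Fin 2 → Plane → ℝ) : WeightedL2 m :=
  if h : ∀ i, InL2 m (φ i) then (memLp_cvec h).toLp else 0

lemma emb_ae {m : ℝ} {φ : Fin 2 → Plane → ℝ} (h : ∀ i, InL2 m (φ i)) :
    ∀ᵐ x ∂(volume : Measure Plane), emb m φ x = cvec φ x := by
  rw [emb, dif_pos h]
  exact (volume_ac m).ae_eq (memLp_cvec h).coeFn_toLp

lemma ext_ae {m : ℝ} {Φ Ψ : WeightedL2 m}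
    (h : ∀ᵐ x ∂(volume : Measure Plane), ∀ i, Φ x i = Ψ x i) : Φ = Ψ := by
  refine Lp.ext ((ac_volume m).ae_eq ?_)
  filter_upwards [h] with x hx
  ext i; exact hx i

lemma emb_add {m : ℝ} {φ χ : Fin 2 → Plane → ℝ} (hφ : ∀ i, InL2 m (φ i))
    (hχ : ∀ i, InL2 m (χ i)) : emb m (fun i x => φ i x + χ i x) = emb m φ + emb m χ := by
  refine ext_ae ?_
  filter_upwards [emb_ae hφ, emb_ae hχ, coe_add_ae (emb m φ) (emb m χ),
    emb_ae (φ := fun i x => φ i x + χ i x) fun i => (hφ i).add (hχ i)] with x h1 h2 h3 h4 i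
  rw [h3 i, h1, h2, h4]
  simp [cvec]

lemma emb_const_mul {m : ℝ} {φ : Fin 2 → Plane → ℝ} (hφ : ∀ i, InL2 m (φ i)) (c : ℝ) :
    emb m (fun i x => c * φ i x) = (c : ℂ) • emb m φ := by
  refine ext_ae ?_
  filter_upwards [emb_ae hφ, coe_smul_ae (c : ℂ) (emb m φ),
    emb_ae (φ := fun i x => c * φ i x) fun i => (hφ i).const_mul c] with x h1 h3 h4 i
  rw [h3 i, h1, h4]
  simp [cvec]

lemma inner_eq_integral {m : ℝ} (Φ Ψ : WeightedL2 m) :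
    inner ℂ Φ Ψ = ∫ x, wt m x • (inner ℂ (Φ x) (Ψ x) : ℂ) := by
  rw [L2.inner_def, integral_weightMeasure]

lemma norm_sq_eq_integral {m : ℝ} (Φ : WeightedL2 m) : ‖Φ‖ ^ 2 = ∫ x, ‖Φ x‖ ^ 2 * wt m x := by
  have h : (inner ℂ Φ Φ : ℂ) = ((∫ x, ‖Φ x‖ ^ 2 * wt m x : ℝ) : ℂ) := by
    rw [inner_eq_integral, ← integral_complex_ofReal]
    congr 1; funext x
    rw [inner_self_eq_norm_sq_to_K]
    simp [mul_comm]
  rw [inner_self_eq_norm_sq_to_K] at h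
  refine Complex.ofReal_injective ?_
  rw [← h, Complex.ofReal_pow]
  rfl

lemma norm_sq_emb_add {m : ℝ} {φ χ : Fin 2 → Plane → ℝ} (hφ : ∀ i, InL2 m (φ i))
    (hχ : ∀ i, InL2 m (χ i)) : ‖emb m φ + Complex.I • emb m χ‖ ^ 2
      = ((∫ x, φ 0 x ^ 2 * wt m x) + ∫ x, φ 1 x ^ 2 * wt m x)
        + ((∫ x, χ 0 x ^ 2 * wt m x) + ∫ x, χ 1 x ^ 2 * wt m x) := by
  rw [norm_sq_eq_integral, ← integral_add (hφ 0).int (hφ 1).int,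
    ← integral_add (hχ 0).int (hχ 1).int, ← integral_add]
  rotate_left
  · exact (hφ 0).int.add (hφ 1).int
  · exact (hχ 0).int.add (hχ 1).int
  refine integral_congr_ae ?_
  filter_upwards [emb_ae hφ, emb_ae hχ, coe_add_ae (emb m φ) (Complex.I • emb m χ),
    coe_smul_ae Complex.I (emb m χ)] with x h1 h2 h3 h4
  have e : ∀ i, ‖(emb m φ + Complex.I • emb m χ : WeightedL2 m) x i‖ ^ 2
      = φ i x ^ 2 + χ i x ^ 2 := fun i => by
    rw [h3 i, h4 i, h1, h2, ← Complex.normSq_eq_norm_sq, Complex.normSq_apply]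
    simp [cvec]; ring
  rw [EuclideanSpace.norm_sq_eq, Fin.sum_univ_two, e, e]
  ring

lemma norm_sq_emb {m : ℝ} {φ : Fin 2 → Plane → ℝ} (hφ : ∀ i, InL2 m (φ i)) : ‖emb m φ‖ ^ 2
      = (∫ x, φ 0 x ^ 2 * wt m x) + ∫ x, φ 1 x ^ 2 * wt m x := by
  rw [norm_sq_eq_integral, ← integral_add (hφ 0).int (hφ 1).int]
  refine integral_congr_ae ?_
  filter_upwards [emb_ae hφ] with x h1
  rw [h1, norm_sq_cvec]; ring

lemma integral_emb {m : ℝ} {φ : Fin 2 → Plane → ℝ} (hφ : ∀ i, InL2 m (φ i)) (a : Plane → ℝ)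
    (i : Fin 2) : ∫ x, a x • emb m φ x i = ((∫ x, a x * φ i x : ℝ) : ℂ) := by
  rw [← integral_complex_ofReal]
  refine integral_congr_ae ?_
  filter_upwards [emb_ae hφ] with x h1
  rw [h1]; simp [cvec]

/-- The real part of an element of the weighted space. -/
def rePart {m : ℝ} (Φ : WeightedL2 m) (i : Fin 2) (x : Plane) : ℝ := (Φ x i).re

/-- The imaginary part of an element of the weighted space. -/
def imPart {m : ℝ} (Φ : WeightedL2 m) (i : Fin 2) (x : Plane) : ℝ := (Φ x i).im

lemma inL2_parts {m : ℝ} (Φ : WeightedL2 m) (i : Fin 2) :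
    InL2 m (rePart Φ i) ∧ InL2 m (imPart Φ i) := by
  have hm : AEStronglyMeasurable (fun x => Φ x i) (volume : Measure Plane) :=
    (locallyIntegrable_comp Φ i).aestronglyMeasurable
  have hI : Integrable fun x => wt m x • ‖Φ x‖ ^ 2 :=
    integrable_weightMeasure_iff.1
      ((memLp_two_iff_integrable_sq_norm (Lp.aestronglyMeasurable Φ)).1 (Lp.memLp Φ))
  have hn : ∀ x, ‖Φ x i‖ ^ 2 ≤ ‖Φ x‖ ^ 2 := fun x =>
    pow_le_pow_left₀ (norm_nonneg _) (PiLp.norm_apply_le _ i) 2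
  have key : ∀ g : Plane → ℝ, AEStronglyMeasurable g volume → (∀ x, |g x| ≤ ‖Φ x i‖) →
      InL2 m g := fun g hg hle => by
    refine ⟨hg, hI.mono' ((hg.pow 2).mul (continuous_wt m).aestronglyMeasurable)
      (Filter.Eventually.of_forall fun x => ?_)⟩
    rw [Real.norm_of_nonneg (mul_nonneg (sq_nonneg _) (wt_pos _ _).le), smul_eq_mul, mul_comm]
    refine mul_le_mul_of_nonneg_left ?_ (wt_pos _ _).le
    rw [← sq_abs]
    exact (pow_le_pow_left₀ (abs_nonneg _) (hle x) 2).trans (hn x)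
  exact ⟨key _ (Complex.continuous_re.comp_aestronglyMeasurable hm) fun x => Complex.abs_re_le_norm _,
    key _ (Complex.continuous_im.comp_aestronglyMeasurable hm) fun x => Complex.abs_im_le_norm _⟩

lemma eq_emb_add {m : ℝ} (Φ : WeightedL2 m) :
    Φ = emb m (rePart Φ) + Complex.I • emb m (imPart Φ) := by
  refine ext_ae ?_
  filter_upwards [emb_ae (m := m) fun i => (inL2_parts Φ i).1,
    emb_ae (m := m) fun i => (inL2_parts Φ i).2,
    coe_add_ae (emb m (rePart Φ)) (Complex.I • emb m (imPart Φ)),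
    coe_smul_ae Complex.I (emb m (imPart Φ))] with x h1 h2 h3 h4 i
  rw [h3 i, h4 i, h1, h2]
  simp only [cvec, rePart, imPart]
  rw [mul_comm]
  exact (Complex.re_add_im _).symm

lemma integral_eq_parts {m : ℝ} (Φ : WeightedL2 m) (i : Fin 2) {a : Plane → ℝ}
    (ha : Continuous a) (hs : HasCompactSupport a) :
    (∫ x, a x * rePart Φ i x) = (∫ x, a x • Φ x i).re ∧
      (∫ x, a x * imPart Φ i x) = (∫ x, a x • Φ x i).im := by
  have h := integrable_test Φ i ha hs
  constructor
  · rw [← RCLike.re_eq_complex_re, ← integral_re h]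
    congr 1; funext x; simp [rePart]
  · rw [← RCLike.im_eq_complex_im, ← integral_im h]
    congr 1; funext x; simp [imPart]

/-! ### Weak limits -/

lemma inner_emb {m : ℝ} {φ : Fin 2 → Plane → ℝ} (hφ : ∀ i, IsTest (φ i)) (Φ : WeightedL2 m) :
    inner ℂ (emb m φ) Φ = (∫ x, (φ 0 x * wt m x) • Φ x 0) + ∫ x, (φ 1 x * wt m x) • Φ x 1 := by
  have t : ∀ i, IsTest fun x => φ i x * wt m x := fun i => (hφ i).mul_smooth (contDiff_wt m)
  rw [inner_eq_integral, ← integral_add (integrable_test Φ 0 (t 0).1.continuous (t 0).2)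
    (integrable_test Φ 1 (t 1).1.continuous (t 1).2)]
  refine integral_congr_ae ?_
  filter_upwards [emb_ae (m := m) fun i => (hφ i).inL2 m] with x h1
  rw [h1, PiLp.inner_apply, Fin.sum_univ_two]
  simp [cvec]
  ring

/-- Boundedness and convergence in the sense of distributions give weak convergence. The vectors `u`
for which the inner products converge form a subspace, closed by boundedness, containing all test
fields. Its orthogonal complement vanishes by the fundamental lemma of the calculus of variations.
-/
lemma tendsto_inner_of_test {m C : ℝ} {a : ℕ → WeightedL2 m} {b : WeightedL2 m}
    (hC : ∀ n, ‖a n‖ ≤ C)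
    (h : ∀ η, IsTest η → ∀ i, Filter.Tendsto (fun n => ∫ x, η x • a n x i) Filter.atTop
      (nhds (∫ x, η x • b x i))) (u : WeightedL2 m) :
    Filter.Tendsto (fun n => inner ℂ u (a n)) Filter.atTop (nhds (inner ℂ u b)) := by
  let S : Submodule ℂ (WeightedL2 m) :=
    { carrier := {u | Filter.Tendsto (fun n => inner ℂ u (a n)) Filter.atTop (nhds (inner ℂ u b))}
      zero_mem' := by simp
      add_mem' := fun {u v} hu hv => by
        simp only [Set.mem_ofPred_eq, inner_add_left] at *
        exact hu.add hv
      smul_mem' := fun c u hu => by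
        simp only [Set.mem_ofPred_eq, inner_smul_left] at *
        exact hu.const_mul _ }
  have hS : IsClosed (S : Set (WeightedL2 m)) := by
    refine isClosed_of_closure_subset fun u hu => ?_
    rw [SetLike.mem_coe]
    change Filter.Tendsto _ _ _
    rw [Metric.tendsto_atTop]
    intro ε hε
    have hB : 0 < C + ‖b‖ + 1 := by
      have := (norm_nonneg _).trans (hC 0)
      positivity
    obtain ⟨v, hv, huv⟩ := Metric.mem_closure_iff.1 hu (ε / 2 / (C + ‖b‖ + 1)) (by positivity)
    have hv' : Filter.Tendsto (fun n => inner ℂ v (a n)) Filter.atTop (nhds (inner ℂ v b)) := hv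
    obtain ⟨N, hN⟩ := Metric.tendsto_atTop.1 hv' (ε / 2) (by positivity)
    refine ⟨N, fun n hn => ?_⟩
    have h1 := hN n hn
    rw [dist_eq_norm] at h1 huv ⊢
    have e : (inner ℂ u (a n) - inner ℂ u b : ℂ)
        = inner ℂ (u - v) (a n - b) + (inner ℂ v (a n) - inner ℂ v b) := by
      rw [inner_sub_left, inner_sub_right, inner_sub_right]; ring
    rw [e]
    have h2 : ‖(inner ℂ (u - v) (a n - b) : ℂ)‖ ≤ ε / 2 := by
      refine (norm_inner_le_norm _ _).trans ?_
      have h3 : ‖a n - b‖ ≤ C + ‖b‖ + 1 := by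
        have := norm_sub_le (a n) b
        linarith [hC n]
      calc _ ≤ ε / 2 / (C + ‖b‖ + 1) * (C + ‖b‖ + 1) := by gcongr
        _ = ε / 2 := by field_simp
    refine (norm_add_le _ _).trans_lt ?_
    linarith
  have hmem : ∀ φ : Fin 2 → Plane → ℝ, (∀ i, IsTest (φ i)) → emb m φ ∈ S := by
    intro φ hφ
    change Filter.Tendsto _ _ _
    simp only [inner_emb hφ]
    exact (h _ ((hφ 0).mul_smooth (contDiff_wt m)) 0).add
      (h _ ((hφ 1).mul_smooth (contDiff_wt m)) 1)
  have hperp : Sᗮ = ⊥ := by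
    rw [Submodule.eq_bot_iff]
    intro v hv
    have hz : ∀ i, ∀ᵐ x ∂(volume : Measure Plane), v x i = 0 := by
      intro i
      refine ae_eq_zero_of_integral_contDiff_smul_eq_zero (locallyIntegrable_comp v i) ?_
      intro η h1 h2
      -- Division by the weight turns the weighted inner product into the unweighted pairing with
      -- `η`.
      have tη : IsTest fun x => η x * wt (-m) x := IsTest.mul_smooth ⟨h1, h2⟩ (contDiff_wt _)
      have e : ∀ x, η x * wt (-m) x * wt m x = η x := fun x => by
        rw [mul_assoc, wt_neg_mul, mul_one]
      have t0 : IsTest fun _ : Plane => (0 : ℝ) :=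
        ⟨contDiff_const, HasCompactSupport.zero⟩
      fin_cases i
      · have := (Submodule.mem_orthogonal _ _).1 hv _ (hmem (fun i => if i = 0 then
          fun x => η x * wt (-m) x else fun _ => 0) (fun i => by split_ifs <;> assumption))
        rw [inner_emb (fun i => by split_ifs <;> assumption)] at this
        simpa [e] using this
      · have := (Submodule.mem_orthogonal _ _).1 hv _ (hmem (fun i => if i = 1 then
          fun x => η x * wt (-m) x else fun _ => 0) (fun i => by split_ifs <;> assumption))
        rw [inner_emb (fun i => by split_ifs <;> assumption)] at this
        simpa [e] using this
    refine ext_ae ?_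
    filter_upwards [hz 0, hz 1, coe_zero_ae m] with x h0 h1 h2 i
    rw [h2 i]
    fin_cases i
    · exact h0
    · exact h1
  have : CompleteSpace S := hS.completeSpace_coe
  have htop : S = ⊤ := Submodule.orthogonal_eq_bot_iff.1 hperp
  have : u ∈ S := htop ▸ Submodule.mem_top
  exact this

/-- Hahn–Banach separation: a functional on the quotient by the closed subspace that does not vanish
on the class of `x`. -/
lemma exists_dual_of_notMem {E : Type*} [NormedAddCommGroup E] [NormedSpace ℂ E]
    {K : Submodule ℂ E} (hK : IsClosed (K : Set E)) {x : E} (hx : x ∉ K) :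
    ∃ f : E →L[ℂ] ℂ, f x ≠ 0 ∧ ∀ y ∈ K, f y = 0 := by
  have := hK
  have h1 : K.mkQ x ≠ 0 := by simpa using hx
  obtain ⟨g, -, hg⟩ := exists_dual_vector ℂ (K.mkQ x) (norm_ne_zero_iff.2 h1)
  refine ⟨g.comp K.mkQL, ?_, fun y hy => ?_⟩
  · change g (K.mkQ x) ≠ 0
    rw [hg]; simpa using h1
  · change g (K.mkQ y) = 0
    rw [(Submodule.Quotient.mk_eq_zero K).2 hy |> fun h => (show K.mkQ y = 0 from h), map_zero]

/-- Closed subspaces are closed under bounded limits in the sense of distributions. -/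
lemma mem_of_bounded_tendsto {m C : ℝ} {K : Submodule ℂ (WeightedL2 m × WeightedL2 m)}
    (hK : IsClosed (K : Set (WeightedL2 m × WeightedL2 m)))
    {a : ℕ → WeightedL2 m × WeightedL2 m} {b : WeightedL2 m × WeightedL2 m}
    (ha : ∀ n, a n ∈ K) (hC : ∀ n, ‖a n‖ ≤ C)
    (h1 : ∀ η, IsTest η → ∀ i, Filter.Tendsto (fun n => ∫ x, η x • (a n).1 x i) Filter.atTop
      (nhds (∫ x, η x • b.1 x i)))
    (h2 : ∀ η, IsTest η → ∀ i, Filter.Tendsto (fun n => ∫ x, η x • (a n).2 x i) Filter.atTop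
      (nhds (∫ x, η x • b.2 x i))) : b ∈ K := by
  by_contra hb
  obtain ⟨f, hf, hfK⟩ := exists_dual_of_notMem hK hb
  apply hf
  -- The product carries the maximum norm and is not a Hilbert space, so the Riesz representation is
  -- applied to the two factors separately.
  set u := (InnerProductSpace.toDual ℂ (WeightedL2 m)).symm
    (f.comp (ContinuousLinearMap.inl ℂ (WeightedL2 m) (WeightedL2 m)))
  set v := (InnerProductSpace.toDual ℂ (WeightedL2 m)).symm
    (f.comp (ContinuousLinearMap.inr ℂ (WeightedL2 m) (WeightedL2 m)))
  have e : ∀ z : WeightedL2 m × WeightedL2 m, f z = inner ℂ u z.1 + inner ℂ v z.2 := fun z => by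
    rw [InnerProductSpace.toDual_symm_apply, InnerProductSpace.toDual_symm_apply]
    simp only [ContinuousLinearMap.comp_apply, ContinuousLinearMap.inl_apply,
      ContinuousLinearMap.inr_apply, ← map_add]
    simp
  have l1 := tendsto_inner_of_test (fun n => (norm_fst_le (a n)).trans (hC n)) h1 u
  have l2 := tendsto_inner_of_test (fun n => (norm_snd_le (a n)).trans (hC n)) h2 v
  have l3 := l1.add l2
  simp only [← e] at l3
  have e0 : ∀ n, f (a n) = 0 := fun n => hfK _ (ha n)
  simp only [e0] at l3
  exact (tendsto_nhds_unique tendsto_const_nhds l3).symm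

/-! ### Approximation of the graph by test stream functions -/

lemma eventuallyEq_partialD {f g : Plane → ℝ} {x : Plane} (h : f =ᶠ[nhds x] g) (j : Fin 2) :
    partialD j f =ᶠ[nhds x] partialD j g :=
  (h.fderiv (𝕜 := ℝ)).mono fun y hy => by simp [partialD, hy]

lemma eventuallyEq_streamOp (A : ℝ) {f g : Plane → ℝ} {x : Plane} (h : f =ᶠ[nhds x] g) :
    streamOp A f =ᶠ[nhds x] streamOp A g := by
  filter_upwards [eventuallyEq_partialD (eventuallyEq_partialD h 0) 0,
    eventuallyEq_partialD (eventuallyEq_partialD h 1) 1, eventuallyEq_partialD h 0,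
    eventuallyEq_partialD h 1, h] with y h1 h2 h3 h4 h5
  simp [streamOp, driftOp, lap, advect, h1, h2, h3, h4, h5]

lemma perpR_eq_of_eventuallyEq {f g : Plane → ℝ} {x : Plane} (h : f =ᶠ[nhds x] g) (i : Fin 2) :
    perpR f i x = perpR g i x := by
  simp [perpR, (eventuallyEq_partialD h 0).self_of_nhds, (eventuallyEq_partialD h 1).self_of_nhds]

/-- For a local operation `F` the sequence is eventually constant: the cutoff equals one near every
point of the support of `η` once `n` is large. -/
lemma tendsto_integral_cut {F : (Plane → ℝ) → Plane → ℝ}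
    (hF : ∀ (f g : Plane → ℝ) (x : Plane), f =ᶠ[nhds x] g → F f x = F g x) (ψ : Plane → ℝ)
    {η : Plane → ℝ} (hη : IsTest η) :
    Filter.Tendsto (fun n : ℕ => ∫ x, η x * F (fun z => cut ((n : ℝ) + 1) z * ψ z) x) Filter.atTop
      (nhds (∫ x, η x * F ψ x)) := by
  obtain ⟨r, hr⟩ := hη.2.isCompact.isBounded.subset_closedBall (0 : Plane)
  refine tendsto_const_nhds.congr' ?_
  obtain ⟨N, hN⟩ := exists_nat_ge r
  filter_upwards [Filter.eventually_ge_atTop N] with n hn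
  refine integral_congr_ae (Filter.Eventually.of_forall fun x => ?_)
  by_cases hx : η x = 0
  · simp [hx]
  have hxr : ‖x‖ ≤ r := by simpa using hr (subset_tsupport _ hx)
  have hNn : (N : ℝ) ≤ n := by exact_mod_cast hn
  have hlt : ‖x‖ < (n : ℝ) + 1 := by linarith
  beta_reduce
  congr 1
  refine hF _ _ _ ?_
  filter_upwards [continuous_norm.continuousAt.eventually_lt continuousAt_const hlt] with y hy
  rw [cut_eq_one (by positivity) (le_of_lt hy), one_mul]

lemma norm_sq_emb_perpR (m : ℝ) {p : Plane → ℝ} (hp : IsTest p) :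
    ‖emb m (perpR p)‖ ^ 2 = ∫ x, gradSq p x * wt m x := by
  rw [norm_sq_emb fun i => (hp.perpR i).inL2 m, integral_gradSq_eq hp (contDiff_wt m)]

lemma inL2_perpR {m : ℝ} {ψ : Plane → ℝ} (h : ∀ j, InL2 m (partialD j ψ)) (i : Fin 2) :
    InL2 m (perpR ψ i) := by
  fin_cases i
  · exact perpR_zero ψ ▸ h 1
  · have := (h 0).const_mul (-1)
    simp only [neg_one_mul] at this
    exact perpR_one ψ ▸ this

lemma tendsto_emb {m : ℝ} {φ : ℕ → Fin 2 → Plane → ℝ} {χ : Fin 2 → Plane → ℝ}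
    (hφ : ∀ n i, InL2 m (φ n i)) (hχ : ∀ i, InL2 m (χ i)) {η : Plane → ℝ} {i : Fin 2}
    (h : Filter.Tendsto (fun n => ∫ x, η x * φ n i x) Filter.atTop
      (nhds (∫ x, η x * χ i x))) :
    Filter.Tendsto (fun n => ∫ x, η x • emb m (φ n) x i) Filter.atTop
      (nhds (∫ x, η x • emb m χ x i)) := by
  simp only [fun n => integral_emb (hφ n) η i, integral_emb hχ η i]
  exact (Complex.continuous_ofReal.tendsto _).comp h

/-- A closed subspace which contains the gradient pairs of all test stream functions contains
those of all sufficiently integrable stream functions. -/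
lemma mem_of_stream (A : ℝ) {m : ℝ} {K : Submodule ℂ (WeightedL2 m × WeightedL2 m)}
    (hK : IsClosed (K : Set (WeightedL2 m × WeightedL2 m)))
    (hT : ∀ p, IsTest p → (emb m (perpR p), emb m (perpR (streamOp A p))) ∈ K)
    {ψ : Plane → ℝ} (hψ : ContDiff ℝ ∞ ψ) (h0 : InL2 (m - 1) ψ) (h1 : ∀ j, InL2 m (partialD j ψ))
    (h2 : ∀ i j, InL2 m (partialD i (partialD j ψ)))
    (h3 : ∀ j, InL2 m (partialD j (streamOp A ψ))) :
    (emb m (perpR ψ), emb m (perpR (streamOp A ψ))) ∈ K := by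
  obtain ⟨C, hC⟩ := exists_bound_gradient_cut hψ h0 h1
  obtain ⟨D, hD⟩ := exists_bound_gradient_streamOp_cut A hψ h0 h1 h2 h3
  have hR : ∀ n : ℕ, (1 : ℝ) ≤ (n : ℝ) + 1 := fun n => by
    have : (0 : ℝ) ≤ n := n.cast_nonneg
    linarith
  have ht : ∀ n : ℕ, IsTest fun z => cut ((n : ℝ) + 1) z * ψ z := fun n =>
    (isTest_cut (by linarith [hR n])).mul_smooth hψ
  refine mem_of_bounded_tendsto hK (C := max (√C) (√D)) (fun n => hT _ (ht n)) (fun n => ?_)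
    (fun η hη i => ?_) (fun η hη i => ?_)
  · rw [Prod.norm_def]
    refine max_le_max ?_ ?_
    · exact Real.le_sqrt_of_sq_le (by rw [norm_sq_emb_perpR m (ht n)]; exact hC _ (hR n))
    · exact Real.le_sqrt_of_sq_le (by
        rw [norm_sq_emb_perpR m ((ht n).streamOp A)]; exact hD _ (hR n))
  · exact tendsto_emb (fun n i => ((ht n).perpR i).inL2 m) (inL2_perpR h1)
      (tendsto_integral_cut (F := fun f => perpR f i)
        (fun f g x h => perpR_eq_of_eventuallyEq h i) ψ hη)
  · exact tendsto_emb (fun n i => (((ht n).streamOp A).perpR i).inL2 m) (inL2_perpR h3)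
      (tendsto_integral_cut (F := fun f => perpR (streamOp A f) i)
        (fun f g x h => perpR_eq_of_eventuallyEq (eventuallyEq_streamOp A h) i) ψ hη)

/-- The same truncation without the operator. The dummy second component allows the criterion for
pairs to be reused. -/
lemma mem_of_stream_zero {m : ℝ} {K : Submodule ℂ (WeightedL2 m × WeightedL2 m)}
    (hK : IsClosed (K : Set (WeightedL2 m × WeightedL2 m)))
    (hT : ∀ p, IsTest p → (emb m (perpR p), 0) ∈ K)
    {ψ : Plane → ℝ} (hψ : ContDiff ℝ ∞ ψ) (h0 : InL2 (m - 1) ψ)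
    (h1 : ∀ j, InL2 m (partialD j ψ)) : (emb m (perpR ψ), 0) ∈ K := by
  obtain ⟨C, hC⟩ := exists_bound_gradient_cut hψ h0 h1
  have hR : ∀ n : ℕ, (1 : ℝ) ≤ (n : ℝ) + 1 := fun n => by
    have : (0 : ℝ) ≤ n := n.cast_nonneg
    linarith
  have ht : ∀ n : ℕ, IsTest fun z => cut ((n : ℝ) + 1) z * ψ z := fun n =>
    (isTest_cut (by linarith [hR n])).mul_smooth hψ
  refine mem_of_bounded_tendsto hK (C := √C) (fun n => hT _ (ht n)) (fun n => ?_)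
    (fun η hη i => ?_) (fun η hη i => tendsto_const_nhds)
  · rw [Prod.norm_def, norm_zero, max_eq_left (norm_nonneg _)]
    exact Real.le_sqrt_of_sq_le (by rw [norm_sq_emb_perpR m (ht n)]; exact hC _ (hR n))
  · exact tendsto_emb (fun n i => ((ht n).perpR i).inL2 m) (inL2_perpR h1)
      (tendsto_integral_cut (F := fun f => perpR f i)
        (fun f g x h => perpR_eq_of_eventuallyEq h i) ψ hη)

lemma exists_mollifier : ∃ ρ : Plane → ℝ, IsTest ρ ∧ IsKernel ρ ∧ ∫ z, ρ z = 1 := by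
  have hb : ∀ x, 0 ≤ bump x := fun x => by simpa [cut] using (cut_mem 1 x).1
  have hI : 0 < ∫ z, bump z :=
    isTest_bump.1.continuous.integral_pos_of_hasCompactSupport_nonneg_nonzero isTest_bump.2 hb
      (x := 0) (by rw [bump_eq_one (by simp)]; exact one_ne_zero)
  -- The bump vanishes outside radius `2`; halving the scale puts the mollifier in the unit ball, as
  -- `IsKernel` demands.
  have h2 := isTest_bump.rescale (N := 2) (by norm_num)
  refine ⟨fun z => (∫ z, bump z)⁻¹ * rescale 2 bump z, h2.const_mul _,
    ⟨(h2.const_mul _).1.continuous, fun z => ?_, fun z hz => ?_⟩, ?_⟩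
  · exact mul_nonneg (inv_nonneg.2 hI.le) (mul_nonneg (by norm_num) (hb _))
  · rw [rescale, bump_eq_zero (by rw [norm_smul]; norm_num; exact hz), mul_zero, mul_zero]
  · rw [integral_const_mul, integral_rescale_one (by norm_num), inv_mul_cancel₀ hI.ne']

lemma inL2_moll {m : ℝ} (hm : 1 < m) {g η κ : Plane → ℝ} (hg : InL2 m g) (hη : IsTest η)
    (hκ : IsKernel κ) (h : ∀ z, |η z| ≤ κ z) : InL2 m (moll g η) ∧
      ∫ x, moll g η x ^ 2 * wt m x ≤ 3 ^ m * (∫ z, κ z) ^ 2 * ∫ x, g x ^ 2 * wt m x := by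
  have hi := hg.integrable hm
  obtain ⟨h1, h2⟩ := inL2_moll_abs (by linarith) hg hi hκ
  have hle : ∀ x, moll g η x ^ 2 ≤ moll (fun t => |g t|) κ x ^ 2 := fun x =>
    sq_le_sq' (by linarith [(abs_le.1 (abs_moll_le hi hη.1.continuous hη.2 hκ.cont hκ.compact h x)).1])
      (abs_le.1 (abs_moll_le hi hη.1.continuous hη.2 hκ.cont hκ.compact h x)).2
  have h3 : InL2 m (moll g η) := h1.of_le (C := 1)
    (contDiff_moll hi hη).continuous.aestronglyMeasurable (fun x => by rw [one_mul]; exact hle x)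
  refine ⟨h3, le_trans (integral_mono h3.int h1.int fun x => ?_) h2⟩
  exact mul_le_mul_of_nonneg_right (hle x) (wt_pos _ _).le

/-- Decay of order `|ξ|^(-m)` with `m > 3` gives the cubic decay that `exists_limit_of_decay` needs.
-/
lemma moll_decay {m : ℝ} (hm : 3 < m) {g ρ : Plane → ℝ} (hg : InL2 m g) (hρ : IsTest ρ)
    (hκ : IsKernel ρ) : ∃ C, ∀ x, |moll g ρ x| * ‖x‖ ^ 3 ≤ C := by
  have hi := hg.integrable (by linarith)
  obtain ⟨C, hC⟩ := moll_abs_decay (by linarith) hg hi hκ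
  refine ⟨√C, fun x => Real.le_sqrt_of_sq_le (le_trans ?_ (hC x))⟩
  have h1 := abs_moll_le hi hρ.1.continuous hρ.2 hκ.cont hκ.compact
    (fun z => (abs_of_nonneg (hκ.nonneg z)).le) x
  rw [mul_pow]
  refine mul_le_mul (pow_le_pow_left₀ (abs_nonneg _) h1 2) ?_ (by positivity) (sq_nonneg _)
  refine le_trans ?_ (wt_mono hm.le x)
  have e : wt 3 x = (1 + ‖x‖ ^ 2) ^ 3 := by
    rw [wt, ← Real.rpow_natCast]; norm_num
  rw [e]
  calc (‖x‖ ^ 3) ^ 2 = (‖x‖ ^ 2) ^ 3 := by ring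
    _ ≤ (1 + ‖x‖ ^ 2) ^ 3 := pow_le_pow_left₀ (by positivity) (by linarith) 3

/-- A mollified divergence-free field has a smooth potential, fixed up to a constant. Cubic decay of
the field gives the potential a limit at infinity; subtracting that limit leaves decay of order
`|ξ|⁻²`, and `inL2_of_gradient` applies. -/
lemma exists_stream_moll {m : ℝ} (hm : 3 < m) {φ : Fin 2 → Plane → ℝ} (hφ : ∀ i, InL2 m (φ i))
    (hd : DivFreeR φ) {ρ : Plane → ℝ} (hρ : IsTest ρ) (hκ : IsKernel ρ) :
    ∃ ψ : Plane → ℝ, ContDiff ℝ ∞ ψ ∧ InL2 (m - 1) ψ ∧ partialD 1 ψ = moll (φ 0) ρ ∧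
      partialD 0 ψ = (fun x => -moll (φ 1) ρ x) := by
  have hi : ∀ i, Integrable (φ i) := fun i => (hφ i).integrable (by linarith)
  have hs : ∀ i, ContDiff ℝ ∞ (moll (φ i) ρ) := fun i => contDiff_moll (hi i) hρ
  obtain ⟨ψ, hψ, ha, hb⟩ := exists_potential (hs 1).neg (hs 0) (fun x => by
    have h := divFree_moll hi hd hρ x
    have e := partialD_neg (f := moll (φ 1) ρ) 1 x
    change partialD 1 (fun z => -moll (φ 1) ρ z) x = _
    rw [e]; linarith)
  obtain ⟨C0, h0⟩ := moll_decay hm (hφ 0) hρ hκ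
  obtain ⟨C1, h1⟩ := moll_decay hm (hφ 1) hρ hκ
  obtain ⟨c, C', hC'⟩ := exists_limit_of_decay hψ (C := max C1 C0) (fun z j => by
    fin_cases j
    · change |partialD 0 ψ z| * _ ≤ _
      rw [ha]
      change |-moll (φ 1) ρ z| * _ ≤ _
      rw [abs_neg]; exact (h1 z).trans (le_max_left _ _)
    · change |partialD 1 ψ z| * _ ≤ _
      rw [hb]; exact (h0 z).trans (le_max_right _ _))
  have hψ' : ContDiff ℝ ∞ fun x => ψ x - c := hψ.sub contDiff_const
  have hp : ∀ j, partialD j (fun x => ψ x - c) = partialD j ψ := fun j => by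
    funext x; rw [partialD_sub hψ contDiff_const, partialD_const, sub_zero]
  have hI : ∀ i, InL2 m (moll (φ i) ρ) := fun i =>
    (inL2_moll (by linarith) (hφ i) hρ hκ fun z => (abs_of_nonneg (hκ.nonneg z)).le).1
  refine ⟨fun x => ψ x - c, hψ', inL2_of_gradient (by linarith) hψ' hC' fun j => ?_,
    (hp 1).trans hb, (hp 0).trans ha⟩
  rw [hp]
  fin_cases j
  · have := (hI 1).const_mul (-1)
    simp only [neg_one_mul] at this
    exact ha ▸ this
  · exact hb ▸ hI 0

lemma perpR_of_partialD {ψ : Plane → ℝ} {φ : Fin 2 → Plane → ℝ} (h1 : partialD 1 ψ = φ 0)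
    (h0 : partialD 0 ψ = fun x => -φ 1 x) : perpR ψ = φ := by
  funext i
  fin_cases i
  · exact (perpR_zero ψ).trans h1
  · refine (perpR_one ψ).trans ?_
    rw [h0]; simp

lemma inL2_partialD_of_perpR {m : ℝ} {ψ : Plane → ℝ} (h : ∀ i, InL2 m (perpR ψ i)) (j : Fin 2) :
    InL2 m (partialD j ψ) := by
  fin_cases j
  · have := (h 1).const_mul (-1)
    rw [perpR_one] at this
    simpa using this
  · exact perpR_zero ψ ▸ h 0

/-- The mollifier enters the bound only through the integral of its commutator kernel, which is
invariant under rescaling. -/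
lemma inL2_linOpR_moll (A : ℝ) {m : ℝ} (hm : 1 < m) {φ f : Fin 2 → Plane → ℝ}
    (hφ : ∀ i, InL2 m (φ i)) (hf : ∀ i, InL2 m (f i)) (hw : WeakEqR A φ f) :
    ∃ C, ∀ ρ, IsTest ρ → IsKernel ρ → ∀ i, InL2 m (linOpR A (fun i => moll (φ i) ρ) i) ∧
      ∫ x, linOpR A (fun i => moll (φ i) ρ) i x ^ 2 * wt m x ≤ C * (∫ z, commKernel ρ z) ^ 2 := by
  obtain ⟨L, hL, h⟩ := abs_linOpR_moll_le A
  have hi : ∀ i, Integrable (φ i) := fun i => (hφ i).integrable hm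
  have hfi : ∀ i, Integrable (f i) := fun i => (hf i).integrable hm
  set g : Fin 2 → Plane → ℝ := fun i t => |f i t| + (|φ 0 t| + |φ 1 t|) with hg
  have hgI : ∀ i, InL2 m (g i) := fun i => (hf i).abs.add ((hφ 0).abs.add (hφ 1).abs)
  refine ⟨L ^ 2 * (3 ^ m * ((∫ x, g 0 x ^ 2 * wt m x) + ∫ x, g 1 x ^ 2 * wt m x)),
    fun ρ hρ hκ i => ?_⟩
  have hs : ∀ i, ContDiff ℝ ∞ (moll (φ i) ρ) := fun i => contDiff_moll (hi i) hρ
  have hc : Continuous (linOpR A (fun i => moll (φ i) ρ) i) := by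
    have h1 : ContDiff ℝ ∞ (linOpR A (fun i => moll (φ i) ρ) i) :=
      ((contDiff_driftOp A (hs i)).add (hs i)).add (contDiff_const.mul
        (((hs 0).mul (contDiff_partialD (contDiff_oseen_apply i) 0)).add
          ((hs 1).mul (contDiff_partialD (contDiff_oseen_apply i) 1))))
    exact h1.continuous
  obtain ⟨h1, h2⟩ := inL2_moll_abs (by linarith) (hgI i) ((hgI i).integrable hm)
    (isKernel_commKernel hρ.1 hκ.supp)
  have hle : ∀ x, linOpR A (fun i => moll (φ i) ρ) i x ^ 2
      ≤ L ^ 2 * moll (fun t => |g i t|) (commKernel ρ) x ^ 2 := fun x => by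
    rw [← mul_pow, ← sq_abs]
    exact pow_le_pow_left₀ (abs_nonneg _) (h φ f ρ hi hfi hw hρ i x) 2
  have h3 := h1.of_le hc.aestronglyMeasurable hle
  refine ⟨h3, ?_⟩
  calc _ ≤ ∫ x, L ^ 2 * (moll (fun t => |g i t|) (commKernel ρ) x ^ 2 * wt m x) := by
        refine integral_mono h3.int (h1.int.const_mul _) fun x => ?_
        beta_reduce
        rw [← mul_assoc]
        exact mul_le_mul_of_nonneg_right (hle x) (wt_pos _ _).le
    _ ≤ L ^ 2 * (3 ^ m * (∫ z, commKernel ρ z) ^ 2 * ∫ x, g i x ^ 2 * wt m x) := by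
        rw [integral_const_mul]
        exact mul_le_mul_of_nonneg_left h2 (sq_nonneg _)
    _ ≤ _ := by
        have n : ∀ i, 0 ≤ ∫ x, g i x ^ 2 * wt m x := fun i =>
          integral_sq_mul_nonneg _ fun x => (wt_pos _ _).le
        have : ∫ x, g i x ^ 2 * wt m x
            ≤ (∫ x, g 0 x ^ 2 * wt m x) + ∫ x, g 1 x ^ 2 * wt m x := by
          fin_cases i
          · exact le_add_of_nonneg_right (n 1)
          · exact le_add_of_nonneg_left (n 0)
        have h3m : (0 : ℝ) ≤ 3 ^ m := by positivity
        calc _ = L ^ 2 * 3 ^ m * (∫ z, commKernel ρ z) ^ 2 * ∫ x, g i x ^ 2 * wt m x := by ring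
          _ ≤ L ^ 2 * 3 ^ m * (∫ z, commKernel ρ z) ^ 2
              * ((∫ x, g 0 x ^ 2 * wt m x) + ∫ x, g 1 x ^ 2 * wt m x) := by gcongr
          _ = _ := by ring

lemma norm_emb_moll_le {m : ℝ} (hm : 1 < m) {φ : Fin 2 → Plane → ℝ} (hφ : ∀ i, InL2 m (φ i))
    {ρ : Plane → ℝ} (hρ : IsTest ρ) (hκ : IsKernel ρ) (h1 : ∫ z, ρ z = 1) :
    ‖emb m (fun i => moll (φ i) ρ)‖ ^ 2
      ≤ 3 ^ m * ((∫ x, φ 0 x ^ 2 * wt m x) + ∫ x, φ 1 x ^ 2 * wt m x) := by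
  have h := fun i => inL2_moll hm (hφ i) hρ hκ fun z => (abs_of_nonneg (hκ.nonneg z)).le
  rw [norm_sq_emb fun i => (h i).1]
  have e0 := (h 0).2
  have e1 := (h 1).2
  rw [h1] at e0 e1
  linarith

/-- A closed subspace which contains the pairs `(∇^⊥p, L_A ∇^⊥p)` for all test functions `p`
contains the whole graph of `L_A`. -/
lemma mem_of_weakEqR (A : ℝ) {m : ℝ} (hm : 3 < m)
    {K : Submodule ℂ (WeightedL2 m × WeightedL2 m)}
    (hK : IsClosed (K : Set (WeightedL2 m × WeightedL2 m)))
    (hT : ∀ p, IsTest p → (emb m (perpR p), emb m (perpR (streamOp A p))) ∈ K)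
    {φ f : Fin 2 → Plane → ℝ} (hφ : ∀ i, InL2 m (φ i)) (hf : ∀ i, InL2 m (f i))
    (hd : DivFreeR φ) (hw : WeakEqR A φ f) : (emb m φ, emb m f) ∈ K := by
  have hm1 : 1 < m := by linarith
  have hi : ∀ i, Integrable (φ i) := fun i => (hφ i).integrable hm1
  obtain ⟨ρ, hρ, hκ, hI⟩ := exists_mollifier
  obtain ⟨C, hC⟩ := inL2_linOpR_moll A hm1 hφ hf hw
  have hN : ∀ n : ℕ, (1 : ℝ) ≤ (n : ℝ) + 1 := fun n => by
    have : (0 : ℝ) ≤ n := n.cast_nonneg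
    linarith
  set r : ℕ → Plane → ℝ := fun n => rescale ((n : ℝ) + 1) ρ with hr
  have rT : ∀ n, IsTest (r n) := fun n => hρ.rescale (hN n)
  have rK : ∀ n, IsKernel (r n) := fun n => hκ.rescale (hN n)
  have rI : ∀ n, ∫ z, r n z = 1 := fun n => by
    rw [hr, integral_rescale_one (by linarith [hN n]), hI]
  have rc : ∀ n, ∫ z, commKernel (r n) z = ∫ z, commKernel ρ z := fun n => by
    rw [hr, commKernel_rescale hρ.1 (by linarith [hN n]),
      integral_rescale_one (by linarith [hN n])]
  have hs : ∀ n i, ContDiff ℝ ∞ (moll (φ i) (r n)) := fun n i => contDiff_moll (hi i) (rT n)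
  have hl : ∀ n i, InL2 m (moll (φ i) (r n)) := fun n i =>
    (inL2_moll hm1 (hφ i) (rT n) (rK n) fun z => (abs_of_nonneg ((rK n).nonneg z)).le).1
  choose ψ hψ hψ0 hψ1 hψ2 using fun n => exists_stream_moll hm hφ hd (rT n) (rK n)
  have hp : ∀ n, perpR (ψ n) = fun i => moll (φ i) (r n) := fun n =>
    perpR_of_partialD (hψ1 n) (hψ2 n)
  have hS : ∀ n, perpR (streamOp A (ψ n)) = linOpR A fun i => moll (φ i) (r n) := fun n => by
    funext i x
    rw [perpR_streamOp A (hψ n), hp]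
  have hSI : ∀ n i, InL2 m (perpR (streamOp A (ψ n)) i) := fun n i => by
    rw [hS]; exact (hC _ (rT n) (rK n) i).1
  have h2 : ∀ n i j, InL2 m (partialD i (partialD j (ψ n))) := by
    have key : ∀ n i k, InL2 m (partialD i (moll (φ k) (r n))) := fun n i k => by
      rw [partialD_moll (hi k) (rT n)]
      refine (inL2_moll hm1 (hφ k) ((rT n).partialD i) (κ := fun z => |partialD i (r n) z|)
        ⟨((rT n).partialD i).1.continuous.abs, fun z => abs_nonneg _, fun z hz => ?_⟩
        fun z => le_rfl).1
      rw [partialD_eq_zero_of_ball (rK n).supp i hz, abs_zero]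
    intro n i j
    fin_cases j
    · change InL2 m (partialD i (partialD 0 (ψ n)))
      have e : partialD i (partialD 0 (ψ n)) = fun x => -1 * partialD i (moll (φ 1) (r n)) x := by
        funext x
        rw [hψ2, partialD_neg, neg_one_mul]
      rw [e]; exact (key n i 1).const_mul (-1)
    · change InL2 m (partialD i (partialD 1 (ψ n)))
      rw [hψ1]; exact key n i 0
  refine mem_of_bounded_tendsto hK
    (a := fun n => (emb m (perpR (ψ n)), emb m (perpR (streamOp A (ψ n)))))
    (C := max (√(3 ^ m * ((∫ x, φ 0 x ^ 2 * wt m x) + ∫ x, φ 1 x ^ 2 * wt m x)))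
      (√(C * (∫ z, commKernel ρ z) ^ 2 + C * (∫ z, commKernel ρ z) ^ 2)))
    (fun n => mem_of_stream A hK hT (hψ n) (hψ0 n)
      (inL2_partialD_of_perpR fun i => by rw [hp]; exact hl n i) (h2 n)
      (inL2_partialD_of_perpR (hSI n))) (fun n => ?_) (fun η hη i => ?_) (fun η hη i => ?_)
  · rw [Prod.norm_def]
    refine max_le_max (Real.le_sqrt_of_sq_le ?_) (Real.le_sqrt_of_sq_le ?_)
    · simp only [hp]
      exact norm_emb_moll_le hm1 hφ (rT n) (rK n) (rI n)
    · rw [norm_sq_emb (hSI n), hS]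
      have e0 := (hC _ (rT n) (rK n) 0).2
      have e1 := (hC _ (rT n) (rK n) 1).2
      rw [rc] at e0 e1
      exact add_le_add e0 e1
  · refine tendsto_emb (fun n i => by rw [hp]; exact hl n i) hφ ?_
    simp only [hp]
    exact tendsto_integral_mul_moll (hi i) hη.1.continuous hη.2 hκ hI
  · refine tendsto_emb hSI hf ?_
    -- Both images are tested with the operator moved onto `η`, so convergence reduces to that of
    -- the mollified fields against fixed continuous, compactly supported functions.
    simp only [hS, ← fun n => integral_adjointOp_linOpR A hη (hs n) i, ← hw η hη i]
    refine (tendsto_integral_mul_moll (hi i) (continuous_adjointOp A hη) (compact_adjointOp A hη)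
      hκ hI).add (Filter.Tendsto.const_mul _ (tendsto_finsetSum _ fun j _ => ?_))
    exact tendsto_integral_mul_moll (hi j) (continuous_coupling hη i j) (compact_coupling hη i j)
      hκ hI

/-- A closed subspace which contains `∇^⊥p` for all test functions `p` contains all
divergence-free fields. -/
lemma mem_of_divFreeR {m : ℝ} (hm : 3 < m) {K : Submodule ℂ (WeightedL2 m × WeightedL2 m)}
    (hK : IsClosed (K : Set (WeightedL2 m × WeightedL2 m)))
    (hT : ∀ p, IsTest p → (emb m (perpR p), 0) ∈ K)
    {φ : Fin 2 → Plane → ℝ} (hφ : ∀ i, InL2 m (φ i)) (hd : DivFreeR φ) : (emb m φ, 0) ∈ K := by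
  have hm1 : 1 < m := by linarith
  have hi : ∀ i, Integrable (φ i) := fun i => (hφ i).integrable hm1
  obtain ⟨ρ, hρ, hκ, hI⟩ := exists_mollifier
  have hN : ∀ n : ℕ, (1 : ℝ) ≤ (n : ℝ) + 1 := fun n => by
    have : (0 : ℝ) ≤ n := n.cast_nonneg
    linarith
  set r : ℕ → Plane → ℝ := fun n => rescale ((n : ℝ) + 1) ρ with hr
  have rT : ∀ n, IsTest (r n) := fun n => hρ.rescale (hN n)
  have rK : ∀ n, IsKernel (r n) := fun n => hκ.rescale (hN n)
  have rI : ∀ n, ∫ z, r n z = 1 := fun n => by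
    rw [hr, integral_rescale_one (by linarith [hN n]), hI]
  have hl : ∀ n i, InL2 m (moll (φ i) (r n)) := fun n i =>
    (inL2_moll hm1 (hφ i) (rT n) (rK n) fun z => (abs_of_nonneg ((rK n).nonneg z)).le).1
  choose ψ hψ hψ0 hψ1 hψ2 using fun n => exists_stream_moll hm hφ hd (rT n) (rK n)
  have hp : ∀ n, perpR (ψ n) = fun i => moll (φ i) (r n) := fun n =>
    perpR_of_partialD (hψ1 n) (hψ2 n)
  refine mem_of_bounded_tendsto hK (a := fun n => (emb m (perpR (ψ n)), 0))
    (C := √(3 ^ m * ((∫ x, φ 0 x ^ 2 * wt m x) + ∫ x, φ 1 x ^ 2 * wt m x)))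
    (fun n => mem_of_stream_zero hK hT (hψ n) (hψ0 n)
      (inL2_partialD_of_perpR fun i => by rw [hp]; exact hl n i)) (fun n => ?_) (fun η hη i => ?_)
    (fun η hη i => tendsto_const_nhds)
  · rw [Prod.norm_def, norm_zero, max_eq_left (norm_nonneg _)]
    refine Real.le_sqrt_of_sq_le ?_
    simp only [hp]
    exact norm_emb_moll_le hm1 hφ (rT n) (rK n) (rI n)
  · refine tendsto_emb (fun n i => by rw [hp]; exact hl n i) hφ ?_
    simp only [hp]
    exact tendsto_integral_mul_moll (hi i) hη.1.continuous hη.2 hκ hI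

lemma divFreeR_parts {m : ℝ} {Φ : WeightedL2 m} (h : DivFree Φ) :
    DivFreeR (rePart Φ) ∧ DivFreeR (imPart Φ) := by
  have e := fun (η : Plane → ℝ) (hη : IsTest η) (j : Fin 2) => integral_eq_parts Φ j
    (continuous_partialD hη.1 j) (compact_partialD hη.2 j)
  constructor <;> intro η hη
  · have := congrArg Complex.re (h η hη)
    simpa only [Complex.re_sum, ← (e η hη _).1, Complex.zero_re] using this
  · have := congrArg Complex.im (h η hη)
    simpa only [Complex.im_sum, ← (e η hη _).2, Complex.zero_im] using this

lemma weakEqR_parts {A m : ℝ} {Φ Ψ : WeightedL2 m} (h : WeakEq A Φ Ψ) :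
    WeakEqR A (rePart Φ) (rePart Ψ) ∧ WeakEqR A (imPart Φ) (imPart Ψ) := by
  have e1 := fun (η : Plane → ℝ) (hη : IsTest η) (i : Fin 2) => integral_eq_parts Φ i
    (continuous_adjointOp A hη) (compact_adjointOp A hη)
  have e2 := fun (η : Plane → ℝ) (hη : IsTest η) (i j : Fin 2) => integral_eq_parts Φ j
    (continuous_coupling hη i j) (compact_coupling hη i j)
  have e3 := fun (η : Plane → ℝ) (hη : IsTest η) (i : Fin 2) => integral_eq_parts Ψ i
    hη.1.continuous hη.2
  constructor <;> intro η hη i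
  · have := congrArg Complex.re (h η hη i)
    simpa only [Complex.add_re, Complex.smul_re, smul_eq_mul, Complex.re_sum, ← (e1 η hη _).1,
      ← (e2 η hη _ _).1, ← (e3 η hη _).1] using this
  · have := congrArg Complex.im (h η hη i)
    simpa only [Complex.add_im, Complex.smul_im, smul_eq_mul, Complex.im_sum, ← (e1 η hη _).2,
      ← (e2 η hη _ _).2, ← (e3 η hη _).2] using this

/-- The coefficients are real, so real and imaginary parts solve the equation separately and
recombine in the complex subspace `K`. -/
lemma mem_of_weakEq (A : ℝ) {m : ℝ} (hm : 3 < m)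
    {K : Submodule ℂ (WeightedL2 m × WeightedL2 m)}
    (hK : IsClosed (K : Set (WeightedL2 m × WeightedL2 m)))
    (hT : ∀ p, IsTest p → (emb m (perpR p), emb m (perpR (streamOp A p))) ∈ K)
    {Φ Ψ : WeightedL2 m} (hd : DivFree Φ) (hw : WeakEq A Φ Ψ) : (Φ, Ψ) ∈ K := by
  have h1 := mem_of_weakEqR A hm hK hT (fun i => (inL2_parts Φ i).1) (fun i => (inL2_parts Ψ i).1)
    (divFreeR_parts hd).1 (weakEqR_parts hw).1
  have h2 := mem_of_weakEqR A hm hK hT (fun i => (inL2_parts Φ i).2) (fun i => (inL2_parts Ψ i).2)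
    (divFreeR_parts hd).2 (weakEqR_parts hw).2
  have h := K.add_mem h1 (K.smul_mem Complex.I h2)
  rw [Prod.smul_mk, Prod.mk_add_mk, ← eq_emb_add, ← eq_emb_add] at h
  exact h

lemma mem_of_divFree {m : ℝ} (hm : 3 < m) {K : Submodule ℂ (WeightedL2 m)}
    (hK : IsClosed (K : Set (WeightedL2 m))) (hT : ∀ p, IsTest p → emb m (perpR p) ∈ K)
    {Φ : WeightedL2 m} (hd : DivFree Φ) : Φ ∈ K := by
  -- The statement for pairs is applied with a second factor that imposes no condition.
  have hK' : IsClosed ((K.prod ⊤ : Submodule ℂ (WeightedL2 m × WeightedL2 m)) :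
      Set (WeightedL2 m × WeightedL2 m)) := by
    rw [Submodule.prod_coe]
    exact hK.prod isClosed_univ
  have hT' : ∀ p, IsTest p → (emb m (perpR p), (0 : WeightedL2 m)) ∈
      (K.prod ⊤ : Submodule ℂ (WeightedL2 m × WeightedL2 m)) := fun p hp => ⟨hT p hp, trivial⟩
  have h1 := (mem_of_divFreeR hm hK' hT' (fun i => (inL2_parts Φ i).1) (divFreeR_parts hd).1).1
  have h2 := (mem_of_divFreeR hm hK' hT' (fun i => (inL2_parts Φ i).2) (divFreeR_parts hd).2).1
  rw [eq_emb_add Φ]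
  exact K.add_mem h1 (K.smul_mem Complex.I h2)

/-! ### Spectra of operators with an invariant functional -/

section Abstract

variable {X : Type*} [NormedAddCommGroup X] [NormedSpace ℂ X] {T : X →ₗ.[ℂ] X} {μ : X →L[ℂ] ℂ}

/-- `λ - T` as a linear map on the domain of `T`. -/
def shiftMap (T : X →ₗ.[ℂ] X) (z : ℂ) : T.domain →ₗ[ℂ] X := z • T.domain.subtype - T.toFun

lemma shiftMap_apply (z : ℂ) (x : T.domain) : shiftMap T z x = z • (x : X) - T x := rfl

lemma functional_shiftMap (hμ : ∀ x : T.domain, μ (T x) = -1 / 2 * μ x) (z : ℂ) (x : T.domain) :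
    μ (shiftMap T z x) = (z + 1 / 2) * μ x := by
  rw [shiftMap_apply, map_sub, map_smul, hμ, smul_eq_mul]; ring

/-- The resolvent estimate, up to the functional `μ`. -/
def ResolventBound (T : X →ₗ.[ℂ] X) (μ : X →L[ℂ] ℂ) (C : ℝ) (z : ℂ) : Prop :=
  ∀ x : T.domain, ‖(x : X)‖ ≤ C * (‖shiftMap T z x‖ + ‖μ x‖)

/-- Solvability in the kernel of `μ`. -/
def KernelSurjective (T : X →ₗ.[ℂ] X) (μ : X →L[ℂ] ℂ) (z : ℂ) : Prop :=
  ∀ y : X, μ y = 0 → ∃ x : T.domain, μ x = 0 ∧ shiftMap T z x = y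

/-- Away from `-1/2` the value `μ x` is determined by the image through `μ((z - T)x) = (z + ½) μ x`,
so the functional can be removed from the estimate. -/
lemma norm_le_of_resolventBound (hμ : ∀ x : T.domain, μ (T x) = -1 / 2 * μ x) {C : ℝ} (hC : 0 ≤ C)
    {z : ℂ} (hz : z + 1 / 2 ≠ 0) (h : ResolventBound T μ C z) (x : T.domain) :
    ‖(x : X)‖ ≤ C * (1 + ‖(z + 1 / 2)⁻¹‖ * ‖μ‖) * ‖shiftMap T z x‖ := by
  refine (h x).trans ?_
  have e : μ x = (z + 1 / 2)⁻¹ * μ (shiftMap T z x) := by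
    rw [functional_shiftMap hμ, inv_mul_cancel_left₀ hz]
  rw [e, norm_mul, mul_assoc]
  refine mul_le_mul_of_nonneg_left ?_ hC
  have := mul_le_mul_of_nonneg_left (μ.le_opNorm (shiftMap T z x)) (norm_nonneg (z + 1 / 2)⁻¹)
  linarith

/-- A closed operator bounded below has closed range, so dense range is full range. -/
lemma shiftMap_surjective [CompleteSpace X] (hT : IsClosed (T.graph : Set (X × X))) {z : ℂ}
    {C : ℝ} (hb : ∀ x : T.domain, ‖(x : X)‖ ≤ C * ‖shiftMap T z x‖)
    (hd : Dense (Set.range (shiftMap T z))) : Function.Surjective (shiftMap T z) := by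
  intro y
  obtain ⟨u, hu, hlim⟩ := mem_closure_iff_seq_limit.1 (hd y)
  choose x hx using hu
  have hcx : CauchySeq fun n => ((x n : X)) := by
    rw [Metric.cauchySeq_iff]
    intro ε hε
    obtain ⟨N, hN⟩ := Metric.cauchySeq_iff.1 hlim.cauchySeq (ε / (|C| + 1)) (by positivity)
    refine ⟨N, fun k hk l hl => ?_⟩
    have h := hN k hk l hl
    rw [dist_eq_norm, ← hx, ← hx, ← map_sub] at h
    rw [dist_eq_norm]
    have h1 := hb (x k - x l)
    rw [Submodule.coe_sub] at h1
    refine lt_of_le_of_lt (h1.trans (mul_le_mul_of_nonneg_right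
      ((le_abs_self C).trans (le_add_of_nonneg_right zero_le_one)) (norm_nonneg _))) ?_
    calc _ < (|C| + 1) * (ε / (|C| + 1)) := by gcongr
      _ = ε := by field_simp
  obtain ⟨v, hv⟩ := cauchySeq_tendsto_of_complete hcx
  have hTx : Filter.Tendsto (fun n => T (x n)) Filter.atTop (nhds (z • v - y)) := by
    have : ∀ n, T (x n) = z • (x n : X) - u n := fun n => by
      rw [← hx, shiftMap_apply]; abel
    simp only [this]
    exact (hv.const_smul z).sub hlim
  have hmem : (v, z • v - y) ∈ T.graph :=
    hT.mem_of_tendsto (hv.prodMk_nhds hTx) (Filter.Eventually.of_forall fun n => T.mem_graph (x n))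
  obtain ⟨w, hw1, hw2⟩ := (LinearPMap.mem_graph_iff T).1 hmem
  refine ⟨w, ?_⟩
  rw [shiftMap_apply, hw2, hw1, sub_sub_cancel]

/-- The equation `(w - T)x = y` is the fixed point equation `x = (z - T)⁻¹(y - (w - z)x)` on `ker
μ`. There the resolvent estimate has no `μ` term, so the map contracts by `|w - z| C ≤ ½`. -/
lemma KernelSurjective.step [CompleteSpace X] {C : ℝ} {z w : ℂ}
    (hb : ResolventBound T μ C z) (hs : KernelSurjective T μ z) (hzw : ‖w - z‖ * C ≤ 1 / 2) :
    KernelSurjective T μ w := by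
  intro y hy
  choose R hR0 hR using hs
  let X0 : Submodule ℂ X := LinearMap.ker μ.toLinearMap
  have hX0 : IsClosed (X0 : Set X) := μ.isClosed_ker
  have : CompleteSpace X0 := hX0.completeSpace_coe
  have m0 : ∀ x : X0, μ (y - (w - z) • (x : X)) = 0 := fun x => by
    have : μ (x : X) = 0 := x.2
    rw [map_sub, map_smul, this, hy, smul_zero, sub_zero]
  let F : X0 → X0 := fun x => ⟨R _ (m0 x), hR0 _ (m0 x)⟩
  have hF : ContractingWith (1 / 2) F := by
    refine ⟨by norm_num, LipschitzWith.of_dist_le_mul fun x x' => ?_⟩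
    have e := hb (R _ (m0 x) - R _ (m0 x'))
    rw [map_sub, hR, hR, Submodule.coe_sub, map_sub, hR0, hR0, sub_zero, norm_zero, add_zero] at e
    have e2 : y - (w - z) • (x : X) - (y - (w - z) • (x' : X)) = -((w - z) • ((x : X) - x')) := by
      rw [smul_sub]; abel
    rw [e2, norm_neg, norm_smul] at e
    rw [dist_eq_norm, dist_eq_norm]
    change ‖((R _ (m0 x) : X)) - R _ (m0 x')‖ ≤ _ * ‖(x : X) - x'‖
    refine e.trans ?_
    push_cast
    calc C * (‖w - z‖ * ‖(x : X) - x'‖) = ‖w - z‖ * C * ‖(x : X) - x'‖ := by ring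
      _ ≤ 1 / 2 * ‖(x : X) - x'‖ := mul_le_mul_of_nonneg_right hzw (norm_nonneg _)
  have : Nonempty X0 := ⟨0⟩
  have hfix : F (ContractingWith.fixedPoint F hF) = ContractingWith.fixedPoint F hF :=
    hF.fixedPoint_isFixedPt
  set x := ContractingWith.fixedPoint F hF
  refine ⟨R _ (m0 x), hR0 _ _, ?_⟩
  have h1 := hR _ (m0 x)
  have h2 : ((R _ (m0 x) : T.domain) : X) = x := congrArg Subtype.val hfix
  rw [shiftMap_apply] at h1 ⊢
  rw [h2] at h1 ⊢
  have h3 : T (R _ (m0 x)) = z • (x : X) - (y - (w - z) • (x : X)) := by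
    rw [eq_sub_iff_add_eq, add_comm]
    exact sub_eq_iff_eq_add.1 h1 |>.symm
  rw [h3, sub_smul]; abel

/-- The constant is uniform on a half-plane, which is convex, so finitely many steps of equal length
lead from `z` to `w`. The path may pass through `-1/2`, since nothing degenerates on `ker μ`. -/
lemma KernelSurjective.march [CompleteSpace X] {C a : ℝ} (hC : 0 ≤ C)
    (hb : ∀ z : ℂ, a ≤ z.re → ResolventBound T μ C z) {z w : ℂ} (hz : a ≤ z.re) (hw : a ≤ w.re)
    (hs : KernelSurjective T μ z) : KernelSurjective T μ w := by
  obtain ⟨n, hn⟩ := exists_nat_gt (2 * (‖w - z‖ * C))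
  have hn0 : (0 : ℝ) < n := lt_of_le_of_lt (by positivity) hn
  have key : ∀ k : ℕ, k ≤ n → KernelSurjective T μ (z + ((k / n : ℝ) : ℂ) * (w - z)) := by
    intro k
    induction k with
    | zero => intro _; simpa using hs
    | succ k ih =>
      intro hk
      refine (ih (by omega)).step (hb _ ?_) ?_
      · have h1 : (k : ℝ) / n ≤ 1 := by
          rw [div_le_one hn0]; exact_mod_cast (by omega : k ≤ n)
        have h2 : (0 : ℝ) ≤ (k : ℝ) / n := by positivity
        rw [Complex.add_re, Complex.re_ofReal_mul, Complex.sub_re]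
        nlinarith
      · have e : z + (((k + 1 : ℕ) / n : ℝ) : ℂ) * (w - z) - (z + ((k / n : ℝ) : ℂ) * (w - z))
            = ((1 / n : ℝ) : ℂ) * (w - z) := by
          push_cast; ring
        rw [e, norm_mul, Complex.norm_real, Real.norm_of_nonneg (by positivity)]
        rw [div_mul_eq_mul_div, div_mul_eq_mul_div, div_le_iff₀ hn0]
        linarith
  have := key n le_rfl
  rw [div_self hn0.ne'] at this
  simpa using this

/-- An operator with the invariant functional `μ`, an eigenvector `e` for `-1/2` with `μ e ≠ 0`, and
resolvent estimates modulo `μ` in the half-plane `Re z > -1`, has there only the simple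
eigenvalue `-1/2`. -/
theorem spectrum_of_resolventBound [CompleteSpace X] (hT : IsClosed (T.graph : Set (X × X)))
    (hμ : ∀ x : T.domain, μ (T x) = -1 / 2 * μ x) {e : X} (he : e ∈ T.domain)
    (hTe : T ⟨e, he⟩ = (-1 / 2 : ℂ) • e) (hμe : μ e ≠ 0)
    (hb : ∀ δ : ℝ, 0 < δ → δ ≤ 1 → ∃ C, 0 ≤ C ∧ ∀ z : ℂ, -1 + 2 * δ ≤ z.re →
      ResolventBound T μ C z)
    {z₀ : ℂ} (hz₀ : -1 / 2 < z₀.re) (hd : Dense (Set.range (shiftMap T z₀))) :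
    IsSimpleEigenvalue T (-1 / 2) e ∧ (-1 / 2 : ℂ) ∈ spectrumSet T ∧
      spectrumSet T \ {(-1 / 2 : ℂ)} ⊆ {z : ℂ | z.re ≤ -1} := by
  have he0 : e ≠ 0 := fun h => hμe (by rw [h, map_zero])
  have hb' : ∀ z : ℂ, -1 < z.re → ∃ C, 0 ≤ C ∧ ResolventBound T μ C z := fun z hz => by
    -- The largest admissible `δ` with `-1 + 2δ ≤ Re z`.
    obtain ⟨C, hC, h⟩ := hb (min 1 ((z.re + 1) / 2)) (lt_min one_pos (by linarith))
      (min_le_left _ _)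
    exact ⟨C, hC, h z (by linarith [min_le_right (1 : ℝ) ((z.re + 1) / 2)])⟩
  have half : ∀ z : ℂ, z ≠ -1 / 2 → z + 1 / 2 ≠ 0 := fun z hz h => hz (by
    rw [eq_neg_of_add_eq_zero_left h]; ring)
  have hK₀ : KernelSurjective T μ z₀ := by
    have hne : z₀ + 1 / 2 ≠ 0 := half z₀ fun h => by
      rw [h] at hz₀; norm_num at hz₀
    obtain ⟨C, hC, h⟩ := hb' z₀ (by linarith)
    have hs := shiftMap_surjective hT (norm_le_of_resolventBound hμ hC hne h) hd
    intro y hy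
    obtain ⟨x, hx⟩ := hs y
    refine ⟨x, ?_, hx⟩
    have := functional_shiftMap hμ z₀ x
    rw [hx, hy] at this
    exact (mul_eq_zero.1 this.symm).resolve_left hne
  have hK : ∀ z : ℂ, -1 < z.re → KernelSurjective T μ z := fun z hz => by
    have hδ : 0 < min 1 (min ((z.re + 1) / 2) ((z₀.re + 1) / 2)) :=
      lt_min one_pos (lt_min (by linarith) (by linarith))
    obtain ⟨C, hC, h⟩ := hb _ hδ (min_le_left _ _)
    have h1 := min_le_right (1 : ℝ) (min ((z.re + 1) / 2) ((z₀.re + 1) / 2))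
    refine hK₀.march hC h ?_ ?_
    · linarith [min_le_right ((z.re + 1) / 2) ((z₀.re + 1) / 2)]
    · linarith [min_le_left ((z.re + 1) / 2) ((z₀.re + 1) / 2)]
  have hinj : ∀ z : ℂ, -1 < z.re → ∀ x : T.domain, μ x = 0 → shiftMap T z x = 0 → x = 0 :=
    fun z hz x h1 h2 => by
      obtain ⟨C, -, h⟩ := hb' z hz
      have := h x
      rw [h1, h2, norm_zero, norm_zero, add_zero, mul_zero] at this
      exact Subtype.ext (norm_le_zero_iff.1 this)
  have hse : ∀ z : ℂ, shiftMap T z ⟨e, he⟩ = (z + 1 / 2) • e := fun z => by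
    rw [shiftMap_apply, hTe, ← sub_smul]; congr 1; ring
  have hhalf : (-1 : ℝ) < (-1 / 2 : ℂ).re := by norm_num
  refine ⟨⟨he0, ⟨he, hTe⟩, fun x hx => ?_, ?_⟩, ?_, ?_⟩
  · rw [Submodule.mem_span_singleton]
    refine ⟨μ x / μ e, ?_⟩
    -- An eigenvector minus its `μ`-component along `e` lies in `ker μ`, where `T + ½` is injective.
    have h := hinj _ hhalf (x - (μ x / μ e) • ⟨e, he⟩) (by
      rw [Submodule.coe_sub, Submodule.coe_smul, map_sub, map_smul, smul_eq_mul,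
        div_mul_cancel₀ _ hμe, sub_self]) (by
      rw [map_sub, map_smul, hse, shiftMap_apply, hx, sub_self]; norm_num)
    have := congrArg Subtype.val h
    rw [Submodule.coe_sub, Submodule.coe_smul, Submodule.coe_zero, sub_eq_zero] at this
    exact this.symm
  · have hr : ∀ x : T.domain, (T.toFun - (-1 / 2 : ℂ) • T.domain.subtype) x
        = -shiftMap T (-1 / 2) x := fun x => by
      rw [shiftMap_apply, neg_sub]; rfl
    refine IsCompl.of_eq ?_ ?_
    · rw [Submodule.eq_bot_iff]
      rintro y ⟨hy1, x, hx⟩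
      obtain ⟨c, rfl⟩ := Submodule.mem_span_singleton.1 hy1
      -- At `z = -1/2` the invariance says that `μ` vanishes on the range, whereas `μ e ≠ 0`; hence
      -- the sum is direct.
      have h := functional_shiftMap hμ (-1 / 2) x
      rw [hr] at hx
      rw [← neg_eq_iff_eq_neg.2 hx.symm, map_neg, map_smul, smul_eq_mul] at h
      have h0 : c * μ e = 0 := by
        rw [← neg_eq_zero, h]; ring
      rw [(mul_eq_zero.1 h0).resolve_right hμe, zero_smul]
    · rw [Submodule.eq_top_iff']
      intro y
      -- Conversely every vector of `ker μ` lies in the range, so the range and `e` together span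
      -- the space.
      obtain ⟨x, -, hx⟩ := hK _ hhalf (-(y - (μ y / μ e) • e)) (by
        rw [map_neg, map_sub, map_smul, smul_eq_mul, div_mul_cancel₀ _ hμe, sub_self, neg_zero])
      refine Submodule.mem_sup.2 ⟨(μ y / μ e) • e, Submodule.smul_mem _ _
        (Submodule.mem_span_singleton_self e), y - (μ y / μ e) • e, ⟨x, ?_⟩, by abel⟩
      rw [hr, hx, neg_neg]
  · rintro ⟨R, h1, -⟩
    have := h1 ⟨e, he⟩
    rw [hTe, sub_self, map_zero] at this
    exact he0 this.symm
  · rintro z ⟨hz, hz'⟩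
    by_contra hre
    apply hz
    have hre' : -1 < z.re := by
      change ¬ z.re ≤ -1 at hre
      linarith
    have hne : z + 1 / 2 ≠ 0 := half z hz'
    obtain ⟨C, hC, h⟩ := hb' z hre'
    have hbd := norm_le_of_resolventBound hμ hC hne h
    have hbij : Function.Bijective (shiftMap T z) := by
      refine ⟨?_, fun y => ?_⟩
      · rw [injective_iff_map_eq_zero]
        intro x hx
        have := hbd x
        rw [hx, norm_zero, mul_zero] at this
        exact Subtype.ext (norm_le_zero_iff.1 this)
      · obtain ⟨x, -, hx⟩ := hK z hre' (y - (μ y / μ e) • e) (by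
          rw [map_sub, map_smul, smul_eq_mul, div_mul_cancel₀ _ hμe, sub_self])
        -- The part of `y` in `ker μ` is solved by `x`; the part along `e` is inverted explicitly,
        -- since `(z - T)e = (z + ½)e`.
        refine ⟨x + (μ y / μ e * (z + 1 / 2)⁻¹) • ⟨e, he⟩, ?_⟩
        rw [map_add, map_smul, hse, hx, smul_smul, inv_mul_cancel_right₀ hne]
        abel
    let E := LinearEquiv.ofBijective (shiftMap T z) hbij
    refine ⟨LinearMap.mkContinuous (T.domain.subtype ∘ₗ E.symm.toLinearMap)
      (C * (1 + ‖(z + 1 / 2)⁻¹‖ * ‖μ‖)) fun y => ?_, fun x => ?_, fun y => ?_⟩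
    · have := hbd (E.symm y)
      rwa [show shiftMap T z (E.symm y) = y from E.apply_symm_apply y] at this
    · change ((E.symm (shiftMap T z x) : T.domain) : X) = x
      rw [show E.symm (shiftMap T z x) = x from E.symm_apply_apply x]
    · exact ⟨(E.symm y).2, E.apply_symm_apply y⟩

end Abstract

/-! ### The graph and the moment functional -/

/-- Pairings with test functions are continuous functionals on the weighted space. Thus the
distributional constraints are closed conditions: the divergence-free space is complete and the
operator is closed. -/
lemma exists_inner_eq {m : ℝ} {a : Plane → ℝ} (ha : IsTest a) (i : Fin 2) :
    ∃ u : WeightedL2 m, ∀ Φ : WeightedL2 m, ∫ x, a x • Φ x i = inner ℂ u Φ := by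
  have t : IsTest fun x => a x * wt (-m) x := ha.mul_smooth (contDiff_wt _)
  have t0 : IsTest fun _ : Plane => (0 : ℝ) := ⟨contDiff_const, HasCompactSupport.zero⟩
  have e : ∀ x, a x * wt (-m) x * wt m x = a x := fun x => by
    rw [mul_assoc, wt_neg_mul, mul_one]
  refine ⟨emb m fun j => if j = i then fun x => a x * wt (-m) x else fun _ => 0, fun Φ => ?_⟩
  rw [inner_emb (fun j => by split_ifs <;> assumption)]
  fin_cases i <;> simp [e]

lemma IsTest.adjointOp (A : ℝ) {η : Plane → ℝ} (hη : IsTest η) : IsTest (adjointOp A η) := by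
  have e : OseenLinearization.adjointOp A η
      = fun x => OseenLinearization.lap η x - OseenLinearization.advect (drift A) η x :=
    funext (adjointOp_eq_sub_advect A hη)
  rw [e]
  exact hη.lap.sub (hη.advect (contDiff_drift A))

lemma isClosed_divFree (m : ℝ) : IsClosed {Φ : WeightedL2 m | DivFree Φ} := by
  simp only [DivFree, Set.ofPred_forall]
  refine isClosed_iInter fun η => isClosed_iInter fun hη => ?_
  choose u hu using fun j => exists_inner_eq (m := m) (hη.partialD j) j
  simp only [hu]
  exact isClosed_eq (by fun_prop) continuous_const

lemma isClosed_weakEq (A m : ℝ) :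
    IsClosed {z : WeightedL2 m × WeightedL2 m | WeakEq A z.1 z.2} := by
  simp only [WeakEq, Set.ofPred_forall]
  refine isClosed_iInter fun η => isClosed_iInter fun hη => isClosed_iInter fun i => ?_
  obtain ⟨u, hu⟩ := exists_inner_eq (m := m) (hη.adjointOp A) i
  obtain ⟨v, hv⟩ := exists_inner_eq (m := m) hη i
  choose w hw using fun j => exists_inner_eq (m := m)
    (hη.mul_smooth (contDiff_partialD (contDiff_oseen_apply i) j)) j
  simp only [hu, hv, hw]
  exact isClosed_eq (by fun_prop) (by fun_prop)

lemma isClosed_linGraph (A m : ℝ) :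
    IsClosed (linGraph A m : Set (divFreeSpace m × divFreeSpace m)) :=
  (isClosed_weakEq A m).preimage ((continuous_subtype_val.comp continuous_fst).prodMk
    (continuous_subtype_val.comp continuous_snd))

lemma divFree_emb {m : ℝ} {φ : Fin 2 → Plane → ℝ} (hφ : ∀ i, InL2 m (φ i)) (hd : DivFreeR φ) :
    DivFree (emb m φ) := fun η hη => by
  simp only [fun j => integral_emb hφ (partialD j η) j, ← Complex.ofReal_sum, hd η hη,
    Complex.ofReal_zero]

lemma weakEq_emb {A m : ℝ} {φ f : Fin 2 → Plane → ℝ} (hφ : ∀ i, InL2 m (φ i))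
    (hf : ∀ i, InL2 m (f i)) (h : WeakEqR A φ f) : WeakEq A (emb m φ) (emb m f) :=
  fun η hη i => by
  rw [integral_emb hφ, integral_emb hf, ← h η hη i]
  simp only [fun j => integral_emb hφ (fun x => η x * partialD j (fun z => oseen z i) x) j]
  rw [Complex.real_smul]
  push_cast
  rfl

lemma divFreeR_perpR {ψ : Plane → ℝ} (hψ : ContDiff ℝ ∞ ψ) : DivFreeR (perpR ψ) :=
  fun _ hη => sum_integral_partialD_perpR hη hψ

lemma weakEqR_perpR (A : ℝ) {ψ : Plane → ℝ} (hψ : ContDiff ℝ ∞ ψ) :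
    WeakEqR A (perpR ψ) (perpR (streamOp A ψ)) := fun η hη i => by
  rw [integral_adjointOp_linOpR A hη (fun i => contDiff_perpR hψ i)]
  simp only [perpR_streamOp A hψ]

/-- The weight function of the moment functional. -/
def momentField (m : ℝ) (i : Fin 2) (x : Plane) : ℝ :=
  (if i = 0 then -(x 1 / 2) else x 0 / 2) * wt (-m) x

/-- The squared norm is of the order of `∫ |ξ|² (1+|ξ|²)^(-m)`, finite for `m > 2`. This makes the
moment a continuous functional. -/
lemma inL2_momentField {m : ℝ} (hm : 2 < m) (i : Fin 2) : InL2 m (momentField m i) := by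
  have hc : Continuous (momentField m i) := by
    refine Continuous.mul ?_ (continuous_wt _)
    split_ifs
    · exact (((contDiff_coord 1).continuous).div_const 2).neg
    · exact ((contDiff_coord 0).continuous).div_const 2
  refine ⟨hc.aestronglyMeasurable, (integrable_wt_neg (s := m - 1) (by linarith)).mono'
    ((hc.pow 2).mul (continuous_wt m)).aestronglyMeasurable
    (Filter.Eventually.of_forall fun x => ?_)⟩
  rw [Real.norm_of_nonneg (mul_nonneg (sq_nonneg _) (wt_pos _ _).le), momentField]
  have e : wt (-(m - 1)) x = (1 + ‖x‖ ^ 2) * (wt (-m) x) ^ 2 * wt m x := by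
    rw [← wt_one, sq, ← wt_add, ← wt_add, ← wt_add]; congr 1; ring
  rw [e, mul_pow]
  refine mul_le_mul_of_nonneg_right (mul_le_mul_of_nonneg_right ?_ (sq_nonneg _)) (wt_pos _ _).le
  rw [norm_sq_eq]
  split_ifs <;> nlinarith [sq_nonneg (x 0), sq_nonneg (x 1)]

/-- The moment `½ ∫ (ξ₁ Φ₂ - ξ₂ Φ₁)`, the integral of the stream function. -/
def moment (m : ℝ) : WeightedL2 m →L[ℂ] ℂ := innerSL ℂ (emb m (momentField m))

lemma moment_emb {m : ℝ} (hm : 2 < m) {φ : Fin 2 → Plane → ℝ} (hφ : ∀ i, InL2 m (φ i)) :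
    moment m (emb m φ) = ((∫ x, (x 0 / 2 * φ 1 x - x 1 / 2 * φ 0 x) : ℝ) : ℂ) := by
  rw [moment, innerSL_apply_apply, inner_eq_integral, ← integral_complex_ofReal]
  refine integral_congr_ae ?_
  filter_upwards [emb_ae (inL2_momentField hm), emb_ae hφ] with x h1 h2
  rw [h1, h2, PiLp.inner_apply, Fin.sum_univ_two]
  have e : (wt (-m) x : ℂ) * wt m x = 1 := by
    rw [← Complex.ofReal_mul, wt_neg_mul, Complex.ofReal_one]
  simp only [cvec, momentField, Complex.real_smul, RCLike.inner_apply, Complex.conj_ofReal]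
  push_cast
  linear_combination ((x 0 : ℂ) / 2 * φ 1 x - x 1 / 2 * φ 0 x) * e

/-- The integrand is `-½ ξ·∇p`, and `div ξ = 2`. -/
lemma moment_perpR {m : ℝ} (hm : 2 < m) {p : Plane → ℝ} (hp : IsTest p) :
    moment m (emb m (perpR p)) = ((∫ x, p x : ℝ) : ℂ) := by
  rw [moment_emb hm fun i => (hp.perpR i).inL2 m]
  congr 1
  have h : ∀ j, ∫ x, p x * partialD j (fun z : Plane => z j) x = -∫ x, partialD j p x * x j :=
    fun j => integral_mul_partialD hp.1 (contDiff_coord j) hp.2 j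
  simp only [partialD_coord, if_true, mul_one] at h
  have i : ∀ j, Integrable fun x => partialD j p x * x j := fun j =>
    ((hp.partialD j).mul_smooth (contDiff_coord j)).integrable
  calc ∫ x, (x 0 / 2 * perpR p 1 x - x 1 / 2 * perpR p 0 x)
      = ∫ x, (-(1 / 2) * (partialD 0 p x * x 0) + -(1 / 2) * (partialD 1 p x * x 1)) := by
        congr 1; funext x; rw [perpR_zero, perpR_one]; ring
    _ = ∫ x, p x := by
        rw [integral_add ((i 0).const_mul _) ((i 1).const_mul _), integral_const_mul,
          integral_const_mul]
        linarith [h 0, h 1]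

/-- The Laplacian integrates to zero, `½ ξ·∇` to `-1` times the mean, and the divergence-free vortex
to zero; with the zero-order term `½` this gives `-½`. -/
lemma integral_streamOp (A : ℝ) {p : Plane → ℝ} (hp : IsTest p) :
    ∫ x, streamOp A p x = -1 / 2 * ∫ x, p x := by
  have h : ∀ j, ∫ x, p x * partialD j (fun z => drift A z j) x
      = -∫ x, partialD j p x * drift A x j := fun j =>
    integral_mul_partialD hp.1 (contDiff_drift A j) hp.2 j
  have i : ∀ j, Integrable fun x => partialD j p x * drift A x j := fun j =>
    ((hp.partialD j).mul_smooth (contDiff_drift A j)).integrable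
  have i' : ∀ j, Integrable fun x => p x * partialD j (fun z => drift A z j) x := fun j =>
    (hp.mul_smooth (contDiff_partialD (contDiff_drift A j) j)).integrable
  have h2 : ∀ j, ∫ x, partialD j (partialD j p) x = 0 := fun j =>
    integral_partialD_eq_zero (hp.partialD j).1 (hp.partialD j).2 j
  have i2 : ∀ j, Integrable (partialD j (partialD j p)) := fun j =>
    ((hp.partialD j).partialD j).integrable
  have hdiv : (∫ x, p x * partialD 0 (fun z => drift A z 0) x)
      + ∫ x, p x * partialD 1 (fun z => drift A z 1) x = ∫ x, p x := by
    rw [← integral_add (i' 0) (i' 1)]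
    congr 1; funext x
    have := div_oseen x
    rw [partialD_drift, partialD_drift, if_pos rfl, if_pos rfl]
    linear_combination -A * p x * this
  calc ∫ x, streamOp A p x = ∫ x, ((partialD 0 (partialD 0 p) x + partialD 1 (partialD 1 p) x)
        + (partialD 0 p x * drift A x 0 + partialD 1 p x * drift A x 1) + 1 / 2 * p x) := by
        congr 1; funext x
        simp only [streamOp, driftOp, lap, advect]; ring
    _ = -1 / 2 * ∫ x, p x := by
        rw [integral_add _ (hp.integrable.const_mul _), integral_add, integral_add (i2 0) (i2 1),
          integral_add (i 0) (i 1), integral_const_mul, h2, h2]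
        · linarith [h 0, h 1]
        · exact (i2 0).add (i2 1)
        · exact (i 0).add (i 1)
        · exact ((i2 0).add (i2 1)).add ((i 0).add (i 1))

/-- The relation holds for test stream functions, and it is the vanishing of a continuous functional
on pairs, so it extends to the whole graph. -/
lemma moment_of_weakEq (A : ℝ) {m : ℝ} (hm : 3 < m) {Φ Ψ : WeightedL2 m} (hd : DivFree Φ)
    (hw : WeakEq A Φ Ψ) : moment m Ψ = -1 / 2 * moment m Φ := by
  let g : WeightedL2 m × WeightedL2 m →L[ℂ] ℂ :=
    (moment m).comp (ContinuousLinearMap.snd ℂ _ _)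
      - (-1 / 2 : ℂ) • (moment m).comp (ContinuousLinearMap.fst ℂ _ _)
  have hg : ∀ z, g z = moment m z.2 - -1 / 2 * moment m z.1 := fun z => rfl
  have : (Φ, Ψ) ∈ LinearMap.ker g.toLinearMap := by
    refine mem_of_weakEq A hm g.isClosed_ker (fun p hp => ?_) hd hw
    change g _ = 0
    rw [hg, moment_perpR (by linarith) hp, moment_perpR (by linarith) (hp.streamOp A),
      integral_streamOp A hp]
    push_cast; ring
  have h2 : g (Φ, Ψ) = 0 := this
  rw [hg] at h2
  exact sub_eq_zero.1 h2

/-! ### The core of test stream functions and the resolvent estimate on the full domain -/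

lemma perpR_add {p q : Plane → ℝ} (hp : ContDiff ℝ ∞ p) (hq : ContDiff ℝ ∞ q) :
    perpR (fun x => p x + q x) = fun i x => perpR p i x + perpR q i x := by
  funext i x
  unfold perpR
  split_ifs
  · exact partialD_add hp hq 1 x
  · rw [partialD_add hp hq 0 x]; ring

lemma perpR_const_mul {p : Plane → ℝ} (hp : ContDiff ℝ ∞ p) (c : ℝ) :
    perpR (fun x => c * p x) = fun i x => c * perpR p i x := by
  funext i x
  unfold perpR
  split_ifs
  · exact partialD_const_mul hp c 1 x
  · rw [partialD_const_mul hp c 0 x]; ring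

lemma streamOp_add (A : ℝ) {p q : Plane → ℝ} (hp : ContDiff ℝ ∞ p) (hq : ContDiff ℝ ∞ q) :
    streamOp A (fun x => p x + q x) = fun x => streamOp A p x + streamOp A q x := by
  have h : ∀ j, partialD j (fun x => p x + q x) = fun x => partialD j p x + partialD j q x :=
    fun j => funext (partialD_add hp hq j)
  funext x
  simp only [streamOp, driftOp, lap, advect, h,
    partialD_add (contDiff_partialD hp _) (contDiff_partialD hq _)]
  ring

lemma streamOp_const_mul (A : ℝ) {p : Plane → ℝ} (hp : ContDiff ℝ ∞ p) (c : ℝ) :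
    streamOp A (fun x => c * p x) = fun x => c * streamOp A p x := by
  have h : ∀ j, partialD j (fun x => c * p x) = fun x => c * partialD j p x :=
    fun j => funext (partialD_const_mul hp c j)
  funext x
  simp only [streamOp, driftOp, lap, advect, h, partialD_const_mul (contDiff_partialD hp _)]
  ring

/-- The field `∇^⊥p` in the weighted space. -/
def fieldOf (m : ℝ) (p : Plane → ℝ) : WeightedL2 m := emb m (perpR p)

lemma fieldOf_add (m : ℝ) {p q : Plane → ℝ} (hp : IsTest p) (hq : IsTest q) :
    fieldOf m (fun x => p x + q x) = fieldOf m p + fieldOf m q := by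
  rw [fieldOf, perpR_add hp.1 hq.1]
  exact emb_add (fun i => (hp.perpR i).inL2 m) fun i => (hq.perpR i).inL2 m

lemma fieldOf_const_mul (m : ℝ) {p : Plane → ℝ} (hp : IsTest p) (c : ℝ) :
    fieldOf m (fun x => c * p x) = (c : ℂ) • fieldOf m p := by
  rw [fieldOf, perpR_const_mul hp.1]
  exact emb_const_mul (fun i => (hp.perpR i).inL2 m) c

lemma fieldOf_sub (m : ℝ) {p q : Plane → ℝ} (hp : IsTest p) (hq : IsTest q) :
    fieldOf m (fun x => p x - q x) = fieldOf m p - fieldOf m q := by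
  have h := fieldOf_add m hp (hq.const_mul (-1))
  rw [fieldOf_const_mul m hq, Complex.ofReal_neg, Complex.ofReal_one, neg_one_smul,
    ← sub_eq_add_neg] at h
  rw [← h]
  congr 1; funext x; ring

/-- The complex span of the pairs `(∇^⊥p, L_A ∇^⊥p)` for test functions `p`. -/
def coreGraph (A m : ℝ) : Submodule ℂ (WeightedL2 m × WeightedL2 m) :=
  Submodule.span ℂ {z | ∃ p, IsTest p ∧ (fieldOf m p, fieldOf m (streamOp A p)) = z}

lemma mem_coreGraph (A m : ℝ) {p : Plane → ℝ} (hp : IsTest p) :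
    (emb m (perpR p), emb m (perpR (streamOp A p))) ∈ coreGraph A m :=
  Submodule.subset_span ⟨p, hp, rfl⟩

/-- Test functions form a real vector space and the operator is real, so the complex span consists
of single combinations `p + iq`, the form in which the a priori estimate is stated. -/
lemma exists_of_mem_coreGraph {A m : ℝ} {z : WeightedL2 m × WeightedL2 m}
    (hz : z ∈ coreGraph A m) : ∃ p q, IsTest p ∧ IsTest q ∧
      z.1 = fieldOf m p + Complex.I • fieldOf m q ∧
      z.2 = fieldOf m (streamOp A p) + Complex.I • fieldOf m (streamOp A q) := by
  have t0 : IsTest fun _ : Plane => (0 : ℝ) := ⟨contDiff_const, HasCompactSupport.zero⟩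
  have f0 : fieldOf m (fun _ => 0) = 0 := by
    have := fieldOf_const_mul m t0 0
    simpa using this
  have s0 : streamOp A (fun _ => 0) = fun _ => 0 := by
    have := streamOp_const_mul A (p := fun _ => 0) contDiff_const 0
    simpa using this
  have hadd : ∀ {p q : Plane → ℝ}, IsTest p → IsTest q →
      fieldOf m (streamOp A fun x => p x + q x)
        = fieldOf m (streamOp A p) + fieldOf m (streamOp A q) := fun hp hq => by
    rw [streamOp_add A hp.1 hq.1, fieldOf_add m (hp.streamOp A) (hq.streamOp A)]
  have hmul : ∀ {p : Plane → ℝ}, IsTest p → ∀ c : ℝ,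
      fieldOf m (streamOp A fun x => c * p x) = (c : ℂ) • fieldOf m (streamOp A p) :=
    fun hp c => by rw [streamOp_const_mul A hp.1, fieldOf_const_mul m (hp.streamOp A)]
  have alg : ∀ (c : ℂ) (u v : WeightedL2 m), c • (u + Complex.I • v)
      = (((c.re : ℂ) • u + ((-c.im : ℝ) : ℂ) • v)
        + Complex.I • ((c.re : ℂ) • v + (c.im : ℂ) • u)) := fun c u v => by
    conv_lhs => rw [← Complex.re_add_im c]
    simp only [smul_add, add_smul, add_mul, smul_smul]
    have e : (c.im : ℂ) * Complex.I * Complex.I = ((-c.im : ℝ) : ℂ) := by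
      rw [mul_assoc, Complex.I_mul_I]; push_cast; ring
    rw [e, mul_comm Complex.I, mul_comm Complex.I]
    abel
  induction hz using Submodule.span_induction with
  | mem z h =>
    obtain ⟨p, hp, rfl⟩ := h
    exact ⟨p, fun _ => 0, hp, t0, by simp [f0], by simp [f0, s0]⟩
  | zero => exact ⟨_, _, t0, t0, by simp [f0], by simp [f0, s0]⟩
  | add z w _ _ hz hw =>
    obtain ⟨p, q, hp, hq, h1, h2⟩ := hz
    obtain ⟨p', q', hp', hq', h1', h2'⟩ := hw
    refine ⟨_, _, hp.add hp', hq.add hq', ?_, ?_⟩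
    · rw [Prod.fst_add, h1, h1', fieldOf_add m hp hp', fieldOf_add m hq hq', smul_add]; abel
    · rw [Prod.snd_add, h2, h2', hadd hp hp', hadd hq hq', smul_add]; abel
  | smul c z _ hz =>
    obtain ⟨p, q, hp, hq, h1, h2⟩ := hz
    refine ⟨_, _, (hp.const_mul c.re).add (hq.const_mul (-c.im)),
      (hq.const_mul c.re).add (hp.const_mul c.im), ?_, ?_⟩
    · rw [Prod.smul_fst, h1, fieldOf_add m (hp.const_mul _) (hq.const_mul _),
        fieldOf_add m (hq.const_mul _) (hp.const_mul _), fieldOf_const_mul m hp,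
        fieldOf_const_mul m hp, fieldOf_const_mul m hq, fieldOf_const_mul m hq, alg]
    · rw [Prod.smul_snd, h2, hadd (hp.const_mul _) (hq.const_mul _),
        hadd (hq.const_mul _) (hp.const_mul _), hmul hp, hmul hp, hmul hq, hmul hq, alg]

lemma norm_sq_fieldOf_add (m : ℝ) {p q : Plane → ℝ} (hp : IsTest p) (hq : IsTest q) :
    ‖fieldOf m p + Complex.I • fieldOf m q‖ ^ 2
      = (∫ x, gradSq p x * wt m x) + ∫ x, gradSq q x * wt m x := by
  rw [fieldOf, fieldOf, norm_sq_emb_add (fun i => (hp.perpR i).inL2 m)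
    fun i => (hq.perpR i).inL2 m, integral_gradSq_eq hp (contDiff_wt m),
    integral_gradSq_eq hq (contDiff_wt m)]

lemma smul_sub_eq_fieldOf (A m : ℝ) {p q : Plane → ℝ} (hp : IsTest p) (hq : IsTest q) (z : ℂ) :
    z • (fieldOf m p + Complex.I • fieldOf m q)
        - (fieldOf m (streamOp A p) + Complex.I • fieldOf m (streamOp A q))
      = fieldOf m (shiftRe z.re z.im p q (streamOp A p))
        + Complex.I • fieldOf m (shiftIm z.re z.im p q (streamOp A q)) := by
  have r1 : shiftRe z.re z.im p q (streamOp A p)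
    = fun x => (fun y => (fun t => z.re * p t) y - (fun t => z.im * q t) y) x - streamOp A p x := rfl
  have r2 : shiftIm z.re z.im p q (streamOp A q)
    = fun x => (fun y => (fun t => z.im * p t) y + (fun t => z.re * q t) y) x - streamOp A q x := rfl
  rw [r1, r2, fieldOf_sub m ((hp.const_mul z.re).sub (hq.const_mul z.im)) (hp.streamOp A),
    fieldOf_sub m ((hp.const_mul z.im).add (hq.const_mul z.re)) (hq.streamOp A),
    fieldOf_sub m (hp.const_mul z.re) (hq.const_mul z.im),
    fieldOf_add m (hp.const_mul z.im) (hq.const_mul z.re), fieldOf_const_mul m hp,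
    fieldOf_const_mul m hq, fieldOf_const_mul m hp, fieldOf_const_mul m hq]
  generalize fieldOf m p = u
  generalize fieldOf m q = v
  generalize fieldOf m (streamOp A p) = u'
  generalize fieldOf m (streamOp A q) = v'
  conv_lhs => rw [← Complex.re_add_im z]
  simp only [smul_add, add_smul, add_mul, smul_smul, smul_sub]
  have : (z.im : ℂ) * Complex.I * Complex.I = -(z.im : ℂ) := by
    rw [mul_assoc, Complex.I_mul_I]; ring
  rw [this, mul_comm Complex.I, mul_comm Complex.I, neg_smul]
  abel

lemma norm_sq_moment_fieldOf_add {m : ℝ} (hm : 2 < m) {p q : Plane → ℝ} (hp : IsTest p)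
    (hq : IsTest q) : ‖moment m (fieldOf m p + Complex.I • fieldOf m q)‖ ^ 2
      = (∫ x, p x) ^ 2 + (∫ x, q x) ^ 2 := by
  rw [map_add, map_smul, fieldOf, fieldOf, moment_perpR hm hp, moment_perpR hm hq,
    ← Complex.normSq_eq_norm_sq, Complex.normSq_apply]
  simp
  ring

lemma isClosed_resolvent_estimate (m C : ℝ) (z : ℂ) :
    IsClosed {w : WeightedL2 m × WeightedL2 m |
      ‖w.1‖ ^ 2 ≤ C * (‖z • w.1 - w.2‖ ^ 2 + ‖moment m w.1‖ ^ 2)} := by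
  refine isClosed_le (continuous_fst.norm.pow 2) (continuous_const.mul (Continuous.add ?_ ?_))
  · exact (((continuous_const_smul z).comp continuous_fst).sub continuous_snd).norm.pow 2
  · exact ((moment m).continuous.comp continuous_fst).norm.pow 2

lemma resolvent_estimate_core (A : ℝ) {m δ : ℝ} (hm : 3 < m) (hδ : 0 < δ) (hδ1 : δ ≤ 1) :
    ∃ C, 0 ≤ C ∧ ∀ z : ℂ, -1 + 2 * δ ≤ z.re → ∀ p q : Plane → ℝ, IsTest p → IsTest q →
      ‖fieldOf m p + Complex.I • fieldOf m q‖ ^ 2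
        ≤ C * (‖z • (fieldOf m p + Complex.I • fieldOf m q)
          - (fieldOf m (streamOp A p) + Complex.I • fieldOf m (streamOp A q))‖ ^ 2
          + ‖moment m (fieldOf m p + Complex.I • fieldOf m q)‖ ^ 2) := by
  obtain ⟨C, hC, h⟩ := a_priori A hm hδ hδ1
  refine ⟨C, hC, fun z hz p q hp hq => ?_⟩
  rw [smul_sub_eq_fieldOf A m hp hq,
    norm_sq_moment_fieldOf_add (by linarith) hp hq,
    norm_sq_fieldOf_add m (hp.shiftRe hq (hp.streamOp A) z.re z.im)
      (hp.shiftIm hq (hq.streamOp A) z.re z.im), norm_sq_fieldOf_add m hp hq]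
  exact h _ _ hz p q hp hq

lemma mem_closure_coreGraph (A : ℝ) {m : ℝ} (hm : 3 < m) {Φ Ψ : WeightedL2 m} (hd : DivFree Φ)
    (hw : WeakEq A Φ Ψ) : (Φ, Ψ) ∈ (coreGraph A m).topologicalClosure := by
  have hK : IsClosed ((coreGraph A m).topologicalClosure : Set (WeightedL2 m × WeightedL2 m)) :=
    Submodule.isClosed_topologicalClosure _
  generalize hg : (coreGraph A m).topologicalClosure = K at hK
  have hT : ∀ p, IsTest p → (emb m (perpR p), emb m (perpR (streamOp A p))) ∈ K := fun p hp => by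
    rw [← hg]
    exact Submodule.le_topologicalClosure _ (mem_coreGraph A m hp)
  exact mem_of_weakEq A hm hK hT hd hw

/-- For fixed `z` the estimate is a closed condition on pairs. It holds on the core, hence on its
closure, which contains the graph. -/
lemma resolvent_estimate_sq (A : ℝ) {m δ : ℝ} (hm : 3 < m) (hδ : 0 < δ) (hδ1 : δ ≤ 1) :
    ∃ C, 0 ≤ C ∧ ∀ z : ℂ, -1 + 2 * δ ≤ z.re → ∀ Φ Ψ : WeightedL2 m, DivFree Φ → WeakEq A Φ Ψ →
      ‖Φ‖ ^ 2 ≤ C * (‖z • Φ - Ψ‖ ^ 2 + ‖moment m Φ‖ ^ 2) := by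
  obtain ⟨C, hC, h⟩ := resolvent_estimate_core A hm hδ hδ1
  refine ⟨C, hC, fun z hz Φ Ψ hd hw => ?_⟩
  have hsub : ∀ w ∈ (coreGraph A m : Set (WeightedL2 m × WeightedL2 m)),
      ‖w.1‖ ^ 2 ≤ C * (‖z • w.1 - w.2‖ ^ 2 + ‖moment m w.1‖ ^ 2) := fun w hw => by
    obtain ⟨p, q, hp, hq, h1, h2⟩ := exists_of_mem_coreGraph hw
    rw [h1, h2]
    exact h z hz p q hp hq
  have hmem := mem_closure_coreGraph A hm hd hw
  have hcl : closure (coreGraph A m : Set (WeightedL2 m × WeightedL2 m)) ⊆ {w |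
      ‖w.1‖ ^ 2 ≤ C * (‖z • w.1 - w.2‖ ^ 2 + ‖moment m w.1‖ ^ 2)} :=
    (isClosed_resolvent_estimate m C z).closure_subset_iff.2 fun w hw => by
      rw [Set.mem_ofPred_eq]; exact hsub w hw
  rw [← SetLike.mem_coe, Submodule.topologicalClosure_coe] at hmem
  have h2 := hcl hmem
  rw [Set.mem_ofPred_eq] at h2
  exact h2

/-- The moment functional on the divergence-free space. -/
def momentDiv (m : ℝ) : divFreeSpace m →L[ℂ] ℂ := (moment m).comp (divFreeSpace m).subtypeL

lemma linOp_apply_mem {A m : ℝ} (x : (linOp A m).domain) :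
    WeakEq A ((x : divFreeSpace m) : WeightedL2 m) (linOp A m x : WeightedL2 m) := by
  have h : ((x : divFreeSpace m), linOp A m x) ∈ linGraph A m :=
    linOp_graph A m ▸ (linOp A m).mem_graph x
  exact h

lemma exists_of_weakEq {A m : ℝ} {Φ Ψ : divFreeSpace m}
    (h : WeakEq A (Φ : WeightedL2 m) (Ψ : WeightedL2 m)) :
    ∃ hΦ : Φ ∈ (linOp A m).domain, linOp A m ⟨Φ, hΦ⟩ = Ψ := by
  have h' : (Φ, Ψ) ∈ (linOp A m).graph := by
    rw [linOp_graph]; exact h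
  obtain ⟨y, hy1, hy2⟩ := (LinearPMap.mem_graph_iff _).1 h'
  obtain rfl : (y : divFreeSpace m) = Φ := hy1
  exact ⟨y.2, hy2⟩

lemma momentDiv_linOp (A : ℝ) {m : ℝ} (hm : 3 < m) (x : (linOp A m).domain) :
    momentDiv m (linOp A m x) = -1 / 2 * momentDiv m x :=
  moment_of_weakEq A hm (x : divFreeSpace m).2 (linOp_apply_mem x)

lemma resolventBound_linOp (A : ℝ) {m δ : ℝ} (hm : 3 < m) (hδ : 0 < δ) (hδ1 : δ ≤ 1) :
    ∃ C, 0 ≤ C ∧ ∀ z : ℂ, -1 + 2 * δ ≤ z.re → ResolventBound (linOp A m) (momentDiv m) C z := by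
  obtain ⟨C, hC, h⟩ := resolvent_estimate_sq A hm hδ hδ1
  refine ⟨√C, Real.sqrt_nonneg C, fun z hz x => ?_⟩
  have h1 := h z hz _ _ (x : divFreeSpace m).2 (linOp_apply_mem x)
  refine le_of_sq_le_sq (h1.trans ?_) (by positivity)
  rw [mul_pow, Real.sq_sqrt hC]
  refine mul_le_mul_of_nonneg_left ?_ hC
  have e1 : ‖z • ((x : divFreeSpace m) : WeightedL2 m) - (linOp A m x : WeightedL2 m)‖
    = ‖shiftMap (linOp A m) z x‖ := rfl
  have e2 : ‖moment m ((x : divFreeSpace m) : WeightedL2 m)‖ = ‖momentDiv m x‖ := rfl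
  rw [e1, e2]
  nlinarith [norm_nonneg (shiftMap (linOp A m) z x), norm_nonneg (momentDiv m x)]

/-! ### The eigenvector -/

lemma contDiff_phi0 : ContDiff ℝ ∞ phi0 := contDiff_const.mul contDiff_gauss

lemma partialD_phi0 (j : Fin 2) : partialD j phi0 = fun x => -(1 / 2) * (x j * phi0 x) := by
  funext x
  have := partialD_const_mul contDiff_gauss (1 / (4 * Real.pi)) j x
  rw [partialD_gauss] at this
  refine Eq.trans this ?_
  unfold phi0; ring

/-- The Gaussian is annihilated by `Δ + ½ ξ·∇ + 1` and, being radial, by the vortex; `streamOp` has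
`½` in place of `1`. -/
lemma streamOp_phi0 (A : ℝ) : streamOp A phi0 = fun x => -(1 / 2) * phi0 x := by
  have h : ∀ j x, partialD j (partialD j phi0) x = (-(1 / 2) + x j ^ 2 / 4) * phi0 x :=
    fun j x => by
    rw [partialD_phi0, partialD_const_mul ((contDiff_coord j).mul contDiff_phi0),
      partialD_mul (contDiff_coord j) contDiff_phi0, partialD_coord, if_pos rfl, partialD_phi0]
    ring
  have h' : ∀ j x, partialD j phi0 x = -(1 / 2) * (x j * phi0 x) := fun j x => by
    rw [partialD_phi0]
  funext x
  simp only [streamOp, driftOp, lap, advect, h, drift, h']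
  linear_combination (A / 2 * phi0 x) * oseen_dot x

lemma inL2_partialD_phi0 {m : ℝ} (hm : 0 ≤ m) (j : Fin 2) : InL2 m (partialD j phi0) := by
  obtain ⟨C, hC, h⟩ := exists_exp_le_wt (m + 2)
  have hs := contDiff_partialD contDiff_phi0 j
  have hp : ∀ x, 0 ≤ phi0 x := fun x => by unfold phi0; positivity
  have hle : ∀ x, phi0 x ≤ 1 / (4 * Real.pi) * C * wt (-(m + 2)) x := fun x => by
    rw [mul_assoc]
    exact mul_le_mul_of_nonneg_left (h x) (by positivity)
  refine ⟨hs.continuous.aestronglyMeasurable, ((integrable_wt_neg (s := m + 3)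
    (by linarith)).const_mul (1 / 4 * (1 / (4 * Real.pi) * C) ^ 2)).mono'
    ((hs.continuous.pow 2).mul (continuous_wt m)).aestronglyMeasurable
    (Filter.Eventually.of_forall fun x => ?_)⟩
  rw [Real.norm_of_nonneg (mul_nonneg (sq_nonneg _) (wt_pos _ _).le), partialD_phi0]
  have e : wt (-(m + 3)) x = (1 + ‖x‖ ^ 2) * (wt (-(m + 2)) x) ^ 2 * wt m x := by
    rw [← wt_one, sq, ← wt_add, ← wt_add, ← wt_add]; congr 1; ring
  have h2 := pow_le_pow_left₀ (hp x) (hle x) 2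
  have h3 : x j ^ 2 ≤ 1 + ‖x‖ ^ 2 := by
    rw [norm_sq_eq]
    fin_cases j <;> simp <;> nlinarith [sq_nonneg (x 0), sq_nonneg (x 1)]
  rw [e]
  calc (-(1 / 2) * (x j * phi0 x)) ^ 2 * wt m x = 1 / 4 * (x j ^ 2 * phi0 x ^ 2) * wt m x := by ring
    _ ≤ 1 / 4 * ((1 + ‖x‖ ^ 2) * (1 / (4 * Real.pi) * C * wt (-(m + 2)) x) ^ 2) * wt m x := by
        have := (wt_pos m x).le
        gcongr
    _ = _ := by ring

/-! ### Existence of weak solutions -/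

/-- The projection theorem of Lions for a coercive form whose second argument is restricted to a
dense set. -/
lemma exists_of_coercive {V D : Type*} [NormedAddCommGroup V] [InnerProductSpace ℝ V]
    [CompleteSpace V] [AddCommGroup D] [Module ℝ D] (J K : D →ₗ[ℝ] V)
    (h : ∀ θ, ‖J θ‖ ^ 2 ≤ inner ℝ (J θ) (K θ)) (z : V) :
    ∃ v ∈ (LinearMap.range J).topologicalClosure, ∀ θ, inner ℝ v (K θ) = inner ℝ z (J θ) := by
  set U := (LinearMap.range J).topologicalClosure with hU
  have : CompleteSpace U := (Submodule.isClosed_topologicalClosure _).completeSpace_coe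
  have hJ : ∀ θ, J θ ∈ U := fun θ => Submodule.le_topologicalClosure _ ⟨θ, rfl⟩
  let P : V →L[ℝ] V := U.starProjection
  -- Pairings with vectors of `U` see only the projection of `K θ`. Coercivity and Cauchy–Schwarz
  -- give `‖J θ‖ ≤ ‖Q θ‖`.
  let Q : D →ₗ[ℝ] V := P.toLinearMap ∘ₗ K
  have hP : ∀ u ∈ U, ∀ w, inner ℝ u (P w) = inner ℝ u w := fun u hu w => by
    rw [← U.inner_starProjection_left_eq_right, U.starProjection_eq_self_iff.2 hu]
  have hQ : ∀ θ, ‖J θ‖ ≤ ‖Q θ‖ := fun θ => by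
    have h1 := h θ
    rw [← hP _ (hJ θ)] at h1
    have h2 := real_inner_le_norm (J θ) (P (K θ))
    by_contra hlt
    push Not at hlt
    have h3 : ‖P (K θ)‖ < ‖J θ‖ := hlt
    nlinarith [norm_nonneg (P (K θ))]
  obtain ⟨s, hs⟩ := Q.rangeRestrict.exists_rightInverse_of_surjective Q.range_rangeRestrict
  have hs' : ∀ y : LinearMap.range Q, Q (s y) = y := fun y => by
    have := LinearMap.congr_fun hs y
    exact congrArg Subtype.val this
  -- The functional `Q θ ↦ ⟨z, J θ⟩`, bounded by `‖z‖`. It is extended by Hahn–Banach, represented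
  -- by Riesz, and the representative is projected to `U`.
  let g : LinearMap.range Q →L[ℝ] ℝ := LinearMap.mkContinuous
    ((innerSL ℝ z).toLinearMap ∘ₗ J ∘ₗ s) ‖z‖ fun y => by
      change ‖inner ℝ z (J (s y))‖ ≤ ‖z‖ * ‖(y : V)‖
      rw [← hs' y]
      exact (norm_inner_le_norm _ _).trans
        (mul_le_mul_of_nonneg_left (hQ _) (norm_nonneg _))
  obtain ⟨G, hG, -⟩ := exists_extension_norm_eq (LinearMap.range Q) g
  set v := (InnerProductSpace.toDual ℝ V).symm G
  refine ⟨P v, U.starProjection_apply_mem v, fun θ => ?_⟩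
  have e1 : inner ℝ (P v) (K θ) = G (Q θ) := by
    rw [show P v = U.starProjection v from rfl, U.inner_starProjection_left_eq_right]
    exact InnerProductSpace.toDual_symm_apply
  have e2 := hG ⟨Q θ, θ, rfl⟩
  -- The value does not depend on the preimage selected by `s`, because `Q θ = 0` forces `J θ = 0`.
  have e3 : J (s ⟨Q θ, θ, rfl⟩) = J θ := by
    rw [← sub_eq_zero, ← map_sub, ← norm_le_zero_iff]
    refine (hQ _).trans ?_
    rw [map_sub, hs', sub_self, norm_zero]
  rw [e1, e2]
  change inner ℝ z (J (s _)) = _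
  rw [e3]

/-- The real space of test functions. -/
def testSpace : Submodule ℝ (Plane → ℝ) where
  carrier := {η | IsTest η}
  zero_mem' := ⟨contDiff_const, HasCompactSupport.zero⟩
  add_mem' := fun h h' => h.add h'
  smul_mem' := fun c _ h => h.const_mul c

/-- Triples of functions in the weighted space. -/
abbrev TripleL2 (m : ℝ) := Lp (EuclideanSpace ℝ (Fin 3)) 2 (weightMeasure m)

/-- Three real functions as a vector valued one. -/
def triple (F : Fin 3 → Plane → ℝ) (x : Plane) : EuclideanSpace ℝ (Fin 3) :=
  WithLp.toLp 2 fun i => F i x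

lemma memLp_triple (m : ℝ) {F : Fin 3 → Plane → ℝ} (h : ∀ i, IsTest (F i)) :
    MemLp (triple F) 2 (weightMeasure m) := by
  refine Continuous.memLp_of_hasCompactSupport ?_ ?_
  · exact (PiLp.continuous_toLp 2 _).comp (continuous_pi fun i => (h i).1.continuous)
  · refine HasCompactSupport.intro (K := tsupport (F 0) ∪ tsupport (F 1) ∪ tsupport (F 2))
      (((h 0).2.isCompact.union (h 1).2.isCompact).union (h 2).2.isCompact) fun x hx => ?_
    simp only [Set.mem_union, not_or] at hx
    ext i
    fin_cases i
    · exact (image_eq_zero_of_notMem_tsupport hx.1.1 : F 0 x = 0)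
    · exact (image_eq_zero_of_notMem_tsupport hx.1.2 : F 1 x = 0)
    · exact (image_eq_zero_of_notMem_tsupport hx.2 : F 2 x = 0)

lemma exists_linearMap_triple (m : ℝ) (F : Fin 3 → testSpace →ₗ[ℝ] (Plane → ℝ))
    (h : ∀ i θ, IsTest (F i θ)) : ∃ J : testSpace →ₗ[ℝ] TripleL2 m,
      ∀ θ, J θ = (memLp_triple m fun i => h i θ).toLp :=
  ⟨{ toFun := fun θ => (memLp_triple m fun i => h i θ).toLp
     map_add' := fun θ θ' => by
      rw [← MemLp.toLp_add]
      congr 1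
      funext x; ext i
      simp [triple]
     map_smul' := fun c θ => by
      rw [RingHom.id_apply, ← MemLp.toLp_const_smul]
      congr 1
      funext x; ext i
      simp [triple] }, fun _ => rfl⟩

lemma inner_triple {m : ℝ} {F : Fin 3 → Plane → ℝ} (h : ∀ i, IsTest (F i)) (v : TripleL2 m) :
    inner ℝ v (memLp_triple m h).toLp
      = ∫ x, (F 0 x * v x 0 + F 1 x * v x 1 + F 2 x * v x 2) * wt m x := by
  rw [L2.inner_def, integral_weightMeasure]
  refine integral_congr_ae ?_
  filter_upwards [(volume_ac m).ae_eq (memLp_triple m h).coeFn_toLp] with x hx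
  rw [hx, PiLp.inner_apply, Fin.sum_univ_three]
  simp [triple]
  ring

lemma toLp_triple_ae {m : ℝ} {F : Fin 3 → Plane → ℝ} (h : ∀ i, IsTest (F i)) :
    ∀ᵐ x ∂(volume : Measure Plane), ∀ i,
      ((memLp_triple m h).toLp (triple F) : TripleL2 m) x i = F i x := by
  filter_upwards [(volume_ac m).ae_eq (memLp_triple m h).coeFn_toLp] with x hx i
  rw [hx]; rfl

lemma inL2_triple {m : ℝ} (v : TripleL2 m) (i : Fin 3) : InL2 m fun x => v x i := by
  have hm : AEStronglyMeasurable (fun x => v x i) (volume : Measure Plane) :=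
    (EuclideanSpace.proj (𝕜 := ℝ) i).continuous.comp_aestronglyMeasurable
      ((Lp.aestronglyMeasurable v).mono_ac (volume_ac m))
  have hI : Integrable fun x => wt m x • ‖v x‖ ^ 2 :=
    integrable_weightMeasure_iff.1
      ((memLp_two_iff_integrable_sq_norm (Lp.aestronglyMeasurable v)).1 (Lp.memLp v))
  refine ⟨hm, hI.mono' ((hm.pow 2).mul (continuous_wt m).aestronglyMeasurable)
    (Filter.Eventually.of_forall fun x => ?_)⟩
  rw [Real.norm_of_nonneg (mul_nonneg (sq_nonneg _) (wt_pos _ _).le), smul_eq_mul, mul_comm]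
  refine mul_le_mul_of_nonneg_left ?_ (wt_pos _ _).le
  rw [← sq_abs]
  exact pow_le_pow_left₀ (abs_nonneg _) (PiLp.norm_apply_le (v x) i) 2

lemma isTest_single {a : Plane → ℝ} (ha : IsTest a) (k i : Fin 3) :
    IsTest (if i = k then a else fun _ => 0) := by
  split_ifs
  · exact ha
  · exact ⟨contDiff_const, HasCompactSupport.zero⟩

lemma exists_inner_triple_eq (m : ℝ) {a : Plane → ℝ} (ha : IsTest a) (k : Fin 3) :
    ∃ u : TripleL2 m, ∀ v : TripleL2 m, ∫ x, a x * v x k = inner ℝ v u := by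
  have t : IsTest fun x => a x * wt (-m) x := ha.mul_smooth (contDiff_wt _)
  have e : ∀ x y : _, a x * wt (-m) x * y * wt m x = a x * y := fun x y => by
    rw [mul_right_comm, mul_assoc (a x), wt_neg_mul, mul_one]
  refine ⟨(memLp_triple m (isTest_single t k)).toLp, fun v => ?_⟩
  rw [inner_triple (isTest_single t k)]
  congr 1; funext x
  fin_cases k <;> simp [e]

/-- Weak derivatives persist in the closure of a set of gradients. -/
lemma weak_derivative_of_closure {m : ℝ} {J : testSpace →ₗ[ℝ] TripleL2 m}
    (hJ : ∀ θ : testSpace, ∀ᵐ x ∂(volume : Measure Plane), J θ x 0 = (θ : Plane → ℝ) x ∧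
      J θ x 1 = partialD 0 θ x ∧ J θ x 2 = partialD 1 θ x)
    {v : TripleL2 m} (hv : v ∈ (LinearMap.range J).topologicalClosure) {η : Plane → ℝ}
    (hη : IsTest η) : (∫ x, η x * v x 1 = -∫ x, partialD 0 η x * v x 0) ∧
      ∫ x, η x * v x 2 = -∫ x, partialD 1 η x * v x 0 := by
  have key : ∀ (k : Fin 3) (j : Fin 2), (∀ θ : testSpace, ∀ᵐ x ∂(volume : Measure Plane),
      J θ x k = partialD j θ x) → ∫ x, η x * v x k = -∫ x, partialD j η x * v x 0 := by
    intro k j hk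
    obtain ⟨u, hu⟩ := exists_inner_triple_eq m hη k
    obtain ⟨w, hw⟩ := exists_inner_triple_eq m (hη.partialD j) 0
    have hcl : IsClosed {v : TripleL2 m | inner ℝ v u = -inner ℝ v w} :=
      isClosed_eq (by fun_prop) (by fun_prop)
    rw [hu, hw]
    rw [← SetLike.mem_coe, Submodule.topologicalClosure_coe] at hv
    refine hcl.closure_subset_iff.2 ?_ hv
    rintro _ ⟨θ, rfl⟩
    rw [Set.mem_ofPred_eq, ← hu, ← hw]
    have e1 : ∫ x, η x * J θ x k = ∫ x, η x * partialD j θ x :=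
      integral_congr_ae (by filter_upwards [hk θ] with x hx; rw [hx])
    have e2 : ∫ x, partialD j η x * J θ x 0 = ∫ x, partialD j η x * (θ : Plane → ℝ) x :=
      integral_congr_ae (by filter_upwards [hJ θ] with x hx; rw [hx.1])
    rw [e1, e2]
    exact integral_mul_partialD hη.1 θ.2.1 hη.2 j
  exact ⟨key 1 0 fun θ => (hJ θ).mono fun x hx => hx.2.1,
    key 2 1 fun θ => (hJ θ).mono fun x hx => hx.2.2⟩

/-- The formal adjoint of `streamOp`. -/
def streamAdj (A : ℝ) (η : Plane → ℝ) (x : Plane) : ℝ :=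
  lap η x - advect (drift A) η x - η x / 2

lemma partialD_adjointOp (A : ℝ) {η : Plane → ℝ} (hη : IsTest η) (j : Fin 2) (x : Plane) :
    partialD j (adjointOp A η) x = streamAdj A (partialD j η) x
      + A * (partialD j (fun z => oseen z 0) x * partialD 0 η x
        + partialD j (fun z => oseen z 1) x * partialD 1 η x) := by
  -- The adjoint reverses the sign of the drift; in this form the derivative formula for `driftOp`
  -- can be reused.
  have e : adjointOp A η = fun x => 2 * lap η x - driftOp A η x := by
    funext x; rw [adjointOp_eq_sub_advect A hη]; unfold driftOp; ring
  have h0 := contDiff_partialD hη.1 0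
  have h1 := contDiff_partialD hη.1 1
  have hc : ∀ i, partialD j (partialD i η) = partialD i (partialD j η) := fun i => by
    funext y; exact partialD_comm hη.1 j i y
  have hl : partialD j (lap η) x = lap (partialD j η) x := by
    unfold lap
    rw [partialD_add (contDiff_partialD h0 0) (contDiff_partialD h1 1),
      partialD_comm h0, partialD_comm h1, hc, hc]
  rw [e, partialD_sub (contDiff_const.mul (contDiff_lap hη.1)) (contDiff_driftOp A hη.1),
    partialD_const_mul (contDiff_lap hη.1), hl, partialD_driftOp A hη.1]
  unfold streamAdj driftOp
  ring

lemma integrable_mul_test {g η : Plane → ℝ} (hg : Integrable g) (hη : IsTest η) :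
    Integrable fun x => η x * g x :=
  hg.locallyIntegrable.integrable_smul_left_of_hasCompactSupport hη.1.continuous hη.2

/-- A weak stream function gives a weak solution of the equation for the field. -/
lemma weakEqR_of_stream {A c m : ℝ} (hm : 1 < m) {g G0 G1 f : Plane → ℝ} (hg : InL2 m g)
    (h0 : InL2 m G0) (h1 : InL2 m G1) (hf : IsTest f)
    (d0 : ∀ η, IsTest η → ∫ x, η x * G0 x = -∫ x, partialD 0 η x * g x)
    (d1 : ∀ η, IsTest η → ∫ x, η x * G1 x = -∫ x, partialD 1 η x * g x)
    (hw : ∀ η, IsTest η → c * (∫ x, η x * g x) - ∫ x, streamAdj A η x * g x = ∫ x, η x * f x)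
    {φ : Fin 2 → Plane → ℝ} (hφ0 : φ 0 = G1) (hφ1 : φ 1 = fun x => -G0 x) :
    DivFreeR φ ∧ WeakEqR A φ fun i x => c * φ i x - perpR f i x := by
  have hgi := hg.integrable hm
  have e0 : ∀ η, IsTest η → ∫ x, η x * φ 0 x = -∫ x, partialD 1 η x * g x := fun η hη => by
    rw [hφ0, d1 η hη]
  have e1 : ∀ η, IsTest η → ∫ x, η x * φ 1 x = ∫ x, partialD 0 η x * g x := fun η hη => by
    rw [hφ1]
    simp only [mul_neg]
    rw [integral_neg, d0 η hη, neg_neg]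
  have hI : ∀ i, InL2 m (φ i) := fun i => by
    fin_cases i
    · exact hφ0 ▸ h1
    · have := h0.const_mul (-1)
      simp only [neg_one_mul] at this
      exact hφ1 ▸ this
  constructor
  · intro η hη
    rw [Fin.sum_univ_two, e0 _ (hη.partialD 0), e1 _ (hη.partialD 1)]
    rw [neg_add_eq_zero]
    congr 1; funext x; rw [partialD_comm hη.1]
  intro η hη i
  have hr : ∀ i, ∫ x, η x * (c * φ i x - perpR f i x)
      = c * (∫ x, η x * φ i x) - ∫ x, η x * perpR f i x := fun i => by
    have i1 := (integrable_mul_test ((hI i).integrable hm) hη).const_mul c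
    have i2 : Integrable fun x => η x * perpR f i x := (hη.mul_smooth (hf.perpR i).1).integrable
    rw [← integral_const_mul, ← integral_sub i1 i2]
    congr 1; funext x; ring
  have hu : ∀ i j, IsTest fun x => η x * partialD j (fun z => oseen z i) x := fun i j =>
    hη.mul_smooth (contDiff_partialD (contDiff_oseen_apply i) j)
  have hp : ∀ i j k x, partialD k (fun x => η x * partialD j (fun z => oseen z i) x) x
      = partialD k η x * partialD j (fun z => oseen z i) x
        + η x * partialD k (partialD j (fun z => oseen z i)) x := fun i j k x =>
    partialD_mul hη.1 (contDiff_partialD (contDiff_oseen_apply i) j) k x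
  have ia := fun k => integrable_mul_test hgi ((hη.adjointOp A).partialD k)
  have iu := fun i j k => integrable_mul_test hgi ((hu i j).partialD k)
  rw [Fin.sum_univ_two, e0 _ (hu i 0), e1 _ (hu i 1), hr]
  fin_cases i
  · change (∫ x, adjointOp A η x * φ 0 x) + A * ((-∫ x, partialD 1 (fun x => η x
      * partialD 0 (fun z => oseen z 0) x) x * g x) + ∫ x, partialD 0 (fun x => η x
      * partialD 1 (fun z => oseen z 0) x) x * g x)
      = c * (∫ x, η x * φ 0 x) - ∫ x, η x * perpR f 0 x
    have hf1 : ∫ x, η x * perpR f 0 x = -∫ x, partialD 1 η x * f x := by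
      rw [perpR_zero]; exact integral_mul_partialD hη.1 hf.1 hη.2 1
    -- The dual of the intertwining relation between `streamOp` and the field operator, with all
    -- derivatives on the test function because `g` has only weak ones. It rests again on `div u⁰ =
    -- 0` and the symmetry of second derivatives.
    have key : ∫ x, streamAdj A (partialD 1 η) x * g x
        = (∫ x, partialD 1 (adjointOp A η) x * g x)
          + A * ((∫ x, partialD 1 (fun x => η x * partialD 0 (fun z => oseen z 0) x) x * g x)
          - ∫ x, partialD 0 (fun x => η x * partialD 1 (fun z => oseen z 0) x) x * g x) := by
      rw [← integral_sub (iu 0 0 1) (iu 0 1 0), ← integral_const_mul, ← integral_add]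
      rotate_left
      · exact ia 1
      · exact ((iu 0 0 1).sub (iu 0 1 0)).const_mul A
      congr 1; funext x
      rw [hp, hp, partialD_adjointOp A hη, partialD_comm (contDiff_oseen_apply 0) 1 0]
      linear_combination -A * partialD 1 η x * g x * div_oseen x
    rw [e0 _ (hη.adjointOp A), e0 _ hη, hf1]
    linear_combination key + hw _ (hη.partialD 1)
  · change (∫ x, adjointOp A η x * φ 1 x) + A * ((-∫ x, partialD 1 (fun x => η x
      * partialD 0 (fun z => oseen z 1) x) x * g x) + ∫ x, partialD 0 (fun x => η x
      * partialD 1 (fun z => oseen z 1) x) x * g x)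
      = c * (∫ x, η x * φ 1 x) - ∫ x, η x * perpR f 1 x
    have hf1 : ∫ x, η x * perpR f 1 x = ∫ x, partialD 0 η x * f x := by
      rw [perpR_one]
      simp only [mul_neg]
      rw [integral_neg, integral_mul_partialD hη.1 hf.1 hη.2 0, neg_neg]
    have key : ∫ x, streamAdj A (partialD 0 η) x * g x
        = (∫ x, partialD 0 (adjointOp A η) x * g x)
          + A * ((∫ x, partialD 0 (fun x => η x * partialD 1 (fun z => oseen z 1) x) x * g x)
          - ∫ x, partialD 1 (fun x => η x * partialD 0 (fun z => oseen z 1) x) x * g x) := by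
      rw [← integral_sub (iu 1 1 0) (iu 1 0 1), ← integral_const_mul, ← integral_add]
      rotate_left
      · exact ia 0
      · exact ((iu 1 1 0).sub (iu 1 0 1)).const_mul A
      congr 1; funext x
      rw [hp, hp, partialD_adjointOp A hη, partialD_comm (contDiff_oseen_apply 1) 1 0]
      linear_combination -A * partialD 0 η x * g x * div_oseen x
    rw [e1 _ (hη.adjointOp A), e1 _ hη, hf1]
    linear_combination -key - hw _ (hη.partialD 0)

/-- The coercive bilinear form of the resolvent equation. -/
lemma coercive_form (A m : ℝ) : ∃ c : ℝ, 0 ≤ c ∧ ∀ θ : Plane → ℝ, IsTest θ →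
    (∫ x, (θ x ^ 2 + gradSq θ x) * wt m x)
      ≤ ∫ x, ((c - 1 / 2) * θ x * θ x
        + (wt (-m) x * partialD 0 (fun z => θ z * wt m z) x - drift A x 0 * θ x) * partialD 0 θ x
        + (wt (-m) x * partialD 1 (fun z => θ z * wt m z) x - drift A x 1 * θ x) * partialD 1 θ x)
          * wt m x := by
  obtain ⟨C, hC, h⟩ := energy_wt m
  -- By `energy_wt` the zero-order coefficient is at least `c - ½ + (1 + m)/2 - C`. The terms `|m| +
  -- 2` keep it above `1` for either sign of `m`.
  refine ⟨C + |m| + 2, by positivity, fun θ hθ => ?_⟩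
  have hW := contDiff_wt m
  have t := hθ.mul_smooth hW
  have i1 : Integrable fun x => θ x ^ 2 * wt m x := hθ.integrable_sq_mul hW
  have i1' : Integrable fun x => θ x ^ 2 * wt (m - 1) x := hθ.integrable_sq_mul (contDiff_wt _)
  have i2 : Integrable fun x => gradSq θ x * wt m x := (hθ.gradSq.mul_smooth hW).integrable
  have i3 : ∀ j, Integrable fun x => (θ x * wt m x) * partialD j (partialD j θ) x := fun j =>
    (t.mul_smooth ((hθ.partialD j).partialD j).1).integrable
  have i3' : ∀ j, Integrable fun x => partialD j (fun z => θ z * wt m z) x * partialD j θ x :=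
    fun j => ((t.partialD j).mul_smooth (hθ.partialD j).1).integrable
  have i4 : Integrable fun x => advect (drift A) θ x * θ x * wt m x :=
    (((hθ.advect (contDiff_drift A)).mul_smooth hθ.1).mul_smooth hW).integrable
  have i5 : Integrable fun x => lap θ x * θ x * wt m x :=
    ((hθ.lap.mul_smooth hθ.1).mul_smooth hW).integrable
  have hj : ∀ j, ∫ x, (θ x * wt m x) * partialD j (partialD j θ) x
      = -∫ x, partialD j (fun z => θ z * wt m z) x * partialD j θ x := fun j =>
    integral_mul_partialD t.1 (hθ.partialD j).1 t.2 j
  have hlap : ∫ x, lap θ x * θ x * wt m x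
      = (∫ x, (θ x * wt m x) * partialD 0 (partialD 0 θ) x)
        + ∫ x, (θ x * wt m x) * partialD 1 (partialD 1 θ) x := by
    rw [← integral_add (i3 0) (i3 1)]
    congr 1; funext x; unfold lap; ring
  have hd : ∫ x, driftOp A θ x * θ x * wt m x
      = (∫ x, lap θ x * θ x * wt m x) + ∫ x, advect (drift A) θ x * θ x * wt m x := by
    rw [← integral_add i5 i4]
    congr 1; funext x; unfold driftOp; ring
  have hR : (∫ x, ((C + |m| + 2 - 1 / 2) * θ x * θ x
        + (wt (-m) x * partialD 0 (fun z => θ z * wt m z) x - drift A x 0 * θ x) * partialD 0 θ x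
        + (wt (-m) x * partialD 1 (fun z => θ z * wt m z) x - drift A x 1 * θ x) * partialD 1 θ x)
          * wt m x)
      = (C + |m| + 2 - 1 / 2) * (∫ x, θ x ^ 2 * wt m x)
        + ((∫ x, partialD 0 (fun z => θ z * wt m z) x * partialD 0 θ x)
          + ∫ x, partialD 1 (fun z => θ z * wt m z) x * partialD 1 θ x)
        - ∫ x, advect (drift A) θ x * θ x * wt m x := by
    have e : ∀ x, ((C + |m| + 2 - 1 / 2) * θ x * θ x
        + (wt (-m) x * partialD 0 (fun z => θ z * wt m z) x - drift A x 0 * θ x) * partialD 0 θ x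
        + (wt (-m) x * partialD 1 (fun z => θ z * wt m z) x - drift A x 1 * θ x) * partialD 1 θ x)
          * wt m x = (C + |m| + 2 - 1 / 2) * (θ x ^ 2 * wt m x)
        + (partialD 0 (fun z => θ z * wt m z) x * partialD 0 θ x
          + partialD 1 (fun z => θ z * wt m z) x * partialD 1 θ x)
        - advect (drift A) θ x * θ x * wt m x := fun x => by
      unfold advect
      linear_combination (partialD 0 (fun z => θ z * wt m z) x * partialD 0 θ x
          + partialD 1 (fun z => θ z * wt m z) x * partialD 1 θ x) * wt_neg_mul m x
    simp only [e]
    rw [integral_sub _ i4, integral_add (i1.const_mul _), integral_add (i3' 0) (i3' 1),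
      integral_const_mul]
    · exact (i3' 0).add (i3' 1)
    · exact (i1.const_mul _).add ((i3' 0).add (i3' 1))
  have hL : ∫ x, (θ x ^ 2 + gradSq θ x) * wt m x
      = (∫ x, θ x ^ 2 * wt m x) + ∫ x, gradSq θ x * wt m x := by
    rw [← integral_add i1 i2]
    congr 1; funext x; ring
  have hmono : ∫ x, θ x ^ 2 * wt (m - 1) x ≤ ∫ x, θ x ^ 2 * wt m x :=
    integral_mono i1' i1 fun x => mul_le_mul_of_nonneg_left (wt_mono (by linarith) x) (sq_nonneg _)
  have hn : 0 ≤ ∫ x, θ x ^ 2 * wt m x := integral_sq_mul_nonneg _ fun x => (wt_pos _ _).le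
  have h1 := h A θ hθ
  have h2 := mul_le_mul_of_nonneg_left hmono hC
  have h3 : 0 ≤ (|m| + m) * ∫ x, θ x ^ 2 * wt m x :=
    mul_nonneg (by linarith [neg_abs_le m]) hn
  have h4 : 0 ≤ |m| * ∫ x, θ x ^ 2 * wt m x := mul_nonneg (abs_nonneg m) hn
  rw [hR, hL]
  have j0 := hj 0
  have j1 := hj 1
  nlinarith

/-- `θ ↦ (θ, ∂₁θ, ∂₂θ)`. -/
def jetMap : Fin 3 → testSpace →ₗ[ℝ] (Plane → ℝ) :=
  let d : Fin 2 → testSpace →ₗ[ℝ] (Plane → ℝ) := fun j =>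
    { toFun := fun θ => partialD j θ
      map_add' := fun θ θ' => funext (partialD_add θ.2.1 θ'.2.1 j)
      map_smul' := fun c θ => funext (partialD_const_mul θ.2.1 c j) }
  ![testSpace.subtype, d 0, d 1]

/-- The second argument of the coercive form of the resolvent equation. -/
def formMap (A m c : ℝ) : Fin 3 → testSpace →ₗ[ℝ] (Plane → ℝ) :=
  let d : Fin 2 → testSpace →ₗ[ℝ] (Plane → ℝ) := fun j =>
    -- In the weighted inner product with `(g, ∂₁g, ∂₂g)` this is the weak form of `(c - M)g` tested
    -- against `θ (1+|ξ|²)^m`.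
    { toFun := fun θ x => wt (-m) x * partialD j (fun z => (θ : Plane → ℝ) z * wt m z) x
        - drift A x j * (θ : Plane → ℝ) x
      map_add' := fun θ θ' => by
        funext x
        have e : (fun z => ((θ + θ' : testSpace) : Plane → ℝ) z * wt m z)
            = fun z => (θ : Plane → ℝ) z * wt m z + (θ' : Plane → ℝ) z * wt m z := by
          funext z; exact add_mul _ _ _
        rw [e, partialD_add (θ.2.1.mul (contDiff_wt m)) (θ'.2.1.mul (contDiff_wt m))]
        simp only [Submodule.coe_add, Pi.add_apply]
        ring
      map_smul' := fun a θ => by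
        funext x
        have e : (fun z => ((a • θ : testSpace) : Plane → ℝ) z * wt m z)
            = fun z => a * ((θ : Plane → ℝ) z * wt m z) := by
          funext z; exact mul_assoc _ _ _
        rw [e, partialD_const_mul (θ.2.1.mul (contDiff_wt m))]
        simp only [Submodule.coe_smul, Pi.smul_apply, smul_eq_mul, RingHom.id_apply]
        ring }
  ![(c - 1 / 2) • testSpace.subtype, d 0, d 1]

lemma isTest_jetMap (i : Fin 3) (θ : testSpace) : IsTest (jetMap i θ) := by
  fin_cases i
  · exact θ.2
  · exact IsTest.partialD θ.2 0
  · exact IsTest.partialD θ.2 1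

lemma isTest_formMap (A m c : ℝ) (i : Fin 3) (θ : testSpace) : IsTest (formMap A m c i θ) := by
  have h : ∀ j : Fin 2, IsTest fun x => wt (-m) x
      * partialD j (fun z => (θ : Plane → ℝ) z * wt m z) x - drift A x j * (θ : Plane → ℝ) x :=
    fun j => (((IsTest.mul_smooth θ.2 (contDiff_wt m)).partialD j).smooth_mul (contDiff_wt _)).sub
      (IsTest.smooth_mul θ.2 (contDiff_drift A j))
  fin_cases i
  · exact IsTest.const_mul θ.2 _
  · exact h 0
  · exact h 1

/-- The Lions theorem is applied to triples `(g, ∂₁g, ∂₂g)`. The drift grows linearly, so the form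
is unbounded and its second argument is restricted to test functions. Membership of the solution in
the closure of the jets makes its last two components weak derivatives of the first, and the rotated
pair is the field sought. -/
lemma exists_weak_solution (A : ℝ) {m : ℝ} (hm : 1 < m) : ∃ c : ℝ, 0 ≤ c ∧ ∀ f, IsTest f →
    ∃ φ : Fin 2 → Plane → ℝ, (∀ i, InL2 m (φ i)) ∧ DivFreeR φ ∧
      WeakEqR A φ fun i x => c * φ i x - perpR f i x := by
  obtain ⟨c, hc, hco⟩ := coercive_form A m
  refine ⟨c, hc, fun f hf => ?_⟩
  obtain ⟨J, hJ⟩ := exists_linearMap_triple m jetMap isTest_jetMap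
  obtain ⟨K, hK⟩ := exists_linearMap_triple m (formMap A m c) (isTest_formMap A m c)
  have aJ : ∀ θ : testSpace, ∀ᵐ x ∂(volume : Measure Plane), J θ x 0 = (θ : Plane → ℝ) x ∧
      J θ x 1 = partialD 0 θ x ∧ J θ x 2 = partialD 1 θ x := fun θ => by
    rw [hJ]
    filter_upwards [toLp_triple_ae (m := m) fun i => isTest_jetMap i θ] with x hx
    exact ⟨hx 0, hx 1, hx 2⟩
  have iJ : ∀ (v : TripleL2 m) (θ : testSpace), inner ℝ v (J θ)
      = ∫ x, ((θ : Plane → ℝ) x * v x 0 + partialD 0 θ x * v x 1 + partialD 1 θ x * v x 2)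
        * wt m x := fun v θ => by
    rw [hJ, inner_triple fun i => isTest_jetMap i θ]; rfl
  have iK : ∀ (v : TripleL2 m) (θ : testSpace), inner ℝ v (K θ)
      = ∫ x, ((c - 1 / 2) * (θ : Plane → ℝ) x * v x 0
        + (wt (-m) x * partialD 0 (fun z => (θ : Plane → ℝ) z * wt m z) x
          - drift A x 0 * (θ : Plane → ℝ) x) * v x 1
        + (wt (-m) x * partialD 1 (fun z => (θ : Plane → ℝ) z * wt m z) x
          - drift A x 1 * (θ : Plane → ℝ) x) * v x 2) * wt m x := fun v θ => by
    rw [hK, inner_triple fun i => isTest_formMap A m c i θ]; rfl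
  have hcoer : ∀ θ, ‖J θ‖ ^ 2 ≤ inner ℝ (J θ) (K θ) := fun θ => by
    rw [← real_inner_self_eq_norm_sq, iJ, iK]
    refine le_of_eq_of_le (integral_congr_ae ?_) ((hco θ θ.2).trans_eq (integral_congr_ae ?_))
    · filter_upwards [aJ θ] with x hx
      rw [hx.1, hx.2.1, hx.2.2]; unfold gradSq; ring
    · filter_upwards [aJ θ] with x hx
      rw [hx.1, hx.2.1, hx.2.2]
  -- The right side is the triple `(f, 0, 0)`.
  have hz := fun i => isTest_single hf 0 i
  obtain ⟨v, hv, hvK⟩ := exists_of_coercive J K hcoer (memLp_triple m hz).toLp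
  have d := fun (η : Plane → ℝ) (hη : IsTest η) => weak_derivative_of_closure aJ hv hη
  have hI := inL2_triple v
  have hgi := (hI 0).integrable hm
  refine ⟨fun i => if i = 0 then fun x => v x 2 else fun x => -v x 1, fun i => ?_,
    weakEqR_of_stream (f := f) (c := c) hm (hI 0) (hI 1) (hI 2) hf (fun η hη => (d η hη).1)
      (fun η hη => (d η hη).2) (fun η hη => ?_) (by simp) (by simp)⟩
  · have := (hI 1).const_mul (-1)
    simp only [neg_one_mul] at this
    beta_reduce
    split_ifs
    · exact hI 2
    · exact this
  -- The form tests against `θ` times the weight, so `θ = η (1+|ξ|²)^(-m)` gives the equation tested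
  -- against `η` itself.
  · have tθ : IsTest fun x => η x * wt (-m) x := hη.mul_smooth (contDiff_wt _)
    have h := hvK ⟨_, tθ⟩
    have hew : ∀ z, η z * wt (-m) z * wt m z = η z := fun z => by
      rw [mul_assoc, wt_neg_mul, mul_one]
    have bT : ∀ j, IsTest fun x => partialD j η x - drift A x j * η x := fun j =>
      (hη.partialD j).sub (hη.smooth_mul (contDiff_drift A j))
    rw [iK, iJ] at h
    have r : ∫ x, ((fun x => η x * wt (-m) x) x * ((memLp_triple m hz).toLp _ : TripleL2 m) x 0
        + partialD 0 (fun x => η x * wt (-m) x) x * ((memLp_triple m hz).toLp _ : TripleL2 m) x 1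
        + partialD 1 (fun x => η x * wt (-m) x) x * ((memLp_triple m hz).toLp _ : TripleL2 m) x 2)
        * wt m x = ∫ x, η x * f x := by
      refine integral_congr_ae ?_
      filter_upwards [toLp_triple_ae (m := m) hz] with x hx
      rw [hx, hx, hx]
      simp
      linear_combination f x * hew x
    have l : ∫ x, ((c - 1 / 2) * (fun x => η x * wt (-m) x) x * v x 0
        + (wt (-m) x * partialD 0 (fun z => (fun x => η x * wt (-m) x) z * wt m z) x
          - drift A x 0 * (fun x => η x * wt (-m) x) x) * v x 1
        + (wt (-m) x * partialD 1 (fun z => (fun x => η x * wt (-m) x) z * wt m z) x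
          - drift A x 1 * (fun x => η x * wt (-m) x) x) * v x 2) * wt m x
        = (c - 1 / 2) * (∫ x, η x * v x 0) + (∫ x, (partialD 0 η x - drift A x 0 * η x) * v x 1)
          + ∫ x, (partialD 1 η x - drift A x 1 * η x) * v x 2 := by
      have i0 := (integrable_mul_test hgi hη).const_mul (c - 1 / 2)
      have i1 := integrable_mul_test ((hI 1).integrable hm) (bT 0)
      have i2 := integrable_mul_test ((hI 2).integrable hm) (bT 1)
      rw [← integral_const_mul, ← integral_add i0 i1, ← integral_add]
      rotate_left
      · exact i0.add i1
      · exact i2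
      congr 1; funext x
      simp only [hew]
      linear_combination ((c - 1 / 2) * η x * v x 0 - drift A x 0 * η x * v x 1
        - drift A x 1 * η x * v x 2 + partialD 0 η x * v x 1 + partialD 1 η x * v x 2)
          * wt_neg_mul m x
    have h' := l.symm.trans (h.trans r)
    rw [(d _ (bT 0)).1, (d _ (bT 1)).2] at h'
    have j0 := integrable_mul_test hgi hη
    have j1 := integrable_mul_test hgi ((bT 0).partialD 0)
    have j2 := integrable_mul_test hgi ((bT 1).partialD 1)
    have js : ∫ x, streamAdj A η x * v x 0
        = (∫ x, partialD 0 (fun x => partialD 0 η x - drift A x 0 * η x) x * v x 0)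
          + (∫ x, partialD 1 (fun x => partialD 1 η x - drift A x 1 * η x) x * v x 0)
          + 1 / 2 * ∫ x, η x * v x 0 := by
      rw [← integral_const_mul, ← integral_add j1 j2, ← integral_add]
      rotate_left
      · exact j1.add j2
      · exact j0.const_mul _
      congr 1; funext x
      have e : ∀ j, partialD j (fun x => partialD j η x - drift A x j * η x) x
          = partialD j (partialD j η) x - ((1 / 2 - A * partialD j (fun z => oseen z j) x) * η x
            + drift A x j * partialD j η x) := fun j => by
        rw [partialD_sub (hη.partialD j).1 ((contDiff_drift A j).mul hη.1),
          partialD_mul (contDiff_drift A j) hη.1, partialD_drift, if_pos rfl]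
      rw [e, e]
      unfold streamAdj lap advect
      linear_combination -(A * η x * v x 0) * div_oseen x
    rw [js]
    linear_combination h'

/-- The range contains `∇^⊥p` for every test function `p`, and by `mem_of_divFree` the closed span
of these is the whole divergence-free space. -/
lemma exists_dense_range (A : ℝ) {m : ℝ} (hm : 3 < m) :
    ∃ c : ℝ, 0 ≤ c ∧ Dense (Set.range (shiftMap (linOp A m) c)) := by
  obtain ⟨c, hc, h⟩ := exists_weak_solution A (m := m) (by linarith)
  refine ⟨c, hc, fun y => ?_⟩
  let K : Submodule ℂ (WeightedL2 m) :=
    (LinearMap.range ((divFreeSpace m).subtype ∘ₗ shiftMap (linOp A m) c)).topologicalClosure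
  have hy : (y : WeightedL2 m) ∈ K := by
    refine mem_of_divFree hm (Submodule.isClosed_topologicalClosure _) (fun p hp => ?_) y.2
    obtain ⟨φ, hφ, hd, hw⟩ := h p hp
    have hP := fun i => (hp.perpR i).inL2 m
    have hφc : ∀ i, InL2 m fun x => c * φ i x := fun i => (hφ i).const_mul c
    have hPn : ∀ i, InL2 m fun x => -1 * perpR p i x := fun i => (hP i).const_mul (-1)
    have e1 : (fun i x => c * φ i x - perpR p i x)
        = fun i x => c * φ i x + -1 * perpR p i x := by
      funext i x; ring
    have e2 : emb m (fun i x => c * φ i x - perpR p i x)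
        = (c : ℂ) • emb m φ - emb m (perpR p) := by
      rw [e1, emb_add hφc hPn, emb_const_mul hφ, emb_const_mul hP]
      simp [sub_eq_add_neg]
    have hw' := weakEq_emb hφ (fun i => by
      rw [congrFun e1 i]; exact (hφc i).add (hPn i)) hw
    rw [e2] at hw'
    let Φ : divFreeSpace m := ⟨emb m φ, divFree_emb hφ hd⟩
    let F : divFreeSpace m := ⟨emb m (perpR p), divFree_emb hP (divFreeR_perpR hp.1)⟩
    obtain ⟨hΦ, hL⟩ := exists_of_weakEq (A := A) (Φ := Φ) (Ψ := (c : ℂ) • Φ - F) hw'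
    refine Submodule.le_topologicalClosure _ ⟨⟨Φ, hΦ⟩, ?_⟩
    change (shiftMap (linOp A m) c ⟨Φ, hΦ⟩ : WeightedL2 m) = _
    rw [shiftMap_apply, hL, sub_sub_cancel]
  rw [closure_subtype]
  change (y : WeightedL2 m) ∈ closure _ at hy
  convert hy using 2
  ext z
  constructor
  · rintro ⟨_, ⟨x, rfl⟩, rfl⟩
    exact ⟨x, rfl⟩
  · rintro ⟨x, rfl⟩
    exact ⟨_, ⟨x, rfl⟩, rfl⟩

/-- `∇^⊥φ₀` as an element of the divergence-free space. -/
lemma exists_eigenvector (A : ℝ) {m : ℝ} (hm : 3 < m) : ∃ e : divFreeSpace m,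
    ((e : WeightedL2 m) : Plane → CVec) =ᵐ[volume] perpGrad phi0 ∧
    (∃ he : e ∈ (linOp A m).domain, linOp A m ⟨e, he⟩ = (-1 / 2 : ℂ) • e) ∧
    momentDiv m e ≠ 0 := by
  have hI : ∀ i, InL2 m (perpR phi0 i) := inL2_perpR (inL2_partialD_phi0 (by linarith))
  refine ⟨⟨emb m (perpR phi0), divFree_emb hI (divFreeR_perpR contDiff_phi0)⟩, ?_,
    exists_of_weakEq ?_, ?_⟩
  · filter_upwards [emb_ae hI] with x hx
    rw [hx]
    ext i
    fin_cases i <;> simp [cvec, perpGrad, perpR]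
  · have hs : perpR (streamOp A phi0) = fun i x => -(1 / 2) * perpR phi0 i x := by
      rw [streamOp_phi0, perpR_const_mul contDiff_phi0]
    have hw := weakEqR_perpR A contDiff_phi0
    rw [hs] at hw
    have := weakEq_emb hI (fun i => (hI i).const_mul _) hw
    rw [emb_const_mul hI] at this
    convert this using 3
    push_cast
    rw [neg_div]
  · change moment m (emb m (perpR phi0)) ≠ 0
    rw [moment_emb (by linarith) hI, Complex.ofReal_ne_zero]
    have hp : ∀ x, 0 < phi0 x := fun x => by unfold phi0; positivity
    -- Since `∇φ₀ = -½ ξ φ₀`, the moment is the integral of the nonnegative function `¼ |ξ|² φ₀`,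
    -- which is positive off the origin.
    have e : ∀ x : Plane, x 0 / 2 * perpR phi0 1 x - x 1 / 2 * perpR phi0 0 x
        = 1 / 4 * (‖x‖ ^ 2 * phi0 x) := fun x => by
      rw [perpR_zero, perpR_one]
      simp only [partialD_phi0, norm_sq_eq]
      ring
    have hint : Integrable fun x : Plane => x 0 / 2 * perpR phi0 1 x - x 1 / 2 * perpR phi0 0 x := by
      have h1 := (inL2_momentField (m := m) (by linarith) 0).integrable_mul (hI 0)
      have h2 := (inL2_momentField (m := m) (by linarith) 1).integrable_mul (hI 1)
      refine (h1.add h2).congr (Filter.Eventually.of_forall fun x => ?_)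
      simp only [momentField, Pi.add_apply, if_true, one_ne_zero, if_false]
      linear_combination (x 0 / 2 * perpR phi0 1 x - x 1 / 2 * perpR phi0 0 x) * wt_neg_mul m x
    simp only [e] at hint ⊢
    refine (integral_pos_of_integrable_nonneg_nonzero (x := EuclideanSpace.single 0 1) ?_ hint
      (fun x => by have := (hp x).le; positivity) ?_).ne'
    · exact continuous_const.mul (contDiff_normsq.continuous.mul contDiff_phi0.continuous)
    · have := hp (EuclideanSpace.single 0 1)
      simp [this.ne']

end OseenLinearization

end

/-! ### Conclusion: the abstract theorem applied to the linearized operator -/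

theorem mainTheorem7 (A m : ℝ) (hm : 3 < m) :
    ∃ e : OseenLinearization.divFreeSpace m,
      ((e : OseenLinearization.WeightedL2 m) : OseenLinearization.Plane → OseenLinearization.CVec)
          =ᵐ[MeasureTheory.volume] OseenLinearization.perpGrad OseenLinearization.phi0 ∧
      OseenLinearization.IsSimpleEigenvalue (OseenLinearization.linOp A m) (-1 / 2) e ∧
      (-1 / 2 : ℂ) ∈ OseenLinearization.spectrumSet (OseenLinearization.linOp A m) ∧
      OseenLinearization.spectrumSet (OseenLinearization.linOp A m) \ {(-1 / 2 : ℂ)}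
        ⊆ {z : ℂ | z.re ≤ -1} := by
  have hcl : IsClosed (OseenLinearization.divFreeSpace m : Set (OseenLinearization.WeightedL2 m)) :=
    OseenLinearization.isClosed_divFree m
  have : CompleteSpace (OseenLinearization.divFreeSpace m) := hcl.completeSpace_coe
  obtain ⟨e, h1, ⟨he, h2⟩, h3⟩ := OseenLinearization.exists_eigenvector A hm
  obtain ⟨c, hc, hd⟩ := OseenLinearization.exists_dense_range A hm
  refine ⟨e, h1, OseenLinearization.spectrum_of_resolventBound
    (μ := OseenLinearization.momentDiv m) ?_ (OseenLinearization.momentDiv_linOp A hm) he h2 h3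
    (fun δ hδ hδ1 => OseenLinearization.resolventBound_linOp A hm hδ hδ1) (z₀ := c) ?_ hd⟩
  · rw [OseenLinearization.linOp_graph]
    exact OseenLinearization.isClosed_linGraph A m
  · rw [Complex.ofReal_re]
    linarith
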